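/- **Theorem 4.4 (twisting automorphisms of $L_\infty$ algebras of formal vector fields).** Let $k$ be a field of characteristic $0$ and let $V$ be a $\mathbb Z/2$-graded dg vector space over $k$ with parity reversion $\Pi V$. *Notation.* Let $\mathfrak c(V)$ and $\mathfrak a(V)$ be the dg Lie algebras of continuous derivations vanishing at zero of $\hat S\Pi V^*$ and $\hat T\Pi V^*$. Thus $\mathfrak c(V)=\prod_{n\ge1}\operatorname{Hom}(S^n\Pi V,\Pi V)$ and $\mathfrak a(V)=\prod_{n\ge1}\operatorname{Hom}((\Pi V)^{\otimes n},\Pi V)$; the bracket is the commutator of vector fields and the differential is the commutator with $d_V$. Put $\tilde{\mathfrak c}(V)=\mathfrak c(V)\oplus V$ and $\tilde{\mathfrak a}(V)=\mathfrak a(V)\oplus V$. Besides the internal differentials, the nonzero structure maps of these $L_\infty$ algebras are $m_2$ on $\Pi\mathfrak c(V)$ (resp. $\Pi\mathfrak a(V)$), which is the parity-shifted bracket, and $m_n(\Pi g,w_1,\dots,w_{n-1})=g(w_1,\dots,w_{n-1})$ for $w_i\in\Pi V$, where in the case of $\tilde{\mathfrak a}(V)$ the map $g$ on the right is replaced by its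 graded symmetrization $\sum_{\sigma}\sigma g$. If $V$ carries a nondegenerate symmetric scalar product, homogeneous and compatible with $d_V$, then $\tilde{\mathfrak{cs}}(V)=\mathfrak{cs}(V)\oplus V$ and $\tilde{\mathfrak{as}}(V)=\mathfrak{as}(V)\oplus V$ are defined by the same formulas on the dg Lie subalgebras $\mathfrak{cs}(V)\subset\mathfrak c(V)$ and $\mathfrak{as}(V)\subset\mathfrak a(V)$ of symplectic derivations. A formal cdga $A$ is an inverse limit of finite-dimensional nilpotent cdgas with a unit adjoined, and $A_+$ is its augmentation ideal. For an $L_\infty$ algebra $L$, $\mathrm{MC}(L,A)$ is the set of even $\zeta\in A_+\otimes\Pi L$ with $d\zeta+\sum_{n\ge1}\frac1{n!}m_n(\zeta,\dots,\zeta)=0$. An element of $\mathrm{MC}(\tilde{\mathfrak c}(V),A)$ or $\mathrm{MC}(\tilde{\mathfrak a}(V),A)$ is a pair $(m,\xi)$, and $m^\xi=e^{\xi}me^{-\xi}-d(\xi)$ is the twisted structure, where $\xi$ is regarded as a constant derivation. An $L_\infty$ morphism $\varphi$ acts on Maurer–Cartan elements by $\zeta\mapsto\sum_{n\ge1}\frac1{n!}\varphi_n(\zeta,\dots,\zeta)$.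 1. $\tilde{\mathfrak c}(V)$ is an $L_\infty$ algebra, and $(m,\xi)\mapsto(m^\xi,-\xi)$ is an automorphism of the functor $A\mapsto\mathrm{MC}(\tilde{\mathfrak c}(V),A)$ on formal cdgas. There is a unique $L_\infty$ morphism $\mathrm{tw}:\tilde{\mathfrak c}(V)\to\tilde{\mathfrak c}(V)$ which acts on Maurer–Cartan elements in this way for all $A$; it is an $L_\infty$ automorphism, with the following components $\mathrm{tw}_n:(\Pi\tilde{\mathfrak c}(V))^{\otimes n}\to\Pi\tilde{\mathfrak c}(V)$. For $f\in\operatorname{Hom}(S^{k+n-1}\Pi V,\Pi V)$ with $k\ge1$ and $w_1,\dots,w_{n-1}\in\Pi V$, the element $\mathrm{tw}_n(\Pi f,w_1,\dots,w_{n-1})$ lies in $\Pi\operatorname{Hom}(S^k\Pi V,\Pi V)$ and $$\mathrm{tw}_n(\Pi f,w_1,\dots,w_{n-1})(x_1,\dots,x_k)=\Pi f(w_1,\dots,w_{n-1},x_1,\dots,x_k);$$ moreover $\mathrm{tw}_1(w)=-w$ for $w\in\Pi V$, and, up to the graded symmetry of $\mathrm{tw}_n$, the value of $\mathrm{tw}_n$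 on any other collection of homogeneous elements (of $\Pi V$ and of the spaces $\Pi\operatorname{Hom}(S^j\Pi V,\Pi V)$) is zero. 2. If $V$ carries a scalar product as above, then $\tilde{\mathfrak{cs}}(V)$ is an $L_\infty$ algebra, $(m,\xi)\mapsto(m^\xi,-\xi)$ is an automorphism of the functor $A\mapsto\mathrm{MC}(\tilde{\mathfrak{cs}}(V),A)$, and there is a unique $L_\infty$ morphism $\tilde{\mathfrak{cs}}(V)\to\tilde{\mathfrak{cs}}(V)$ acting on Maurer–Cartan elements in this way for all $A$; it is an $L_\infty$ automorphism and is the restriction of $\mathrm{tw}$ from part 1. 3. The statements of part 1 hold for $\tilde{\mathfrak a}(V)$ in place of $\tilde{\mathfrak c}(V)$, with the following components. For $f\in\operatorname{Hom}((\Pi V)^{\otimes (n-1+k)},\Pi V)$ with $k\ge1$ and $w_1,\dots,w_{n-1}\in\Pi V$, the element $\mathrm{tw}_n(\Pi f,w_1,\dots,w_{n-1})$ lies in $\Pi\operatorname{Hom}((\Pi V)^{\otimes k},\Pi V)$ and $$\mathrm{tw}_n(\Pi f,w_1,\dots,w_{n-1})(x_1,\dots,x_k)=\sum_{\sigma\in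 S_{n-1}}\Pi f\bigl(\sigma(w_1\otimes\dots\otimes w_{n-1})\mid x_1,\dots,x_k\bigr),$$ where $f(z_1,\dots,z_{n-1}\mid x_1,\dots,x_k)$ is the sum, with Koszul signs, of the values of $f$ on all $\binom{n-1+k}{k}$ shuffles of the two sequences (both kept in order); moreover $\mathrm{tw}_1(w)=-w$, and all other values are zero in the same sense. 4. If $V$ carries a scalar product as above, then the statements of part 2 hold for $\tilde{\mathfrak{as}}(V)$, with the restriction of $\mathrm{tw}$ from part 3. -/

import Mathlib

open scoped TensorProduct

universe u v w

noncomputable section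

namespace Twisting

/-! ## Super vector spaces -/

/-- The sign `(-1)^p`. -/
def sg (k : Type u) [Field k] (p : ZMod 2) : k := (-1) ^ p.val

/-- A `ℤ/2`-grading on the vector space `V` (in characteristic different from 2), given by its
parity involution: the even part is the `+1` eigenspace and the odd part the `-1` eigenspace. -/
structure SuperStructure (k : Type u) (V : Type v) [Field k] [AddCommGroup V] [Module k V] where
  par : V →ₗ[k] V
  par_par : ∀ x, par (par x) = x

/-- A differential graded structure on `V`: a `ℤ/2`-grading and an odd differential. -/
structure DGStructure (k : Type u) (V : Type v) [Field k] [AddCommGroup V] [Module k V]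
    extends SuperStructure k V where
  d : V →ₗ[k] V
  d_par : ∀ x, d (par x) = -par (d x)
  d_d : ∀ x, d (d x) = 0

section Super

variable {k : Type u} [Field k] {V : Type v} [AddCommGroup V] [Module k V]
variable {X : Type w} [AddCommGroup X] [Module k X]

/-- `x` is homogeneous of parity `p`. -/
def SuperStructure.IsHom (G : SuperStructure k V) (p : ZMod 2) (x : V) : Prop :=
  G.par x = sg k p • x

/-- The projection to the homogeneous part of parity `p`. -/
def SuperStructure.proj (G : SuperStructure k V) (p : ZMod 2) : V →ₗ[k] V :=
  (2⁻¹ : k) • (LinearMap.id + sg k p • G.par)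

/-- The parity reversion `ΠV`, on the same underlying vector space. -/
def SuperStructure.shift (G : SuperStructure k V) : SuperStructure k V where
  par := -G.par
  par_par x := by simp [G.par_par]

/-- The parity reversion `ΠV` of a dg vector space. -/
def DGStructure.shift (E : DGStructure k V) : DGStructure k V where
  toSuperStructure := E.toSuperStructure.shift
  d := E.d
  d_par x := by simp [SuperStructure.shift, E.d_par]
  d_d := E.d_d

/-- The direct sum of two super vector spaces. -/
def SuperStructure.prod (G : SuperStructure k V) (H : SuperStructure k X) :
    SuperStructure k (V × X) where
  par := G.par.prodMap H.par
  par_par x := by simp [G.par_par, H.par_par]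

end Super

/-! ## Koszul signs -/

section Koszul

variable (k : Type u) [Field k]

/-- The Koszul sign of the stable rearrangement of homogeneous elements `x_0, …, x_{n-1}` of
parities `p_0, …, p_{n-1}` into the order in which the labels `c_0, …, c_{n-1}` increase. -/
def koszul {n : ℕ} {α : Type*} [LinearOrder α] (c : Fin n → α) (p : Fin n → ZMod 2) : k :=
  ∏ i, ∏ j, if i < j ∧ c j < c i then sg k (p i * p j) else 1

variable {k}

theorem sg_mul_self (p : ZMod 2) : sg k p * sg k p = 1 := by
  unfold sg
  rw [← pow_add, ← two_mul, pow_mul]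
  simp

theorem prod_pairs {n : ℕ} (h : Fin n → Fin n → k) (hd : ∀ i, h i i = 1) :
    ∏ i, ∏ j, h i j = ∏ i, ∏ j, if i < j then h i j * h j i else 1 := by
  have e : ∀ i j, h i j = (if i < j then h i j else 1) * (if j < i then h i j else 1) := by
    intro i j
    rcases lt_trichotomy i j with hij | hij | hij
    · simp [hij, hij.not_gt]
    · subst hij; simp [hd]
    · simp [hij, hij.not_gt]
  have e2 : ∀ i j, (if i < j then h i j * h j i else 1)
      = (if i < j then h i j else 1) * (if i < j then h j i else 1) := by
    intro i j; split_ifs <;> simp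
  simp_rw [e2, Finset.prod_mul_distrib]
  conv_lhs => enter [2, i, 2, j]; rw [e i j]
  simp_rw [Finset.prod_mul_distrib]
  congr 1
  exact Finset.prod_comm

theorem koszul_mul {n : ℕ} (s t : Equiv.Perm (Fin n)) (p : Fin n → ZMod 2) :
    koszul k (s * t).symm p = koszul k s.symm p * koszul k t.symm (p ∘ s) := by
  have h3 : koszul k t.symm (p ∘ s) = ∏ i, ∏ j,
      if s.symm i < s.symm j ∧ t.symm (s.symm j) < t.symm (s.symm i) then sg k (p i * p j)
      else 1 := by
    unfold koszul
    rw [← Equiv.prod_comp s.symm]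
    refine Finset.prod_congr rfl fun i _ => ?_
    rw [← Equiv.prod_comp s.symm]
    simp
  rw [h3]
  unfold koszul
  rw [prod_pairs _ (by simp), prod_pairs _ (by simp), prod_pairs (fun i j =>
      if s.symm i < s.symm j ∧ t.symm (s.symm j) < t.symm (s.symm i) then sg k (p i * p j)
      else 1) (by simp)]
  simp_rw [← Finset.prod_mul_distrib]
  refine Finset.prod_congr rfl fun i _ => Finset.prod_congr rfl fun j _ => ?_
  by_cases hij : i < j
  · have hst : ∀ a, (s * t).symm a = t.symm (s.symm a) := fun a => rfl
    have hne : s.symm i ≠ s.symm j := fun h => hij.ne (s.symm.injective h)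
    have hne2 : t.symm (s.symm i) ≠ t.symm (s.symm j) := fun h => hne (t.symm.injective h)
    have hc : sg k (p j * p i) = sg k (p i * p j) := by rw [mul_comm]
    rcases lt_or_gt_of_ne hne with h1 | h1 <;> rcases lt_or_gt_of_ne hne2 with h2 | h2 <;>
      simp [hij, hij.not_gt, h1, h1.not_gt, h2, h2.not_gt, hst, hc, sg_mul_self]
  · simp [hij]

end Koszul

section Act

variable {k : Type u} [Field k] {V : Type v} [AddCommGroup V] [Module k V]
variable {X : Type w} [AddCommGroup X] [Module k X]

/-- The signed action of a permutation on multilinear maps: on homogeneous arguments,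
`(act σ f)(x_0, …, x_{n-1}) = ± f(x_{σ 0}, …, x_{σ (n-1)})` with the Koszul sign. -/
def act (G : SuperStructure k V) {n : ℕ} (σ : Equiv.Perm (Fin n)) :
    MultilinearMap k (fun _ : Fin n => V) X →ₗ[k] MultilinearMap k (fun _ : Fin n => V) X :=
  ∑ p : Fin n → ZMod 2, koszul k σ.symm p •
    (MultilinearMap.compLinearMapₗ (fun i => G.proj (p i)) ∘ₗ
      (MultilinearMap.domDomCongrLinearEquiv k k V X σ).toLinearMap)

/-- The sum over all permutations of the signed action. -/
def koszulSymm (G : SuperStructure k V) {n : ℕ} :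
    MultilinearMap k (fun _ : Fin n => V) X →ₗ[k] MultilinearMap k (fun _ : Fin n => V) X :=
  ∑ σ : Equiv.Perm (Fin n), act G σ

end Act


section ActLemmas

variable {k : Type u} [Field k] {V : Type v} [AddCommGroup V] [Module k V]
variable {X : Type w} [AddCommGroup X] [Module k X]

theorem act_apply (G : SuperStructure k V) {n : ℕ} (σ : Equiv.Perm (Fin n))
    (f : MultilinearMap k (fun _ : Fin n => V) X) (x : Fin n → V) :
    act G σ f x = ∑ p : Fin n → ZMod 2,
      koszul k σ.symm p • f (fun i => G.proj (p (σ i)) (x (σ i))) := by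
  simp only [act, LinearMap.coe_sum, Finset.sum_apply, sum_apply]
  rfl

theorem zmod_two (p : ZMod 2) : p = 0 ∨ p = 1 := by
  fin_cases p
  · exact Or.inl rfl
  · exact Or.inr rfl

theorem sg_zero : sg k 0 = 1 := by simp [sg]

theorem sg_one : sg k 1 = -1 := by
  have h : (1 : ZMod 2).val = 1 := rfl
  simp [sg, h]

theorem proj_proj [CharZero k] (G : SuperStructure k V) (p q : ZMod 2) (x : V) :
    G.proj p (G.proj q x) = if p = q then G.proj p x else 0 := by
  rcases zmod_two p with rfl | rfl <;> rcases zmod_two q with rfl | rfl <;>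
    simp [SuperStructure.proj, sg_zero, sg_one, G.par_par] <;> module

theorem proj_par (G : SuperStructure k V) (p : ZMod 2) (x : V) :
    G.proj p (G.par x) = G.par (G.proj p x) := by
  simp [SuperStructure.proj, G.par_par]

theorem act_act [CharZero k] (G : SuperStructure k V) {n : ℕ} (σ τ : Equiv.Perm (Fin n))
    (f : MultilinearMap k (fun _ : Fin n => V) X) :
    act G σ (act G τ f) = act G (σ * τ) f := by
  ext x
  simp only [act_apply]
  refine Finset.sum_congr rfl fun p _ => ?_
  rw [Finset.sum_eq_single (p ∘ σ)]
  · simp [proj_proj, koszul_mul, mul_smul]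
  · intro q _ hq
    obtain ⟨j, hj⟩ : ∃ j, q j ≠ (p ∘ σ) j := by
      by_contra h
      push Not at h
      exact hq (funext h)
    rw [f.map_coord_zero (τ.symm j), smul_zero]
    simp only [Equiv.apply_symm_apply]
    exact (proj_proj _ _ _ _).trans (if_neg hj)
  · simp

theorem act_koszulSymm [CharZero k] (G : SuperStructure k V) {n : ℕ} (σ : Equiv.Perm (Fin n))
    (f : MultilinearMap k (fun _ : Fin n => V) X) : act G σ (koszulSymm G f) = koszulSymm G f := by
  simp only [koszulSymm, LinearMap.coe_sum, Finset.sum_apply, map_sum, act_act]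
  exact Fintype.sum_equiv (Equiv.mulLeft σ) _ _ fun _ => rfl

theorem sum_proj [CharZero k] (G : SuperStructure k V) (x : V) : ∑ p, G.proj p x = x := by
  rw [show (Finset.univ : Finset (ZMod 2)) = {0, 1} from rfl, Finset.sum_pair (by decide)]
  simp [SuperStructure.proj, sg_zero, sg_one]
  module

theorem act_one [CharZero k] (G : SuperStructure k V) {n : ℕ}
    (f : MultilinearMap k (fun _ : Fin n => V) X) : act G 1 f = f := by
  ext x
  have h : ∀ p : Fin n → ZMod 2, koszul k (1 : Equiv.Perm (Fin n)).symm p = 1 := by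
    intro p
    refine Finset.prod_eq_one fun i _ => Finset.prod_eq_one fun j _ => if_neg ?_
    rintro ⟨h1, h2⟩
    exact absurd h1 h2.not_gt
  simp only [act_apply, h, one_smul, Equiv.Perm.coe_one, id_eq]
  rw [← f.map_sum (fun i p => G.proj p (x i))]
  simp only [sum_proj]

end ActLemmas

/-! ## Formal vector fields

For a super vector space `U`, a continuous derivation of the completed tensor algebra `T̂ U*` is
the same as a family `f = (f_0, f_1, …)` of multilinear maps `f_n : U^n → U`, and a continuous
derivation of the completed symmetric algebra `Ŝ U*` is the same as such a family with every
`f_n` graded symmetric. -/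

section Fields

variable (k : Type u) [Field k] (V : Type v) [AddCommGroup V] [Module k V]

/-- Families of multilinear maps `f_n : V^n → V`, `n = 0, 1, 2, …`. -/
abbrev Fam : Type v := (n : ℕ) → MultilinearMap k (fun _ : Fin n => V) V

variable {k V}

/-- The grading on families of multilinear maps. -/
def SuperStructure.fam (G : SuperStructure k V) : SuperStructure k (Fam k V) where
  par := LinearMap.pi fun n =>
    (LinearMap.compMultilinearMapₗ k G.par) ∘ₗ
      (MultilinearMap.compLinearMapₗ fun _ : Fin n => G.par) ∘ₗ LinearMap.proj n
  par_par f := by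
    funext n
    ext x
    simp [G.par_par]

/-- The vector field with the single component `w ∈ V` in arity `0`. -/
def constField : V →ₗ[k] Fam k V :=
  LinearMap.pi fun n => match n with
    | 0 => (MultilinearMap.constLinearEquivOfIsEmpty k k (fun _ : Fin 0 => V) V).toLinearMap
    | _ + 1 => 0

/-- The vector field with the single component `a : V → V` in arity `1`. -/
def linField (a : V →ₗ[k] V) : Fam k V
  | 1 => MultilinearMap.ofSubsingleton k V V (0 : Fin 1) a
  | _ => 0

/-- Insertion of `g` into the slot `i` of `f`:
`x ↦ f (…, g (x ∘ e ∘ inl), …)`, the remaining slots of `f` being filled with `x ∘ e ∘ inr`. -/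
def insertAt {n a b : ℕ} (e : Fin a ⊕ Fin b ≃ Fin n) (i : Fin (b + 1)) :
    MultilinearMap k (fun _ : Fin (b + 1) => V) V →ₗ[k]
      MultilinearMap k (fun _ : Fin a => V) V →ₗ[k] MultilinearMap k (fun _ : Fin n => V) V :=
  LinearMap.mk₂ k
    (fun f g => MultilinearMap.domDomCongr e
      (MultilinearMap.uncurrySum ((f.curryMid i).compMultilinearMap g)))
    (fun _ _ _ => by ext; simp) (fun _ _ _ => by ext; simp)
    (fun _ _ _ => by ext; simp) (fun _ _ _ => by ext; simp)

/-- The composition of graded symmetric vector fields (substitution of `g` into one slot of `f`,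
summed over all ways to distribute the arguments):
`(f ∘ g)_n(x) = ∑_a 1/(a! (n-a)!) ∑_σ ± f_{n-a+1}(g_a(x_{σ 0}, …, x_{σ (a-1)}), x_{σ a}, …)`. -/
def circS (G : SuperStructure k V) : Fam k V →ₗ[k] Fam k V →ₗ[k] Fam k V :=
  LinearMap.mk₂ k
    (fun f g n => ∑ a : Fin (n + 1),
      ((((a : ℕ).factorial * (n - a : ℕ).factorial : ℕ) : k)⁻¹) •
        koszulSymm G (insertAt (finSumFinEquiv.trans (finCongr (by omega : (a : ℕ) + (n - a) = n))) 0
          (f (n - a + 1)) (g a)))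
    (fun _ _ _ => by
      funext n
      simp only [Pi.add_apply, map_add, LinearMap.add_apply, smul_add, Finset.sum_add_distrib])
    (fun c _ _ => by
      funext n
      simp only [Pi.smul_apply, map_smul, LinearMap.smul_apply, Finset.smul_sum]
      exact Finset.sum_congr rfl fun _ _ => smul_comm _ _ _)
    (fun _ _ _ => by
      funext n
      simp only [Pi.add_apply, map_add, smul_add, Finset.sum_add_distrib])
    (fun c _ _ => by
      funext n
      simp only [Pi.smul_apply, map_smul, Finset.smul_sum]
      exact Finset.sum_congr rfl fun _ _ => smul_comm _ _ _)

/-- The bijection `Fin a ⊕ Fin (n - a) ≃ Fin n` under which `Fin a` becomes the block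
`i, …, i + a - 1` and `Fin (n - a)` its complement, both in increasing order. -/
def blockEquiv (n : ℕ) (a : Fin (n + 1)) (i : Fin (n - a + 1)) :
    Fin (a : ℕ) ⊕ Fin (n - a) ≃ Fin n :=
  Equiv.ofBijective
    (Sum.elim (fun j => ⟨i + j, by omega⟩)
      (fun j => if j.val < i.val then ⟨j, by omega⟩ else ⟨a + j, by omega⟩))
    ((Fintype.bijective_iff_injective_and_card _).2 ⟨by
      rintro (x | x) (y | y) h
      · simp only [Sum.elim_inl, Fin.mk.injEq] at h
        congr 1; ext; omega
      · simp only [Sum.elim_inl, Sum.elim_inr] at h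
        split_ifs at h <;> simp only [Fin.mk.injEq] at h <;> omega
      · simp only [Sum.elim_inl, Sum.elim_inr] at h
        split_ifs at h <;> simp only [Fin.mk.injEq] at h <;> omega
      · simp only [Sum.elim_inr] at h
        congr 1; ext
        split_ifs at h <;> simp only [Fin.mk.injEq] at h <;> omega, by simp; omega⟩)

/-- The composition of noncommutative vector fields:
`(f ∘ g)_n(x) = ∑_{a, i} ± f_{n-a+1}(x_0, …, x_{i-1}, g_a(x_i, …, x_{i+a-1}), x_{i+a}, …)`,
the sign coming from moving `g` past `x_0, …, x_{i-1}`. -/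
def circT (G : SuperStructure k V) : Fam k V →ₗ[k] Fam k V →ₗ[k] Fam k V :=
  LinearMap.mk₂ k
    (fun f g n => ∑ a : Fin (n + 1), ∑ i : Fin (n - a + 1), ∑ q : ZMod 2,
      MultilinearMap.compLinearMapₗ
        (fun j : Fin n => if j.val < i.val then G.par ^ q.val else LinearMap.id)
        (insertAt (blockEquiv n a i) i (f (n - a + 1)) (G.fam.proj q g a)))
    (fun _ _ _ => by
      funext n
      simp only [Pi.add_apply, map_add, LinearMap.add_apply, Finset.sum_add_distrib])
    (fun _ _ _ => by
      funext n
      simp only [Pi.smul_apply, map_smul, LinearMap.smul_apply, Finset.smul_sum])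
    (fun _ _ _ => by
      funext n
      simp only [Pi.add_apply, map_add, Finset.sum_add_distrib])
    (fun _ _ _ => by
      funext n
      simp only [Pi.smul_apply, map_smul, Finset.smul_sum])

theorem circS_apply (G : SuperStructure k V) (f g : Fam k V) (n : ℕ) :
    circS G f g n = ∑ a : Fin (n + 1),
      ((((a : ℕ).factorial * (n - a : ℕ).factorial : ℕ) : k)⁻¹) •
        koszulSymm G (insertAt (finSumFinEquiv.trans (finCongr (by omega : (a : ℕ) + (n - a) = n))) 0
          (f (n - a + 1)) (g a)) := rfl

theorem circT_apply (G : SuperStructure k V) (f g : Fam k V) (n : ℕ) :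
    circT G f g n = ∑ a : Fin (n + 1), ∑ i : Fin (n - a + 1), ∑ q : ZMod 2,
      MultilinearMap.compLinearMapₗ
        (fun j : Fin n => if j.val < i.val then G.par ^ q.val else LinearMap.id)
        (insertAt (blockEquiv n a i) i (f (n - a + 1)) (G.fam.proj q g a)) := rfl

/-- The graded commutator `[f, g] = f ∘ g - (-1)^{|f||g|} g ∘ f`. -/
def commutator (G : SuperStructure k V) (circ : Fam k V →ₗ[k] Fam k V →ₗ[k] Fam k V) :
    Fam k V →ₗ[k] Fam k V →ₗ[k] Fam k V :=
  circ - ∑ p : ZMod 2, ∑ q : ZMod 2,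
    sg k (p * q) • (circ.compl₁₂ (G.fam.proj q) (G.fam.proj p)).flip

/-- The Lie bracket of (commutative) formal vector fields. -/
def bracketS (G : SuperStructure k V) : Fam k V →ₗ[k] Fam k V →ₗ[k] Fam k V :=
  commutator G (circS G)

/-- The Lie bracket of noncommutative formal vector fields. -/
def bracketT (G : SuperStructure k V) : Fam k V →ₗ[k] Fam k V →ₗ[k] Fam k V :=
  commutator G (circT G)

/-- The map induced on vector fields by passing from `T̂ U*` to its quotient `Ŝ U*`. -/
def symmetrize (G : SuperStructure k V) : Fam k V →ₗ[k] Fam k V :=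
  LinearMap.pi fun n => koszulSymm G ∘ₗ LinearMap.proj n

/-- A space of formal vector fields on the dg vector space `V` is a dg Lie subalgebra for the
bracket `br`; the differential is the bracket with the linear vector field `d`. -/
structure IsDGLieSubalgebra (D : DGStructure k V) (br : Fam k V →ₗ[k] Fam k V →ₗ[k] Fam k V)
    (S : Submodule k (Fam k V)) : Prop where
  par_mem : ∀ f ∈ S, D.fam.par f ∈ S
  d_mem : ∀ f ∈ S, br (linField D.d) f ∈ S
  br_mem : ∀ f ∈ S, ∀ g ∈ S, br f g ∈ S

variable (k V) in
/-- Noncommutative formal vector fields vanishing at zero. -/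
def aFields : Submodule k (Fam k V) where
  carrier := {f | f 0 = 0}
  add_mem' {f g} hf hg := by simp_all
  zero_mem' := rfl
  smul_mem' c f hf := by simp_all

/-- Commutative formal vector fields vanishing at zero. -/
def cFields (G : SuperStructure k V) : Submodule k (Fam k V) where
  carrier := {f | f 0 = 0 ∧ ∀ n (σ : Equiv.Perm (Fin n)), act G σ (f n) = f n}
  add_mem' {f g} hf hg := ⟨by simp [hf.1, hg.1], fun n σ => by
    rw [Pi.add_apply, map_add, hf.2, hg.2]⟩
  zero_mem' := ⟨rfl, fun n σ => by simp⟩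
  smul_mem' c f hf := ⟨by simp [hf.1], fun n σ => by
    rw [Pi.smul_apply, map_smul, hf.2]⟩

/-- The families `f` for which every form `ω(f_n(x_1, …, x_n), x_{n+1})` is invariant under cyclic
permutations (with Koszul signs), that is, the vector fields preserving `ω`. -/
def cyclicFields (G : SuperStructure k V) (ω : V →ₗ[k] V →ₗ[k] k) : Submodule k (Fam k V) where
  carrier := {f | ∀ (n : ℕ) (p : Fin (n + 1) → ZMod 2) (x : Fin (n + 1) → V),
    (∀ i, G.IsHom (p i) (x i)) →
      ω (f n (Fin.init x)) (x (Fin.last n)) =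
        koszul k (finRotate (n + 1)).symm p *
          ω (f n (Fin.init (x ∘ finRotate (n + 1)))) ((x ∘ finRotate (n + 1)) (Fin.last n))}
  add_mem' {f g} hf hg n p x hx := by
    simp only [Pi.add_apply, _root_.add_apply, map_add, LinearMap.add_apply]
    rw [hf n p x hx, hg n p x hx]
    ring
  zero_mem' n p x hx := by simp
  smul_mem' c f hf n p x hx := by
    simp only [Pi.smul_apply, _root_.smul_apply, map_smul, LinearMap.smul_apply]
    rw [hf n p x hx]
    simp only [smul_eq_mul]
    ring

/-- Symplectic formal vector fields vanishing at zero. -/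
def csFields (G : SuperStructure k V) (ω : V →ₗ[k] V →ₗ[k] k) : Submodule k (Fam k V) :=
  cFields G ⊓ cyclicFields G ω

/-- Noncommutative symplectic formal vector fields vanishing at zero. -/
def asFields (G : SuperStructure k V) (ω : V →ₗ[k] V →ₗ[k] k) : Submodule k (Fam k V) :=
  aFields k V ⊓ cyclicFields G ω

theorem proj_mem {G : SuperStructure k V} {S : Submodule k (Fam k V)}
    (h : ∀ f ∈ S, G.fam.par f ∈ S) (p : ZMod 2) {f : Fam k V} (hf : f ∈ S) :
    G.fam.proj p f ∈ S :=
  S.smul_mem _ (S.add_mem hf (S.smul_mem _ (h f hf)))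

theorem commutator_mem {G : SuperStructure k V} {S : Submodule k (Fam k V)}
    (h : ∀ f ∈ S, G.fam.par f ∈ S) {circ : Fam k V →ₗ[k] Fam k V →ₗ[k] Fam k V}
    (hc : ∀ f ∈ S, ∀ g ∈ S, circ f g ∈ S) {f g : Fam k V} (hf : f ∈ S) (hg : g ∈ S) :
    commutator G circ f g ∈ S := by
  simp only [commutator, LinearMap.sub_apply, LinearMap.coe_sum, Finset.sum_apply]
  exact S.sub_mem (hc f hf g hg) (S.sum_mem fun p _ => S.sum_mem fun q _ =>
    S.smul_mem _ (hc _ (proj_mem h q hg) _ (proj_mem h p hf)))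

theorem aFields_isDGLieSubalgebra (D : DGStructure k V) :
    IsDGLieSubalgebra D (bracketT D.toSuperStructure) (aFields k V) := by
  have hp : ∀ f ∈ aFields k V, D.fam.par f ∈ aFields k V := by
    intro f (hf : f 0 = 0)
    change D.fam.par f 0 = 0
    ext x
    simp [SuperStructure.fam, hf]
  have hc : ∀ f ∈ aFields k V, ∀ g ∈ aFields k V,
      circT D.toSuperStructure f g ∈ aFields k V := by
    intro f _ g hg
    have h0 : ∀ q, ∀ a : Fin 1, (D.fam.proj q g) (a : ℕ) = 0 := by
      intro q a
      rw [show (a : ℕ) = 0 by omega]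
      exact proj_mem hp q hg
    change circT D.toSuperStructure f g 0 = 0
    rw [circT_apply]
    refine Finset.sum_eq_zero fun a _ => Finset.sum_eq_zero fun i _ =>
      Finset.sum_eq_zero fun q _ => ?_
    rw [h0 q a, map_zero, map_zero]
  exact ⟨hp, fun f hf => commutator_mem hp hc rfl hf, fun f hf g hg => commutator_mem hp hc hf hg⟩

theorem cFields_isDGLieSubalgebra [CharZero k] (D : DGStructure k V) :
    IsDGLieSubalgebra D (bracketS D.toSuperStructure) (cFields D.toSuperStructure) := by
  have hp : ∀ f ∈ cFields D.toSuperStructure, D.fam.par f ∈ cFields D.toSuperStructure := by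
    rintro f ⟨hf, hs⟩
    refine ⟨by ext x; simp [SuperStructure.fam, hf], fun n σ => ?_⟩
    conv_rhs => rw [show D.fam.par f n = D.par.compMultilinearMap
      ((f n).compLinearMap fun _ => D.par) from rfl, ← hs n σ]
    ext x
    simp only [act_apply, SuperStructure.fam]
    simp [act_apply, proj_par]
  have hc : ∀ f ∈ cFields D.toSuperStructure, ∀ g ∈ cFields D.toSuperStructure,
      circS D.toSuperStructure f g ∈ cFields D.toSuperStructure := by
    rintro f _ g ⟨hg, _⟩
    refine ⟨?_, fun n σ => ?_⟩
    · have h0 : ∀ a : Fin 1, g (a : ℕ) = 0 := by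
        intro a
        rw [show (a : ℕ) = 0 by omega]
        exact hg
      rw [circS_apply]
      refine Finset.sum_eq_zero fun a _ => ?_
      rw [h0 a, map_zero, map_zero, smul_zero]
    · rw [circS_apply, map_sum]
      refine Finset.sum_congr rfl fun a _ => ?_
      rw [map_smul, act_koszulSymm]
  have hd : linField D.d ∈ cFields D.toSuperStructure := by
    refine ⟨rfl, fun n σ => ?_⟩
    match n with
    | 0 => simp [linField]
    | 1 => rw [Subsingleton.elim σ 1, act_one]
    | n + 2 => simp [linField]
  exact ⟨hp, fun f hf => commutator_mem hp hc hd hf, fun f hf g hg => commutator_mem hp hc hf hg⟩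

end Fields

/-! ## `L∞` algebras

Everything is written on the parity reversion `W = ΠL` of the underlying space of an `L∞` algebra
`L`, where all structure maps are odd and graded symmetric. -/

section LInfty

variable (k : Type u) [Field k] (W : Type v) [AddCommGroup W] [Module k W]

/-- A super vector space `W` with multilinear maps `m_n : W^n → W`. The internal differential of
`W` is included in `m_1`. -/
structure LInftyData where
  gr : SuperStructure k W
  m : (n : ℕ) → MultilinearMap k (fun _ : Fin n => W) W

variable {k W}

/-- The subfamily of `x` indexed by the elements of `S`, in increasing order. -/
def subfamily {n : ℕ} {W : Type*} (S : Finset (Fin n)) (x : Fin n → W) : Fin S.card → W :=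
  fun i => x (S.orderEmbOfFin rfl i)

/-- The Koszul sign for moving the arguments indexed by `S` to the front. -/
def frontSign (k : Type u) [Field k] {n : ℕ} (S : Finset (Fin n)) (p : Fin n → ZMod 2) : k :=
  koszul k (fun i => if i ∈ S then 0 else 1) p

/-- The `L∞` algebra axioms: `m_0 = 0`, the maps `m_n` are odd and graded symmetric, and
`∑_S ± m(m(x_S), x_{Sᶜ}) = 0`, the sum over all subsets `S` of the set of arguments. -/
structure IsLInfty (L : LInftyData k W) : Prop where
  zero : L.m 0 = 0
  odd : ∀ n x, L.gr.par (L.m n x) = -L.m n (fun i => L.gr.par (x i))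
  symm : ∀ n (σ : Equiv.Perm (Fin n)), act L.gr σ (L.m n) = L.m n
  jacobi : ∀ (n : ℕ) (p : Fin n → ZMod 2) (x : Fin n → W), (∀ i, L.gr.IsHom (p i) (x i)) →
    ∑ S : Finset (Fin n), frontSign k S p •
      L.m (Sᶜ.card + 1) (Fin.cons (L.m S.card (subfamily S x)) (subfamily Sᶜ x)) = 0

/-- The value on homogeneous elements of the composition `ψ ∘ φ` of two families of multilinear
maps, `∑_r 1/r! ∑ ± ψ_r(φ(x_{B_1}), …, φ(x_{B_r}))`, the inner sum over all decompositions of the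
set of arguments into an ordered `r`-tuple of blocks `B_j = c⁻¹(j)`. -/
def compVal {W₁ W₂ : Type*} [AddCommGroup W₁] [Module k W₁] [AddCommGroup W₂] [Module k W₂]
    (ψ : (n : ℕ) → MultilinearMap k (fun _ : Fin n => W₁) W₂)
    (φ : (n : ℕ) → MultilinearMap k (fun _ : Fin n => W) W₁)
    {n : ℕ} (p : Fin n → ZMod 2) (x : Fin n → W) : W₂ :=
  ∑ r ∈ Finset.range (n + 1), ((r.factorial : k)⁻¹) • ∑ c : Fin n → Fin r, koszul k c p •
    ψ r (fun j => φ (Finset.univ.filter (fun i => c i = j)).card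
      (subfamily (Finset.univ.filter (fun i => c i = j)) x))

/-- `φ = (φ_1, φ_2, …)` is an `L∞` morphism: the maps `φ_n` are even and graded symmetric, and
`∑_S ± φ(m(x_S), x_{Sᶜ}) = ∑_r 1/r! ∑ ± m'_r(φ(x_{B_1}), …, φ(x_{B_r}))`. -/
structure IsLInftyHom {W' : Type*} [AddCommGroup W'] [Module k W']
    (L : LInftyData k W) (L' : LInftyData k W')
    (φ : (n : ℕ) → MultilinearMap k (fun _ : Fin n => W) W') : Prop where
  zero : φ 0 = 0
  even : ∀ n x, L'.gr.par (φ n x) = φ n (fun i => L.gr.par (x i))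
  symm : ∀ n (σ : Equiv.Perm (Fin n)), act L.gr σ (φ n) = φ n
  comm : ∀ (n : ℕ) (p : Fin n → ZMod 2) (x : Fin n → W), (∀ i, L.gr.IsHom (p i) (x i)) →
    ∑ S : Finset (Fin n), frontSign k S p •
      φ (Sᶜ.card + 1) (Fin.cons (L.m S.card (subfamily S x)) (subfamily Sᶜ x)) = compVal L'.m φ p x

/-- The components of the identity `L∞` morphism. -/
def idVal : {n : ℕ} → (Fin n → W) → W
  | 1, x => x 0
  | _, _ => 0

/-- `φ` is an `L∞` automorphism: an `L∞` morphism with an inverse `L∞` morphism. -/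
structure IsLInftyAut (L : LInftyData k W)
    (φ : (n : ℕ) → MultilinearMap k (fun _ : Fin n => W) W) : Prop where
  hom : IsLInftyHom L L φ
  inv : ∃ ψ : (n : ℕ) → MultilinearMap k (fun _ : Fin n => W) W, IsLInftyHom L L ψ ∧
    ∀ (n : ℕ) (p : Fin n → ZMod 2) (x : Fin n → W), (∀ i, L.gr.IsHom (p i) (x i)) →
      compVal ψ φ p x = idVal x ∧ compVal φ ψ p x = idVal x

end LInfty

/-! ## Formal commutative dg algebras -/

/-- A finite-dimensional augmented supercommutative dg algebra with nilpotent augmentation ideal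
(the unitalization of a finite-dimensional nilpotent cdga). -/
structure ArtinCdga (k : Type u) [Field k] where
  carrier : Type u
  [ring : Ring carrier]
  [algebra : Algebra k carrier]
  [finite : Module.Finite k carrier]
  par : carrier →ₐ[k] carrier
  par_par : ∀ a, par (par a) = a
  comm : ∀ (p q : ZMod 2) (a b : carrier), par a = sg k p • a → par b = sg k q • b →
    a * b = sg k (p * q) • (b * a)
  d : carrier →ₗ[k] carrier
  d_par : ∀ a, d (par a) = -par (d a)
  d_d : ∀ a, d (d a) = 0
  d_mul : ∀ a b, d (a * b) = d a * b + par a * d b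
  aug : carrier →ₐ[k] k
  aug_par : ∀ a, aug (par a) = aug a
  aug_d : ∀ a, aug (d a) = 0
  nilpotent : ∃ N : ℕ, ∀ a : Fin N → carrier, (∀ i, aug (a i) = 0) → (List.ofFn a).prod = 0

attribute [instance] ArtinCdga.ring ArtinCdga.algebra ArtinCdga.finite

/-- The grading of the algebra. -/
def ArtinCdga.gr {k : Type u} [Field k] (R : ArtinCdga k) : SuperStructure k R.carrier where
  par := R.par.toLinearMap
  par_par := R.par_par

/-- Morphisms of augmented cdgas. -/
structure ArtinCdga.Hom {k : Type u} [Field k] (R R' : ArtinCdga k) where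
  f : R.carrier →ₐ[k] R'.carrier
  par : ∀ a, f (R.par a) = R'.par (f a)
  d : ∀ a, f (R.d a) = R'.d (f a)
  aug : ∀ a, R'.aug (f a) = R.aug a

/-- A formal cdga, presented as the inverse limit of a directed inverse system of
finite-dimensional augmented cdgas with nilpotent augmentation ideals. -/
structure FormalCdga (k : Type u) [Field k] where
  ι : Type w
  [preorder : Preorder ι]
  nonempty : Nonempty ι
  directed : ∀ i j : ι, ∃ l, i ≤ l ∧ j ≤ l
  obj : ι → ArtinCdga k
  map : ∀ {i j : ι}, i ≤ j → ArtinCdga.Hom (obj j) (obj i)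
  map_id : ∀ (i : ι) (a : (obj i).carrier), (map (le_refl i)).f a = a
  map_comp : ∀ {i j l : ι} (hij : i ≤ j) (hjl : j ≤ l) (a : (obj l).carrier),
    (map hij).f ((map hjl).f a) = (map (hij.trans hjl)).f a

attribute [instance] FormalCdga.preorder

/-- A continuous morphism of formal cdgas `A = lim A_i → B = lim B_j`: for every `j` the
composition `A → B_j` factors through some `A_i`, and these maps are compatible. -/
structure FormalCdga.Hom {k : Type u} [Field k] (A B : FormalCdga.{u, w} k) where
  idx : B.ι → A.ι
  f : ∀ j, ArtinCdga.Hom (A.obj (idx j)) (B.obj j)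
  compat : ∀ {j j' : B.ι} (h : j ≤ j'), ∃ (i : A.ι) (h₁ : idx j ≤ i) (h₂ : idx j' ≤ i),
    ∀ a, (B.map h).f ((f j').f ((A.map h₂).f a)) = (f j).f ((A.map h₁).f a)

/-! ## Extension of scalars -/

section Extension

variable {k : Type u} [Field k]

/-- The multilinear map `(a_i ⊗ x_i)_i ↦ α(a) ⊗ f(x)`. -/
def tensorMulti {A : Type*} [AddCommGroup A] [Module k A] {B : Type*} [AddCommGroup B] [Module k B]
    {X : Type*} [AddCommGroup X] [Module k X] {Y : Type*} [AddCommGroup Y] [Module k Y] :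
    (n : ℕ) → MultilinearMap k (fun _ : Fin n => A) B →ₗ[k]
      MultilinearMap k (fun _ : Fin n => X) Y →ₗ[k]
        MultilinearMap k (fun _ : Fin n => A ⊗[k] X) (B ⊗[k] Y)
  | 0 => LinearMap.mk₂ k (fun α f => MultilinearMap.constOfIsEmpty k _ (α 0 ⊗ₜ[k] f 0))
      (fun _ _ _ => by ext; simp [TensorProduct.add_tmul])
      (fun _ _ _ => by ext; simp [TensorProduct.smul_tmul'])
      (fun _ _ _ => by ext; simp [TensorProduct.tmul_add])
      (fun _ _ _ => by ext; simp)
  | n + 1 => LinearMap.mk₂ k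
      (fun α f => LinearMap.uncurryLeft
        (TensorProduct.lift ((tensorMulti n).compl₁₂ α.curryLeft f.curryLeft)))
      (fun α α' f => by
        have h : TensorProduct.lift ((tensorMulti (B := B) (Y := Y) n).compl₁₂
              (α + α').curryLeft f.curryLeft) =
            TensorProduct.lift ((tensorMulti n).compl₁₂ α.curryLeft f.curryLeft) +
            TensorProduct.lift ((tensorMulti n).compl₁₂ α'.curryLeft f.curryLeft) :=
          TensorProduct.ext' fun a x => by
            simp [show (α + α').curryLeft a = α.curryLeft a + α'.curryLeft a from rfl]
        rw [h]
        rfl)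
      (fun c α f => by
        have h : TensorProduct.lift ((tensorMulti (B := B) (Y := Y) n).compl₁₂
              (c • α).curryLeft f.curryLeft) =
            c • TensorProduct.lift ((tensorMulti n).compl₁₂ α.curryLeft f.curryLeft) :=
          TensorProduct.ext' fun a x => by
            simp [show (c • α).curryLeft a = c • α.curryLeft a from rfl]
        rw [h]
        rfl)
      (fun α f f' => by
        have h : TensorProduct.lift ((tensorMulti (B := B) (Y := Y) n).compl₁₂
              α.curryLeft (f + f').curryLeft) =
            TensorProduct.lift ((tensorMulti n).compl₁₂ α.curryLeft f.curryLeft) +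
            TensorProduct.lift ((tensorMulti n).compl₁₂ α.curryLeft f'.curryLeft) :=
          TensorProduct.ext' fun a x => by
            simp [show (f + f').curryLeft x = f.curryLeft x + f'.curryLeft x from rfl]
        rw [h]
        rfl)
      (fun c α f => by
        have h : TensorProduct.lift ((tensorMulti (B := B) (Y := Y) n).compl₁₂
              α.curryLeft (c • f).curryLeft) =
            c • TensorProduct.lift ((tensorMulti n).compl₁₂ α.curryLeft f.curryLeft) :=
          TensorProduct.ext' fun a x => by
            simp [show (c • f).curryLeft x = c • f.curryLeft x from rfl]
        rw [h]
        rfl)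

theorem tensorMulti_tmul {A : Type*} [AddCommGroup A] [Module k A]
    {B : Type*} [AddCommGroup B] [Module k B]
    {X : Type*} [AddCommGroup X] [Module k X] {Y : Type*} [AddCommGroup Y] [Module k Y] (n : ℕ)
    (α : MultilinearMap k (fun _ : Fin n => A) B) (f : MultilinearMap k (fun _ : Fin n => X) Y)
    (a : Fin n → A) (x : Fin n → X) :
    tensorMulti n α f (fun i => a i ⊗ₜ[k] x i) = α a ⊗ₜ[k] f x := by
  induction n with
  | zero => simp [tensorMulti, Subsingleton.elim a 0, Subsingleton.elim x 0]
  | succ n ih =>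
    simp only [tensorMulti, LinearMap.mk₂_apply, LinearMap.uncurryLeft_apply,
      TensorProduct.lift.tmul, LinearMap.compl₁₂_apply]
    refine (ih _ _ (Fin.tail a) (Fin.tail x)).trans ?_
    simp

variable {X : Type*} [AddCommGroup X] [Module k X] {Y : Type*} [AddCommGroup Y] [Module k Y]
variable {Z : Type*} [AddCommGroup Z] [Module k Z]

/-- The `A`-linear extension of a multilinear map `f : X^n → Y` of parity `q`: on homogeneous
elements, `(a_1 ⊗ x_1, …, a_n ⊗ x_n) ↦ ± a_1 ⋯ a_n ⊗ f(x_1, …, x_n)` with the Koszul sign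
`(-1)^(∑ q |a_i| + ∑_{i < j} |x_i| |a_j|)`. -/
def extendScalars (R : ArtinCdga k) (G : SuperStructure k X) (q : ZMod 2) {n : ℕ}
    (f : MultilinearMap k (fun _ : Fin n => X) Y) :
    MultilinearMap k (fun _ : Fin n => R.carrier ⊗[k] X) (R.carrier ⊗[k] Y) :=
  ∑ a : Fin n → ZMod 2, ∑ p : Fin n → ZMod 2,
    ((∏ i, sg k (q * a i)) * ∏ i, ∏ j, if i < j then sg k (p i * a j) else 1) •
      tensorMulti n
        ((MultilinearMap.mkPiAlgebraFin k n R.carrier).compLinearMap fun i => R.gr.proj (a i))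
        (f.compLinearMap fun i => G.proj (p i))

/-- The `A`-linear extension of an even bilinear map. -/
def extBilin (R : ArtinCdga k) (G : SuperStructure k X) (b : X →ₗ[k] Y →ₗ[k] Z) :
    R.carrier ⊗[k] X →ₗ[k] R.carrier ⊗[k] Y →ₗ[k] R.carrier ⊗[k] Z :=
  ∑ p : ZMod 2, ∑ a : ZMod 2, sg k (p * a) •
    TensorProduct.map₂ ((LinearMap.mul k R.carrier).compl₂ (R.gr.proj a)) (b ∘ₗ G.proj p)

end Extension

/-! ## Maurer–Cartan elements -/

section MC

variable {k : Type u} [Field k] {W : Type v} [AddCommGroup W] [Module k W]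

/-- The Maurer–Cartan equation `d_A ξ + ∑_n 1/n! m_n(ξ, …, ξ) = 0` for an even element `ξ` of
`A_+ ⊗ W`; the sum is finite since `A_+` is nilpotent. -/
structure IsMC (L : LInftyData k W) (R : ArtinCdga k) (ξ : R.carrier ⊗[k] W) : Prop where
  even : TensorProduct.map R.par.toLinearMap L.gr.par ξ = ξ
  mem : R.aug.toLinearMap.rTensor W ξ = 0
  eqn : R.d.rTensor W ξ +
    ∑ᶠ n : ℕ, ((n.factorial : k)⁻¹) • extendScalars R L.gr 1 (L.m n) (fun _ => ξ) = 0

/-- The set `MC(L, A)` for a formal cdga `A = lim A_i`: the Maurer–Cartan elements in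
`A_+ ⊗ W = lim ((A_i)_+ ⊗ W)`. -/
def MC (L : LInftyData k W) (A : FormalCdga.{u, w} k) :
    Set ((i : A.ι) → (A.obj i).carrier ⊗[k] W) :=
  {ξ | (∀ i, IsMC L (A.obj i) (ξ i)) ∧
    ∀ i j (h : i ≤ j), (A.map h).f.toLinearMap.rTensor W (ξ j) = ξ i}

/-- The map `A ⊗ W → B ⊗ W` induced by a morphism `A → B` of formal cdgas. -/
def FormalCdga.Hom.push {A B : FormalCdga.{u, w} k} (F : FormalCdga.Hom A B)
    (ξ : (i : A.ι) → (A.obj i).carrier ⊗[k] W) : (j : B.ι) → (B.obj j).carrier ⊗[k] W :=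
  fun j => (F.f j).f.toLinearMap.rTensor W (ξ (F.idx j))

/-- The action `ξ ↦ ∑_n 1/n! φ_n(ξ, …, ξ)` of an `L∞` morphism `φ` on Maurer–Cartan elements. -/
def pushMC {W' : Type*} [AddCommGroup W'] [Module k W'] (L : LInftyData k W)
    (φ : (n : ℕ) → MultilinearMap k (fun _ : Fin n => W) W') (R : ArtinCdga k)
    (ξ : R.carrier ⊗[k] W) : R.carrier ⊗[k] W' :=
  ∑ᶠ n : ℕ, ((n.factorial : k)⁻¹) • extendScalars R L.gr 0 (φ n) (fun _ => ξ)

end MC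

/-! ## The `L∞` algebras of vector fields with a Maurer–Cartan element -/

section Tilde

variable {k : Type u} [Field k] {V : Type v} [AddCommGroup V] [Module k V]

/-- For a dg Lie algebra `S` of formal vector fields on the dg vector space `U = ΠV` and a map `ρ`
to commutative vector fields, the `L∞` structure on `S ⊕ V`, written on `Π(S ⊕ V) = ΠS ⊕ U`:
the differential is `Πf ↦ -Π[d, f]` on `ΠS` and `d` on `U`; the bracket is
`m_2(Πf, Πg) = (-1)^{|f|} Π[f, g]`; the products `m_n(Πf, w_1, …, w_{n-1}) = ρ(f)(w_1, …, w_{n-1})`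
are extended to other orders of the arguments by graded symmetry; all other products vanish. -/
def tilde (D : DGStructure k V) (br : Fam k V →ₗ[k] Fam k V →ₗ[k] Fam k V)
    (ρ : Fam k V →ₗ[k] Fam k V) (S : Submodule k (Fam k V)) (h : IsDGLieSubalgebra D br S) :
    LInftyData k (S × V) :=
  let gr : SuperStructure k (S × V) :=
    SuperStructure.prod
      (SuperStructure.shift ⟨D.fam.par.restrict h.par_mem, fun f => Subtype.ext (D.fam.par_par f)⟩)
      D.toSuperStructure
  let diff : (n : ℕ) → MultilinearMap k (fun _ : Fin n => S × V) (S × V) := fun n =>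
    match n with
    | 1 => MultilinearMap.ofSubsingleton k (S × V) (S × V) (0 : Fin 1)
        ((-(br (linField D.d)).restrict h.d_mem).prodMap D.d)
    | _ => 0
  let lie : (n : ℕ) → MultilinearMap k (fun _ : Fin n => S × V) (S × V) := fun n =>
    match n with
    | 2 => LinearMap.uncurryLeft
        ((MultilinearMap.ofSubsingletonₗ k k (S × V) (S × V) (0 : Fin 1)).toLinearMap ∘ₗ
          LinearMap.mk₂ k
            (fun z z' : S × V => ((⟨br (D.fam.par z.1) z'.1,
              h.br_mem _ (h.par_mem _ z.1.2) _ z'.1.2⟩, 0) : S × V))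
            (fun _ _ _ => by ext1 <;> simp) (fun _ _ _ => by ext1 <;> simp)
            (fun _ _ _ => by ext1 <;> simp) (fun _ _ _ => by ext1 <;> simp))
    | _ => 0
  let mixed : (n : ℕ) → MultilinearMap k (fun _ : Fin n => S × V) (S × V) := fun n =>
    match n with
    | 0 => 0
    | n + 1 => ((n.factorial : k)⁻¹) • koszulSymm gr
        (LinearMap.compMultilinearMap (LinearMap.inr k S V)
          (LinearMap.uncurryLeft
            (MultilinearMap.compLinearMapₗ (fun _ : Fin n => LinearMap.snd k S V) ∘ₗ
              LinearMap.proj n ∘ₗ ρ ∘ₗ S.subtype ∘ₗ LinearMap.fst k S V)))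
  { gr := gr
    m := fun n => diff n + lie n + mixed n }

/-- `c̃(V)`: commutative vector fields on `ΠV` vanishing at zero, extended by `V`. -/
def cTilde [CharZero k] (E : DGStructure k V) :
    LInftyData k (cFields E.shift.toSuperStructure × V) :=
  tilde E.shift (bracketS E.shift.toSuperStructure) LinearMap.id
    (cFields E.shift.toSuperStructure) (cFields_isDGLieSubalgebra E.shift)

/-- `ã(V)`: noncommutative vector fields on `ΠV` vanishing at zero, extended by `V`. -/
def aTilde (E : DGStructure k V) : LInftyData k (aFields k V × V) :=
  tilde E.shift (bracketT E.shift.toSuperStructure) (symmetrize E.shift.toSuperStructure)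
    (aFields k V) (aFields_isDGLieSubalgebra E.shift)

/-- A nondegenerate symmetric scalar product of parity `ε` on the dg vector space `V`. -/
structure IsInnerProduct (E : DGStructure k V) (ε : ZMod 2) (s : V →ₗ[k] V →ₗ[k] k) : Prop where
  parity : ∀ x y, s (E.par x) (E.par y) = sg k ε * s x y
  symm : ∀ (p q : ZMod 2) (x y : V), E.IsHom p x → E.IsHom q y → s x y = sg k (p * q) * s y x
  nondegenerate : ∀ x, (∀ y, s x y = 0) → x = 0
  d_compat : ∀ x y, s (E.d x) y + s (E.par x) (E.d y) = 0

/-- The symplectic form `ω(Πx, Πy) = (-1)^{|x|} ⟨x, y⟩` on `ΠV`. -/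
def symplecticForm (E : DGStructure k V) (s : V →ₗ[k] V →ₗ[k] k) : V →ₗ[k] V →ₗ[k] k :=
  s ∘ₗ E.par

/-- `c̃s(V)`: symplectic vector fields on `ΠV` vanishing at zero, extended by `V`. -/
def csTilde (E : DGStructure k V) (s : V →ₗ[k] V →ₗ[k] k)
    (h : IsDGLieSubalgebra E.shift (bracketS E.shift.toSuperStructure)
      (csFields E.shift.toSuperStructure (symplecticForm E s))) :
    LInftyData k (csFields E.shift.toSuperStructure (symplecticForm E s) × V) :=
  tilde E.shift (bracketS E.shift.toSuperStructure) LinearMap.id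
    (csFields E.shift.toSuperStructure (symplecticForm E s)) h

/-- `ãs(V)`: noncommutative symplectic vector fields on `ΠV` vanishing at zero, extended
by `V`. -/
def asTilde (E : DGStructure k V) (s : V →ₗ[k] V →ₗ[k] k)
    (h : IsDGLieSubalgebra E.shift (bracketT E.shift.toSuperStructure)
      (asFields E.shift.toSuperStructure (symplecticForm E s))) :
    LInftyData k (asFields E.shift.toSuperStructure (symplecticForm E s) × V) :=
  tilde E.shift (bracketT E.shift.toSuperStructure) (symmetrize E.shift.toSuperStructure)
    (asFields E.shift.toSuperStructure (symplecticForm E s)) h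

/-! ## Twisting -/

/-- The twisted structure `m^ξ = e^ξ m e^{-ξ} - d(ξ)` for `ξ ∈ (A_+ ⊗ U)_0` and an odd element
`m ∈ A ⊗ Der`. Here `ξ` acts as the constant derivation `φ ↦ φ(ξ)` on functions on `U`, whose
commutator with `m` is `[m, ξ]` in the bracket `br` of families of multilinear maps, and the term
`-d(ξ)` is the constant vector field with value `d_{A ⊗ U} ξ`. -/
def twist (D : DGStructure k V) (br : Fam k V →ₗ[k] Fam k V →ₗ[k] Fam k V) (R : ArtinCdga k)
    (ξ : R.carrier ⊗[k] V) (m : R.carrier ⊗[k] Fam k V) : R.carrier ⊗[k] Fam k V :=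
  (∑ᶠ i : ℕ, ((i.factorial : k)⁻¹) •
      (((extBilin R D.fam br).flip (constField.lTensor R.carrier ξ)) ^ i) m) +
    constField.lTensor R.carrier
      (R.d.rTensor V ξ + TensorProduct.map R.par.toLinearMap D.d ξ)

/-- The vector field component of an element of `A ⊗ (ΠS ⊕ U)`, regarded as an element of
`A ⊗ S` (by `a ⊗ Πf ↦ (-1)^{|a|} a ⊗ f`) and of the bigger space of all vector fields. -/
def fieldPart (R : ArtinCdga k) (S : Submodule k (Fam k V)) :
    R.carrier ⊗[k] (S × V) →ₗ[k] R.carrier ⊗[k] Fam k V :=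
  TensorProduct.map R.par.toLinearMap (S.subtype ∘ₗ LinearMap.fst k S V)

/-- The component in `A ⊗ U` of an element of `A ⊗ (ΠS ⊕ U)`. -/
def vecPart (R : ArtinCdga k) (S : Submodule k (Fam k V)) :
    R.carrier ⊗[k] (S × V) →ₗ[k] R.carrier ⊗[k] V :=
  (LinearMap.snd k S V).lTensor R.carrier

/-- `ζ' = (m^ξ, -ξ)` where `ζ = (m, ξ)`. -/
def IsTwistOf (D : DGStructure k V) (br : Fam k V →ₗ[k] Fam k V →ₗ[k] Fam k V)
    {S : Submodule k (Fam k V)} (R : ArtinCdga k) (ζ ζ' : R.carrier ⊗[k] (S × V)) : Prop :=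
  fieldPart R S ζ' = twist D br R (vecPart R S ζ) (fieldPart R S ζ) ∧
    vecPart R S ζ' = -vecPart R S ζ

/-- `(m, ξ) ↦ (m^ξ, -ξ)` defines an automorphism of the functor `A ↦ MC(L, A)` on formal cdgas. -/
def TwistingIsFunctorAut (D : DGStructure k V) (br : Fam k V →ₗ[k] Fam k V →ₗ[k] Fam k V)
    {S : Submodule k (Fam k V)} (L : LInftyData k (S × V)) : Prop :=
  ∃ T : ∀ A : FormalCdga.{u, w} k, ((i : A.ι) → (A.obj i).carrier ⊗[k] (S × V)) →
      ((i : A.ι) → (A.obj i).carrier ⊗[k] (S × V)),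
    (∀ A, ∀ ζ ∈ MC L A, ∀ i, IsTwistOf D br (A.obj i) (ζ i) (T A ζ i)) ∧
    (∀ A, Set.BijOn (T A) (MC L A) (MC L A)) ∧
    ∀ A B (F : FormalCdga.Hom A B), ∀ ζ ∈ MC L A,
      F.push ζ ∈ MC L B ∧ T B (F.push ζ) = F.push (T A ζ)

/-- The action of `φ` on Maurer–Cartan elements over all formal cdgas is `(m, ξ) ↦ (m^ξ, -ξ)`. -/
def InducesTwisting (D : DGStructure k V) (br : Fam k V →ₗ[k] Fam k V →ₗ[k] Fam k V)
    {S : Submodule k (Fam k V)} (L : LInftyData k (S × V))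
    (φ : (n : ℕ) → MultilinearMap k (fun _ : Fin n => S × V) (S × V)) : Prop :=
  ∀ A : FormalCdga.{u, w} k, ∀ ζ ∈ MC L A, ∀ i,
    IsTwistOf D br (A.obj i) (ζ i) (pushMC L φ (A.obj i) (ζ i))

/-- `φ` is the `L∞` automorphism induced by the twisting of Maurer–Cartan elements: it is an `L∞`
automorphism acting on Maurer–Cartan elements by twisting, and the only such `L∞` morphism. -/
structure IsInducedByTwisting (D : DGStructure k V)
    (br : Fam k V →ₗ[k] Fam k V →ₗ[k] Fam k V)
    {S : Submodule k (Fam k V)} (L : LInftyData k (S × V))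
    (φ : (n : ℕ) → MultilinearMap k (fun _ : Fin n => S × V) (S × V)) : Prop where
  aut : IsLInftyAut L φ
  induces : InducesTwisting.{u, v, w} D br L φ
  unique : ∀ ψ : (n : ℕ) → MultilinearMap k (fun _ : Fin n => S × V) (S × V),
    IsLInftyHom L L ψ → InducesTwisting.{u, v, w} D br L ψ → ψ = φ

/-- The explicit components: `tw_{m+1}(Πf, w_1, …, w_m)` is the vector field
`(x_1, …, x_k) ↦ ins f_{m+k} w x` for `k ≥ 1`, `tw_1(w) = -w`, and all other values (on
several vectors, or on more than one vector field) are zero. -/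
structure HasTwistingComponents {S : Submodule k (Fam k V)}
    (ins : ∀ {m l : ℕ}, MultilinearMap k (fun _ : Fin (m + l) => V) V →
      (Fin m → V) → (Fin l → V) → V)
    (tw : (n : ℕ) → MultilinearMap k (fun _ : Fin n => S × V) (S × V)) : Prop where
  field_fst : ∀ (m : ℕ) (f : S) (w : Fin m → V) (l : ℕ) (x : Fin l → V), 1 ≤ l →
    ((tw (m + 1) (Fin.cons (f, 0) fun j => (0, w j))).1 : Fam k V) l x =
      ins ((f : Fam k V) (m + l)) w x
  field_snd : ∀ (m : ℕ) (f : S) (w : Fin m → V),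
    (tw (m + 1) (Fin.cons (f, 0) fun j => (0, w j))).2 = 0
  vec_one : ∀ w : V, tw 1 (fun _ => (0, w)) = (0, -w)
  vec_other : ∀ n ≠ 1, ∀ w : Fin n → V, tw n (fun j => (0, w j)) = 0
  two_fields : ∀ (n : ℕ) (z : Fin n → S × V) (i j : Fin n), i ≠ j → (z i).2 = 0 → (z j).2 = 0 →
    tw n z = 0

/-- `f(w_1, …, w_m, x_1, …, x_l)`. -/
def insC {m l : ℕ} (f : MultilinearMap k (fun _ : Fin (m + l) => V) V) (w : Fin m → V)
    (x : Fin l → V) : V :=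
  f (Fin.append w x)

open Classical in
/-- `∑_σ f(σ(w_1 ⊗ … ⊗ w_m) | x_1, …, x_l)`: the sum with Koszul signs over all rearrangements of
`w_1, …, w_m, x_1, …, x_l` in which the `x_j` remain in order. -/
def insA (G : SuperStructure k V) {m l : ℕ} (f : MultilinearMap k (fun _ : Fin (m + l) => V) V)
    (w : Fin m → V) (x : Fin l → V) : V :=
  ∑ τ : Equiv.Perm (Fin (m + l)) with StrictMono fun j : Fin l => τ.symm (Fin.natAdd m j),
    act G τ f (Fin.append w x)

/-- For `S ⊆ S'`, the maps `ψ` on `ΠS ⊕ U` are the restrictions of the maps `φ` on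
`ΠS' ⊕ U`. -/
def IsRestriction {S S' : Submodule k (Fam k V)} (hS : S ≤ S')
    (ψ : (n : ℕ) → MultilinearMap k (fun _ : Fin n => S × V) (S × V))
    (φ : (n : ℕ) → MultilinearMap k (fun _ : Fin n => S' × V) (S' × V)) : Prop :=
  ∀ n (z : Fin n → S × V), φ n (fun i => (Submodule.inclusion hS (z i).1, (z i).2)) =
    (Submodule.inclusion hS (ψ n z).1, (ψ n z).2)

end Tilde

end Twisting

end

open Twisting

set_option linter.unusedSectionVars false

noncomputable section

namespace Twisting

/-! ## Signs and homogeneous elements -/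

section Sign

variable {k : Type u} [Field k]

/-! All formal vector fields on U = ΠV, constant ones included, form a graded Lie algebra 𝔤 = S ⊕ U.
The fields S vanishing at zero are a subalgebra, the constants U are abelian, and the linear field Δ
= d is odd, lies in S, has square zero and acts on U as d. These are the data of a higher derived
bracket construction, and they are all that the main argument uses (`TwistData`).

Over an Artinian cdga A an even ζ = (m, ξ) gives an odd element M = m + Δ of A ⊗ 𝔤, and X = [·, ξ]
is a nilpotent derivation, so e^X is an automorphism of the bracket. Let P and π be the projections
of 𝔤 to U and S. The generating series of the structure maps is Q(ζ) = (-½[M, M], P e^X M), and that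
of the twisting is T(ζ) = (π e^X m, -ξ) (`F_ser`, `vec_ser`, `F_ser_tw`, `vec_ser_tw`). In this form
the L∞ relation (`dser_ser`), the morphism relation (`dser_tw`) and T ∘ T = id (`tw_tw`) need only
the Jacobi identity, [U, U] = 0 and [S, S] ⊂ S; the key identity is `brR_self_decomp`.

Identities of series become identities of symmetric multilinear maps by polarization: over the
Grassmann algebra on t_1, …, t_n one takes the coefficient of t_1 ⋯ t_n at the point ∑ t_i ⊗ x_i
(`linfty_jacobi_of_ser`, `linfty_comm_of_ser`, `compVal_of_ser`, `eq_of_ser_eq`).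

On a Maurer–Cartan element the U-component of the equation says d_A ξ + P e^X M = 0. Hence the
constant part of e^X m, which π removes, is exactly what the term with d(ξ) in the twisted structure
cancels, and T(ζ) = (m^ξ, -ξ) (`F_ser_tw_of_isMC`). For uniqueness, every even ζ in A_+ ⊗ W lifts to
the Maurer–Cartan element ζ - ε Q(ζ) over the cone of A (`exists_isMC_cone`), so Maurer–Cartan
elements see the whole series of a morphism.

It remains to supply the Lie algebras. The composition of noncommutative fields is a pre-Lie product
(`circT_assoc`). Symmetrization is a Lie homomorphism onto the commutative fields, with the section
f_n ↦ f_n / n!, so every axiom descends (`symmetrize_bracketT`, `isFieldAlgebra_bracketS`).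
Cyclically invariant fields are closed under the bracket (`bracketT_mem_cyclicFields`), and
symmetrization preserves them. Finally, iterated brackets with constants are insertions of vectors,
which yields both the products of the L∞ structure and the components of the twisting
(`iter_bracketT`, `iter_bracketS`). -/

theorem sg_add (p q : ZMod 2) : sg k (p + q) = sg k p * sg k q := by
  rcases zmod_two p with rfl | rfl <;> rcases zmod_two q with rfl | rfl
  · simp [sg_zero]
  · simp [sg_zero]
  · simp [sg_zero]
  · rw [show (1 + 1 : ZMod 2) = 0 from rfl, sg_zero, sg_one]; ring

theorem sg_sum {ι : Type*} (s : Finset ι) (f : ι → ZMod 2) :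
    sg k (∑ i ∈ s, f i) = ∏ i ∈ s, sg k (f i) := by
  classical
  induction s using Finset.induction_on with
  | empty => simp [sg_zero]
  | insert a s ha ih => rw [Finset.sum_insert ha, Finset.prod_insert ha, sg_add, ih]

theorem sg_ite (P : Prop) [Decidable P] (p : ZMod 2) :
    (if P then sg k p else 1) = sg k (if P then p else 0) := by
  split_ifs <;> simp [sg_zero]

theorem zmod_two_add_self (p : ZMod 2) : p + p = 0 := by
  revert p; decide

theorem koszul_eq {n : ℕ} {α : Type*} [LinearOrder α] (c : Fin n → α) (p : Fin n → ZMod 2) :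
    koszul k c p = sg k (∑ i, ∑ j, if i < j ∧ c j < c i then p i * p j else 0) := by
  simp only [koszul, sg_ite, sg_sum]

theorem sg_smul_sg_smul {M : Type*} [AddCommGroup M] [Module k M] (p : ZMod 2) (x : M) :
    sg k p • sg k p • x = x := by
  rw [smul_smul, sg_mul_self, one_smul]

theorem sg_smul_cancel {M : Type*} [AddCommGroup M] [Module k M] (p : ZMod 2) {x y : M}
    (h : sg k p • x = sg k p • y) : x = y := by
  rw [← sg_smul_sg_smul (k := k) p x, h, sg_smul_sg_smul]

end Sign

section Hom

variable {k : Type u} [Field k] {V : Type*} [AddCommGroup V] [Module k V]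
variable {X : Type*} [AddCommGroup X] [Module k X]

theorem isHom_proj (G : SuperStructure k V) (p : ZMod 2) (x : V) : G.IsHom p (G.proj p x) := by
  rcases zmod_two p with rfl | rfl <;>
    simp [SuperStructure.IsHom, SuperStructure.proj, sg_zero, sg_one, G.par_par] <;> module

theorem SuperStructure.IsHom.smul {G : SuperStructure k V} {p : ZMod 2} {x : V} (h : G.IsHom p x)
    (c : k) : G.IsHom p (c • x) := by
  simp only [SuperStructure.IsHom, map_smul] at *
  rw [h, smul_comm]

theorem SuperStructure.IsHom.add {G : SuperStructure k V} {p : ZMod 2} {x y : V}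
    (h : G.IsHom p x) (h' : G.IsHom p y) : G.IsHom p (x + y) := by
  simp only [SuperStructure.IsHom, map_add] at *
  rw [h, h', smul_add]

theorem SuperStructure.IsHom.sub {G : SuperStructure k V} {p : ZMod 2} {x y : V}
    (h : G.IsHom p x) (h' : G.IsHom p y) : G.IsHom p (x - y) := by
  simp only [SuperStructure.IsHom, map_sub] at *
  rw [h, h', smul_sub]

theorem SuperStructure.IsHom.neg {G : SuperStructure k V} {p : ZMod 2} {x : V}
    (h : G.IsHom p x) : G.IsHom p (-x) := by
  simp only [SuperStructure.IsHom, map_neg] at *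
  rw [h, smul_neg]

theorem isHom_zero (G : SuperStructure k V) (p : ZMod 2) : G.IsHom p 0 := by
  simp [SuperStructure.IsHom]

variable [CharZero k]

theorem SuperStructure.IsHom.proj {G : SuperStructure k V} {p : ZMod 2} {x : V} (h : G.IsHom p x)
    (q : ZMod 2) : G.proj q x = if q = p then x else 0 := by
  simp only [SuperStructure.IsHom] at h
  rcases zmod_two p with rfl | rfl <;> rcases zmod_two q with rfl | rfl <;>
    simp [SuperStructure.proj, sg_zero, sg_one, h] <;> module

theorem SuperStructure.IsHom.proj_self {G : SuperStructure k V} {p : ZMod 2} {x : V}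
    (h : G.IsHom p x) : G.proj p x = x := by
  simp [h.proj]

/-- In the sum over parity vectors every term other than the one for `p` applies some projection to
an element of the wrong parity. -/
theorem act_isHom (G : SuperStructure k V) {n : ℕ} (σ : Equiv.Perm (Fin n))
    (f : MultilinearMap k (fun _ : Fin n => V) X) {p : Fin n → ZMod 2} {x : Fin n → V}
    (hx : ∀ i, G.IsHom (p i) (x i)) :
    act G σ f x = koszul k σ.symm p • f (x ∘ σ) := by
  rw [act_apply, Finset.sum_eq_single p]
  · simp only [(hx _).proj_self]
    rfl
  · intro q _ hq
    obtain ⟨j, hj⟩ : ∃ j, q j ≠ p j := by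
      by_contra h
      push Not at h
      exact hq (funext h)
    rw [f.map_coord_zero (σ.symm j), smul_zero]
    simp [(hx j).proj, hj]
  · simp

/-- A multilinear map vanishing on tuples from the sets `s i` vanishes on tuples from their
spans. -/
theorem multilinear_eq_zero_of_span {n : ℕ} (F : MultilinearMap k (fun _ : Fin n => V) X)
    (s : Fin n → Set V) (h : ∀ x, (∀ i, x i ∈ s i) → F x = 0) (x : Fin n → V)
    (hx : ∀ i, x i ∈ Submodule.span k (s i)) : F x = 0 := by
  classical
  -- `T` is the set of slots whose entry is only known to lie in the span; they are reduced to the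
  -- generating set one at a time.
  have key : ∀ T : Finset (Fin n), ∀ x : Fin n → V, (∀ i, x i ∈ Submodule.span k (s i)) →
      (∀ i ∉ T, x i ∈ s i) → F x = 0 := by
    intro T
    induction T using Finset.induction_on with
    | empty => exact fun x _ hx => h x fun i => hx i (by simp)
    | insert a T ha ih =>
      intro x hx hT
      rw [← Function.update_eq_self a x]
      refine Submodule.span_induction (p := fun y _ => F (Function.update x a y) = 0)
        ?_ ?_ ?_ ?_ (hx a)
      · intro y hy
        refine ih _ (fun i => ?_) (fun i hi => ?_)
        · by_cases hia : i = a
          · subst hia; simpa using Submodule.subset_span hy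
          · simpa [hia] using hx i
        · by_cases hia : i = a
          · subst hia; simpa using hy
          · simpa [hia] using hT i (by simp [hia, hi])
      · exact F.map_update_zero _ _
      · intro y z _ _ hy hz
        rw [F.map_update_add, hy, hz, add_zero]
      · intro c y _ hy
        rw [F.map_update_smul, hy, smul_zero]
  exact key Finset.univ x hx (by simp)

theorem multilinear_eq_of_span {n : ℕ} (F F' : MultilinearMap k (fun _ : Fin n => V) X)
    (s : Fin n → Set V) (h : ∀ x, (∀ i, x i ∈ s i) → F x = F' x) (x : Fin n → V)
    (hx : ∀ i, x i ∈ Submodule.span k (s i)) : F x = F' x := by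
  have := multilinear_eq_zero_of_span (F - F') s
    (fun x hx => by rw [sub_apply, h x hx, sub_self]) x hx
  exact sub_eq_zero.1 (by simpa using this)

theorem mem_span_isHom (G : SuperStructure k V) (x : V) :
    x ∈ Submodule.span k {y | ∃ p, G.IsHom p y} := by
  rw [← sum_proj G x]
  exact Submodule.sum_mem _ fun p _ => Submodule.subset_span ⟨p, isHom_proj G p x⟩

theorem multilinear_ext_isHom (G : SuperStructure k V) {n : ℕ}
    (F F' : MultilinearMap k (fun _ : Fin n => V) X)
    (h : ∀ (p : Fin n → ZMod 2) (x : Fin n → V), (∀ i, G.IsHom (p i) (x i)) → F x = F' x) :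
    F = F' := by
  ext x
  refine multilinear_eq_of_span F F' (fun _ => {y | ∃ p, G.IsHom p y}) (fun x hx => ?_) x
    fun i => mem_span_isHom G _
  choose p hp using hx
  exact h p x hp

theorem linear_ext_isHom (G : SuperStructure k V) {F F' : V →ₗ[k] X}
    (h : ∀ p x, G.IsHom p x → F x = F' x) : F = F' := by
  ext x
  rw [← sum_proj G x, map_sum, map_sum]
  exact Finset.sum_congr rfl fun p _ => h p _ (isHom_proj G p x)

end Hom

/-! ## Total parity in `A ⊗ X` -/

section Tensor

variable {k : Type u} [Field k] (R : ArtinCdga k)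
variable {X : Type*} [AddCommGroup X] [Module k X]
variable {Y : Type*} [AddCommGroup Y] [Module k Y]
variable {Z : Type*} [AddCommGroup Z] [Module k Z]

/-- The grading on `A ⊗ X`. -/
def tot (G : SuperStructure k X) : SuperStructure k (R.carrier ⊗[k] X) where
  par := TensorProduct.map R.par.toLinearMap G.par
  par_par x := by
    have : TensorProduct.map R.par.toLinearMap G.par ∘ₗ TensorProduct.map R.par.toLinearMap G.par
        = LinearMap.id := TensorProduct.ext' fun a x => by simp [R.par_par, G.par_par]
    exact LinearMap.congr_fun this x

/-- Pure tensors of homogeneous elements, of total parity `e`. -/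
def pureSet (G : SuperStructure k X) (e : ZMod 2) : Set (R.carrier ⊗[k] X) :=
  {z | ∃ (α p : ZMod 2) (a : R.carrier) (x : X), R.gr.IsHom α a ∧ G.IsHom p x ∧ α + p = e ∧
    z = a ⊗ₜ x}

/-- Pure tensors of homogeneous elements of total parity `e`, the first one in the augmentation
ideal. -/
def augPureSet (G : SuperStructure k X) (e : ZMod 2) : Set (R.carrier ⊗[k] X) :=
  {z | ∃ (α p : ZMod 2) (a : R.carrier) (x : X), R.gr.IsHom α a ∧ R.aug a = 0 ∧ G.IsHom p x ∧
    α + p = e ∧ z = a ⊗ₜ x}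

variable {R}

theorem isHom_tmul {G : SuperStructure k X} {α p : ZMod 2} {a : R.carrier} {x : X}
    (ha : R.gr.IsHom α a) (hx : G.IsHom p x) : (tot R G).IsHom (α + p) (a ⊗ₜ[k] x) := by
  have ha' : R.par a = sg k α • a := ha
  simp only [SuperStructure.IsHom] at *
  simp [tot, ha', hx, TensorProduct.smul_tmul', sg_add, mul_smul, TensorProduct.tmul_smul]
  rw [smul_comm]

theorem aug_proj (p : ZMod 2) (a : R.carrier) (h : R.aug a = 0) : R.aug (R.gr.proj p a) = 0 := by
  have : R.aug (R.gr.par a) = R.aug a := R.aug_par a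
  simp [SuperStructure.proj, this, h]

variable [CharZero k]

/-- Projecting both factors refines the grading by total parity; on an element of total parity `e`
only the pairs of parities `(α, e - α)` survive. -/
theorem exists_tot_parts (G : SuperStructure k X) {e : ZMod 2} {z : R.carrier ⊗[k] X}
    (hz : (tot R G).IsHom e z) :
    z = ∑ α : ZMod 2, TensorProduct.map (R.gr.proj α) (G.proj (e - α)) z := by
  have h1 : ∀ z : R.carrier ⊗[k] X, z = ∑ p : ZMod 2, ∑ α : ZMod 2,
      TensorProduct.map (R.gr.proj α) (G.proj (p - α)) z := by
    intro z
    induction z with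
    | zero => simp
    | add z z' hz hz' =>
      conv_lhs => rw [hz, hz']
      simp only [map_add, Finset.sum_add_distrib]
    | tmul a x =>
      rw [Finset.sum_comm]
      simp only [TensorProduct.map_tmul]
      have : ∀ α : ZMod 2, ∑ p : ZMod 2, G.proj (p - α) x = x := fun α => by
        rw [← sum_proj G x]
        exact Fintype.sum_equiv (Equiv.subRight α) _ _ fun p => by simp [sum_proj]
      simp only [← TensorProduct.tmul_sum, this, ← TensorProduct.sum_tmul, sum_proj]
  have h2 : ∀ p z, ∑ α : ZMod 2, TensorProduct.map (R.gr.proj α) (G.proj (p - α)) z =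
      (tot R G).proj p z := by
    intro p z
    induction z with
    | zero => simp
    | add z z' hz hz' => simp only [map_add, Finset.sum_add_distrib, hz, hz']
    | tmul a x =>
      conv_rhs => rw [h1 (a ⊗ₜ x)]
      simp only [map_sum, TensorProduct.map_tmul]
      symm
      rw [Finset.sum_eq_single p]
      · refine Finset.sum_congr rfl fun α _ => ?_
        have := isHom_tmul (isHom_proj R.gr α a) (isHom_proj G (p - α) x)
        rw [add_sub_cancel] at this
        rw [this.proj_self]
      · intro q _ hq
        refine Finset.sum_eq_zero fun α _ => ?_
        have := isHom_tmul (isHom_proj R.gr α a) (isHom_proj G (q - α) x)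
        rw [add_sub_cancel] at this
        rw [this.proj, if_neg hq.symm]
      · simp
  rw [h2, hz.proj_self]

theorem mem_span_pureSet {G : SuperStructure k X} {e : ZMod 2} {z : R.carrier ⊗[k] X}
    (hz : (tot R G).IsHom e z) : z ∈ Submodule.span k (pureSet R G e) := by
  rw [exists_tot_parts G hz]
  refine Submodule.sum_mem _ fun α _ => ?_
  clear hz
  induction z with
  | zero => simp
  | add z z' hz hz' => rw [map_add]; exact Submodule.add_mem _ hz hz'
  | tmul a x =>
    exact Submodule.subset_span ⟨α, e - α, _, _, isHom_proj R.gr α a, isHom_proj G _ x,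
      by ring, rfl⟩

/-- The map `a ↦ a - aug a` projects onto the augmentation ideal and its extension fixes `z`, so the
coefficients of `z` can be replaced by elements of that ideal. -/
theorem mem_span_augPureSet {G : SuperStructure k X} {e : ZMod 2} {z : R.carrier ⊗[k] X}
    (hz : (tot R G).IsHom e z) (h : R.aug.toLinearMap.rTensor X z = 0) :
    z ∈ Submodule.span k (augPureSet R G e) := by
  have h1 : (LinearMap.id - Algebra.linearMap k R.carrier ∘ₗ R.aug.toLinearMap).rTensor X z = z := by
    rw [LinearMap.rTensor_sub, LinearMap.rTensor_comp]
    simp [h]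
  rw [exists_tot_parts G hz]
  refine Submodule.sum_mem _ fun α _ => ?_
  rw [← h1]
  clear hz h1 h
  induction z with
  | zero => simp
  | add z z' hz hz' => rw [map_add, map_add]; exact Submodule.add_mem _ hz hz'
  | tmul a x =>
    refine Submodule.subset_span ⟨α, e - α, _, _, isHom_proj R.gr α _, ?_, isHom_proj G _ x,
      by ring, rfl⟩
    exact aug_proj _ _ (by simp)

theorem isHom_of_mem_span {G : SuperStructure k X} {e : ZMod 2} {z : R.carrier ⊗[k] X}
    (hz : z ∈ Submodule.span k (pureSet R G e)) : (tot R G).IsHom e z := by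
  induction hz using Submodule.span_induction with
  | mem z hz =>
    obtain ⟨α, p, a, x, ha, hx, rfl, rfl⟩ := hz
    exact isHom_tmul ha hx
  | zero => exact isHom_zero _ _
  | add x y _ _ hx hy => exact hx.add hy
  | smul c x _ hx => exact hx.smul c

/-- Linear maps on `A ⊗ X` agreeing on homogeneous pure tensors of parity `e` agree on elements
of parity `e`. -/
theorem linear_eq_of_isHom {G : SuperStructure k X} {e : ZMod 2} {F F' : R.carrier ⊗[k] X →ₗ[k] Y}
    (h : ∀ (α p : ZMod 2) (a : R.carrier) (x : X), R.gr.IsHom α a → G.IsHom p x → α + p = e →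
      F (a ⊗ₜ x) = F' (a ⊗ₜ x)) {z : R.carrier ⊗[k] X} (hz : (tot R G).IsHom e z) :
    F z = F' z := by
  replace hz := mem_span_pureSet hz
  induction hz using Submodule.span_induction with
  | mem z hz =>
    obtain ⟨α, p, a, x, ha, hx, h1, rfl⟩ := hz
    exact h α p a x ha hx h1
  | zero => simp
  | add x y _ _ h1 h2 => rw [map_add, map_add, h1, h2]
  | smul c x _ h1 => rw [map_smul, map_smul, h1]

theorem tensor_ext_isHom {G : SuperStructure k X} {F F' : R.carrier ⊗[k] X →ₗ[k] Y}
    (h : ∀ (α p : ZMod 2) (a : R.carrier) (x : X), R.gr.IsHom α a → G.IsHom p x →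
      F (a ⊗ₜ x) = F' (a ⊗ₜ x)) : F = F' := by
  refine linear_ext_isHom (tot R G) fun e z hz => ?_
  exact linear_eq_of_isHom (fun α p a x ha hx _ => h α p a x ha hx) hz

/-! ## Extension of scalars on homogeneous tensors -/

/-- On homogeneous pure tensors one term of the double sum over parities survives. The sign is
written as `sg` of a single exponent, so that all later comparisons of signs are identities in `ZMod
2`. -/
theorem extendScalars_tmul (G : SuperStructure k X) (q : ZMod 2) {n : ℕ}
    (f : MultilinearMap k (fun _ : Fin n => X) Y) {α p : Fin n → ZMod 2} {a : Fin n → R.carrier}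
    {x : Fin n → X} (ha : ∀ i, R.gr.IsHom (α i) (a i)) (hx : ∀ i, G.IsHom (p i) (x i)) :
    extendScalars R G q f (fun i => a i ⊗ₜ x i) =
      sg k (∑ i, q * α i + ∑ i, ∑ j, if i < j then p i * α j else 0) •
        ((List.ofFn a).prod ⊗ₜ[k] f x) := by
  have h1 : ∀ (β r : Fin n → ZMod 2), tensorMulti n
        ((MultilinearMap.mkPiAlgebraFin k n R.carrier).compLinearMap fun i => R.gr.proj (β i))
        (f.compLinearMap fun i => G.proj (r i)) (fun i => a i ⊗ₜ x i) =
      if β = α ∧ r = p then (List.ofFn a).prod ⊗ₜ[k] f x else 0 := by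
    intro β r
    rw [tensorMulti_tmul]
    split_ifs with h
    · obtain ⟨rfl, rfl⟩ := h
      simp [(ha _).proj_self, (hx _).proj_self]
    · by_cases h2 : β = α
      · have h3 : r ≠ p := fun h3 => h ⟨h2, h3⟩
        obtain ⟨j, hj⟩ : ∃ j, r j ≠ p j := by
          by_contra h
          push Not at h
          exact h3 (funext h)
        rw [MultilinearMap.compLinearMap_apply f, f.map_coord_zero j, TensorProduct.tmul_zero]
        simp [(hx j).proj, hj]
      · obtain ⟨j, hj⟩ : ∃ j, β j ≠ α j := by
          by_contra h
          push Not at h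
          exact h2 (funext h)
        rw [MultilinearMap.compLinearMap_apply, MultilinearMap.map_coord_zero _ j,
          TensorProduct.zero_tmul]
        simp [(ha j).proj, hj]
  simp only [extendScalars, sum_apply, smul_apply, h1, ite_and, smul_ite,
    smul_zero]
  rw [Finset.sum_eq_single α]
  · simp [sg_add, sg_sum, sg_ite]
  · intro β _ h; simp [h]
  · simp

theorem extBilin_tmul (G : SuperStructure k X) (b : X →ₗ[k] Y →ₗ[k] Z) {p α : ZMod 2}
    {a a' : R.carrier} {x : X} (hx : G.IsHom p x) (ha' : R.gr.IsHom α a') (y : Y) :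
    extBilin R G b (a ⊗ₜ x) (a' ⊗ₜ y) = sg k (p * α) • ((a * a') ⊗ₜ[k] b x y) := by
  have h1 : ∀ q β : ZMod 2, TensorProduct.map₂ ((LinearMap.mul k R.carrier).compl₂ (R.gr.proj β))
      (b ∘ₗ G.proj q) (a ⊗ₜ x) (a' ⊗ₜ y) =
      if q = p ∧ β = α then (a * a') ⊗ₜ[k] b x y else 0 := by
    intro q β
    rw [TensorProduct.map₂_apply_tmul, TensorProduct.map_tmul, LinearMap.compl₂_apply,
      LinearMap.comp_apply, hx.proj,
      ha'.proj]
    by_cases hq : q = p <;> by_cases hb : β = α <;> simp [hq, hb]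
  simp only [extBilin, LinearMap.coe_sum, Finset.sum_apply, LinearMap.smul_apply, h1, ite_and]
  rw [Finset.sum_eq_single p, Finset.sum_eq_single α]
  · simp
  · intro β _ h; simp [h]
  · simp
  · intro β _ h; simp [h]
  · simp

end Tensor

/-! ## Permuting the arguments -/

section Perm

variable {k : Type u} [Field k]

theorem two_zmod_two : (2 : ZMod 2) = 0 := rfl

/-- The additive form of `prod_pairs`: exponents given by double sums can be compared on each
unordered pair of indices separately. -/
theorem sum_pairs {n : ℕ} (h : Fin n → Fin n → ZMod 2) (hd : ∀ i, h i i = 0) :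
    ∑ i, ∑ j, h i j = ∑ i, ∑ j, if i < j then h i j + h j i else 0 := by
  have e : ∀ i j, h i j = (if i < j then h i j else 0) + (if j < i then h i j else 0) := by
    intro i j
    rcases lt_trichotomy i j with hij | hij | hij
    · simp [hij, hij.not_gt]
    · subst hij; simp [hd]
    · simp [hij, hij.not_gt]
  have e2 : ∀ i j, (if i < j then h i j + h j i else 0)
      = (if i < j then h i j else 0) + (if i < j then h j i else 0) := by
    intro i j; split_ifs <;> simp
  simp_rw [e2, Finset.sum_add_distrib]
  conv_lhs => enter [2, i, 2, j]; rw [e i j]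
  simp_rw [Finset.sum_add_distrib]
  congr 1
  exact Finset.sum_comm

theorem koszul_swap {n : ℕ} (i : Fin n) (p : Fin (n + 1) → ZMod 2) :
    koszul k (Equiv.swap i.castSucc i.succ).symm p = sg k (p i.castSucc * p i.succ) := by
  have h : ∀ x y : Fin (n + 1), (x < y ∧ (Equiv.swap i.castSucc i.succ).symm y <
      (Equiv.swap i.castSucc i.succ).symm x) ↔ x = i.castSucc ∧ y = i.succ := by
    intro x y
    simp only [Equiv.symm_swap, Equiv.swap_apply_def, Fin.ext_iff, Fin.lt_def]
    split_ifs <;> simp_all <;> omega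
  rw [koszul_eq]
  simp only [h, ite_and]
  congr 1
  rw [Finset.sum_eq_single i.castSucc (fun b _ hb => by simp [hb]) (by simp)]
  simp

theorem prod_swap (R : ArtinCdga k) {n : ℕ} (i : Fin n) {α : Fin (n + 1) → ZMod 2}
    {a : Fin (n + 1) → R.carrier} (ha : ∀ i, R.gr.IsHom (α i) (a i)) :
    (List.ofFn (a ∘ Equiv.swap i.castSucc i.succ)).prod =
      sg k (α i.castSucc * α i.succ) • (List.ofFn a).prod := by
  induction n with
  | zero => exact i.elim0
  | succ n ih =>
    induction i using Fin.cases with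
    | zero =>
      have h2 : ∀ j : Fin n, Equiv.swap (0 : Fin (n + 2)) 1 j.succ.succ = j.succ.succ := fun j =>
        Equiv.swap_apply_of_ne_of_ne (Fin.succ_ne_zero _) (by simp [Fin.ext_iff])
      have h3 := R.comm (α 1) (α 0) (a 1) (a 0) (ha 1) (ha 0)
      simp only [List.ofFn_succ, List.prod_cons, Function.comp, Fin.castSucc_zero, Fin.succ_zero_eq_one,
        Equiv.swap_apply_left, Equiv.swap_apply_right, h2]
      rw [← mul_assoc, h3, smul_mul_assoc, mul_assoc, mul_comm (α 1)]
    | succ i =>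
      have h0 : Equiv.swap i.succ.castSucc i.succ.succ 0 = 0 :=
        Equiv.swap_apply_of_ne_of_ne (by simp [Fin.ext_iff]) (Fin.succ_ne_zero _).symm
      have hs : ∀ j : Fin (n + 1), Equiv.swap i.succ.castSucc i.succ.succ j.succ =
          (Equiv.swap i.castSucc i.succ j).succ := by
        intro j
        simp only [Equiv.swap_apply_def, Fin.ext_iff, Fin.val_succ, Fin.val_castSucc]
        split_ifs <;> simp_all
      rw [List.ofFn_succ, List.ofFn_succ (f := a), List.prod_cons, List.prod_cons]
      have := ih i (α := Fin.tail α) (a := Fin.tail a) fun j => ha j.succ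
      simp only [Function.comp, h0, hs] at this ⊢
      rw [show (fun j => a (Equiv.swap i.castSucc i.succ j).succ) =
        Fin.tail a ∘ Equiv.swap i.castSucc i.succ from rfl, this, mul_smul_comm]
      rfl

/-- Both sides are multiplicative in `σ` by `koszul_mul`, and adjacent transpositions generate the
symmetric group, so supercommutativity of neighbours suffices. -/
theorem prod_perm (R : ArtinCdga k) {n : ℕ} (σ : Equiv.Perm (Fin n)) {α : Fin n → ZMod 2}
    {a : Fin n → R.carrier} (ha : ∀ i, R.gr.IsHom (α i) (a i)) :
    (List.ofFn (a ∘ σ)).prod = koszul k σ.symm α • (List.ofFn a).prod := by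
  cases n with
  | zero =>
    rw [Subsingleton.elim (a ∘ σ) a]
    simp [koszul]
  | succ n =>
    have h : σ ∈ Submonoid.closure (Set.range fun i : Fin n => Equiv.swap i.castSucc i.succ) := by
      rw [Equiv.Perm.mclosure_swap_castSucc_succ]; trivial
    induction h using Submonoid.closure_induction generalizing α a with
    | mem σ h =>
      obtain ⟨i, rfl⟩ := h
      rw [prod_swap R i ha, koszul_swap]
    | one =>
      have h : koszul k (1 : Equiv.Perm (Fin (n + 1))).symm α = 1 := by
        refine Finset.prod_eq_one fun i _ => Finset.prod_eq_one fun j _ => if_neg ?_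
        rintro ⟨h1, h2⟩
        exact absurd h1 h2.not_gt
      simp [h]
    | mul s t _ _ hs ht =>
      rw [koszul_mul, mul_smul, smul_comm, ← hs ha, ← ht (a := a ∘ s) (α := α ∘ s) fun i => ha _]
      rfl

variable [CharZero k] {R : ArtinCdga k}
variable {X : Type*} [AddCommGroup X] [Module k X]
variable {Y : Type*} [AddCommGroup Y] [Module k Y]

/-- Rearranging pure tensors produces a sign from the coefficients, one from the vectors and one
from the changed order in which coefficients pass vectors. Together they are the Koszul sign of the
total parities. -/
theorem extendScalars_act (G : SuperStructure k X) (q : ZMod 2) {n : ℕ} (σ : Equiv.Perm (Fin n))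
    (f : MultilinearMap k (fun _ : Fin n => X) Y) {e : Fin n → ZMod 2}
    {ζ : Fin n → R.carrier ⊗[k] X} (hζ : ∀ i, (tot R G).IsHom (e i) (ζ i)) :
    extendScalars R G q (act G σ f) ζ = koszul k σ.symm e • extendScalars R G q f (ζ ∘ σ) := by
  refine multilinear_eq_of_span (extendScalars R G q (act G σ f))
    (koszul k σ.symm e • (extendScalars R G q f).domDomCongr σ)
    (fun i => pureSet R G (e i)) ?_ ζ fun i => mem_span_pureSet (hζ i)
  intro z hz
  choose α p a x ha hx he hz using hz
  obtain rfl : z = fun i => a i ⊗ₜ x i := funext hz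
  obtain rfl : (fun i => α i + p i) = e := funext he
  rw [extendScalars_tmul G q _ ha hx, act_isHom G σ f hx, smul_apply, MultilinearMap.domDomCongr_apply,
    extendScalars_tmul G q f (a := fun i => a (σ i)) (x := fun i => x (σ i)) (fun i => ha (σ i)) (fun i => hx (σ i)),
    show (fun i => a (σ i)) = a ∘ σ from rfl, prod_perm R σ ha]
  rw [TensorProduct.tmul_smul, ← TensorProduct.smul_tmul', koszul_eq, koszul_eq, koszul_eq, smul_smul, smul_smul,
    smul_smul, ← sg_add, ← sg_add, ← sg_add]
  congr 2
  have h1 : ∑ i, q * α (σ i) = ∑ i, q * α i := Equiv.sum_comp σ fun i => q * α i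
  have h2 : (∑ i, ∑ j, if i < j then p (σ i) * α (σ j) else 0) =
      ∑ i, ∑ j, if i < j then (if σ.symm i < σ.symm j then p i * α j else p j * α i) else 0 := by
    have : ∀ i, (∑ j, if i < j then p (σ i) * α (σ j) else 0) =
        ∑ j, if i < σ.symm j then p (σ i) * α j else 0 := fun i => by
      rw [← Equiv.sum_comp σ fun j => if i < σ.symm j then p (σ i) * α j else 0]
      simp
    simp only [this]
    rw [← Equiv.sum_comp σ.symm]
    simp only [Equiv.apply_symm_apply]
    rw [sum_pairs _ (by simp)]
    refine Finset.sum_congr rfl fun i _ => Finset.sum_congr rfl fun j _ => ?_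
    by_cases hij : i < j
    · have hne : σ.symm i ≠ σ.symm j := fun h => hij.ne (σ.symm.injective h)
      rcases lt_or_gt_of_ne hne with h | h <;> simp [hij, h, h.not_gt]
    · simp [hij]
  -- The exponents agree on every pair `i < j`: an inversion of `σ` contributes `(α i + p i) * (α j
  -- + p j)`, and the cross terms account for the changed order.
  have h3 : (∑ i, ∑ j, if i < j then p i * α j else 0) +
        (∑ i, ∑ j, if i < j ∧ σ.symm j < σ.symm i then p i * p j else 0) =
      (∑ i, ∑ j, if i < j ∧ σ.symm j < σ.symm i then (α i + p i) * (α j + p j) else 0) +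
        (∑ i, ∑ j, if i < j then (if σ.symm i < σ.symm j then p i * α j else p j * α i) else 0) +
        ∑ i, ∑ j, if i < j ∧ σ.symm j < σ.symm i then α i * α j else 0 := by
    simp only [← Finset.sum_add_distrib]
    refine Finset.sum_congr rfl fun i _ => Finset.sum_congr rfl fun j _ => ?_
    by_cases hij : i < j
    · have hne : σ.symm i ≠ σ.symm j := fun h => hij.ne (σ.symm.injective h)
      rcases lt_or_gt_of_ne hne with h | h
      · simp [hij, h, h.not_gt]
      · simp only [hij, h, h.not_gt, and_self, if_true, if_false]
        linear_combination (-(α i * α j) - p j * α i) * two_zmod_two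
    · simp [hij]
  rw [h1, h2]
  linear_combination h3

theorem koszul_eq_one {n : ℕ} {α : Type*} [LinearOrder α] (c : Fin n → α) {e : Fin n → ZMod 2}
    (he : ∀ i j, i ≠ j → e i * e j = 0) : koszul k c e = 1 := by
  refine Finset.prod_eq_one fun i _ => Finset.prod_eq_one fun j _ => ?_
  split_ifs with h
  · rw [he i j h.1.ne, sg_zero]
  · rfl

/-- The condition `he` says that no two arguments are odd, so no sign is left. It covers the two
cases that occur: all arguments even, or one argument of arbitrary parity among even ones. -/
theorem extendScalars_perm (G : SuperStructure k X) (q : ZMod 2) {n : ℕ} (σ : Equiv.Perm (Fin n))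
    (f : MultilinearMap k (fun _ : Fin n => X) Y) {e : Fin n → ZMod 2}
    {ζ : Fin n → R.carrier ⊗[k] X} (hζ : ∀ i, (tot R G).IsHom (e i) (ζ i))
    (he : ∀ i j, i ≠ j → e i * e j = 0) :
    extendScalars R G q (act G σ f) ζ = extendScalars R G q f (ζ ∘ σ) := by
  rw [extendScalars_act G q σ f hζ, koszul_eq_one _ he, one_smul]

end Perm

/-! ## Naturality, derivations and nilpotence -/

section Natural

variable {k : Type u} [Field k] [CharZero k] {R R' : ArtinCdga k}
variable {X : Type*} [AddCommGroup X] [Module k X]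
variable {Y : Type*} [AddCommGroup Y] [Module k Y]

theorem multilinear_tensor_ext (G : SuperStructure k X) {n : ℕ}
    {F F' : MultilinearMap k (fun _ : Fin n => R.carrier ⊗[k] X) Y}
    (h : ∀ (α p : Fin n → ZMod 2) (a : Fin n → R.carrier) (x : Fin n → X),
      (∀ i, R.gr.IsHom (α i) (a i)) → (∀ i, G.IsHom (p i) (x i)) →
      F (fun i => a i ⊗ₜ x i) = F' (fun i => a i ⊗ₜ x i)) : F = F' := by
  refine multilinear_ext_isHom (tot R G) F F' fun e z hz => ?_
  refine multilinear_eq_of_span F F' (fun i => pureSet R G (e i)) ?_ z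
    fun i => mem_span_pureSet (hz i)
  intro z hz
  choose α p a x ha hx he hz using hz
  obtain rfl : z = fun i => a i ⊗ₜ x i := funext hz
  exact h α p a x ha hx

theorem extendScalars_map (φ : R.carrier →ₐ[k] R'.carrier) (hφ : ∀ a, φ (R.par a) = R'.par (φ a))
    (G : SuperStructure k X) (q : ZMod 2) {n : ℕ}
    (f : MultilinearMap k (fun _ : Fin n => X) Y) (ζ : Fin n → R.carrier ⊗[k] X) :
    φ.toLinearMap.rTensor Y (extendScalars R G q f ζ) =
      extendScalars R' G q f (fun i => φ.toLinearMap.rTensor X (ζ i)) := by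
  have : (φ.toLinearMap.rTensor Y).compMultilinearMap (extendScalars R G q f) =
      (extendScalars R' G q f).compLinearMap fun _ => φ.toLinearMap.rTensor X := by
    refine multilinear_tensor_ext G fun α p a x ha hx => ?_
    have ha' : ∀ i, R'.gr.IsHom (α i) (φ (a i)) := fun i => by
      have h1 : R.par (a i) = sg k (α i) • a i := ha i
      change R'.par _ = _
      rw [← hφ, h1, map_smul]
    rw [LinearMap.compMultilinearMap_apply, MultilinearMap.compLinearMap_apply,
      extendScalars_tmul G q f ha hx]
    simp only [LinearMap.rTensor_tmul, map_smul, AlgHom.toLinearMap_apply]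
    rw [extendScalars_tmul G q f ha' hx, map_list_prod, List.map_ofFn]
    rfl
  exact congrArg (fun F => F ζ) this

/-- Composition with a linear map in the target. -/
theorem extendScalars_comp {Z : Type*} [AddCommGroup Z] [Module k Z] (G : SuperStructure k X)
    (q : ZMod 2) {n : ℕ} (g : Y →ₗ[k] Z)
    (f : MultilinearMap k (fun _ : Fin n => X) Y) (ζ : Fin n → R.carrier ⊗[k] X) :
    extendScalars R G q (g.compMultilinearMap f) ζ =
      g.lTensor R.carrier (extendScalars R G q f ζ) := by
  have : extendScalars R G q (g.compMultilinearMap f) =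
      (g.lTensor R.carrier).compMultilinearMap (extendScalars R G q f) := by
    refine multilinear_tensor_ext G fun α p a x ha hx => ?_
    rw [LinearMap.compMultilinearMap_apply, extendScalars_tmul G q f ha hx,
      extendScalars_tmul G q _ ha hx]
    simp
  exact congrArg (fun F => F ζ) this

theorem extendScalars_isHom (G : SuperStructure k X) (H : SuperStructure k Y) (q : ZMod 2) {n : ℕ}
    {f : MultilinearMap k (fun _ : Fin n => X) Y}
    (hf : ∀ x, H.par (f x) = sg k q • f (fun i => G.par (x i))) {e : Fin n → ZMod 2}
    {ζ : Fin n → R.carrier ⊗[k] X} (hζ : ∀ i, (tot R G).IsHom (e i) (ζ i)) :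
    (tot R H).IsHom (q + ∑ i, e i) (extendScalars R G q f ζ) := by
  have : (tot R H).par.compMultilinearMap (extendScalars R G q f) =
      sg k q • (extendScalars R G q f).compLinearMap fun _ => (tot R G).par := by
    refine multilinear_tensor_ext G fun α p a x ha hx => ?_
    have h1 : ∀ i, (tot R G).par (a i ⊗ₜ x i) = sg k (α i + p i) • (a i ⊗ₜ x i) :=
      fun i => isHom_tmul (ha i) (hx i)
    have h2 : ∀ i, G.par (x i) = sg k (p i) • x i := hx
    simp only [LinearMap.compMultilinearMap_apply, smul_apply, MultilinearMap.compLinearMap_apply,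
      h1]
    rw [MultilinearMap.map_smul_univ, extendScalars_tmul G q f ha hx, map_smul,
      smul_comm (∏ i, sg k (α i + p i)), smul_comm (sg k q)]
    congr 1
    have h3 : R.par (List.ofFn a).prod = (∏ i, sg k (α i)) • (List.ofFn a).prod := by
      rw [map_list_prod, List.map_ofFn]
      have : R.par ∘ a = fun i => sg k (α i) • a i := funext ha
      rw [this]
      exact MultilinearMap.map_smul_univ (MultilinearMap.mkPiAlgebraFin k n R.carrier) _ _
    simp only [tot, TensorProduct.map_tmul, AlgHom.toLinearMap_apply, h3, hf, h2]
    rw [MultilinearMap.map_smul_univ]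
    simp only [sg_add, Finset.prod_mul_distrib, TensorProduct.tmul_smul, TensorProduct.smul_tmul', smul_smul]
    ring_nf
  have h := congrArg (fun F => F ζ) this
  have h1 : ∀ i, (tot R G).par (ζ i) = sg k (e i) • ζ i := hζ
  simp only [LinearMap.compMultilinearMap_apply, smul_apply, MultilinearMap.compLinearMap_apply,
    h1] at h
  rw [MultilinearMap.map_smul_univ, smul_smul, ← sg_sum, ← sg_add] at h
  exact h

theorem ArtinCdga.d_one (R : ArtinCdga k) : R.d 1 = 0 := by
  have h := R.d_mul 1 1
  simpa using h

theorem ArtinCdga.d_isHom {α : ZMod 2} {a : R.carrier} (ha : R.gr.IsHom α a) :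
    R.gr.IsHom (α + 1) (R.d a) := by
  have h : R.par a = sg k α • a := ha
  have h2 := R.d_par a
  rw [h, map_smul] at h2
  change R.par (R.d a) = _
  rw [sg_add, sg_one, mul_neg, mul_one, neg_smul, h2, neg_neg]

theorem d_list_prod {n : ℕ} {α : Fin n → ZMod 2} {a : Fin n → R.carrier}
    (ha : ∀ i, R.gr.IsHom (α i) (a i)) :
    R.d (List.ofFn a).prod = ∑ j, sg k (∑ i, if i < j then α i else 0) •
      (List.ofFn (Function.update a j (R.d (a j)))).prod := by
  induction n with
  | zero => simp [ArtinCdga.d_one]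
  | succ n ih =>
    rw [List.ofFn_succ, List.prod_cons, R.d_mul, ih fun i => ha i.succ, Fin.sum_univ_succ]
    congr 1
    · simp [List.ofFn_succ, sg_zero]
    · have h : R.par (a 0) = sg k (α 0) • a 0 := ha 0
      rw [Finset.mul_sum]
      refine Finset.sum_congr rfl fun j _ => ?_
      rw [Fin.sum_univ_succ, h]
      simp only [Fin.succ_pos, if_true, Fin.succ_lt_succ_iff, sg_add, List.ofFn_succ, List.prod_cons, mul_smul_comm,
        smul_mul_assoc, mul_smul]
      rw [smul_comm, Function.update_of_ne (Fin.succ_ne_zero j).symm]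
      have : (fun i : Fin n => Function.update a j.succ (R.d (a j.succ)) i.succ) =
          Function.update (fun i : Fin n => a i.succ) j (R.d (a j.succ)) := by
        funext i
        by_cases hij : i = j
        · subst hij; simp
        · simp [hij]
      rw [this]

/-- Leibniz rule in the coefficients. For even arguments the sign of moving `d` past the earlier
coefficients is the sign by which the raised parity of the `j`-th coefficient passes the earlier
vectors, so only the sign of moving `d` past `f` remains. -/
theorem d_extendScalars (G : SuperStructure k X) (q : ZMod 2) {n : ℕ}
    (f : MultilinearMap k (fun _ : Fin n => X) Y) {ζ : Fin n → R.carrier ⊗[k] X}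
    (hζ : ∀ i, (tot R G).IsHom 0 (ζ i)) :
    R.d.rTensor Y (extendScalars R G q f ζ) =
      sg k q • ∑ j, extendScalars R G q f (Function.update ζ j (R.d.rTensor X (ζ j))) := by
  have hu : ∀ (z : Fin n → R.carrier ⊗[k] X) j, Function.update z j (R.d.rTensor X (z j)) =
      fun i => (if i = j then R.d.rTensor X else LinearMap.id) (z i) := by
    intro z j
    funext i
    by_cases hij : i = j
    · subst hij; simp
    · simp [hij]
  have := multilinear_eq_of_span ((R.d.rTensor Y).compMultilinearMap (extendScalars R G q f))
    (sg k q • ∑ j, (extendScalars R G q f).compLinearMap fun i =>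
      if i = j then R.d.rTensor X else LinearMap.id) (fun i => pureSet R G 0) ?_ ζ
      fun i => mem_span_pureSet (hζ i)
  · simpa only [LinearMap.compMultilinearMap_apply, smul_apply, sum_apply,
      MultilinearMap.compLinearMap_apply, ← hu] using this
  · intro z hz
    choose α p a x ha hx he hz using hz
    obtain rfl : z = fun i => a i ⊗ₜ x i := funext hz
    -- Total parity zero forces each vector to have the parity of its coefficient.
    obtain rfl : α = p := funext fun i => by
      have := he i
      rw [← sub_eq_zero, sub_eq_add_neg, ZMod.neg_eq_self_mod_two, this]
    simp only [LinearMap.compMultilinearMap_apply, smul_apply, sum_apply,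
      MultilinearMap.compLinearMap_apply, ← hu]
    rw [extendScalars_tmul G q f ha hx, map_smul, LinearMap.rTensor_tmul, d_list_prod ha,
      TensorProduct.sum_tmul, Finset.smul_sum, Finset.smul_sum]
    refine Finset.sum_congr rfl fun j _ => ?_
    have h1 : Function.update (fun i => a i ⊗ₜ[k] x i) j (R.d.rTensor X (a j ⊗ₜ x j)) =
        fun i => Function.update a j (R.d (a j)) i ⊗ₜ x i := by
      funext i
      by_cases hij : i = j
      · subst hij; simp
      · simp [hij]
    have h2 : ∀ i, R.gr.IsHom (α i + if i = j then 1 else 0) (Function.update a j (R.d (a j)) i) := by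
      intro i
      by_cases hij : i = j
      · subst hij; simpa using ArtinCdga.d_isHom (ha i)
      · simpa [hij] using ha i
    rw [h1, extendScalars_tmul G q f h2 hx, ← TensorProduct.smul_tmul', smul_smul, smul_smul, ← sg_add,
      ← sg_add]
    congr 2
    have h3 : (∑ i, ∑ l, if i < l then α i * (α l + if l = j then 1 else 0) else 0) =
        (∑ i, ∑ l, if i < l then α i * α l else 0) + ∑ i, if i < j then α i else 0 := by
      rw [← Finset.sum_add_distrib]
      refine Finset.sum_congr rfl fun i _ => ?_
      have h5 : (if i < j then α i else 0) = ∑ l, if l = j then (if i < l then α i else 0) else 0 := by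
        simp
      rw [h5, ← Finset.sum_add_distrib]
      refine Finset.sum_congr rfl fun l _ => ?_
      split_ifs <;> simp [mul_add, *]
    have h4 : ∑ i, q * (α i + if i = j then 1 else 0) = ∑ i, q * α i + q := by
      simp only [mul_add, Finset.sum_add_distrib]
      simp
    rw [h3, h4]
    linear_combination (-q) * two_zmod_two

theorem ArtinCdga.exists_nilp (R : ArtinCdga k) : ∃ N : ℕ, ∀ n ≥ N, ∀ a : Fin n → R.carrier,
    (∀ i, R.aug (a i) = 0) → (List.ofFn a).prod = 0 := by
  obtain ⟨N, hN⟩ := R.nilpotent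
  refine ⟨N, fun n hn a ha => ?_⟩
  obtain ⟨m, rfl⟩ := Nat.exists_eq_add_of_le hn
  rw [List.ofFn_add, List.prod_append]
  erw [hN _ fun i => ha _, zero_mul]

theorem extendScalars_eq_zero (G : SuperStructure k X) (q : ZMod 2) {N : ℕ}
    (hN : ∀ n ≥ N, ∀ a : Fin n → R.carrier, (∀ i, R.aug (a i) = 0) → (List.ofFn a).prod = 0)
    {n : ℕ} (hn : N ≤ n) (f : MultilinearMap k (fun _ : Fin n => X) Y)
    {ζ : Fin n → R.carrier ⊗[k] X} {e : Fin n → ZMod 2} (hζ : ∀ i, (tot R G).IsHom (e i) (ζ i))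
    (h : ∀ i, R.aug.toLinearMap.rTensor X (ζ i) = 0) : extendScalars R G q f ζ = 0 := by
  refine multilinear_eq_zero_of_span _ (fun i => augPureSet R G (e i)) ?_ ζ
    fun i => mem_span_augPureSet (hζ i) (h i)
  intro z hz
  choose α p a x ha h0 hx he hz using hz
  obtain rfl : z = fun i => a i ⊗ₜ x i := funext hz
  rw [extendScalars_tmul G q f ha hx, hN n hn a h0, TensorProduct.zero_tmul, smul_zero]

theorem aug_extendScalars (G : SuperStructure k X) (q : ZMod 2) {n : ℕ}
    (f : MultilinearMap k (fun _ : Fin n => X) Y)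
    {ζ : Fin n → R.carrier ⊗[k] X} {e : Fin n → ZMod 2} (hζ : ∀ i, (tot R G).IsHom (e i) (ζ i))
    (i : Fin n) (h : R.aug.toLinearMap.rTensor X (ζ i) = 0) :
    R.aug.toLinearMap.rTensor Y (extendScalars R G q f ζ) = 0 := by
  refine multilinear_eq_zero_of_span
    ((R.aug.toLinearMap.rTensor Y).compMultilinearMap (extendScalars R G q f))
    (fun j => {z | ∃ (α p : ZMod 2) (a : R.carrier) (x : X), R.gr.IsHom α a ∧
      (j = i → R.aug a = 0) ∧ G.IsHom p x ∧ α + p = e j ∧ z = a ⊗ₜ x}) ?_ ζ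
    fun j => ?_
  · intro z hz
    choose α p a x ha h0 hx he hz using hz
    obtain rfl : z = fun i => a i ⊗ₜ x i := funext hz
    have h1 : R.aug (List.ofFn a).prod = 0 := by
      rw [map_list_prod]
      exact List.prod_eq_zero (List.mem_map.2 ⟨a i, by simp, h0 i rfl⟩)
    rw [LinearMap.compMultilinearMap_apply, extendScalars_tmul G q f ha hx]
    simp [h1]
  · by_cases hj : j = i
    · subst hj
      refine Submodule.span_mono ?_ (mem_span_augPureSet (hζ j) h)
      rintro z ⟨α, p, a, x, h1, h2, h3, h4, h5⟩
      exact ⟨α, p, a, x, h1, fun _ => h2, h3, h4, h5⟩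
    · refine Submodule.span_mono ?_ (mem_span_pureSet (hζ j))
      rintro z ⟨α, p, a, x, h1, h3, h4, h5⟩
      exact ⟨α, p, a, x, h1, fun h => absurd h hj, h3, h4, h5⟩

end Natural

/-! ## Grassmann algebras

The free supercommutative algebra on generators `t_i` of parity `p_i` modulo `t_i^2 = 0`, with
basis `t_S` indexed by sets of generators. -/

/-- The exponent of the sign relating `t_S t_T` and `t_{S ∪ T}`. -/
def crossing {n : ℕ} (p : Fin n → ZMod 2) (S T : Finset (Fin n)) : ZMod 2 :=
  ∑ i ∈ S, ∑ j ∈ T, if j < i then p i * p j else 0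

theorem crossing_union_left {n : ℕ} (p : Fin n → ZMod 2) {S T : Finset (Fin n)}
    (h : Disjoint S T) (U : Finset (Fin n)) :
    crossing p (S ∪ T) U = crossing p S U + crossing p T U := Finset.sum_union h

theorem crossing_union_right {n : ℕ} (p : Fin n → ZMod 2) (U : Finset (Fin n))
    {S T : Finset (Fin n)} (h : Disjoint S T) :
    crossing p U (S ∪ T) = crossing p U S + crossing p U T := by
  simp only [crossing, ← Finset.sum_add_distrib]
  exact Finset.sum_congr rfl fun i _ => Finset.sum_union h

/-- For `i ∈ S` and `j ∈ T` exactly one of `j < i` and `i < j` holds. In terms of exponents this is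
the supercommutativity of `t_S` and `t_T`. -/
theorem crossing_add_crossing {n : ℕ} (p : Fin n → ZMod 2) {S T : Finset (Fin n)}
    (h : Disjoint S T) :
    crossing p S T + crossing p T S = (∑ i ∈ S, p i) * ∑ j ∈ T, p j := by
  rw [crossing, crossing, Finset.sum_comm (s := T), ← Finset.sum_add_distrib, Finset.sum_mul_sum]
  refine Finset.sum_congr rfl fun i hi => ?_
  rw [← Finset.sum_add_distrib]
  refine Finset.sum_congr rfl fun j hj => ?_
  have hne : i ≠ j := fun h' => Finset.disjoint_left.1 h hi (h' ▸ hj)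
  rcases lt_or_gt_of_ne hne with h1 | h1 <;> simp [h1, h1.not_gt, mul_comm]

/-- The underlying space of the Grassmann algebra. -/
@[nolint unusedArguments]
def Grass (k : Type u) [Field k] {n : ℕ} (_ : Fin n → ZMod 2) : Type u := Finset (Fin n) → k

namespace Grass

variable {k : Type u} [Field k] {n : ℕ} {p : Fin n → ZMod 2}

instance : AddCommGroup (Grass k p) := inferInstanceAs (AddCommGroup (Finset (Fin n) → k))
instance : Module k (Grass k p) := inferInstanceAs (Module k (Finset (Fin n) → k))
instance : Module.Finite k (Grass k p) :=
  inferInstanceAs (Module.Finite k (Finset (Fin n) → k))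

variable (k p) in
/-- The basis `t_S`. -/
def basis : Module.Basis (Finset (Fin n)) k (Grass k p) := Pi.basisFun k (Finset (Fin n))

variable (k p) in
/-- The product of basis elements. -/
def basisMul (S T : Finset (Fin n)) : Grass k p :=
  if Disjoint S T then sg k (crossing p S T) • basis k p (S ∪ T) else 0

variable (k p) in
/-- The product. -/
def mulL : Grass k p →ₗ[k] Grass k p →ₗ[k] Grass k p :=
  (basis k p).constr k fun S => (basis k p).constr k fun T => basisMul k p S T

theorem mulL_basis (S T : Finset (Fin n)) :
    mulL k p (basis k p S) (basis k p T) = basisMul k p S T := by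
  simp [mulL]

theorem mulL_assoc (f g h : Grass k p) :
    mulL k p (mulL k p f g) h = mulL k p f (mulL k p g h) := by
  have h3 : ∀ S T U, mulL k p (mulL k p (basis k p S) (basis k p T)) (basis k p U) =
      mulL k p (basis k p S) (mulL k p (basis k p T) (basis k p U)) := by
    intro S T U
    simp only [mulL_basis, basisMul]
    by_cases hST : Disjoint S T <;> by_cases hTU : Disjoint T U <;> by_cases hSU : Disjoint S U <;>
      simp [hST, hTU, hSU, mulL_basis, basisMul, Finset.disjoint_union_left, Finset.disjoint_union_right]
    rw [smul_smul, smul_smul, ← sg_add, ← sg_add, crossing_union_left p hST,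
      crossing_union_right p S hTU]
    congr 2
    ring
  have h2 : ∀ S T, ∀ h, mulL k p (mulL k p (basis k p S) (basis k p T)) h =
      mulL k p (basis k p S) (mulL k p (basis k p T) h) := fun S T h =>
    LinearMap.congr_fun ((basis k p).ext (f₁ := mulL k p (mulL k p (basis k p S) (basis k p T)))
      (f₂ := mulL k p (basis k p S) ∘ₗ mulL k p (basis k p T)) fun U => h3 S T U) h
  have h1 : ∀ S, ∀ g h, mulL k p (mulL k p (basis k p S) g) h =
      mulL k p (basis k p S) (mulL k p g h) := fun S g h =>
    LinearMap.congr_fun ((basis k p).ext (f₁ := (mulL k p).flip h ∘ₗ mulL k p (basis k p S))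
      (f₂ := mulL k p (basis k p S) ∘ₗ (mulL k p).flip h) fun T => h2 S T h) g
  exact LinearMap.congr_fun ((basis k p).ext (f₁ := (mulL k p).flip h ∘ₗ (mulL k p).flip g)
      (f₂ := (mulL k p).flip (mulL k p g h)) fun S => h1 S g h) f

theorem one_mulL (f : Grass k p) : mulL k p (basis k p ∅) f = f :=
  LinearMap.congr_fun ((basis k p).ext (f₁ := mulL k p (basis k p ∅)) (f₂ := LinearMap.id)
    fun S => by simp [mulL_basis, basisMul, crossing, sg_zero]) f

theorem mulL_one (f : Grass k p) : mulL k p f (basis k p ∅) = f :=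
  LinearMap.congr_fun ((basis k p).ext (f₁ := (mulL k p).flip (basis k p ∅)) (f₂ := LinearMap.id)
    fun S => by simp [mulL_basis, basisMul, crossing, sg_zero]) f

instance : Ring (Grass k p) where
  __ := (inferInstance : AddCommGroup (Grass k p))
  mul f g := mulL k p f g
  one := basis k p ∅
  left_distrib f g h := map_add (mulL k p f) g h
  right_distrib f g h := LinearMap.congr_fun (map_add (mulL k p) f g) h
  zero_mul f := LinearMap.congr_fun (map_zero (mulL k p)) f
  mul_zero f := map_zero (mulL k p f)
  mul_assoc := mulL_assoc
  one_mul := one_mulL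
  mul_one := mulL_one

theorem one_def : (1 : Grass k p) = basis k p ∅ := rfl

instance : Algebra k (Grass k p) :=
  Algebra.ofModule (fun c f g => LinearMap.congr_fun (map_smul (mulL k p) c f) g)
    fun c f g => map_smul (mulL k p f) c g

theorem basis_mul_basis (S T : Finset (Fin n)) :
    basis k p S * basis k p T =
      if Disjoint S T then sg k (crossing p S T) • basis k p (S ∪ T) else 0 := mulL_basis S T

theorem linear_ext₂ {X : Type*} [AddCommGroup X] [Module k X]
    {b b' : Grass k p →ₗ[k] Grass k p →ₗ[k] X}
    (h : ∀ S T, b (basis k p S) (basis k p T) = b' (basis k p S) (basis k p T)) : b = b' :=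
  (basis k p).ext fun S => (basis k p).ext fun T => h S T

variable (k p) in
/-- The parity involution. -/
def parHom : Grass k p →ₐ[k] Grass k p :=
  AlgHom.ofLinearMap ((basis k p).constr k fun S => sg k (∑ i ∈ S, p i) • basis k p S)
    (by simp [one_def, sg_zero])
    (by
      intro f g
      refine LinearMap.congr_fun (LinearMap.congr_fun (linear_ext₂ (b := (mulL k p).compr₂
        ((basis k p).constr k fun S => sg k (∑ i ∈ S, p i) • basis k p S))
        (b' := (mulL k p).compl₁₂ ((basis k p).constr k fun S => sg k (∑ i ∈ S, p i) • basis k p S)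
        ((basis k p).constr k fun S => sg k (∑ i ∈ S, p i) • basis k p S)) fun S T => ?_) f) g
      simp only [LinearMap.compr₂_apply, LinearMap.compl₁₂_apply, Module.Basis.constr_basis,
        map_smul, LinearMap.smul_apply, mulL_basis, basisMul]
      split_ifs with h
      · simp only [map_smul, Module.Basis.constr_basis, smul_smul]
        rw [Finset.sum_union h, sg_add]
        congr 1
        ring
      · simp)

theorem parHom_basis (S : Finset (Fin n)) :
    parHom k p (basis k p S) = sg k (∑ i ∈ S, p i) • basis k p S :=
  (basis k p).constr_basis k _ S

variable (k p) in
/-- The augmentation. -/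
def augHom : Grass k p →ₐ[k] k :=
  AlgHom.ofLinearMap ((basis k p).coord ∅)
    (by simp [one_def])
    (by
      intro f g
      refine LinearMap.congr_fun (LinearMap.congr_fun (linear_ext₂ (b := (mulL k p).compr₂
        ((basis k p).coord ∅))
        (b' := (LinearMap.mul k k).compl₁₂ ((basis k p).coord ∅) ((basis k p).coord ∅))
        fun S T => ?_) f) g
      simp only [LinearMap.compr₂_apply, LinearMap.compl₁₂_apply, mulL_basis, basisMul,
        Module.Basis.coord_apply, LinearMap.mul_apply', Module.Basis.repr_self]
      by_cases hS : S = ∅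
      · subst hS; simp [crossing, sg_zero]
      · split_ifs with h
        · simp [Finsupp.single_apply, hS, Finset.union_eq_empty]
        · simp [Finsupp.single_apply, hS])

theorem augHom_basis (S : Finset (Fin n)) : augHom k p (basis k p S) = if S = ∅ then 1 else 0 := by
  change (basis k p).coord ∅ (basis k p S) = _
  simp [Finsupp.single_apply]

/-- Every factor in the augmentation ideal contributes at least one generator, so a monomial with
fewer generators than there are factors cannot occur. -/
theorem coord_list_prod (l : List (Grass k p)) (hl : ∀ a ∈ l, augHom k p a = 0)
    (S : Finset (Fin n)) (hS : S.card < l.length) : (basis k p).coord S l.prod = 0 := by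
  induction l generalizing S with
  | nil => simp at hS
  | cons a l ih =>
    rw [List.prod_cons, ← (basis k p).sum_repr a, ← (basis k p).sum_repr l.prod,
      Finset.sum_mul_sum, map_sum]
    refine Finset.sum_eq_zero fun T _ => ?_
    rw [map_sum]
    refine Finset.sum_eq_zero fun U _ => ?_
    rw [smul_mul_smul_comm, map_smul, basis_mul_basis]
    by_cases hT : T = ∅
    · have : (basis k p).repr a T = 0 := by subst hT; exact hl a (by simp)
      simp [this]
    · by_cases hU : U.card < l.length
      · have : (basis k p).repr l.prod U = 0 := ih (fun a ha => hl a (by simp [ha])) U hU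
        simp [this]
      · split_ifs with h
        · have : T ∪ U ≠ S := by
            rintro rfl
            have h1 := Finset.card_union_of_disjoint h
            have h2 : 0 < T.card := Finset.card_pos.2 (Finset.nonempty_iff_ne_empty.2 hT)
            simp only [List.length_cons] at hS
            omega
          simp [this]
        · simp

/-- Compare the coefficients of `t_S` in the eigenvalue equation; the signs 1 and -1 differ in
characteristic zero. -/
theorem par_coord [CharZero k] {α : ZMod 2} {a : Grass k p} (ha : parHom k p a = sg k α • a)
    (S : Finset (Fin n)) (h : (basis k p).repr a S ≠ 0) : ∑ i ∈ S, p i = α := by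
  have h1 : (basis k p).coord S ∘ₗ (parHom k p).toLinearMap =
      sg k (∑ i ∈ S, p i) • (basis k p).coord S := by
    refine (basis k p).ext fun T => ?_
    simp only [LinearMap.comp_apply, AlgHom.toLinearMap_apply, parHom_basis, map_smul,
      LinearMap.smul_apply, Module.Basis.coord_apply, Module.Basis.repr_self]
    by_cases hT : T = S
    · subst hT; simp
    · simp [hT]
  have h2 := LinearMap.congr_fun h1 a
  simp only [LinearMap.comp_apply, AlgHom.toLinearMap_apply, ha, map_smul, LinearMap.smul_apply,
    Module.Basis.coord_apply, smul_eq_mul] at h2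
  have h3 := mul_right_cancel₀ h h2
  rcases zmod_two α with rfl | rfl <;> rcases zmod_two (∑ i ∈ S, p i) with h4 | h4 <;>
    rw [h4] at h3 ⊢
  · rw [sg_zero, sg_one] at h3; exact absurd h3 (by norm_num)
  · rw [sg_zero, sg_one] at h3; exact absurd h3 (by norm_num)

theorem super_comm [CharZero k] (α β : ZMod 2) (a b : Grass k p)
    (ha : parHom k p a = sg k α • a) (hb : parHom k p b = sg k β • b) :
    a * b = sg k (α * β) • (b * a) := by
  have h : ∀ S T, basis k p S * basis k p T =
      sg k ((∑ i ∈ S, p i) * ∑ i ∈ T, p i) • (basis k p T * basis k p S) := by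
    intro S T
    rw [basis_mul_basis, basis_mul_basis]
    by_cases h : Disjoint S T
    · rw [if_pos h, if_pos h.symm, smul_smul, ← sg_add, Finset.union_comm,
        ← crossing_add_crossing p h, add_assoc, zmod_two_add_self, add_zero]
    · rw [if_neg h, if_neg fun h' => h h'.symm, smul_zero]
  rw [← (basis k p).sum_repr a, ← (basis k p).sum_repr b, Finset.sum_mul_sum, Finset.sum_mul_sum,
    Finset.sum_comm, Finset.smul_sum]
  refine Finset.sum_congr rfl fun T _ => ?_
  rw [Finset.smul_sum]
  refine Finset.sum_congr rfl fun S _ => ?_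
  rw [smul_mul_smul_comm, smul_mul_smul_comm, h]
  by_cases h1 : (basis k p).repr a S = 0
  · simp [h1]
  by_cases h2 : (basis k p).repr b T = 0
  · simp [h2]
  rw [par_coord ha S h1, par_coord hb T h2, smul_comm, mul_comm ((basis k p).repr a S)]

variable (k p) in
/-- The Grassmann algebra with zero differential. -/
abbrev cdga [CharZero k] : ArtinCdga k where
  carrier := Grass k p
  par := parHom k p
  par_par a := by
    refine LinearMap.congr_fun ((basis k p).ext (f₁ := (parHom k p).toLinearMap ∘ₗ
      (parHom k p).toLinearMap) (f₂ := LinearMap.id) fun S => ?_) a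
    simp [parHom_basis, sg_smul_sg_smul]
  comm := super_comm
  d := 0
  d_par := by simp
  d_d := by simp
  d_mul := by simp
  aug := augHom k p
  aug_par a := by
    refine LinearMap.congr_fun ((basis k p).ext (f₁ := (augHom k p).toLinearMap ∘ₗ
      (parHom k p).toLinearMap) (f₂ := (augHom k p).toLinearMap) fun S => ?_) a
    by_cases h : S = ∅ <;> simp [parHom_basis, augHom_basis, h, sg_zero]
  aug_d := by simp
  nilpotent := ⟨n + 1, fun a ha => (basis k p).ext_elem fun S =>
    (coord_list_prod _ (fun b hb => by obtain ⟨i, rfl⟩ := List.mem_ofFn.1 hb; exact ha i) S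
      (by rw [List.length_ofFn]; exact Nat.lt_succ_of_le (by simpa using S.card_le_univ))).trans
      (by simp)⟩

end Grass

/-! ## Adjoining an odd generator with nonzero differential -/

section Cone

variable {k : Type u} [Field k] (R : ArtinCdga k)

/-- The elements `a + ε b`, with `b` in the augmentation ideal, as matrices `(par a, b; 0, a)`. -/
def coneSubalgebra : Subalgebra k (Matrix (Fin 2) (Fin 2) R.carrier) where
  -- The upper left entry is `par a` so that the matrix product encodes the rule `a ε = ε par(a)`
  -- for an odd `ε` with `ε² = 0`.
  carrier := {M | M 1 0 = 0 ∧ M 0 0 = R.par (M 1 1) ∧ R.aug (M 0 1) = 0}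
  mul_mem' {M N} hM hN := by
    obtain ⟨h1, h2, h3⟩ := hM
    obtain ⟨h4, h5, h6⟩ := hN
    simp [Matrix.mul_apply, Fin.sum_univ_two, h1, h2, h3, h4, h5, h6]
  add_mem' {M N} hM hN := by
    obtain ⟨h1, h2, h3⟩ := hM
    obtain ⟨h4, h5, h6⟩ := hN
    simp [h1, h2, h3, h4, h5, h6]
  algebraMap_mem' c := by simp [Matrix.algebraMap_eq_diagonal]

variable {R} in
/-- The element `a + ε b`. -/
def coneMk (a b : R.carrier) (hb : R.aug b = 0) : coneSubalgebra R :=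
  ⟨!![R.par a, b; 0, a], by simp, by simp, by simpa using hb⟩

variable {R} in
theorem cone_ext {M N : coneSubalgebra R} (h : M.1 1 1 = N.1 1 1) (h' : M.1 0 1 = N.1 0 1) :
    M = N := by
  refine Subtype.ext (Matrix.ext fun i j => ?_)
  obtain ⟨h1, h2, -⟩ := M.2
  obtain ⟨h3, h4, -⟩ := N.2
  fin_cases i <;> fin_cases j
  · exact h2.trans ((congrArg R.par h).trans h4.symm)
  · exact h'
  · exact h1.trans h3.symm
  · exact h

variable {R} in
theorem cone_mul_one_one (M N : coneSubalgebra R) : (M * N).1 1 1 = M.1 1 1 * N.1 1 1 := by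
  have h1 := M.2.1
  change (M.1 * N.1) 1 1 = _
  simp [Matrix.mul_apply, Fin.sum_univ_two, h1]

variable {R} in
theorem cone_mul_zero_one (M N : coneSubalgebra R) :
    (M * N).1 0 1 = R.par (M.1 1 1) * N.1 0 1 + M.1 0 1 * N.1 1 1 := by
  have h1 := M.2.2.1
  change (M.1 * N.1) 0 1 = _
  simp [Matrix.mul_apply, Fin.sum_univ_two, h1]

/-- The parity involution `a + ε b ↦ par a - ε par b`. -/
def conePar : coneSubalgebra R →ₐ[k] coneSubalgebra R :=
  AlgHom.ofLinearMap
    { toFun := fun M => coneMk (R.par (M.1 1 1)) (-R.par (M.1 0 1))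
        (by have := M.2.2.2; simp [R.aug_par, this])
      map_add' := fun M N => cone_ext (by simp [coneMk]) (by simp [coneMk]; abel)
      map_smul' := fun c M => cone_ext (by simp [coneMk]) (by simp [coneMk]) }
    (cone_ext (by simp [coneMk]) (by simp [coneMk]))
    (fun M N => cone_ext
      (by simp [coneMk, cone_mul_one_one])
      (by simp [coneMk, cone_mul_zero_one]; abel))

theorem conePar_one_one (M : coneSubalgebra R) : (conePar R M).1 1 1 = R.par (M.1 1 1) := by
  simp [conePar, coneMk]

theorem conePar_zero_one (M : coneSubalgebra R) : (conePar R M).1 0 1 = -R.par (M.1 0 1) := by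
  simp [conePar, coneMk]

/-- The differential `∂/∂ε`. -/
def coneD : coneSubalgebra R →ₗ[k] coneSubalgebra R where
  toFun M := coneMk (M.1 0 1) 0 (by simp)
  map_add' M N := cone_ext (by simp [coneMk]) (by simp [coneMk])
  map_smul' c M := cone_ext (by simp [coneMk]) (by simp [coneMk])

theorem coneD_one_one (M : coneSubalgebra R) : (coneD R M).1 1 1 = M.1 0 1 := by
  simp [coneD, coneMk]

theorem coneD_zero_one (M : coneSubalgebra R) : (coneD R M).1 0 1 = 0 := by
  simp [coneD, coneMk]

/-- The projection `a + ε b ↦ a`. -/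
def coneProj : coneSubalgebra R →ₐ[k] R.carrier :=
  AlgHom.ofLinearMap
    { toFun := fun M => M.1 1 1
      map_add' := fun M N => by simp
      map_smul' := fun c M => by simp }
    (show (1 : Matrix (Fin 2) (Fin 2) R.carrier) 1 1 = 1 by simp)
    (fun M N => cone_mul_one_one M N)

/-- The upper right entry of a product is a sum of words in which one letter is an upper right entry
and all others are diagonal entries. All letters lie in the augmentation ideal, so words of length
at least `N` vanish. In `key` the list `l'` collects the diagonal entries already passed. -/
theorem cone_list_prod_zero_one (l : List (coneSubalgebra R)) (hl : ∀ M ∈ l, R.aug (M.1 1 1) = 0)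
    (N : ℕ) (hN : ∀ l : List R.carrier, N ≤ l.length → (∀ a ∈ l, R.aug a = 0) → l.prod = 0)
    (h : N ≤ l.length) : l.prod.1 0 1 = 0 := by
  have key : ∀ (l : List (coneSubalgebra R)), (∀ M ∈ l, R.aug (M.1 1 1) = 0) →
      ∀ l' : List R.carrier, (∀ a ∈ l', R.aug a = 0) → N ≤ l.length + l'.length →
      (l'.map R.par).prod * l.prod.1 0 1 = 0 := by
    intro l
    induction l with
    | nil =>
      intro _ l' h' hl'
      simp
    | cons M l ih =>
      intro hM l' h' hl'
      rw [List.prod_cons, cone_mul_zero_one, mul_add, ← mul_assoc]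
      have h1 := ih (fun M hM' => hM M (by simp [hM'])) (l' ++ [M.1 1 1])
        (by
          intro a ha
          rcases List.mem_append.1 ha with ha | ha
          · exact h' a ha
          · rw [List.mem_singleton.1 ha]; exact hM M (by simp))
        (by simp at hl' ⊢; omega)
      rw [List.map_append, List.prod_append] at h1
      simp only [List.map_cons, List.map_nil, List.prod_singleton] at h1
      rw [h1, zero_add]
      have h2 := hN (l'.map R.par ++ M.1 0 1 :: l.map (coneProj R)) (by simp at hl' ⊢; omega) (by
        intro a ha
        simp only [List.mem_append, List.mem_map, List.mem_cons] at ha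
        rcases ha with ⟨b, hb, rfl⟩ | rfl | ⟨M', hM', rfl⟩
        · rw [R.aug_par, h' b hb]
        · exact M.2.2.2
        · exact hM M' (by simp [hM']))
      rw [List.prod_append, List.prod_cons, ← map_list_prod, ← map_list_prod] at h2
      rw [← map_list_prod]
      exact h2
  simpa using key l hl [] (by simp) (by simpa using h)

/-- The cone `k ⊕ (A_+ ⊗ k[ε])` with differential `∂/∂ε`. -/
abbrev cone [CharZero k] : ArtinCdga k where
  carrier := coneSubalgebra R
  finite := Module.Finite.of_injective (coneSubalgebra R).val.toLinearMap Subtype.val_injective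
  par := conePar R
  par_par M := cone_ext (by simp [conePar_one_one, R.par_par])
    (by simp [conePar_zero_one, R.par_par])
  comm p q M N hM hN := by
    have h1 : R.par (M.1 1 1) = sg k p • M.1 1 1 := by
      rw [← conePar_one_one, hM]; simp
    have h2 : R.par (N.1 1 1) = sg k q • N.1 1 1 := by
      rw [← conePar_one_one, hN]; simp
    have h3 : R.par (M.1 0 1) = sg k (p + 1) • M.1 0 1 := by
      rw [← neg_neg (R.par _), ← conePar_zero_one, hM, sg_add, sg_one]; simp
    have h4 : R.par (N.1 0 1) = sg k (q + 1) • N.1 0 1 := by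
      rw [← neg_neg (R.par _), ← conePar_zero_one, hN, sg_add, sg_one]; simp
    refine cone_ext ?_ ?_
    · have h5 : (sg k (p * q) • (N * M)).1 1 1 = sg k (p * q) • (N * M).1 1 1 := rfl
      rw [h5, cone_mul_one_one, cone_mul_one_one, R.comm p q _ _ h1 h2]
    · have h5 : (sg k (p * q) • (N * M)).1 0 1 = sg k (p * q) • (N * M).1 0 1 := rfl
      rw [h5, cone_mul_zero_one, cone_mul_zero_one, R.comm (p + 1) q _ _ h3 h2, h1, h2,
        smul_mul_assoc, smul_mul_assoc, R.comm p (q + 1) _ _ h1 h4, smul_add, smul_smul, smul_smul,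
        ← sg_add, ← sg_add, add_comm]
      congr 3
      · ring
      · linear_combination p * two_zmod_two
  d := coneD R
  d_par M := cone_ext (by simp [coneD_one_one, conePar_zero_one, conePar_one_one])
    (by simp [coneD_zero_one, conePar_zero_one])
  d_d M := cone_ext (by simp [coneD_one_one, coneD_zero_one]) (by simp [coneD_zero_one])
  d_mul M N := by
    refine cone_ext ?_ ?_
    · change _ = (coneD R M * N).1 1 1 + (conePar R M * coneD R N).1 1 1
      simp only [coneD_one_one, cone_mul_one_one, cone_mul_zero_one, conePar_one_one, add_comm]
    · change _ = (coneD R M * N).1 0 1 + (conePar R M * coneD R N).1 0 1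
      simp only [coneD_zero_one, coneD_one_one, cone_mul_zero_one, conePar_zero_one]
      simp
  aug := R.aug.comp (coneProj R)
  aug_par M := by
    change R.aug ((conePar R M).1 1 1) = R.aug (M.1 1 1)
    rw [conePar_one_one, R.aug_par]
  aug_d M := by
    change R.aug ((coneD R M).1 1 1) = 0
    rw [coneD_one_one]
    exact M.2.2.2
  nilpotent := by
    obtain ⟨N, hN⟩ := R.exists_nilp
    have hN' : ∀ l : List R.carrier, N ≤ l.length → (∀ a ∈ l, R.aug a = 0) → l.prod = 0 := by
      intro l hl h
      rw [← List.ofFn_get l]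
      exact hN _ hl _ fun i => h _ (List.get_mem _ _)
    refine ⟨N, fun M hM => cone_ext ?_ ?_⟩
    · change coneProj R _ = _
      rw [map_list_prod, hN' _ (by simp) (fun b hb => by
        obtain ⟨M', hM', rfl⟩ := List.mem_map.1 hb
        obtain ⟨i, rfl⟩ := List.mem_ofFn.1 hM'
        exact hM i)]
      simp
    · rw [cone_list_prod_zero_one R _ (fun b hb => by obtain ⟨i, rfl⟩ := List.mem_ofFn.1 hb; exact hM i) N hN' (by simp)]
      simp

end Cone

/-! ## Polarization -/

namespace Grass

variable {k : Type u} [Field k] [CharZero k] {n : ℕ} {p : Fin n → ZMod 2}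

/-- The parity of `t_S`. -/
def parity (p : Fin n → ZMod 2) (S : Finset (Fin n)) : ZMod 2 := ∑ i ∈ S, p i

/-- The sum of the products of parities over the pairs of elements of `S`. -/
def pairs (p : Fin n → ZMod 2) (S : Finset (Fin n)) : ZMod 2 :=
  ∑ i ∈ S, ∑ j ∈ S, if i < j then p i * p j else 0

theorem isHom_basis (S : Finset (Fin n)) :
    (cdga k p).gr.IsHom (parity p S) (basis k p S) := parHom_basis S

theorem parity_union {S T : Finset (Fin n)} (h : Disjoint S T) :
    parity p (S ∪ T) = parity p S + parity p T := Finset.sum_union h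

theorem parity_compl (S : Finset (Fin n)) :
    parity p S + parity p Sᶜ = parity p Finset.univ := by
  rw [← parity_union disjoint_compl_right, Finset.union_compl]

/-- A pair with one index in each part contributes the product of parities, whichever index is
smaller. -/
theorem pairs_union {S T : Finset (Fin n)} (h : Disjoint S T) :
    pairs p (S ∪ T) = pairs p S + pairs p T + parity p S * parity p T := by
  have h1 : parity p S * parity p T = crossing p T S + crossing p S T := by
    rw [add_comm, crossing_add_crossing p h]; rfl
  rw [h1]
  simp only [pairs, crossing]
  rw [Finset.sum_union h]
  simp only [Finset.sum_union h, Finset.sum_add_distrib]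
  have h2 : (∑ i ∈ S, ∑ j ∈ T, if i < j then p i * p j else 0) =
      ∑ i ∈ T, ∑ j ∈ S, if j < i then p i * p j else 0 := by
    rw [Finset.sum_comm]
    simp only [mul_comm]
  have h3 : (∑ i ∈ T, ∑ j ∈ S, if i < j then p i * p j else 0) =
      ∑ i ∈ S, ∑ j ∈ T, if j < i then p i * p j else 0 := by
    rw [Finset.sum_comm]
    simp only [mul_comm]
  rw [h2, h3]
  ring

/-- Moving `S` to the front inverts exactly the pairs `j < i` with `i ∈ S` and `j ∉ S`. -/
theorem frontSign_eq (S : Finset (Fin n)) (q : Fin n → ZMod 2) :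
    frontSign k S q = sg k (crossing q S Sᶜ) := by
  rw [frontSign, koszul_eq, crossing]
  congr 1
  rw [Finset.sum_comm, ← Finset.sum_add_sum_compl S]
  have h0 : (∑ i ∈ Sᶜ, ∑ x, if x < i ∧ (if i ∈ S then 0 else 1) < (if x ∈ S then 0 else 1 : ℕ)
      then q x * q i else 0) = 0 := by
    refine Finset.sum_eq_zero fun i hi => Finset.sum_eq_zero fun j _ => if_neg ?_
    rintro ⟨-, h⟩
    rw [if_neg (Finset.mem_compl.1 hi)] at h
    split_ifs at h <;> omega
  rw [h0, add_zero]
  refine Finset.sum_congr rfl fun i hi => ?_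
  rw [← Finset.sum_add_sum_compl S]
  have h1 : (∑ x ∈ S, if x < i ∧ (if i ∈ S then 0 else 1) < (if x ∈ S then 0 else 1 : ℕ)
      then q x * q i else 0) = 0 := by
    refine Finset.sum_eq_zero fun j hj => if_neg ?_
    rintro ⟨-, h⟩
    rw [if_pos hj] at h
    omega
  rw [h1, zero_add]
  refine Finset.sum_congr rfl fun j hj => ?_
  simp [hi, Finset.mem_compl.1 hj, mul_comm]

theorem list_prod_basis {r : ℕ} (S : Fin r → Finset (Fin n)) :
    (List.ofFn fun j => basis k p (S j)).prod =
      if ∀ i j, i < j → Disjoint (S i) (S j) then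
        sg k (∑ i, ∑ j, if i < j then crossing p (S i) (S j) else 0) •
          basis k p (Finset.univ.biUnion S)
      else 0 := by
  induction r with
  | zero => simp [one_def, sg_zero]
  | succ r ih =>
    rw [List.ofFn_succ, List.prod_cons, ih fun j => S j.succ]
    have hU : Finset.univ.biUnion S = S 0 ∪ Finset.univ.biUnion fun j : Fin r => S j.succ := by
      ext i
      simp [Fin.exists_fin_succ]
    have hd : Disjoint (S 0) (Finset.univ.biUnion fun j : Fin r => S j.succ) ↔
        ∀ j : Fin r, Disjoint (S 0) (S j.succ) := by
      simp [Finset.disjoint_biUnion_right]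
    have hc : (∀ i j : Fin (r + 1), i < j → Disjoint (S i) (S j)) ↔
        (∀ j : Fin r, Disjoint (S 0) (S j.succ)) ∧
          ∀ i j : Fin r, i < j → Disjoint (S i.succ) (S j.succ) := by
      constructor
      · exact fun h => ⟨fun j => h _ _ (Fin.succ_pos j),
          fun i j hij => h _ _ (Fin.succ_lt_succ_iff.2 hij)⟩
      · rintro ⟨h1, h2⟩ i j hij
        induction i using Fin.cases with
        | zero =>
          induction j using Fin.cases with
          | zero => exact absurd hij (lt_irrefl _)
          | succ j => exact h1 j
        | succ i =>
          induction j using Fin.cases with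
          | zero => exact absurd hij (by simp)
          | succ j => exact h2 i j (Fin.succ_lt_succ_iff.1 hij)
    by_cases h2 : ∀ i j : Fin r, i < j → Disjoint (S i.succ) (S j.succ)
    · rw [if_pos h2, mul_smul_comm, basis_mul_basis]
      by_cases h1 : ∀ j : Fin r, Disjoint (S 0) (S j.succ)
      · rw [if_pos (hd.2 h1), if_pos (hc.2 ⟨h1, h2⟩), smul_smul, ← sg_add, hU]
        congr 2
        have h3 : crossing p (S 0) (Finset.univ.biUnion fun j : Fin r => S j.succ) =
            ∑ j : Fin r, crossing p (S 0) (S j.succ) := by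
          simp only [crossing]
          rw [Finset.sum_comm (s := Finset.univ)]
          refine Finset.sum_congr rfl fun i _ => Finset.sum_biUnion fun a _ b _ hab => ?_
          rcases lt_or_gt_of_ne hab with h | h
          · exact h2 a b h
          · exact (h2 b a h).symm
        rw [h3, Fin.sum_univ_succ, Fin.sum_univ_succ]
        simp only [lt_irrefl, if_false, Fin.succ_pos, if_true, zero_add]
        rw [add_comm]
        congr 1
        refine Finset.sum_congr rfl fun i _ => ?_
        rw [Fin.sum_univ_succ]
        simp
      · rw [if_neg fun h => h1 (hd.1 h), smul_zero, if_neg fun h => h1 (hc.1 h).1]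
    · rw [if_neg h2, mul_zero, if_neg fun h => h2 (hc.1 h).2]

variable {W : Type*} [AddCommGroup W] [Module k W] {Y : Type*} [AddCommGroup Y] [Module k Y]

variable (k p) in
/-- The coefficient of `t_S`. -/
def coeff (W : Type*) [AddCommGroup W] [Module k W] (S : Finset (Fin n)) :
    (cdga k p).carrier ⊗[k] W →ₗ[k] W :=
  (TensorProduct.lid k W).toLinearMap ∘ₗ ((basis k p).coord S).rTensor W

theorem coeff_basis (S T : Finset (Fin n)) (w : W) :
    coeff k p W S ((basis k p T : (cdga k p).carrier) ⊗ₜ w) = if T = S then w else 0 := by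
  simp [coeff, Finsupp.single_apply]

/-- The generic even element `∑ t_i ⊗ x_i`. -/
def generic (p : Fin n → ZMod 2) (x : Fin n → W) : (cdga k p).carrier ⊗[k] W :=
  ∑ i, (basis k p {i} : (cdga k p).carrier) ⊗ₜ[k] x i

theorem isHom_generic {G : SuperStructure k W} {x : Fin n → W} (hx : ∀ i, G.IsHom (p i) (x i)) :
    (tot (cdga k p) G).IsHom 0 (generic p x) := by
  refine isHom_of_mem_span (Submodule.sum_mem _ fun i _ => Submodule.subset_span
    ⟨p i, p i, _, _, ?_, hx i, zmod_two_add_self _, rfl⟩)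
  have := isHom_basis (k := k) (p := p) {i}
  simpa [parity] using this

theorem aug_generic (x : Fin n → W) :
    (cdga k p).aug.toLinearMap.rTensor W (generic p x) = 0 := by
  simp [generic, augHom_basis]

/-- An injective tuple is the increasing enumeration of its image composed with a permutation, so
each `m`-element set is met `m!` times with the same value. -/
theorem sum_injective_eq {M : Type*} [AddCommGroup M] [Module k M] {m : ℕ}
    (g : (Fin m → Fin n) → M) (h0 : ∀ c, ¬ Function.Injective c → g c = 0)
    (hσ : ∀ c (σ : Equiv.Perm (Fin m)), g (c ∘ σ) = g c) (F : Finset (Fin n) → M)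
    (hF : ∀ S : Finset (Fin n), ∀ h : S.card = m, g (S.orderEmbOfFin h) = F S) :
    ∑ c, g c = (m.factorial : k) • ∑ S ∈ Finset.powersetCard m Finset.univ, F S := by
  classical
  have h1 : ∑ c, g c = ∑ c with Function.Injective c, g c :=
    (Finset.sum_filter_of_ne fun c _ hc => by by_contra h; exact hc (h0 c h)).symm
  have h2 : ∀ c ∈ Finset.univ.filter (Function.Injective : (Fin m → Fin n) → Prop),
      Finset.univ.image c ∈ Finset.powersetCard m (Finset.univ : Finset (Fin n)) := by
    intro c hc
    rw [Finset.mem_powersetCard]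
    refine ⟨Finset.subset_univ _, ?_⟩
    rw [Finset.card_image_of_injective _ (Finset.mem_filter.1 hc).2]
    simp
  rw [h1, ← Finset.sum_fiberwise_of_maps_to h2, Finset.smul_sum]
  refine Finset.sum_congr rfl fun S hS => ?_
  have hS' : S.card = m := (Finset.mem_powersetCard.1 hS).2
  have h3 : ∑ c ∈ (Finset.univ.filter (Function.Injective : (Fin m → Fin n) → Prop)).filter
      (fun c => Finset.univ.image c = S), g c =
      ∑ σ : Equiv.Perm (Fin m), g (S.orderEmbOfFin hS' ∘ σ) := by
    symm
    refine Finset.sum_bij (fun σ _ => S.orderEmbOfFin hS' ∘ σ) ?_ ?_ ?_ (fun _ _ => rfl)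
    · intro σ _
      simp only [Finset.mem_filter, Finset.mem_univ, true_and]
      refine ⟨(S.orderEmbOfFin hS').injective.comp σ.injective, ?_⟩
      ext i
      have : i ∈ S ↔ i ∈ Set.range (S.orderEmbOfFin hS') := by
        rw [Finset.range_orderEmbOfFin]; simp
      rw [this]
      simp only [Finset.mem_image, Finset.mem_univ, true_and, Set.mem_range, Function.comp]
      exact ⟨fun ⟨a, ha⟩ => ⟨σ a, ha⟩, fun ⟨a, ha⟩ => ⟨σ.symm a, by simpa using ha⟩⟩
    · intro σ _ τ _ h
      exact Equiv.ext fun i => (S.orderEmbOfFin hS').injective (congrFun h i)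
    · intro c hc
      simp only [Finset.mem_filter, Finset.mem_univ, true_and] at hc
      have hm : ∀ j, c j ∈ Set.range (S.orderEmbOfFin hS') := fun j => by
        rw [Finset.range_orderEmbOfFin, ← hc.2]
        simp
      choose s hs using hm
      have hinj : Function.Injective s := fun i j hij => hc.1 (by rw [← hs, ← hs, hij])
      exact ⟨Equiv.ofBijective s (Finite.injective_iff_bijective.1 hinj), Finset.mem_univ _,
        funext hs⟩
  rw [h3]
  simp only [hσ, hF S hS', Finset.sum_const, Finset.card_univ, Fintype.card_perm, Fintype.card_fin,
    Nat.cast_smul_eq_nsmul]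

/-- Squares of generators vanish, so only injective choices of indices contribute, and symmetry
makes the `m!` orderings of a set of indices equal, which cancels the factorial. The series thus
becomes a sum over subsets. -/
theorem extendScalars_generic {G : SuperStructure k W} (q : ZMod 2)
    {φ : (m : ℕ) → MultilinearMap k (fun _ : Fin m => W) Y}
    (hφ : ∀ m (σ : Equiv.Perm (Fin m)), act G σ (φ m) = φ m) {x : Fin n → W}
    (hx : ∀ i, G.IsHom (p i) (x i)) (m : ℕ) :
    ((m.factorial : k)⁻¹) • extendScalars (cdga k p) G q (φ m) (fun _ => generic p x) =
      ∑ S ∈ Finset.powersetCard m Finset.univ, sg k (q * parity p S + pairs p S) •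
        ((basis k p S : (cdga k p).carrier) ⊗ₜ[k] φ S.card (subfamily S x)) := by
  have hb : ∀ i, (cdga k p).gr.IsHom (p i) (basis k p {i}) := fun i => by
    simpa [parity] using isHom_basis (k := k) (p := p) {i}
  rw [generic.eq_def, MultilinearMap.map_sum]
  rw [sum_injective_eq (k := k) (m := m) _ ?_ ?_ (fun S => sg k (q * parity p S + pairs p S) •
        ((basis k p S : (cdga k p).carrier) ⊗ₜ[k] φ S.card (subfamily S x))) ?_, smul_smul,
    inv_mul_cancel₀ (by exact_mod_cast m.factorial_ne_zero), one_smul]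
  · intro c hc
    rw [extendScalars_tmul G q _ (fun j => hb (c j)) (fun j => hx (c j)),
      list_prod_basis, if_neg, TensorProduct.zero_tmul, smul_zero]
    intro h
    refine hc fun i j hij => ?_
    rcases lt_trichotomy i j with h1 | h1 | h1
    · have := h i j h1
      simp [hij] at this
    · exact h1
    · have := h j i h1
      simp [hij] at this
  · intro c σ
    conv_rhs => rw [← hφ m σ]
    rw [extendScalars_perm G q σ (φ m) (e := fun _ => 0) _ (by simp)]
    · rfl
    · intro j
      have := isHom_tmul (hb (c j)) (hx (c j))
      rwa [zmod_two_add_self] at this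
  · intro S h
    subst h
    rw [extendScalars_tmul G q _ (fun j => hb (S.orderEmbOfFin rfl j))
      (fun j => hx (S.orderEmbOfFin rfl j)), list_prod_basis, if_pos, ← TensorProduct.smul_tmul',
      smul_smul, ← sg_add]
    · have hU : Finset.univ.biUnion (fun j => {S.orderEmbOfFin rfl j}) = S := by
        ext i
        have : i ∈ S ↔ i ∈ Set.range (S.orderEmbOfFin rfl) := by
          rw [Finset.range_orderEmbOfFin]; simp
        rw [this]
        simp only [Finset.mem_biUnion, Finset.mem_univ, true_and, Finset.mem_singleton, Set.mem_range]
        exact exists_congr fun _ => eq_comm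
      have hc : (∑ i, ∑ j, if i < j then crossing p {S.orderEmbOfFin rfl i}
          {S.orderEmbOfFin rfl j} else 0) = 0 := by
        refine Finset.sum_eq_zero fun i _ => Finset.sum_eq_zero fun j _ => ?_
        split_ifs with hij
        · have : S.orderEmbOfFin rfl i < S.orderEmbOfFin rfl j := by simpa using hij
          simp [crossing, this.not_gt]
        · rfl
      have hs : ∀ f : Fin n → ZMod 2, ∑ j, f (S.orderEmbOfFin rfl j) = ∑ i ∈ S, f i := by
        intro f
        conv_rhs => rw [← Finset.map_orderEmbOfFin_univ S rfl, Finset.sum_map]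
        rfl
      have hp : (∑ i, ∑ j, if i < j then p (S.orderEmbOfFin rfl i) * p (S.orderEmbOfFin rfl j)
          else 0) = pairs p S := by
        rw [pairs, ← hs]
        refine Finset.sum_congr rfl fun i _ => ?_
        rw [← hs]
        simp
      rw [hU, hc, add_zero, hp, ← Finset.mul_sum, hs]
      rfl
    · intro i j hij
      simp [hij.ne]

theorem sum_generic {G : SuperStructure k W} (q : ZMod 2)
    {φ : (m : ℕ) → MultilinearMap k (fun _ : Fin m => W) Y}
    (hφ : ∀ m (σ : Equiv.Perm (Fin m)), act G σ (φ m) = φ m) {x : Fin n → W}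
    (hx : ∀ i, G.IsHom (p i) (x i)) :
    ∑ m ∈ Finset.range (n + 1), ((m.factorial : k)⁻¹) •
        extendScalars (cdga k p) G q (φ m) (fun _ => generic p x) =
      ∑ S : Finset (Fin n), sg k (q * parity p S + pairs p S) •
        ((basis k p S : (cdga k p).carrier) ⊗ₜ[k] φ S.card (subfamily S x)) := by
  simp only [extendScalars_generic q hφ hx]
  have := Finset.sum_powerset (Finset.univ : Finset (Fin n)) fun S =>
    sg k (q * parity p S + pairs p S) •
        ((basis k p S : (cdga k p).carrier) ⊗ₜ[k] φ S.card (subfamily S x))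
  rw [Finset.powerset_univ, Finset.card_univ, Fintype.card_fin] at this
  exact this.symm

end Grass

/-! ## Fixing the first argument -/

section Cons

/-- The permutation of `{0, …, n}` fixing `0` and acting by `σ` on the successors. -/
def liftPerm {n : ℕ} (σ : Equiv.Perm (Fin n)) : Equiv.Perm (Fin (n + 1)) :=
  Equiv.Perm.decomposeFin.symm (0, σ)

theorem liftPerm_zero {n : ℕ} (σ : Equiv.Perm (Fin n)) : liftPerm σ 0 = 0 := by
  simp [liftPerm]

theorem liftPerm_succ {n : ℕ} (σ : Equiv.Perm (Fin n)) (i : Fin n) :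
    liftPerm σ i.succ = (σ i).succ := by
  simp [liftPerm]

theorem liftPerm_symm_zero {n : ℕ} (σ : Equiv.Perm (Fin n)) : (liftPerm σ).symm 0 = 0 := by
  rw [Equiv.symm_apply_eq, liftPerm_zero]

theorem liftPerm_symm_succ {n : ℕ} (σ : Equiv.Perm (Fin n)) (i : Fin n) :
    (liftPerm σ).symm i.succ = (σ.symm i).succ := by
  rw [Equiv.symm_apply_eq, liftPerm_succ, Equiv.apply_symm_apply]

theorem cons_comp_liftPerm {α : Type*} {n : ℕ} (σ : Equiv.Perm (Fin n)) (a : α) (x : Fin n → α) :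
    (Fin.cons a x : Fin (n + 1) → α) ∘ liftPerm σ = Fin.cons a (x ∘ σ) := by
  funext i
  induction i using Fin.cases with
  | zero => simp [liftPerm_zero]
  | succ i => simp [liftPerm_succ]

theorem koszul_liftPerm {k : Type u} [Field k] {n : ℕ} (σ : Equiv.Perm (Fin n)) (a : ZMod 2)
    (p : Fin n → ZMod 2) :
    koszul k (liftPerm σ).symm (Fin.cons a p : Fin (n + 1) → ZMod 2) = koszul k σ.symm p := by
  simp [koszul, Fin.prod_univ_succ, liftPerm_symm_zero, liftPerm_symm_succ]

variable {k : Type u} [Field k] [CharZero k] {V : Type*} [AddCommGroup V] [Module k V]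
variable {X : Type*} [AddCommGroup X] [Module k X]

/-- A permutation fixing the first slot moves nothing past the first argument, so currying
introduces no sign. -/
theorem act_curryLeft (G : SuperStructure k V) {n : ℕ} (σ : Equiv.Perm (Fin n))
    (f : MultilinearMap k (fun _ : Fin (n + 1) => V) X) (y : V) :
    act G σ (f.curryLeft y) = (act G (liftPerm σ) f).curryLeft y := by
  have h : act G σ ∘ₗ f.curryLeft = (act G (liftPerm σ) f).curryLeft := by
    refine linear_ext_isHom G fun a y hy => multilinear_ext_isHom G _ _ fun p x hx => ?_
    have hc : ∀ i : Fin (n + 1), G.IsHom ((Fin.cons a p : Fin (n + 1) → ZMod 2) i)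
        ((Fin.cons y x : Fin (n + 1) → V) i) := by
      intro i
      induction i using Fin.cases with
      | zero => simpa using hy
      | succ i => simpa using hx i
    rw [LinearMap.comp_apply, act_isHom G σ _ hx, MultilinearMap.curryLeft_apply,
      MultilinearMap.curryLeft_apply, act_isHom G _ f hc, koszul_liftPerm, cons_comp_liftPerm]
  exact LinearMap.congr_fun h y

theorem act_curryLeft_eq {G : SuperStructure k V} {n : ℕ}
    {f : MultilinearMap k (fun _ : Fin (n + 1) => V) X} (hf : ∀ σ, act G σ f = f)
    (y : V) (σ : Equiv.Perm (Fin n)) : act G σ (f.curryLeft y) = f.curryLeft y := by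
  rw [act_curryLeft, hf]

/-- Moving `b` to the front past `f` costs `q * β`. The remaining coefficients must pass the vector
`y` as well as `f`, hence the parity `q + π` for the curried map. -/
theorem extendScalars_cons {R : ArtinCdga k} {G : SuperStructure k V} (q : ZMod 2) {n : ℕ}
    (f : MultilinearMap k (fun _ : Fin (n + 1) => V) X) {β π : ZMod 2} {b : R.carrier} {y : V}
    (hb : R.gr.IsHom β b) (hy : G.IsHom π y) (ζ : Fin n → R.carrier ⊗[k] V) :
    extendScalars R G q f (Fin.cons (b ⊗ₜ y) ζ) =
      sg k (q * β) • (LinearMap.mulLeft k b).rTensor X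
        (extendScalars R G (q + π) (f.curryLeft y) ζ) := by
  have h : (extendScalars R G q f).curryLeft (b ⊗ₜ y) = sg k (q * β) •
      ((LinearMap.mulLeft k b).rTensor X).compMultilinearMap
        (extendScalars R G (q + π) (f.curryLeft y)) := by
    refine multilinear_tensor_ext G fun α p a x ha hx => ?_
    have h1 : (Fin.cons (b ⊗ₜ[k] y) fun i => a i ⊗ₜ[k] x i : Fin (n + 1) → R.carrier ⊗[k] V) =
        fun i => (Fin.cons b a : Fin (n + 1) → R.carrier) i ⊗ₜ[k]
          (Fin.cons y x : Fin (n + 1) → V) i := by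
      funext i
      induction i using Fin.cases with
      | zero => simp
      | succ i => simp
    have h2 : ∀ i : Fin (n + 1), R.gr.IsHom ((Fin.cons β α : Fin (n + 1) → ZMod 2) i)
        ((Fin.cons b a : Fin (n + 1) → R.carrier) i) := by
      intro i
      induction i using Fin.cases with
      | zero => simpa using hb
      | succ i => simpa using ha i
    have h3 : ∀ i : Fin (n + 1), G.IsHom ((Fin.cons π p : Fin (n + 1) → ZMod 2) i)
        ((Fin.cons y x : Fin (n + 1) → V) i) := by
      intro i
      induction i using Fin.cases with
      | zero => simpa using hy
      | succ i => simpa using hx i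
    rw [MultilinearMap.curryLeft_apply, h1, extendScalars_tmul G q f h2 h3, smul_apply,
      LinearMap.compMultilinearMap_apply, extendScalars_tmul G (q + π) _ ha hx]
    simp only [map_smul, LinearMap.rTensor_tmul, LinearMap.mulLeft_apply, smul_smul, ← sg_add,
      List.ofFn_succ, List.prod_cons, Fin.cons_zero, Fin.cons_succ, Fin.sum_univ_succ,
      MultilinearMap.curryLeft_apply, Fin.succ_lt_succ_iff, Fin.succ_pos, if_true,
      if_false, Fin.not_lt_zero, zero_add]
    congr 2
    simp only [← Finset.mul_sum]
    ring
  have := congrArg (fun F => F ζ) h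
  exact this

end Cons

/-! ### Top coefficients of derivatives and compositions -/

namespace Grass

variable {k : Type u} [Field k] [CharZero k] {n : ℕ} {p : Fin n → ZMod 2}
variable {W : Type*} [AddCommGroup W] [Module k W] {Y : Type*} [AddCommGroup Y] [Module k Y]

/-- The coefficient of the product of all generators in the first derivative of a family of
symmetric maps. -/
theorem coeff_derivative {G : SuperStructure k W} (q : ZMod 2)
    {φ : (m : ℕ) → MultilinearMap k (fun _ : Fin m => W) Y}
    (hφ : ∀ m (σ : Equiv.Perm (Fin m)), act G σ (φ m) = φ m) {x : Fin n → W}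
    (hx : ∀ i, G.IsHom (p i) (x i)) {y : Finset (Fin n) → W}
    (hy : ∀ S, G.IsHom (parity p S + 1) (y S)) :
    coeff k p Y Finset.univ (∑ m ∈ Finset.range (n + 1), ((m.factorial : k)⁻¹) •
      extendScalars (cdga k p) G q (φ (m + 1)) (Fin.cons
        (∑ S, sg k (parity p S + pairs p S) • ((basis k p S : (cdga k p).carrier) ⊗ₜ[k] y S))
          fun _ => generic p x)) =
    sg k ((q + 1) * parity p Finset.univ + pairs p Finset.univ) •
      ∑ S, frontSign k S p • φ (Sᶜ.card + 1) (Fin.cons (y S) (subfamily Sᶜ x)) := by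
  have h1 : ∀ m, extendScalars (cdga k p) G q (φ (m + 1)) (Fin.cons
        (∑ S, sg k (parity p S + pairs p S) • ((basis k p S : (cdga k p).carrier) ⊗ₜ[k] y S))
          fun _ => generic p x) = ∑ S, sg k (parity p S + pairs p S + q * parity p S) •
        (LinearMap.mulLeft k (basis k p S : (cdga k p).carrier)).rTensor Y
        (extendScalars (cdga k p) G (q + (parity p S + 1)) ((φ (m + 1)).curryLeft (y S))
          fun _ => generic p x) := by
    intro m
    have := congrArg (fun F => F fun _ => generic p x)
      (map_sum (extendScalars (cdga k p) G q (φ (m + 1))).curryLeft (fun S =>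
      sg k (parity p S + pairs p S) • ((basis k p S : (cdga k p).carrier) ⊗ₜ[k] y S)) Finset.univ)
    simp only [map_smul, sum_apply, smul_apply, MultilinearMap.curryLeft_apply] at this
    rw [this]
    refine Finset.sum_congr rfl fun S _ => ?_
    rw [extendScalars_cons q _ (isHom_basis S) (hy S), smul_smul, ← sg_add]
  simp only [h1, Finset.smul_sum]
  rw [Finset.sum_comm, map_sum]
  refine Finset.sum_congr rfl fun S _ => ?_
  have h2 := sum_generic (q + (parity p S + 1))
    (φ := fun m => (φ (m + 1)).curryLeft (y S))
    (fun m σ => act_curryLeft_eq (hφ (m + 1)) (y S) σ) hx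
  have h3 : ∀ m, ((m.factorial : k)⁻¹) • sg k (parity p S + pairs p S + q * parity p S) •
        (LinearMap.mulLeft k (basis k p S : (cdga k p).carrier)).rTensor Y
        (extendScalars (cdga k p) G (q + (parity p S + 1)) ((φ (m + 1)).curryLeft (y S))
          fun _ => generic p x) = (sg k (parity p S + pairs p S + q * parity p S) •
        (LinearMap.mulLeft k (basis k p S : (cdga k p).carrier)).rTensor Y)
        (((m.factorial : k)⁻¹) • (extendScalars (cdga k p) G (q + (parity p S + 1))
          ((φ (m + 1)).curryLeft (y S)) fun _ => generic p x)) := by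
    intro m
    rw [LinearMap.smul_apply, map_smul, smul_comm]
  rw [Finset.sum_congr rfl fun m _ => h3 m, ← map_sum, h2]
  simp only [map_sum, LinearMap.smul_apply, map_smul, LinearMap.rTensor_tmul,
    LinearMap.mulLeft_apply]
  -- Only `T = Sᶜ` completes `t_S` to the product of all generators.
  have h4 : ∀ T, coeff k p Y Finset.univ ((basis k p S * basis k p T : (cdga k p).carrier) ⊗ₜ[k]
      (φ (T.card + 1)).curryLeft (y S) (subfamily T x)) = if T = Sᶜ then
        sg k (crossing p S Sᶜ) • φ (Sᶜ.card + 1) (Fin.cons (y S) (subfamily Sᶜ x)) else 0 := by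
    intro T
    have := basis_mul_basis (k := k) (p := p) S T
    split_ifs at this with hd
    · rw [this, ← TensorProduct.smul_tmul', map_smul, coeff_basis]
      by_cases hT : T = Sᶜ
      · subst hT; simp
      · have : S ∪ T ≠ Finset.univ := fun h => hT (by
          ext i
          have h1 := Finset.ext_iff.1 h i
          have h2 : i ∈ S → i ∉ T := fun h => Finset.disjoint_left.1 hd h
          simp only [Finset.mem_union, Finset.mem_univ, iff_true, Finset.mem_compl] at h1 ⊢
          tauto)
        simp [hT, this]
    · rw [this, TensorProduct.zero_tmul, map_zero, if_neg]
      rintro rfl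
      exact hd disjoint_compl_right
  simp only [h4, smul_ite, smul_zero, Finset.sum_ite_eq', Finset.mem_univ, if_true]
  rw [frontSign_eq, smul_smul, smul_smul, smul_smul, ← sg_add, ← sg_add, ← sg_add]
  congr 2
  rw [← parity_compl S, ← Finset.union_compl S, pairs_union disjoint_compl_right]
  linear_combination (0 : ZMod 2) * two_zmod_two

/-- Turns sums over pairs of blocks into sums over pairs of indices, where the exponents of a
decomposition can be compared. -/
theorem sum_fibers {r : ℕ} (c : Fin n → Fin r) (P : Fin r → Fin r → Prop)
    [∀ i j, Decidable (P i j)] (h : Fin n → Fin n → ZMod 2) :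
    (∑ j, ∑ j', if P j j' then ∑ a with c a = j, ∑ b with c b = j', h a b else 0) =
      ∑ a, ∑ b, if P (c a) (c b) then h a b else 0 := by
  rw [← Finset.sum_fiberwise Finset.univ c]
  refine Finset.sum_congr rfl fun j _ => ?_
  have : ∀ a, (∑ b, if P (c a) (c b) then h a b else 0) =
      ∑ j', ∑ b with c b = j', if P (c a) (c b) then h a b else 0 :=
    fun a => (Finset.sum_fiberwise Finset.univ c _).symm
  simp only [this]
  rw [Finset.sum_comm]
  refine Finset.sum_congr rfl fun j' _ => ?_
  have h2 : ∀ a ∈ Finset.univ.filter (fun a => c a = j),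
      (∑ b with c b = j', if P (c a) (c b) then h a b else 0) =
        if P j j' then ∑ b with c b = j', h a b else 0 := by
    intro a ha
    rw [(Finset.mem_filter.1 ha).2]
    split_ifs with hP
    · exact Finset.sum_congr rfl fun b hb => by rw [(Finset.mem_filter.1 hb).2, if_pos hP]
    · exact Finset.sum_eq_zero fun b hb => by rw [(Finset.mem_filter.1 hb).2, if_neg hP]
  rw [Finset.sum_congr rfl h2]
  split_ifs <;> simp

/-- The coefficient of the product of all generators in a composition. -/
theorem coeff_comp {G : SuperStructure k W} (q : ZMod 2) {r : ℕ}
    (ψ : MultilinearMap k (fun _ : Fin r => W) Y) {y : Finset (Fin n) → W}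
    (hy : ∀ S, G.IsHom (parity p S) (y S)) :
    coeff k p Y Finset.univ (extendScalars (cdga k p) G q ψ fun _ =>
      ∑ S, sg k (pairs p S) • ((basis k p S : (cdga k p).carrier) ⊗ₜ[k] y S)) =
    sg k (q * parity p Finset.univ + pairs p Finset.univ) •
      ∑ c : Fin n → Fin r, koszul k c p •
        ψ fun j => y (Finset.univ.filter fun i => c i = j) := by
  classical
  rw [MultilinearMap.map_sum, map_sum, Finset.smul_sum]
  symm
  -- The tuples of subsets whose monomials multiply to a multiple of the top one are the ordered
  -- decompositions into blocks, possibly empty, that is, the fibres of maps `c`. All other tuples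
  -- contribute zero.
  refine Fintype.sum_of_injective (fun (c : Fin n → Fin r) (j : Fin r) =>
    Finset.univ.filter fun i => c i = j) ?_ _ _ ?_ ?_
  · intro c c' h
    funext i
    have := Finset.ext_iff.1 (congrFun h (c i)) i
    simpa [eq_comm] using this
  · intro S hS
    rw [MultilinearMap.map_smul_univ, extendScalars_tmul G q ψ (fun j => isHom_basis (S j)) (fun j => hy (S j)),
      list_prod_basis]
    split_ifs with hd
    · rw [← TensorProduct.smul_tmul', map_smul, map_smul, map_smul, coeff_basis, if_neg, smul_zero, smul_zero, smul_zero]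
      intro hU
      refine hS ?_
      have h1 : ∀ i, ∃ j, i ∈ S j := fun i => by
        have := Finset.ext_iff.1 hU i
        simpa using this
      choose c hc using h1
      refine ⟨c, funext fun j => ?_⟩
      ext i
      simp only [Finset.mem_filter, Finset.mem_univ, true_and]
      refine ⟨fun h => h ▸ hc i, fun h => ?_⟩
      rcases lt_trichotomy (c i) j with h1 | h1 | h1
      · exact absurd h (Finset.disjoint_left.1 (hd _ _ h1) (hc i))
      · exact h1
      · exact absurd (hc i) (Finset.disjoint_left.1 (hd _ _ h1) h)
    · rw [TensorProduct.zero_tmul, smul_zero, smul_zero, map_zero]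
  · intro c
    rw [MultilinearMap.map_smul_univ, extendScalars_tmul G q ψ (fun j => isHom_basis _) (fun j => hy _),
      list_prod_basis, if_pos]
    · rw [← TensorProduct.smul_tmul', map_smul, map_smul, map_smul, coeff_basis, if_pos, koszul_eq, smul_smul, smul_smul, smul_smul,
        ← sg_sum, ← sg_add, ← sg_add, ← sg_add]
      · congr 2
        have e1 : ∑ j, pairs p (Finset.univ.filter fun i => c i = j) =
            ∑ a, ∑ b, if c a = c b then (if a < b then p a * p b else 0) else 0 := by
          rw [← sum_fibers c (fun j j' => j = j')]
          simp [pairs]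
        have e2 : (∑ i, ∑ j, if i < j then crossing p (Finset.univ.filter fun a => c a = i)
            (Finset.univ.filter fun a => c a = j) else 0) =
            ∑ b, ∑ a, if c a < c b then (if b < a then p a * p b else 0) else 0 := by
          rw [Finset.sum_comm (s := (Finset.univ : Finset (Fin n))), ← sum_fibers c (fun j j' => j < j')]
          rfl
        have e3 : (∑ i, ∑ j, if i < j then parity p (Finset.univ.filter fun a => c a = i) *
            parity p (Finset.univ.filter fun a => c a = j) else 0) =
            ∑ a, ∑ b, if a < b then (if c a < c b then p a * p b else 0) +
              (if c b < c a then p b * p a else 0) else 0 := by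
          simp only [parity, Finset.sum_mul_sum]
          rw [sum_fibers c (fun j j' => j < j') (fun a b => p a * p b), sum_pairs _ (by simp)]
        have e4 : ∑ j, q * parity p (Finset.univ.filter fun i => c i = j) =
            q * parity p Finset.univ := by
          rw [← Finset.mul_sum, parity, ← Finset.sum_fiberwise Finset.univ c]
          rfl
        -- For `a < b` there are three cases: the same block, blocks in the same order, blocks in
        -- the opposite order. In the last case the two terms on the right correspond to reordering
        -- the blocks and to passing coefficients across values.
        have e5 : pairs p Finset.univ + (∑ i, ∑ j, if i < j ∧ c j < c i then p i * p j else 0) =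
            (∑ a, ∑ b, if c a = c b then (if a < b then p a * p b else 0) else 0) +
            (∑ a, ∑ b, if a < b then (if c a < c b then p a * p b else 0) +
              (if c b < c a then p b * p a else 0) else 0) +
            ∑ b, ∑ a, if c a < c b then (if b < a then p a * p b else 0) else 0 := by
          simp only [pairs, ← Finset.sum_add_distrib]
          refine Finset.sum_congr rfl fun a _ => Finset.sum_congr rfl fun b _ => ?_
          by_cases hab : a < b
          · rcases lt_trichotomy (c a) (c b) with h | h | h
            · simp [hab, h, h.not_gt, h.ne]
            · simp [hab, h]
            · simp [hab, h, h.not_gt, h.ne', mul_comm]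
          · simp [hab]
        rw [e1, e2, e3, e4]
        linear_combination e5
      · ext i
        simp
    · intro i j hij
      rw [Finset.disjoint_left]
      intro a ha hb
      simp only [Finset.mem_filter, Finset.mem_univ, true_and] at ha hb
      exact hij.ne (ha.symm.trans hb)

end Grass

/-! ## Power series defined by symmetric maps -/

section Series

variable {k : Type u} [Field k] [CharZero k]
variable {W : Type*} [AddCommGroup W] [Module k W] {Y : Type*} [AddCommGroup Y] [Module k Y]

/-- The series `∑ 1/n! φ_n(ζ, …, ζ)`. -/
def ser (G : SuperStructure k W) (R : ArtinCdga k) (q : ZMod 2)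
    (φ : (n : ℕ) → MultilinearMap k (fun _ : Fin n => W) Y) (ζ : R.carrier ⊗[k] W) :
    R.carrier ⊗[k] Y :=
  ∑ᶠ n : ℕ, ((n.factorial : k)⁻¹) • extendScalars R G q (φ n) (fun _ => ζ)

/-- The derivative `∑ 1/n! φ_{n+1}(v, ζ, …, ζ)`. -/
def dser (G : SuperStructure k W) (R : ArtinCdga k) (q : ZMod 2)
    (φ : (n : ℕ) → MultilinearMap k (fun _ : Fin n => W) Y) (ζ v : R.carrier ⊗[k] W) :
    R.carrier ⊗[k] Y :=
  ∑ᶠ n : ℕ, ((n.factorial : k)⁻¹) • extendScalars R G q (φ (n + 1)) (Fin.cons v fun _ => ζ)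

/-- Elements of parity `e` of `A_+ ⊗ W`. -/
structure AugHom (G : SuperStructure k W) (R : ArtinCdga k) (e : ZMod 2)
    (ζ : R.carrier ⊗[k] W) : Prop where
  hom : (tot R G).IsHom e ζ
  aug : R.aug.toLinearMap.rTensor W ζ = 0

theorem AugHom.neg {G : SuperStructure k W} {R : ArtinCdga k} {e : ZMod 2}
    {ζ : R.carrier ⊗[k] W} (h : AugHom G R e ζ) : AugHom G R e (-ζ) :=
  ⟨h.hom.neg, by rw [map_neg, h.aug, neg_zero]⟩

variable {G : SuperStructure k W} {R : ArtinCdga k} {q : ZMod 2}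
variable {φ : (n : ℕ) → MultilinearMap k (fun _ : Fin n => W) Y} {ζ v : R.carrier ⊗[k] W}

theorem finsum_eq_sum_range {M : Type*} [AddCommMonoid M] (f : ℕ → M) (N : ℕ)
    (h : ∀ n ≥ N, f n = 0) : ∑ᶠ n, f n = ∑ n ∈ Finset.range N, f n := by
  refine finsum_eq_sum_of_support_subset f fun n hn => ?_
  by_contra h'
  exact hn (h n (by simpa using h'))

/-- All products of at least `N` elements of the augmentation ideal vanish. -/
def NilBound (R : ArtinCdga k) (N : ℕ) : Prop :=
  ∀ n ≥ N, ∀ a : Fin n → R.carrier, (∀ i, R.aug (a i) = 0) → (List.ofFn a).prod = 0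

theorem NilBound.mono {N N' : ℕ} (h : NilBound R N) (hN : N ≤ N') : NilBound R N' :=
  fun n hn => h n (hN.trans hn)

theorem ser_eq_sum {N : ℕ} (hN : NilBound R N) (hζ : AugHom G R 0 ζ) :
    ser G R q φ ζ = ∑ n ∈ Finset.range N,
      ((n.factorial : k)⁻¹) • extendScalars R G q (φ n) (fun _ => ζ) :=
  finsum_eq_sum_range _ N fun n hn => by
    rw [extendScalars_eq_zero G q hN hn _ (fun _ => hζ.hom) fun _ => hζ.aug, smul_zero]

theorem cons_isHom {e : ZMod 2} (hv : (tot R G).IsHom e v) (hζ : (tot R G).IsHom 0 ζ) {n : ℕ} :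
    ∀ i, (tot R G).IsHom ((Fin.cons e fun _ => 0 : Fin (n + 1) → ZMod 2) i)
      ((Fin.cons v fun _ => ζ : Fin (n + 1) → R.carrier ⊗[k] W) i) := by
  intro i
  induction i using Fin.cases with
  | zero => simpa using hv
  | succ i => simpa using hζ

theorem cons_orthogonal (e : ZMod 2) {n : ℕ} (i j : Fin (n + 1)) (h : i ≠ j) :
    (Fin.cons e fun _ => 0 : Fin (n + 1) → ZMod 2) i *
      (Fin.cons e fun _ => 0 : Fin (n + 1) → ZMod 2) j = 0 := by
  induction i using Fin.cases with
  | zero =>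
    induction j using Fin.cases with
    | zero => exact absurd rfl h
    | succ j => simp
  | succ i => simp

theorem dser_eq_sum {N : ℕ} (hN : NilBound R N) (hζ : AugHom G R 0 ζ) {e : ZMod 2}
    (hv : AugHom G R e v) :
    dser G R q φ ζ v = ∑ n ∈ Finset.range N,
      ((n.factorial : k)⁻¹) • extendScalars R G q (φ (n + 1)) (Fin.cons v fun _ => ζ) :=
  finsum_eq_sum_range _ N fun n hn => by
    rw [extendScalars_eq_zero G q hN (hn.trans n.le_succ) _ (cons_isHom hv.hom hζ.hom), smul_zero]
    intro i
    induction i using Fin.cases with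
    | zero => simpa using hv.aug
    | succ i => simpa using hζ.aug

theorem ser_map {R' : ArtinCdga k} (f : R.carrier →ₐ[k] R'.carrier)
    (hf : ∀ a, f (R.par a) = R'.par (f a)) (hf' : ∀ a, R'.aug (f a) = R.aug a)
    (hζ : AugHom G R 0 ζ) :
    f.toLinearMap.rTensor Y (ser G R q φ ζ) = ser G R' q φ (f.toLinearMap.rTensor W ζ) ∧
      AugHom G R' 0 (f.toLinearMap.rTensor W ζ) := by
  have h1 : ∀ e z, (tot R G).IsHom e z → (tot R' G).IsHom e (f.toLinearMap.rTensor W z) := by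
    intro e z hz
    have h : (tot R' G).par ∘ₗ f.toLinearMap.rTensor W = f.toLinearMap.rTensor W ∘ₗ (tot R G).par :=
      TensorProduct.ext' fun a x => by simp [tot, hf]
    have h2 := LinearMap.congr_fun h z
    have h3 : (tot R G).par z = sg k e • z := hz
    simp only [LinearMap.comp_apply, h3, map_smul] at h2
    exact h2
  have h2 : AugHom G R' 0 (f.toLinearMap.rTensor W ζ) := by
    refine ⟨h1 _ _ hζ.hom, ?_⟩
    rw [← LinearMap.comp_apply, ← LinearMap.rTensor_comp,
      show R'.aug.toLinearMap ∘ₗ f.toLinearMap = R.aug.toLinearMap from LinearMap.ext hf', hζ.aug]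
  refine ⟨?_, h2⟩
  obtain ⟨N, hN⟩ := R.exists_nilp
  obtain ⟨N', hN'⟩ := R'.exists_nilp
  rw [ser_eq_sum (NilBound.mono (N' := N + N') hN (by omega)) hζ,
    ser_eq_sum (NilBound.mono (N' := N + N') hN' (by omega)) h2, map_sum]
  refine Finset.sum_congr rfl fun n _ => ?_
  rw [map_smul, extendScalars_map f hf]

theorem dser_map {R' : ArtinCdga k} (f : R.carrier →ₐ[k] R'.carrier)
    (hf : ∀ a, f (R.par a) = R'.par (f a)) (hf' : ∀ a, R'.aug (f a) = R.aug a)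
    (hζ : AugHom G R 0 ζ) {e : ZMod 2} (hv : AugHom G R e v)
    (hv' : AugHom G R' e (f.toLinearMap.rTensor W v)) :
    f.toLinearMap.rTensor Y (dser G R q φ ζ v) =
      dser G R' q φ (f.toLinearMap.rTensor W ζ) (f.toLinearMap.rTensor W v) := by
  have h2 := (ser_map (q := q) (φ := φ) f hf hf' hζ).2
  obtain ⟨N, hN⟩ := R.exists_nilp
  obtain ⟨N', hN'⟩ := R'.exists_nilp
  rw [dser_eq_sum (NilBound.mono (N' := N + N') hN (by omega)) hζ hv,
    dser_eq_sum (NilBound.mono (N' := N + N') hN' (by omega)) h2 hv', map_sum]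
  refine Finset.sum_congr rfl fun n _ => ?_
  rw [map_smul, extendScalars_map f hf]
  congr 2
  funext i
  induction i using Fin.cases with
  | zero => simp
  | succ i => simp

theorem dser_neg (v : R.carrier ⊗[k] W) : dser G R q φ ζ (-v) = -dser G R q φ ζ v := by
  rw [dser, dser, ← finsum_neg_distrib]
  refine finsum_congr fun n => ?_
  have := map_neg (extendScalars R G q (φ (n + 1))).curryLeft v
  have h : extendScalars R G q (φ (n + 1)) (Fin.cons (-v) fun _ => ζ) =
      -extendScalars R G q (φ (n + 1)) (Fin.cons v fun _ => ζ) :=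
    congrArg (fun F => F fun _ => ζ) this
  rw [h, smul_neg]

/-- Symmetric maps on one element of any parity and otherwise even elements. -/
theorem extendScalars_update {n : ℕ} {f : MultilinearMap k (fun _ : Fin (n + 1) => W) Y}
    (hf : ∀ σ, act G σ f = f) {e : ZMod 2} (hv : (tot R G).IsHom e v)
    (hζ : (tot R G).IsHom 0 ζ) (j : Fin (n + 1)) :
    extendScalars R G q f (Function.update (fun _ => ζ) j v) =
      extendScalars R G q f (Fin.cons v fun _ => ζ) := by
  have h1 : Function.update (fun _ => ζ) j v =
      (Fin.cons v fun _ => ζ : Fin (n + 1) → R.carrier ⊗[k] W) ∘ Equiv.swap 0 j := by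
    funext i
    by_cases hi : i = j
    · subst hi; simp
    · rw [Function.update_of_ne hi]
      by_cases h0 : i = 0
      · subst h0
        have : j ≠ 0 := fun h => hi h.symm
        obtain ⟨j, rfl⟩ := Fin.exists_succ_eq.2 this
        simp
      · rw [Function.comp, Equiv.swap_apply_of_ne_of_ne h0 hi]
        obtain ⟨i, rfl⟩ := Fin.exists_succ_eq.2 h0
        simp
  rw [h1, ← extendScalars_perm G q _ f (cons_isHom hv hζ) (cons_orthogonal e), hf]

/-- This is `n / n! = 1 / (n - 1)!`; the term with `n = 0` drops out. It shifts the index when an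
exponential series is differentiated. -/
theorem sum_range_succ_factorial {M : Type*} [AddCommGroup M] [Module k M] (f : ℕ → M) (N : ℕ) :
    ∑ n ∈ Finset.range (N + 1), ((n.factorial : k)⁻¹) • ((n : k) • f n) =
      ∑ n ∈ Finset.range N, ((n.factorial : k)⁻¹) • f (n + 1) := by
  rw [Finset.sum_range_succ']
  simp only [Nat.cast_zero, zero_smul, smul_zero, add_zero]
  refine Finset.sum_congr rfl fun n _ => ?_
  rw [smul_smul]
  congr 1
  rw [Nat.factorial_succ]
  have h1 : ((n + 1 : ℕ) : k) ≠ 0 := by exact_mod_cast n.succ_ne_zero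
  have h2 : (n.factorial : k) ≠ 0 := by exact_mod_cast n.factorial_ne_zero
  push_cast at *
  field_simp

theorem augHom_d (hζ : AugHom G R 0 ζ) : AugHom G R 1 (R.d.rTensor W ζ) := by
  constructor
  · have h : (tot R G).par ∘ₗ R.d.rTensor W = -(R.d.rTensor W ∘ₗ (tot R G).par) :=
      TensorProduct.ext' fun a x => by simp [tot, R.d_par, TensorProduct.neg_tmul]
    have h1 := LinearMap.congr_fun h ζ
    have h2 : (tot R G).par ζ = sg k 0 • ζ := hζ.hom
    simp only [LinearMap.comp_apply, LinearMap.neg_apply, h2, sg_zero, one_smul] at h1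
    rw [SuperStructure.IsHom, h1, sg_one, neg_smul, one_smul]
  · rw [← LinearMap.comp_apply, ← LinearMap.rTensor_comp,
      show R.aug.toLinearMap ∘ₗ R.d = 0 from LinearMap.ext R.aug_d]
    simp

/-- Chain rule: by symmetry the `n` terms of the Leibniz rule in degree `n` coincide, and the factor
`n` lowers the factorial. -/
theorem d_ser (hφ : ∀ n (σ : Equiv.Perm (Fin n)), act G σ (φ n) = φ n) (hζ : AugHom G R 0 ζ) :
    R.d.rTensor Y (ser G R q φ ζ) = sg k q • dser G R q φ ζ (R.d.rTensor W ζ) := by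
  obtain ⟨N, hN⟩ := R.exists_nilp
  rw [ser_eq_sum (NilBound.mono (N' := N + 1) hN (by omega)) hζ, dser_eq_sum hN hζ (augHom_d hζ),
    map_sum]
  have key := sum_range_succ_factorial (k := k) (fun n => match n with
      | 0 => 0
      | n + 1 => extendScalars R G q (φ (n + 1)) (Fin.cons (R.d.rTensor W ζ) fun _ => ζ)) N
  refine Eq.trans ?_ (congrArg (sg k q • ·) key)
  simp only [Finset.smul_sum]
  refine Finset.sum_congr rfl fun n _ => ?_
  rw [map_smul, d_extendScalars G q _ fun _ => hζ.hom, smul_comm]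
  congr 2
  cases n with
  | zero => simp
  | succ n =>
    simp only [extendScalars_update (hφ _) (augHom_d hζ).hom hζ.hom, Finset.sum_const,
      Finset.card_univ, Fintype.card_fin, Nat.cast_smul_eq_nsmul]

theorem augHom_ser {H : SuperStructure k Y}
    (hφ : ∀ n x, H.par (φ n x) = sg k q • φ n (fun i => G.par (x i))) (h0 : φ 0 = 0)
    (hζ : AugHom G R 0 ζ) : AugHom H R q (ser G R q φ ζ) := by
  obtain ⟨N, hN⟩ := R.exists_nilp
  rw [ser_eq_sum hN hζ]
  constructor
  · refine Finset.sum_induction _ ((tot R H).IsHom q) (fun _ _ => SuperStructure.IsHom.add)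
      (isHom_zero _ _) fun n _ => SuperStructure.IsHom.smul ?_ _
    have := extendScalars_isHom G H q (hφ n) (fun _ => hζ.hom)
    simpa using this
  · rw [map_sum]
    refine Finset.sum_eq_zero fun n _ => ?_
    rw [map_smul]
    cases n with
    | zero =>
      have : extendScalars R G q (φ 0) = 0 := by
        rw [h0]
        refine multilinear_tensor_ext G fun α p a x ha hx => ?_
        rw [extendScalars_tmul G q _ ha hx]
        simp
      rw [this]; simp
    | succ n => rw [aug_extendScalars G q _ (fun _ => hζ.hom) 0 hζ.aug, smul_zero]

end Series

/-! ## Identities between multilinear maps from identities between series -/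

section Polarize

variable {k : Type u} [Field k] [CharZero k]
variable {W : Type*} [AddCommGroup W] [Module k W] {Y : Type*} [AddCommGroup Y] [Module k Y]
variable {n : ℕ} {p : Fin n → ZMod 2} {x : Fin n → W} {G : SuperStructure k W}

theorem nilBound_grass : NilBound (Grass.cdga k p) (n + 1) := fun m hm a ha =>
  (Grass.basis k p).ext_elem fun S =>
    (Grass.coord_list_prod _ (fun b hb => by obtain ⟨i, rfl⟩ := List.mem_ofFn.1 hb; exact ha i) S
      (by rw [List.length_ofFn]; exact (Nat.lt_succ_of_le (by simpa using S.card_le_univ)).trans_le hm)).trans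
      (by simp)

theorem augHom_generic (hx : ∀ i, G.IsHom (p i) (x i)) :
    AugHom G (Grass.cdga k p) 0 (Grass.generic p x) :=
  ⟨Grass.isHom_generic hx, Grass.aug_generic x⟩

theorem ser_generic (q : ZMod 2) {φ : (m : ℕ) → MultilinearMap k (fun _ : Fin m => W) Y}
    (hφ : ∀ m (σ : Equiv.Perm (Fin m)), act G σ (φ m) = φ m) (hx : ∀ i, G.IsHom (p i) (x i)) :
    ser G (Grass.cdga k p) q φ (Grass.generic p x) = ∑ S : Finset (Fin n),
      sg k (q * Grass.parity p S + Grass.pairs p S) •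
        ((Grass.basis k p S : (Grass.cdga k p).carrier) ⊗ₜ[k] φ S.card (subfamily S x)) := by
  rw [ser_eq_sum nilBound_grass (augHom_generic hx), Grass.sum_generic q hφ hx]

theorem isHom_subfamily {H : SuperStructure k Y} {q : ZMod 2}
    {φ : (m : ℕ) → MultilinearMap k (fun _ : Fin m => W) Y}
    (hφ : ∀ n x, H.par (φ n x) = sg k q • φ n (fun i => G.par (x i)))
    (hx : ∀ i, G.IsHom (p i) (x i)) (S : Finset (Fin n)) :
    H.IsHom (Grass.parity p S + q) (φ S.card (subfamily S x)) := by
  have h1 : ∀ i, G.par (subfamily S x i) = sg k (p (S.orderEmbOfFin rfl i)) • subfamily S x i :=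
    fun i => hx _
  have hs : ∑ j, p (S.orderEmbOfFin rfl j) = Grass.parity p S := by
    rw [Grass.parity]
    conv_rhs => rw [← Finset.map_orderEmbOfFin_univ S rfl, Finset.sum_map]
    rfl
  rw [SuperStructure.IsHom, hφ]
  simp only [h1]
  rw [MultilinearMap.map_smul_univ, ← sg_sum, hs, smul_smul, ← sg_add, add_comm]

/-- Polarization: evaluate `H` at the generic element over the Grassmann algebra and take the
coefficient of the product of all generators. By `coeff_derivative` this is the Jacobi sum up to one
overall sign. -/
theorem linfty_jacobi_of_ser {m : (n : ℕ) → MultilinearMap k (fun _ : Fin n => W) W}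
    (hm : ∀ n x, G.par (m n x) = -m n (fun i => G.par (x i))) (h0 : m 0 = 0)
    (hs : ∀ n (σ : Equiv.Perm (Fin n)), act G σ (m n) = m n)
    (H : ∀ (R : ArtinCdga k) (ζ : R.carrier ⊗[k] W), AugHom G R 0 ζ →
      dser G R 1 m ζ (ser G R 1 m ζ) = 0) (hx : ∀ i, G.IsHom (p i) (x i)) :
    ∑ S : Finset (Fin n), frontSign k S p •
      m (Sᶜ.card + 1) (Fin.cons (m S.card (subfamily S x)) (subfamily Sᶜ x)) = 0 := by
  have hm' : ∀ n x, G.par (m n x) = sg k 1 • m n (fun i => G.par (x i)) := fun n x => by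
    rw [hm, sg_one, neg_smul, one_smul]
  have h1 := H (Grass.cdga k p) _ (augHom_generic hx)
  rw [dser_eq_sum nilBound_grass (augHom_generic hx) (augHom_ser hm' h0 (augHom_generic hx)),
    ser_generic 1 hs hx] at h1
  have h2 := Grass.coeff_derivative 1 hs hx (y := fun S => m S.card (subfamily S x))
    fun S => isHom_subfamily hm' hx S
  simp only [one_mul] at h1
  rw [h1, map_zero] at h2
  exact sg_smul_cancel _ (h2.symm.trans (smul_zero _).symm)

/-- The inner series is a sum over subsets by `ser_generic`; substituting it into `ψ r` and keeping
the top monomial leaves the ordered decompositions that index `compVal`. -/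
theorem coeff_ser_comp {W₁ : Type*} [AddCommGroup W₁] [Module k W₁] {G₁ : SuperStructure k W₁}
    (q : ZMod 2) {φ : (n : ℕ) → MultilinearMap k (fun _ : Fin n => W) W₁}
    (hφ : ∀ n x, G₁.par (φ n x) = φ n (fun i => G.par (x i))) (h0 : φ 0 = 0)
    (hs : ∀ n (σ : Equiv.Perm (Fin n)), act G σ (φ n) = φ n)
    (ψ : (n : ℕ) → MultilinearMap k (fun _ : Fin n => W₁) Y)
    (hx : ∀ i, G.IsHom (p i) (x i)) :
    Grass.coeff k p Y Finset.univ (ser G₁ (Grass.cdga k p) q ψ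
      (ser G (Grass.cdga k p) 0 φ (Grass.generic p x))) =
      sg k (q * Grass.parity p Finset.univ + Grass.pairs p Finset.univ) • compVal ψ φ p x := by
  have hφ' : ∀ n x, G₁.par (φ n x) = sg k 0 • φ n (fun i => G.par (x i)) := fun n x => by
    rw [hφ, sg_zero, one_smul]
  rw [ser_eq_sum nilBound_grass (augHom_ser hφ' h0 (augHom_generic hx)), ser_generic 0 hs hx,
    map_sum, compVal, Finset.smul_sum]
  refine Finset.sum_congr rfl fun r _ => ?_
  simp only [zero_mul, zero_add]
  rw [map_smul, Grass.coeff_comp q (ψ r) (y := fun S => φ S.card (subfamily S x)) fun S => by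
    simpa using isHom_subfamily hφ' hx S, smul_comm]

/-- Top coefficients of both sides of `H` at the generic element: the left one is given by
`coeff_derivative`, the right one by `coeff_ser_comp`, with the same overall sign. -/
theorem linfty_comm_of_ser {W₁ : Type*} [AddCommGroup W₁] [Module k W₁] {G₁ : SuperStructure k W₁}
    {m : (n : ℕ) → MultilinearMap k (fun _ : Fin n => W) W}
    (hm : ∀ n x, G.par (m n x) = -m n (fun i => G.par (x i))) (hm0 : m 0 = 0)
    (hms : ∀ n (σ : Equiv.Perm (Fin n)), act G σ (m n) = m n)
    {m₁ : (n : ℕ) → MultilinearMap k (fun _ : Fin n => W₁) W₁}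
    {φ : (n : ℕ) → MultilinearMap k (fun _ : Fin n => W) W₁}
    (hφ : ∀ n x, G₁.par (φ n x) = φ n (fun i => G.par (x i))) (h0 : φ 0 = 0)
    (hs : ∀ n (σ : Equiv.Perm (Fin n)), act G σ (φ n) = φ n)
    (H : ∀ (R : ArtinCdga k) (ζ : R.carrier ⊗[k] W), AugHom G R 0 ζ →
      dser G R 0 φ ζ (ser G R 1 m ζ) = ser G₁ R 1 m₁ (ser G R 0 φ ζ))
    (hx : ∀ i, G.IsHom (p i) (x i)) :
    ∑ S : Finset (Fin n), frontSign k S p •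
      φ (Sᶜ.card + 1) (Fin.cons (m S.card (subfamily S x)) (subfamily Sᶜ x)) =
        compVal m₁ φ p x := by
  have hm' : ∀ n x, G.par (m n x) = sg k 1 • m n (fun i => G.par (x i)) := fun n x => by
    rw [hm, sg_one, neg_smul, one_smul]
  have h1 := congrArg (Grass.coeff k p W₁ Finset.univ) (H (Grass.cdga k p) _ (augHom_generic hx))
  rw [coeff_ser_comp 1 hφ h0 hs m₁ hx, dser_eq_sum nilBound_grass (augHom_generic hx)
    (augHom_ser hm' hm0 (augHom_generic hx)), ser_generic 1 hms hx] at h1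
  have h2 := Grass.coeff_derivative 0 hs hx (y := fun S => m S.card (subfamily S x))
    fun S => isHom_subfamily hm' hx S
  simp only [one_mul] at h1
  rw [h1] at h2
  simp only [zero_add, one_mul] at h2
  exact (sg_smul_cancel _ h2).symm

theorem coeff_generic : Grass.coeff k p W Finset.univ (Grass.generic p x) = idVal x := by
  rw [Grass.generic, map_sum]
  rw [Finset.sum_congr rfl fun i _ => Grass.coeff_basis _ _ _]
  match n with
  | 0 => rfl
  | 1 =>
    simp [idVal]
  | n + 2 =>
    refine Finset.sum_eq_zero fun i _ => if_neg fun h => ?_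
    have := congrArg Finset.card h
    simp at this

theorem compVal_of_ser {φ ψ : (n : ℕ) → MultilinearMap k (fun _ : Fin n => W) W}
    (hφ : ∀ n x, G.par (φ n x) = φ n (fun i => G.par (x i))) (h0 : φ 0 = 0)
    (hs : ∀ n (σ : Equiv.Perm (Fin n)), act G σ (φ n) = φ n)
    (H : ∀ (R : ArtinCdga k) (ζ : R.carrier ⊗[k] W), AugHom G R 0 ζ →
      ser G R 0 ψ (ser G R 0 φ ζ) = ζ) (hx : ∀ i, G.IsHom (p i) (x i)) :
    compVal ψ φ p x = idVal x := by
  have h1 := congrArg (Grass.coeff k p W Finset.univ) (H (Grass.cdga k p) _ (augHom_generic hx))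
  rw [coeff_ser_comp 0 hφ h0 hs ψ hx, coeff_generic] at h1
  match n with
  | 0 =>
    simpa [Grass.parity, Grass.pairs, sg_zero] using h1
  | 1 => simpa [Grass.parity, Grass.pairs, sg_zero] using h1
  | n + 2 => exact sg_smul_cancel _ (h1.trans (smul_zero _).symm)

/-- The top coefficient of a series at the generic element recovers its component of arity `n` on
`x`, up to a sign common to both families. -/
theorem eq_of_ser_eq {φ ψ : (n : ℕ) → MultilinearMap k (fun _ : Fin n => W) Y}
    (q : ZMod 2) (hφ : ∀ n (σ : Equiv.Perm (Fin n)), act G σ (φ n) = φ n)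
    (hψ : ∀ n (σ : Equiv.Perm (Fin n)), act G σ (ψ n) = ψ n)
    (H : ∀ (n : ℕ) (p : Fin n → ZMod 2) (x : Fin n → W), (∀ i, G.IsHom (p i) (x i)) →
      ser G (Grass.cdga k p) q φ (Grass.generic p x) =
        ser G (Grass.cdga k p) q ψ (Grass.generic p x)) : φ = ψ := by
  funext n
  refine multilinear_ext_isHom G _ _ fun p x hx => ?_
  have h := congrArg (Grass.coeff k p Y Finset.univ) (H n p x hx)
  rw [ser_generic q hφ hx, ser_generic q hψ hx, map_sum, map_sum] at h
  rw [Finset.sum_congr rfl fun S _ => (map_smul _ _ _).trans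
      (congrArg _ (Grass.coeff_basis _ _ _)),
    Finset.sum_congr rfl fun S _ => (map_smul _ _ _).trans
      (congrArg _ (Grass.coeff_basis _ _ _))] at h
  simp only [smul_ite, smul_zero, Finset.sum_ite_eq',
    Finset.mem_univ, if_true] at h
  have h1 := sg_smul_cancel _ h
  -- The coefficient has arity `univ.card`, which is `n` only propositionally; the arity is
  -- transported for a general subset.
  have h2 : ∀ (φ : (n : ℕ) → MultilinearMap k (fun _ : Fin n => W) Y) (S : Finset (Fin n))
      (hS : S.card = n), φ S.card (subfamily S x) = φ n (x ∘ S.orderEmbOfFin hS) := by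
    intro φ S hS
    have : ∀ (m : ℕ) (hm : S.card = m), φ S.card (subfamily S x) = φ m (x ∘ S.orderEmbOfFin hm) := by
      rintro m rfl; rfl
    exact this n hS
  rw [h2 φ _ (by simp), h2 ψ _ (by simp)] at h1
  have h3 : ∀ h : (Finset.univ : Finset (Fin n)).card = n,
      x ∘ Finset.univ.orderEmbOfFin h = x := fun h => by
    rw [← Finset.orderEmbOfFin_unique h (f := id) (by simp) strictMono_id]
    rfl
  rwa [h3] at h1

end Polarize

/-! ## Maurer–Cartan elements -/

section MaurerCartan

variable {k : Type u} [Field k] [CharZero k] {W : Type*} [AddCommGroup W] [Module k W]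

theorem IsMC.augHom {L : LInftyData k W} {R : ArtinCdga k} {ξ : R.carrier ⊗[k] W}
    (h : IsMC L R ξ) : AugHom L.gr R 0 ξ :=
  ⟨by rw [SuperStructure.IsHom, sg_zero, one_smul]; exact h.even, h.mem⟩

theorem isMC_iff {L : LInftyData k W} {R : ArtinCdga k} {ξ : R.carrier ⊗[k] W} :
    IsMC L R ξ ↔ AugHom L.gr R 0 ξ ∧ R.d.rTensor W ξ + ser L.gr R 1 L.m ξ = 0 := by
  refine ⟨fun h => ⟨h.augHom, h.eqn⟩, fun h => ⟨?_, h.1.aug, h.2⟩⟩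
  have := h.1.hom
  rwa [SuperStructure.IsHom, sg_zero, one_smul] at this

theorem isMC_map {L : LInftyData k W} {R R' : ArtinCdga k} (F : ArtinCdga.Hom R R')
    {ξ : R.carrier ⊗[k] W} (h : IsMC L R ξ) : IsMC L R' (F.f.toLinearMap.rTensor W ξ) := by
  obtain ⟨h1, h2⟩ := isMC_iff.1 h
  have h3 := ser_map (q := 1) (φ := L.m) F.f F.par F.aug h1
  refine isMC_iff.2 ⟨h3.2, ?_⟩
  rw [← h3.1, ← LinearMap.comp_apply (LinearMap.rTensor W R'.d), ← LinearMap.rTensor_comp,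
    show R'.d ∘ₗ F.f.toLinearMap = F.f.toLinearMap ∘ₗ R.d from LinearMap.ext fun a => (F.d a).symm,
    LinearMap.rTensor_comp, LinearMap.comp_apply, ← map_add, h2, map_zero]

/-- Chain rule: with `Q` and `Q'` the series of structure maps, `d φ(ξ) = φ'(d ξ) = -φ'(Q(ξ)) =
-Q'(φ(ξ))`. -/
theorem isMC_pushMC {L L' : LInftyData k W}
    {φ : (n : ℕ) → MultilinearMap k (fun _ : Fin n => W) W}
    (hφ : ∀ n x, L'.gr.par (φ n x) = φ n (fun i => L.gr.par (x i))) (h0 : φ 0 = 0)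
    (hs : ∀ n (σ : Equiv.Perm (Fin n)), act L.gr σ (φ n) = φ n)
    (H : ∀ (R : ArtinCdga k) (ζ : R.carrier ⊗[k] W), AugHom L.gr R 0 ζ →
      dser L.gr R 0 φ ζ (ser L.gr R 1 L.m ζ) = ser L'.gr R 1 L'.m (ser L.gr R 0 φ ζ))
    {R : ArtinCdga k} {ξ : R.carrier ⊗[k] W} (h : IsMC L R ξ) : IsMC L' R (pushMC L φ R ξ) := by
  obtain ⟨h1, h2⟩ := isMC_iff.1 h
  change IsMC L' R (ser L.gr R 0 φ ξ)
  refine isMC_iff.2 ⟨augHom_ser (fun n x => by rw [hφ, sg_zero, one_smul]) h0 h1, ?_⟩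
  rw [d_ser hs h1, sg_zero, one_smul, eq_neg_of_add_eq_zero_left h2, dser_neg, H R ξ h1,
    neg_add_cancel]

/-- The inclusion `a ↦ a` into the cone. -/
def coneIncl (R : ArtinCdga k) : R.carrier →ₗ[k] (cone R).carrier where
  toFun a := coneMk a 0 (by simp)
  map_add' a b := cone_ext (by simp [coneMk]) (by simp [coneMk])
  map_smul' c a := cone_ext (by simp [coneMk]) (by simp [coneMk])

/-- The map `b ↦ ε b` into the cone. -/
def coneEps (R : ArtinCdga k) : R.carrier →ₗ[k] (cone R).carrier where
  -- The cone contains `ε b` only for `b` in the augmentation ideal. Subtracting the augmentation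
  -- makes the map total and changes nothing on that ideal.
  toFun b := coneMk 0 (b - algebraMap k R.carrier (R.aug b)) (by simp)
  map_add' a b := cone_ext (by simp [coneMk]) (by simp [coneMk]; abel)
  map_smul' c a := cone_ext (by simp [coneMk]) (by
    change c • a - algebraMap k R.carrier (R.aug (c • a)) =
      c • (a - algebraMap k R.carrier (R.aug a))
    simp [Algebra.smul_def, mul_sub])

/-- An element of the cone is determined by its own projection to `A` and that of its differential,
so an equation over the cone can be checked on these two projections. -/
theorem cone_decomp (R : ArtinCdga k) : (LinearMap.id : (cone R).carrier →ₗ[k] (cone R).carrier) =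
    coneIncl R ∘ₗ (coneProj R).toLinearMap +
      coneEps R ∘ₗ (coneProj R).toLinearMap ∘ₗ (cone R).d := by
  refine LinearMap.ext fun M => cone_ext ?_ ?_
  · change M.1 1 1 = M.1 1 1 + 0
    rw [add_zero]
  · change M.1 0 1 = 0 + ((coneD R M).1 1 1 - algebraMap k R.carrier (R.aug ((coneD R M).1 1 1)))
    rw [coneD_one_one, M.2.2.2]
    simp

/-- The lift is `z = ζ - ε Q(ζ)` with `Q` the series of structure maps. Its Maurer–Cartan expression
projects to `-Q(ζ) + Q(ζ) = 0`, and the differential of that expression projects to the derivative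
of `Q` at `ζ` in the direction `Q(ζ)`, which vanishes by `H`. By `cone_decomp` nothing else has to
be checked. -/
theorem exists_isMC_cone {L : LInftyData k W}
    (hm : ∀ n x, L.gr.par (L.m n x) = -L.m n (fun i => L.gr.par (x i))) (h0 : L.m 0 = 0)
    (hs : ∀ n (σ : Equiv.Perm (Fin n)), act L.gr σ (L.m n) = L.m n)
    (H : ∀ (R : ArtinCdga k) (ζ : R.carrier ⊗[k] W), AugHom L.gr R 0 ζ →
      dser L.gr R 1 L.m ζ (ser L.gr R 1 L.m ζ) = 0)
    {R : ArtinCdga k} {ζ : R.carrier ⊗[k] W} (hζ : AugHom L.gr R 0 ζ) :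
    ∃ z : (cone R).carrier ⊗[k] W, IsMC L (cone R) z ∧
      (coneProj R).toLinearMap.rTensor W z = ζ := by
  have hQ : AugHom L.gr R 1 (ser L.gr R 1 L.m ζ) :=
    augHom_ser (fun n x => by rw [hm, sg_one, neg_smul, one_smul]) h0 hζ
  set Q := ser L.gr R 1 L.m ζ with hQdef
  set π := (coneProj R).toLinearMap with hπ
  have hπj : π ∘ₗ coneIncl R = LinearMap.id := rfl
  have hπe : π ∘ₗ coneEps R = 0 := rfl
  have hdj : (cone R).d ∘ₗ coneIncl R = 0 := LinearMap.ext fun a => cone_ext rfl rfl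
  have hde : π ∘ₗ (cone R).d ∘ₗ coneEps R =
    LinearMap.id - Algebra.linearMap k R.carrier ∘ₗ R.aug.toLinearMap := rfl
  have haj : (cone R).aug.toLinearMap ∘ₗ coneIncl R = R.aug.toLinearMap := rfl
  have hae : (cone R).aug.toLinearMap ∘ₗ coneEps R = 0 := LinearMap.ext fun a => map_zero R.aug
  have hpj : (cone R).par.toLinearMap ∘ₗ coneIncl R = coneIncl R ∘ₗ R.par.toLinearMap :=
    LinearMap.ext fun a => cone_ext rfl (by
      change (conePar R (coneMk a 0 (by simp))).1 0 1 = 0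
      rw [conePar_zero_one]
      simp [coneMk])
  have hpe : (cone R).par.toLinearMap ∘ₗ coneEps R = -(coneEps R ∘ₗ R.par.toLinearMap) :=
    LinearMap.ext fun a => cone_ext (by
      change R.par 0 = -0
      simp) (by
      change (conePar R (coneMk 0 (a - algebraMap k R.carrier (R.aug a)) (by simp))).1 0 1 =
        -(R.par a - algebraMap k R.carrier (R.aug (R.par a)))
      rw [conePar_zero_one]
      simp [coneMk, R.aug_par])
  have hc : ∀ {A B C : Type u} [AddCommGroup A] [Module k A] [AddCommGroup B] [Module k B]
      [AddCommGroup C] [Module k C] (f : A →ₗ[k] B) (g : B →ₗ[k] C) (y : A ⊗[k] W),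
      g.rTensor W (f.rTensor W y) = (g ∘ₗ f).rTensor W y := by
    intro A B C _ _ _ _ _ _ f g y
    rw [LinearMap.rTensor_comp]; rfl
  set z := (coneIncl R).rTensor W ζ - (coneEps R).rTensor W Q with hz
  have hπz : π.rTensor W z = ζ := by
    rw [hz, map_sub, hc, hc, hπj, hπe]
    simp
  have hzA : AugHom L.gr (cone R) 0 z := by
    constructor
    · have e1 : (tot (cone R) L.gr).par ∘ₗ (coneIncl R).rTensor W =
          (coneIncl R).rTensor W ∘ₗ (tot R L.gr).par := TensorProduct.ext' fun a x => by
        have := LinearMap.congr_fun hpj a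
        simp only [LinearMap.comp_apply, AlgHom.toLinearMap_apply] at this
        simp [tot, this]
      have e2 : (tot (cone R) L.gr).par ∘ₗ (coneEps R).rTensor W =
          (coneEps R).rTensor W ∘ₗ ((-1 : k) • (tot R L.gr).par) := TensorProduct.ext' fun a x => by
        have := LinearMap.congr_fun hpe a
        simp only [LinearMap.comp_apply, AlgHom.toLinearMap_apply, LinearMap.neg_apply] at this
        simp only [LinearMap.comp_apply, LinearMap.rTensor_tmul, LinearMap.smul_apply, tot,
          TensorProduct.map_tmul, AlgHom.toLinearMap_apply, this]
        rw [neg_one_smul, ← TensorProduct.neg_tmul, LinearMap.rTensor_tmul, map_neg]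
      have e3 := LinearMap.congr_fun e1 ζ
      have e4 := LinearMap.congr_fun e2 Q
      have e5 : (tot R L.gr).par ζ = sg k 0 • ζ := hζ.hom
      have e6 : (tot R L.gr).par Q = sg k 1 • Q := hQ.hom
      simp only [LinearMap.comp_apply, LinearMap.smul_apply, e5, e6, map_smul] at e3 e4
      rw [SuperStructure.IsHom, hz, map_sub, e3, e4, sg_one, sg_zero, smul_smul]
      norm_num
    · rw [hz, map_sub, hc, hc, haj, hae, hζ.aug]
      simp
  have hπdz : π.rTensor W ((cone R).d.rTensor W z) = -Q := by
    have h1 : (LinearMap.id - Algebra.linearMap k R.carrier ∘ₗ R.aug.toLinearMap).rTensor W Q = Q := by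
      rw [LinearMap.rTensor_sub, LinearMap.rTensor_comp]
      simp [hQ.aug]
    rw [hz, map_sub, map_sub, hc, hc, hc, hc, LinearMap.comp_assoc, LinearMap.comp_assoc,
      hdj, hde, h1]
    simp
  have hn : ∀ a, coneProj R ((cone R).par a) = R.par (coneProj R a) := conePar_one_one R
  have hn' : ∀ a, R.aug (coneProj R a) = (cone R).aug a := fun a => rfl
  refine ⟨z, isMC_iff.2 ⟨hzA, ?_⟩, hπz⟩
  set X := (cone R).d.rTensor W z + ser L.gr (cone R) 1 L.m z with hX
  have hser := (ser_map (q := 1) (φ := L.m) (coneProj R) hn hn' hzA).1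
  have h1 : π.rTensor W X = 0 := by
    rw [hX, map_add, hπdz, hser, hπz, ← hQdef, neg_add_cancel]
  -- As the differential squares to zero, only the series contributes here, through the chain rule
  -- and the value `-Q` of the projection of `d z`.
  have h2 : π.rTensor W ((cone R).d.rTensor W X) = 0 := by
    have hdd : (cone R).d ∘ₗ (cone R).d = 0 := LinearMap.ext (cone R).d_d
    rw [hX, map_add, d_ser hs hzA, hc, hdd, LinearMap.rTensor_zero, LinearMap.zero_apply, zero_add,
      map_smul, hπ, dser_map (coneProj R) hn hn' hzA (augHom_d hzA) (by
        rw [← hπ, hπdz]; exact hQ.neg), ← hπ, hπdz, hπz, dser_neg, H R ζ hζ]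
    simp
  have h3 := congrArg (fun f => f.rTensor W X) (cone_decomp R)
  simp only [LinearMap.rTensor_id, LinearMap.rTensor_add, LinearMap.add_apply, ← hc, LinearMap.id_apply] at h3
  rw [h3, ← hπ, h1, h2]
  simp

/-- An Artinian cdga as a constant inverse system. -/
def constFormal (R : ArtinCdga k) : FormalCdga.{u, w} k where
  ι := PUnit
  nonempty := ⟨PUnit.unit⟩
  directed _ _ := ⟨PUnit.unit, le_rfl, le_rfl⟩
  obj _ := R
  map _ := ⟨AlgHom.id k _, fun _ => rfl, fun _ => rfl, fun _ => rfl⟩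
  map_id _ _ := rfl
  map_comp _ _ _ := rfl

theorem mem_MC_constFormal {L : LInftyData k W} {R : ArtinCdga k} {ξ : R.carrier ⊗[k] W}
    (h : IsMC L R ξ) : (fun _ => ξ) ∈ MC L (constFormal.{u, w} R) := by
  refine ⟨fun _ => h, fun _ _ _ => ?_⟩
  change (AlgHom.id k R.carrier).toLinearMap.rTensor W ξ = ξ
  rw [AlgHom.toLinearMap_id, LinearMap.rTensor_id, LinearMap.id_apply]

end MaurerCartan

/-! ## Exponentials of nilpotent endomorphisms -/

section Exp

variable {k : Type u} [Field k] [CharZero k]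
variable {M : Type*} [AddCommGroup M] [Module k M]
variable {M₁ : Type*} [AddCommGroup M₁] [Module k M₁]
variable {M₂ : Type*} [AddCommGroup M₂] [Module k M₂]

/-- The exponential of a nilpotent endomorphism. -/
def expEnd (X : M →ₗ[k] M) (m : M) : M :=
  ∑ᶠ n : ℕ, ((n.factorial : k)⁻¹) • (X ^ n) m

theorem expEnd_eq_sum {X : M →ₗ[k] M} {N : ℕ} (h : X ^ N = 0) (m : M) :
    expEnd X m = ∑ n ∈ Finset.range N, ((n.factorial : k)⁻¹) • (X ^ n) m :=
  finsum_eq_sum_range _ N fun n hn => by rw [pow_eq_zero_of_le hn h]; simp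

theorem expEnd_eq_exp [Module ℚ M] {X : M →ₗ[k] M} (h : IsNilpotent X) (m : M) :
    expEnd X m = IsNilpotent.exp (A := Module.End k M) X m := by
  obtain ⟨N, hN⟩ := h
  rw [expEnd_eq_sum hN, IsNilpotent.exp_eq_sum (A := Module.End k M) hN, LinearMap.coe_sum,
    Finset.sum_apply]
  refine Finset.sum_congr rfl fun n _ => ?_
  rw [LinearMap.smul_apply, ← Rat.cast_smul_eq_qsmul k]
  simp

theorem expEnd_neg_expEnd {X : M →ₗ[k] M} (h : IsNilpotent X) (m : M) :
    expEnd (-X) (expEnd X m) = m := by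
  -- Characteristic zero gives the rational structure in which `IsNilpotent.exp` is formed.
  let _ : Module ℚ M := Module.compHom M (algebraMap ℚ k)
  rw [expEnd_eq_exp h, expEnd_eq_exp (IsNilpotent.neg h)]
  exact LinearMap.congr_fun (IsNilpotent.exp_neg_mul_exp_self (A := Module.End k M) h) m

theorem expEnd_add (X : M →ₗ[k] M) (hX : IsNilpotent X) (m m' : M) :
    expEnd X (m + m') = expEnd X m + expEnd X m' := by
  let _ : Module ℚ M := Module.compHom M (algebraMap ℚ k)
  simp [expEnd_eq_exp hX]

theorem expEnd_smul (X : M →ₗ[k] M) (hX : IsNilpotent X) (c : k) (m : M) :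
    expEnd X (c • m) = c • expEnd X m := by
  let _ : Module ℚ M := Module.compHom M (algebraMap ℚ k)
  simp [expEnd_eq_exp hX]

/-- The derivation rule says that `b` intertwines `X ⊗ 1 + 1 ⊗ X` with `X`. The two summands
commute, so the exponential of their sum is `e^X ⊗ e^X`. -/
theorem expEnd_bilin {X : M →ₗ[k] M} (hX : IsNilpotent X) (b : M →ₗ[k] M →ₗ[k] M)
    (h : ∀ x y, X (b x y) = b (X x) y + b x (X y)) (x y : M) :
    expEnd X (b x y) = b (expEnd X x) (expEnd X y) := by
  let _ : Module ℚ M := Module.compHom M (algebraMap ℚ k)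
  simp only [expEnd_eq_exp hX]
  have hl : IsNilpotent (X.lTensor M : Module.End k (M ⊗[k] M)) :=
    hX.map <| Module.End.lTensorAlgHom k M M
  have hr : IsNilpotent (X.rTensor M : Module.End k (M ⊗[k] M)) :=
    hX.map <| Module.End.rTensorAlgHom k M M
  have hc : Commute (X.lTensor M : Module.End k (M ⊗[k] M)) (X.rTensor M) := by
    ext; simp
  have h1 := LinearMap.congr_fun (Module.End.commute_exp_left_of_commute
    (g := TensorProduct.lift b) (hc.isNilpotent_add hl hr) hX
      (TensorProduct.ext' fun x y => by simp [h, add_comm])) (x ⊗ₜ y)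
  rw [IsNilpotent.exp_add_of_commute hc hl hr] at h1
  have h2 : IsNilpotent.exp (A := Module.End k (M ⊗[k] M)) (X.lTensor M) =
    (IsNilpotent.exp (A := Module.End k M) X).lTensor M :=
      (hX.map_exp (Module.End.lTensorAlgHom k M M)).symm
  have h3 : IsNilpotent.exp (A := Module.End k (M ⊗[k] M)) (X.rTensor M) =
    (IsNilpotent.exp (A := Module.End k M) X).rTensor M :=
      (hX.map_exp (Module.End.rTensorAlgHom k M M)).symm
  rw [h2, h3] at h1
  simpa using h1

theorem expEnd_of_sq {X : M →ₗ[k] M} {m : M} (h : X (X m) = 0) : expEnd X m = m + X m := by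
  rw [expEnd, finsum_eq_sum_range _ 2]
  · simp [Finset.sum_range_succ]
  · intro n hn
    obtain ⟨n, rfl⟩ := Nat.exists_eq_add_of_le' hn
    rw [pow_add]
    simp [pow_two, h]

theorem expEnd_of_eq_zero {X : M →ₗ[k] M} {m : M} (h : X m = 0) : expEnd X m = m := by
  rw [expEnd_of_sq (by rw [h, map_zero]), h, add_zero]

end Exp

/-! ## Iterated brackets -/

section Iter

variable {k : Type u} [Field k] {A : Type*} [AddCommGroup A] [Module k A]
variable {U : Type*} [AddCommGroup U] [Module k U]

/-- The iterated bracket `[…[[f, c u_0], c u_1], …, c u_{n-1}]`. -/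
def iter (b : A →ₗ[k] A →ₗ[k] A) (c : U →ₗ[k] A) :
    (n : ℕ) → A →ₗ[k] MultilinearMap k (fun _ : Fin n => U) A
  | 0 => (MultilinearMap.constLinearEquivOfIsEmpty k k (fun _ : Fin 0 => U) A).toLinearMap
  | n + 1 =>
    { toFun := fun f => LinearMap.uncurryLeft (iter b c n ∘ₗ b f ∘ₗ c)
      map_add' := fun f f' => by ext; simp
      map_smul' := fun a f => by ext; simp }

theorem iter_zero (b : A →ₗ[k] A →ₗ[k] A) (c : U →ₗ[k] A) (f : A) (x : Fin 0 → U) :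
    iter b c 0 f x = f := rfl

theorem iter_succ (b : A →ₗ[k] A →ₗ[k] A) (c : U →ₗ[k] A) (n : ℕ) (f : A) (x : Fin (n + 1) → U) :
    iter b c (n + 1) f x = iter b c n (b f (c (x 0))) (Fin.tail x) := rfl

theorem iter_const (b : A →ₗ[k] A →ₗ[k] A) (c : U →ₗ[k] A) (n : ℕ) (f : A) (u : U) :
    iter b c n f (fun _ => u) = ((b.flip (c u)) ^ n) f := by
  induction n generalizing f with
  | zero => rfl
  | succ n ih => rw [iter_succ]; exact (ih _).trans (by rw [pow_succ]; rfl)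

variable [CharZero k] {g : SuperStructure k A} {gU : SuperStructure k U}

/-- Each bracket moves the next coefficient past `f` and past the vectors already bracketed. The
resulting exponent matches `extendScalars_tmul`, which makes iterated brackets compatible with
extension of scalars. -/
theorem iter_tmul {R : ArtinCdga k} {b : A →ₗ[k] A →ₗ[k] A} {c : U →ₗ[k] A}
    (hb : ∀ p q x y, g.IsHom p x → g.IsHom q y → g.IsHom (p + q) (b x y))
    (hc : ∀ p u, gU.IsHom p u → g.IsHom p (c u)) {n : ℕ} {φ : ZMod 2} {a₀ : R.carrier} {f : A}
    (hf : g.IsHom φ f) {α p : Fin n → ZMod 2} {a : Fin n → R.carrier} {x : Fin n → U}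
    (ha : ∀ i, R.gr.IsHom (α i) (a i)) (hx : ∀ i, gU.IsHom (p i) (x i)) :
    iter (extBilin R g b) (c.lTensor R.carrier) n (a₀ ⊗ₜ f) (fun i => a i ⊗ₜ x i) =
      sg k (∑ i, φ * α i + ∑ i, ∑ j, if i < j then p i * α j else 0) •
        ((a₀ * (List.ofFn a).prod) ⊗ₜ[k] iter b c n f x) := by
  induction n generalizing φ f a₀ with
  | zero => simp [iter_zero, sg_zero]
  | succ n ih =>
    rw [iter_succ, iter_succ, LinearMap.lTensor_tmul, extBilin_tmul g b hf (ha 0)]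
    have h := ih (a₀ := a₀ * a 0) (hb _ _ _ _ hf (hc _ _ (hx 0))) (fun i => ha i.succ)
      (fun i => hx i.succ)
    rw [map_smul, _root_.smul_apply]
    refine (congrArg _ h).trans ?_
    rw [smul_smul, ← sg_add, List.ofFn_succ, List.prod_cons, mul_assoc]
    congr 2
    simp only [Fin.sum_univ_succ, Fin.succ_pos, if_true, Fin.not_lt_zero, if_false, zero_add,
      Fin.succ_lt_succ_iff, add_mul, Finset.sum_add_distrib]
    ring

end Iter

/-! ## The abstract setting -/

section Bilinear

variable {k : Type u} [Field k] [CharZero k] {R : ArtinCdga k}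
variable {X : Type*} [AddCommGroup X] [Module k X] {Y : Type*} [AddCommGroup Y] [Module k Y]
variable {Z : Type*} [AddCommGroup Z] [Module k Z]

theorem isHom_mul {p q : ZMod 2} {a b : R.carrier} (ha : R.gr.IsHom p a) (hb : R.gr.IsHom q b) :
    R.gr.IsHom (p + q) (a * b) := by
  have h1 : R.par a = sg k p • a := ha
  have h2 : R.par b = sg k q • b := hb
  rw [SuperStructure.IsHom]
  change R.par (a * b) = _
  rw [map_mul, h1, h2, smul_mul_smul_comm, ← sg_add]

theorem bilin_eq_of_isHom {G : SuperStructure k X} {H : SuperStructure k Y} {e e' : ZMod 2}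
    {B B' : R.carrier ⊗[k] X →ₗ[k] R.carrier ⊗[k] Y →ₗ[k] Z}
    (h : ∀ (α p : ZMod 2) (a : R.carrier) (x : X) (β q : ZMod 2) (b : R.carrier) (y : Y),
      R.gr.IsHom α a → G.IsHom p x → R.gr.IsHom β b → H.IsHom q y → α + p = e → β + q = e' →
      B (a ⊗ₜ x) (b ⊗ₜ y) = B' (a ⊗ₜ x) (b ⊗ₜ y))
    {x : R.carrier ⊗[k] X} {y : R.carrier ⊗[k] Y}
    (hx : (tot R G).IsHom e x) (hy : (tot R H).IsHom e' y) : B x y = B' x y :=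
  linear_eq_of_isHom (F := B.flip y) (F' := B'.flip y) (fun α p a f ha hf hp =>
    linear_eq_of_isHom (F := B (a ⊗ₜ f)) (F' := B' (a ⊗ₜ f)) (fun β q b f' hb hf' hq =>
      h _ _ _ _ _ _ _ _ ha hf hb hf' hp hq) hy) hx

theorem bilin_tensor_ext {G : SuperStructure k X} {H : SuperStructure k Y}
    {B B' : R.carrier ⊗[k] X →ₗ[k] R.carrier ⊗[k] Y →ₗ[k] Z}
    (h : ∀ (α p : ZMod 2) (a : R.carrier) (x : X) (β q : ZMod 2) (b : R.carrier) (y : Y),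
      R.gr.IsHom α a → G.IsHom p x → R.gr.IsHom β b → H.IsHom q y →
      B (a ⊗ₜ x) (b ⊗ₜ y) = B' (a ⊗ₜ x) (b ⊗ₜ y)) : B = B' :=
  tensor_ext_isHom fun _ _ _ _ ha hf => tensor_ext_isHom fun _ _ _ _ hb hf' =>
    h _ _ _ _ _ _ _ _ ha hf hb hf'

end Bilinear

/-- A graded Lie algebra `𝔤 = S ⊕ U`, with projections `r` and `P`, in which `U` is abelian and `S`
is a subalgebra, together with an odd element `Δ ∈ S` of square zero normalizing `U`. -/
structure TwistData (k : Type u) [Field k] (𝔤 S U : Type*) [AddCommGroup 𝔤] [Module k 𝔤]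
    [AddCommGroup S] [Module k S] [AddCommGroup U] [Module k U] where
  g : SuperStructure k 𝔤
  gS : SuperStructure k S
  gU : SuperStructure k U
  br : 𝔤 →ₗ[k] 𝔤 →ₗ[k] 𝔤
  i : S →ₗ[k] 𝔤
  r : 𝔤 →ₗ[k] S
  c : U →ₗ[k] 𝔤
  P : 𝔤 →ₗ[k] U
  d : U →ₗ[k] U
  Δ : 𝔤
  i_par : ∀ s, i (gS.par s) = g.par (i s)
  c_par : ∀ u, c (gU.par u) = g.par (c u)
  br_par : ∀ x y, br (g.par x) (g.par y) = g.par (br x y)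
  antisymm : ∀ p q x y, g.IsHom p x → g.IsHom q y → br x y = -(sg k (p * q) • br y x)
  jacobi : ∀ p q l x y z, g.IsHom p x → g.IsHom q y → g.IsHom l z →
    br x (br y z) = br (br x y) z + sg k (p * q) • br y (br x z)
  P_c : ∀ u, P (c u) = u
  P_i : ∀ s, P (i s) = 0
  r_i : ∀ s, r (i s) = s
  decomp : ∀ x, i (r x) + c (P x) = x
  br_c_c : ∀ u u', br (c u) (c u') = 0
  P_br : ∀ s s', P (br (i s) (i s')) = 0
  Δ_odd : g.IsHom 1 Δ
  P_Δ : P Δ = 0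
  br_Δ_Δ : br Δ Δ = 0
  br_Δ_c : ∀ u, br Δ (c u) = c (d u)

namespace TwistData

variable {k : Type u} [Field k] [CharZero k] {𝔤 S U : Type*} [AddCommGroup 𝔤] [Module k 𝔤]
variable [AddCommGroup S] [Module k S] [AddCommGroup U] [Module k U] (D : TwistData k 𝔤 S U)

theorem r_c (u : U) : D.r (D.c u) = 0 := by
  have h := D.decomp (D.c u)
  rw [D.P_c, add_eq_right] at h
  rw [← D.r_i (D.r (D.c u)), h, map_zero]

theorem P_par (x : 𝔤) : D.P (D.g.par x) = D.gU.par (D.P x) := by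
  conv_lhs => rw [← D.decomp x, map_add, ← D.i_par, ← D.c_par, map_add, D.P_i, D.P_c, zero_add]

theorem r_par (x : 𝔤) : D.r (D.g.par x) = D.gS.par (D.r x) := by
  conv_lhs => rw [← D.decomp x, map_add, ← D.i_par, ← D.c_par, map_add, D.r_i, D.r_c, add_zero]

theorem isHom_br {p q : ZMod 2} {x y : 𝔤} (hx : D.g.IsHom p x) (hy : D.g.IsHom q y) :
    D.g.IsHom (p + q) (D.br x y) := by
  rw [SuperStructure.IsHom] at *
  rw [← D.br_par, hx, hy, map_smul, map_smul, LinearMap.smul_apply, smul_smul, ← sg_add, add_comm]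

theorem isHom_c {p : ZMod 2} {u : U} (hu : D.gU.IsHom p u) : D.g.IsHom p (D.c u) := by
  rw [SuperStructure.IsHom] at *
  rw [← D.c_par, hu, map_smul]

theorem isHom_i {p : ZMod 2} {s : S} (hs : D.gS.IsHom p s) : D.g.IsHom p (D.i s) := by
  rw [SuperStructure.IsHom] at *
  rw [← D.i_par, hs, map_smul]

/-- The bracket with the odd element `Δ` anticommutes with the parity involution, and `c` is
injective. -/
theorem d_par (u : U) : D.d (D.gU.par u) = -D.gU.par (D.d u) := by
  have h : D.c (D.d (D.gU.par u)) = D.c (-D.gU.par (D.d u)) := by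
    have h1 : D.Δ = -D.g.par D.Δ := by
      rw [show D.g.par D.Δ = sg k 1 • D.Δ from D.Δ_odd, sg_one]; simp
    rw [← D.br_Δ_c, h1, D.c_par, map_neg, LinearMap.neg_apply, D.br_par, D.br_Δ_c, map_neg, D.c_par]
  rw [← D.P_c (D.d _), h, D.P_c]

/-! ### Extension of scalars -/

variable (R : ArtinCdga k)

/-- The bracket of `A ⊗ 𝔤`. -/
abbrev brR : R.carrier ⊗[k] 𝔤 →ₗ[k] R.carrier ⊗[k] 𝔤 →ₗ[k] R.carrier ⊗[k] 𝔤 :=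
  extBilin R D.g D.br

variable {R}

theorem brR_antisymm {p q : ZMod 2} {x y : R.carrier ⊗[k] 𝔤} (hx : (tot R D.g).IsHom p x)
    (hy : (tot R D.g).IsHom q y) : D.brR R x y = -(sg k (p * q) • D.brR R y x) := by
  have key := bilin_eq_of_isHom (B := D.brR R) (B' := (-sg k (p * q)) • (D.brR R).flip)
    (fun α φ a f β ψ b f' ha hf hb hf' h h' => by
      rw [LinearMap.smul_apply, LinearMap.smul_apply, LinearMap.flip_apply, neg_smul]
      rw [extBilin_tmul D.g D.br hf hb, extBilin_tmul D.g D.br hf' ha, D.antisymm _ _ _ _ hf hf',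
        R.comm _ _ _ _ ha hb, TensorProduct.tmul_neg, smul_neg, TensorProduct.tmul_smul,
        ← TensorProduct.smul_tmul', smul_smul, smul_smul, smul_smul, ← sg_add, ← sg_add, ← sg_add]
      congr 3
      subst h h'
      grind) hx hy
  rw [key, LinearMap.smul_apply, LinearMap.smul_apply, LinearMap.flip_apply, neg_smul]

theorem brR_jacobi_tmul {α β γ φ ψ l : ZMod 2} {a b c : R.carrier} {f f' z : 𝔤}
    (ha : R.gr.IsHom α a) (hf : D.g.IsHom φ f) (hb : R.gr.IsHom β b) (hf' : D.g.IsHom ψ f')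
    (hc : R.gr.IsHom γ c) (hz : D.g.IsHom l z) :
    D.brR R (a ⊗ₜ f) (D.brR R (b ⊗ₜ f') (c ⊗ₜ z)) =
      D.brR R (D.brR R (a ⊗ₜ f) (b ⊗ₜ f')) (c ⊗ₜ z) +
        sg k ((α + φ) * (β + ψ)) • D.brR R (b ⊗ₜ f') (D.brR R (a ⊗ₜ f) (c ⊗ₜ z)) := by
  rw [extBilin_tmul D.g D.br hf' hc, extBilin_tmul D.g D.br hf hb, extBilin_tmul D.g D.br hf hc,
    map_smul, map_smul, map_smul, LinearMap.smul_apply, extBilin_tmul D.g D.br hf (isHom_mul hb hc),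
    extBilin_tmul D.g D.br hf' (isHom_mul ha hc), extBilin_tmul D.g D.br (D.isHom_br hf hf') hc,
    D.jacobi _ _ _ _ _ _ hf hf' hz, TensorProduct.tmul_add, smul_add, smul_add, ← mul_assoc b a,
    R.comm _ _ _ _ hb ha, TensorProduct.tmul_smul, smul_mul_assoc, ← TensorProduct.smul_tmul',
    mul_assoc]
  simp only [smul_smul, ← sg_add]
  congr 3 <;> grind

theorem brR_jacobi {p q : ZMod 2} {x y : R.carrier ⊗[k] 𝔤} (hx : (tot R D.g).IsHom p x)
    (hy : (tot R D.g).IsHom q y) (z : R.carrier ⊗[k] 𝔤) :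
    D.brR R x (D.brR R y z) =
      D.brR R (D.brR R x y) z + sg k (p * q) • D.brR R y (D.brR R x z) := by
  have key : D.brR R x ∘ₗ D.brR R y =
      D.brR R (D.brR R x y) + sg k (p * q) • D.brR R y ∘ₗ D.brR R x := by
    refine tensor_ext_isHom (G := D.g) fun γ l c z hc hz => ?_
    have key := bilin_eq_of_isHom (B := (D.brR R).compl₂ ((D.brR R).flip (c ⊗ₜ z)))
      (B' := (D.brR R).compr₂ ((D.brR R).flip (c ⊗ₜ z)) +
        sg k (p * q) • ((D.brR R).compl₂ ((D.brR R).flip (c ⊗ₜ z))).flip)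
      (fun α φ a f β ψ b f' ha hf hb hf' h h' => by
        subst h h'
        simp only [LinearMap.compl₂_apply, LinearMap.add_apply, LinearMap.smul_apply,
          LinearMap.flip_apply, LinearMap.compr₂_apply]
        exact D.brR_jacobi_tmul ha hf hb hf' hc hz) hx hy
    simp only [LinearMap.compl₂_apply, LinearMap.add_apply, LinearMap.smul_apply,
      LinearMap.flip_apply, LinearMap.compr₂_apply] at key
    exact key
  exact LinearMap.congr_fun key z

end TwistData

/-! ### Linearity of scalar extensions and series of symmetrized maps -/

section Linearity

variable {k : Type u} [Field k] [CharZero k] {R : ArtinCdga k}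
variable {X : Type*} [AddCommGroup X] [Module k X] {Y : Type*} [AddCommGroup Y] [Module k Y]
variable (G : SuperStructure k X) (q : ZMod 2) {n : ℕ}

theorem extendScalars_add (f f' : MultilinearMap k (fun _ : Fin n => X) Y) :
    extendScalars R G q (f + f') = extendScalars R G q f + extendScalars R G q f' := by
  refine multilinear_tensor_ext G fun α p a x ha hx => ?_
  rw [_root_.add_apply, extendScalars_tmul G q _ ha hx, extendScalars_tmul G q _ ha hx,
    extendScalars_tmul G q _ ha hx, _root_.add_apply, TensorProduct.tmul_add, smul_add]

theorem extendScalars_smul (c : k) (f : MultilinearMap k (fun _ : Fin n => X) Y) :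
    extendScalars R G q (c • f) = c • extendScalars R G q f := by
  refine multilinear_tensor_ext G fun α p a x ha hx => ?_
  rw [_root_.smul_apply, extendScalars_tmul G q _ ha hx, extendScalars_tmul G q _ ha hx,
    _root_.smul_apply, TensorProduct.tmul_smul, smul_comm]

theorem extendScalars_zero : extendScalars R G q (0 : MultilinearMap k (fun _ : Fin n => X) Y) = 0 := by
  have := extendScalars_smul (R := R) G q (0 : k) (0 : MultilinearMap k (fun _ : Fin n => X) Y)
  simpa using this

theorem extendScalars_sum {ι : Type*} (s : Finset ι)
    (f : ι → MultilinearMap k (fun _ : Fin n => X) Y) :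
    extendScalars R G q (∑ i ∈ s, f i) = ∑ i ∈ s, extendScalars R G q (f i) := by
  classical
  induction s using Finset.induction_on with
  | empty => simp [extendScalars_zero]
  | insert i s hi ih => rw [Finset.sum_insert hi, extendScalars_add, ih, Finset.sum_insert hi]

theorem par_list_prod {n : ℕ} {α : Fin n → ZMod 2} {a : Fin n → R.carrier}
    (ha : ∀ i, R.gr.IsHom (α i) (a i)) :
    R.par (List.ofFn a).prod = sg k (∑ i, α i) • (List.ofFn a).prod := by
  induction n with
  | zero => simp [sg_zero]
  | succ n ih =>
    have h0 : R.par (a 0) = sg k (α 0) • a 0 := ha 0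
    rw [List.ofFn_succ, List.prod_cons, map_mul, ih fun i => ha i.succ, h0,
      smul_mul_smul_comm, ← sg_add, Fin.sum_univ_succ]

/-- The involution of `A` multiplies by the sign of the total parity of the coefficients, which is
precisely the effect of replacing `q` by `q + 1` in the extension sign. Maps of either parity can
therefore be treated as odd ones. -/
theorem par_extendScalars (f : MultilinearMap k (fun _ : Fin n => X) Y)
    (ζ : Fin n → R.carrier ⊗[k] X) :
    R.par.toLinearMap.rTensor Y (extendScalars R G q f ζ) = extendScalars R G (q + 1) f ζ := by
  have : (R.par.toLinearMap.rTensor Y).compMultilinearMap (extendScalars R G q f) =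
      extendScalars R G (q + 1) f := by
    refine multilinear_tensor_ext G fun α p a x ha hx => ?_
    rw [LinearMap.compMultilinearMap_apply, extendScalars_tmul G q _ ha hx,
      extendScalars_tmul G _ _ ha hx, map_smul, LinearMap.rTensor_tmul, AlgHom.toLinearMap_apply,
      par_list_prod ha,
      ← TensorProduct.smul_tmul', smul_smul, ← sg_add]
    congr 2
    simp only [add_mul, one_mul, Finset.sum_add_distrib]
    ring
  exact congrArg (fun F => F ζ) this

variable {G} {q}
variable {φ ψ : (n : ℕ) → MultilinearMap k (fun _ : Fin n => X) Y} {ζ v : R.carrier ⊗[k] X}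

theorem ser_add (hζ : AugHom G R 0 ζ) :
    ser G R q (fun n => φ n + ψ n) ζ = ser G R q φ ζ + ser G R q ψ ζ := by
  obtain ⟨N, hN⟩ := R.exists_nilp
  rw [ser_eq_sum hN hζ, ser_eq_sum hN hζ, ser_eq_sum hN hζ, ← Finset.sum_add_distrib]
  refine Finset.sum_congr rfl fun n _ => ?_
  rw [extendScalars_add, _root_.add_apply, smul_add]

theorem dser_add (hζ : AugHom G R 0 ζ) {e : ZMod 2} (hv : AugHom G R e v) :
    dser G R q (fun n => φ n + ψ n) ζ v = dser G R q φ ζ v + dser G R q ψ ζ v := by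
  obtain ⟨N, hN⟩ := R.exists_nilp
  rw [dser_eq_sum hN hζ hv, dser_eq_sum hN hζ hv, dser_eq_sum hN hζ hv, ← Finset.sum_add_distrib]
  refine Finset.sum_congr rfl fun n _ => ?_
  rw [extendScalars_add, _root_.add_apply, smul_add]

theorem ser_single {m : ℕ} (h : ∀ n ≠ m, φ n = 0) :
    ser G R q φ ζ = ((m.factorial : k)⁻¹) • extendScalars R G q (φ m) (fun _ => ζ) :=
  finsum_eq_single _ m fun n hn => by rw [h n hn, extendScalars_zero]; simp

theorem dser_single {m : ℕ} (h : ∀ n ≠ m + 1, φ n = 0) :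
    dser G R q φ ζ v =
      ((m.factorial : k)⁻¹) • extendScalars R G q (φ (m + 1)) (Fin.cons v fun _ => ζ) :=
  finsum_eq_single _ m fun n hn => by rw [h (n + 1) (by omega), extendScalars_zero]; simp

theorem par_ser (hζ : AugHom G R 0 ζ) :
    R.par.toLinearMap.rTensor Y (ser G R q φ ζ) = ser G R (q + 1) φ ζ := by
  obtain ⟨N, hN⟩ := R.exists_nilp
  rw [ser_eq_sum hN hζ, ser_eq_sum hN hζ, map_sum]
  refine Finset.sum_congr rfl fun n _ => ?_
  rw [map_smul, par_extendScalars]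

theorem par_dser (hζ : AugHom G R 0 ζ) {e : ZMod 2} (hv : AugHom G R e v) :
    R.par.toLinearMap.rTensor Y (dser G R q φ ζ v) = dser G R (q + 1) φ ζ v := by
  obtain ⟨N, hN⟩ := R.exists_nilp
  rw [dser_eq_sum hN hζ hv, dser_eq_sum hN hζ hv, map_sum]
  refine Finset.sum_congr rfl fun n _ => ?_
  rw [map_smul, par_extendScalars]

theorem extendScalars_koszulSymm_const (f : MultilinearMap k (fun _ : Fin n => X) Y)
    (hζ : (tot R G).IsHom 0 ζ) :
    extendScalars R G q (koszulSymm G f) (fun _ => ζ) =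
      (n.factorial : k) • extendScalars R G q f (fun _ => ζ) := by
  rw [koszulSymm, LinearMap.coe_sum, Finset.sum_apply, extendScalars_sum,
    _root_.sum_apply, Finset.sum_congr rfl fun σ _ => extendScalars_perm G q σ f
      (e := fun _ => 0) (fun _ => hζ) (by simp)]
  simp [Function.comp_def, Fintype.card_perm, Nat.cast_smul_eq_nsmul]

theorem sum_perm_symm_zero {M : Type*} [AddCommGroup M] [Module k M] (n : ℕ)
    (f : Fin (n + 1) → M) :
    ∑ σ : Equiv.Perm (Fin (n + 1)), f (σ.symm 0) = (n.factorial : k) • ∑ j, f j := by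
  rw [← Equiv.sum_comp (Equiv.inv (Equiv.Perm (Fin (n + 1))))
    (fun σ : Equiv.Perm (Fin (n + 1)) => f (σ.symm 0)),
    ← Equiv.sum_comp (Equiv.Perm.decomposeFin (n := n)).symm, Fintype.sum_prod_type]
  have : ∀ j (τ : Equiv.Perm (Fin n)), f ((Equiv.inv (Equiv.Perm (Fin (n + 1)))
      (Equiv.Perm.decomposeFin.symm (j, τ))).symm 0) = f j := fun j τ => by
    congr 1
    exact Equiv.Perm.decomposeFin_symm_apply_zero j τ
  simp only [this]
  simp [Fintype.card_perm, Nat.cast_smul_eq_nsmul, Finset.smul_sum]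

/-- A permutation `σ` puts `v` into the slot `σ⁻¹ 0`, and each slot arises from `n!` permutations;
no signs occur because the other arguments are even. -/
theorem extendScalars_koszulSymm_cons (f : MultilinearMap k (fun _ : Fin (n + 1) => X) Y)
    {e : ZMod 2} (hv : (tot R G).IsHom e v) (hζ : (tot R G).IsHom 0 ζ) :
    extendScalars R G q (koszulSymm G f) (Fin.cons v fun _ => ζ) =
      (n.factorial : k) • ∑ j, extendScalars R G q f (Function.update (fun _ => ζ) j v) := by
  rw [koszulSymm, LinearMap.coe_sum, Finset.sum_apply, extendScalars_sum,
    _root_.sum_apply, Finset.sum_congr rfl fun σ _ => extendScalars_perm G q σ f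
      (cons_isHom hv hζ) (cons_orthogonal e), ← sum_perm_symm_zero]
  refine Finset.sum_congr rfl fun σ _ => ?_
  congr 1
  funext i
  by_cases hi : i = σ.symm 0
  · subst hi; simp
  · rw [Function.update_of_ne hi]
    have : σ i ≠ 0 := fun h => hi (by rw [← h, Equiv.symm_apply_apply])
    obtain ⟨l, hl⟩ := Fin.exists_succ_eq.2 this
    rw [Function.comp, ← hl, Fin.cons_succ]

end Linearity

namespace TwistData

variable {k : Type u} [Field k] [CharZero k] {𝔤 S U : Type*} [AddCommGroup 𝔤] [Module k 𝔤]
variable [AddCommGroup S] [Module k S] [AddCommGroup U] [Module k U] (D : TwistData k 𝔤 S U)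

/-! ### The structure maps -/

/-- The grading on `ΠS ⊕ U`. -/
def gr : SuperStructure k (S × U) := D.gS.shift.prod D.gU

/-- `(z, z_1, …, z_n) ↦ [[f, u_1], …, u_n]` where `f` is the first component of `z`, and `u_j` the
second component of `z_j`. -/
def nested (n : ℕ) : MultilinearMap k (fun _ : Fin (n + 1) => S × U) 𝔤 :=
  LinearMap.uncurryLeft (MultilinearMap.compLinearMapₗ (fun _ : Fin n => LinearMap.snd k S U) ∘ₗ
    iter D.br D.c n ∘ₗ D.i ∘ₗ LinearMap.fst k S U)

theorem nested_apply (n : ℕ) (z : Fin (n + 1) → S × U) :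
    D.nested n z = iter D.br D.c n (D.i (z 0).1) (fun j => (z j.succ).2) := rfl

/-- The symmetrizations of the maps `nested`, followed by a linear map. -/
def symNested {Y : Type*} [AddCommGroup Y] [Module k Y] (T : 𝔤 →ₗ[k] Y) :
    (n : ℕ) → MultilinearMap k (fun _ : Fin n => S × U) Y
  | 0 => 0
  | n + 1 => ((n.factorial : k)⁻¹) • koszulSymm D.gr (T.compMultilinearMap (D.nested n))

/-- The differential. -/
def diff : (n : ℕ) → MultilinearMap k (fun _ : Fin n => S × U) (S × U)
  | 1 => MultilinearMap.ofSubsingleton k (S × U) (S × U) (0 : Fin 1)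
      ((-(D.r ∘ₗ D.br D.Δ ∘ₗ D.i)).prodMap D.d)
  | _ => 0

/-- The bracket. -/
def lie : (n : ℕ) → MultilinearMap k (fun _ : Fin n => S × U) (S × U)
  | 2 => LinearMap.uncurryLeft
      ((MultilinearMap.ofSubsingletonₗ k k (S × U) (S × U) (0 : Fin 1)).toLinearMap ∘ₗ
        (D.br.compl₁₂ (D.g.par ∘ₗ D.i ∘ₗ LinearMap.fst k S U) (D.i ∘ₗ LinearMap.fst k S U)).compr₂
          (LinearMap.inl k S U ∘ₗ D.r))
  | _ => 0

theorem lie_two (z : Fin 2 → S × U) :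
    D.lie 2 z = (D.r (D.br (D.g.par (D.i (z 0).1)) (D.i (z 1).1)), 0) := rfl

/-- The `L∞` structure on `ΠS ⊕ U`. -/
def tilde : LInftyData k (S × U) where
  gr := D.gr
  m n := D.diff n + D.lie n + D.symNested (LinearMap.inr k S U ∘ₗ D.P) n

/-- The linear part of the twisting on `U`. -/
def negVec : (n : ℕ) → MultilinearMap k (fun _ : Fin n => S × U) (S × U)
  | 1 => MultilinearMap.ofSubsingleton k (S × U) (S × U) (0 : Fin 1)
      (-(LinearMap.inr k S U ∘ₗ LinearMap.snd k S U))
  | _ => 0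

/-- The twisting automorphism. -/
def tw (n : ℕ) : MultilinearMap k (fun _ : Fin n => S × U) (S × U) :=
  D.symNested (LinearMap.inl k S U ∘ₗ D.r) n + negVec n

variable {D}

theorem isHom_fst {p : ZMod 2} {z : S × U} (h : D.gr.IsHom p z) : D.gS.IsHom (p + 1) z.1 := by
  have h1 : -D.gS.par z.1 = sg k p • z.1 := congrArg Prod.fst h
  rw [SuperStructure.IsHom, sg_add, sg_one, mul_neg_one, neg_smul, ← h1, neg_neg]

theorem isHom_snd {p : ZMod 2} {z : S × U} (h : D.gr.IsHom p z) : D.gU.IsHom p z.2 :=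
  congrArg Prod.snd h

variable (D) (R : ArtinCdga k)

/-! ### The components of elements of `A ⊗ (ΠS ⊕ U)` -/

/-- The component in `A ⊗ S ⊂ A ⊗ 𝔤`. -/
def F : R.carrier ⊗[k] (S × U) →ₗ[k] R.carrier ⊗[k] 𝔤 :=
  TensorProduct.map R.par.toLinearMap (D.i ∘ₗ LinearMap.fst k S U)

/-- The component in `A ⊗ U`. -/
def vec (_ : TwistData k 𝔤 S U) : R.carrier ⊗[k] (S × U) →ₗ[k] R.carrier ⊗[k] U :=
  (LinearMap.snd k S U).lTensor R.carrier

/-- The element `1 ⊗ Δ`. -/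
def ΔR : R.carrier ⊗[k] 𝔤 := 1 ⊗ₜ D.Δ

/-- Constants in `A ⊗ 𝔤`. -/
abbrev cR : R.carrier ⊗[k] U →ₗ[k] R.carrier ⊗[k] 𝔤 := D.c.lTensor R.carrier

/-- The projection of `A ⊗ 𝔤` to the constants. -/
abbrev PR : R.carrier ⊗[k] 𝔤 →ₗ[k] R.carrier ⊗[k] U := D.P.lTensor R.carrier

/-- The projection of `A ⊗ 𝔤` to the vector fields vanishing at zero. -/
abbrev πR : R.carrier ⊗[k] 𝔤 →ₗ[k] R.carrier ⊗[k] 𝔤 := (D.i ∘ₗ D.r).lTensor R.carrier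

variable {R}

theorem F_tmul (a : R.carrier) (z : S × U) : D.F R (a ⊗ₜ z) = R.par a ⊗ₜ D.i z.1 := rfl

theorem vec_tmul (a : R.carrier) (z : S × U) : D.vec R (a ⊗ₜ z) = a ⊗ₜ z.2 := rfl

/-- The expression in `key` recovers `z` from its two components. The involution used in `F` is
undone by applying it a second time. -/
theorem ext_F_vec {z z' : R.carrier ⊗[k] (S × U)} (h : D.F R z = D.F R z')
    (h' : D.vec R z = D.vec R z') : z = z' := by
  have key : ∀ z : R.carrier ⊗[k] (S × U),
      TensorProduct.map R.par.toLinearMap (LinearMap.inl k S U ∘ₗ D.r) (D.F R z) +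
        (LinearMap.inr k S U).lTensor R.carrier (D.vec R z) = z := by
    intro z
    induction z with
    | zero => simp
    | add z z' hz hz' =>
      conv_rhs => rw [← hz, ← hz']
      simp only [map_add]
      abel
    | tmul a z =>
      rw [F_tmul, vec_tmul, TensorProduct.map_tmul, LinearMap.lTensor_tmul,
        AlgHom.toLinearMap_apply, R.par_par, ← TensorProduct.tmul_add]
      simp [D.r_i]
  rw [← key z, h, h', key z']

theorem isHom_F {e : ZMod 2} {z : R.carrier ⊗[k] (S × U)} (hz : (tot R D.gr).IsHom e z) :
    (tot R D.g).IsHom (e + 1) (D.F R z) := by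
  have h : (tot R D.g).par ∘ₗ D.F R = (-1 : k) • D.F R ∘ₗ (tot R D.gr).par :=
    TensorProduct.ext' fun a x => by
      simp only [LinearMap.comp_apply, LinearMap.smul_apply, F_tmul, tot, TensorProduct.map_tmul,
        AlgHom.toLinearMap_apply, gr, SuperStructure.prod, LinearMap.prodMap_apply,
        SuperStructure.shift, LinearMap.neg_apply, map_neg, TensorProduct.tmul_neg, D.i_par]
      rw [neg_one_smul, neg_neg]
  have h1 := LinearMap.congr_fun h z
  have h2 : (tot R D.gr).par z = sg k e • z := hz
  rw [LinearMap.comp_apply, LinearMap.smul_apply, LinearMap.comp_apply, h2, map_smul] at h1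
  rw [SuperStructure.IsHom, h1, sg_add, sg_one, mul_comm, mul_smul]

theorem isHom_vec {e : ZMod 2} {z : R.carrier ⊗[k] (S × U)} (hz : (tot R D.gr).IsHom e z) :
    (tot R D.gU).IsHom e (D.vec R z) := by
  have h : (tot R D.gU).par ∘ₗ D.vec R = D.vec R ∘ₗ (tot R D.gr).par :=
    TensorProduct.ext' fun a x => rfl
  have h1 := LinearMap.congr_fun h z
  have h2 : (tot R D.gr).par z = sg k e • z := hz
  rw [LinearMap.comp_apply, LinearMap.comp_apply, h2, map_smul] at h1
  exact h1

theorem isHom_cR {e : ZMod 2} {u : R.carrier ⊗[k] U} (hu : (tot R D.gU).IsHom e u) :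
    (tot R D.g).IsHom e (D.cR R u) := by
  have h : (tot R D.g).par ∘ₗ D.cR R = D.cR R ∘ₗ (tot R D.gU).par :=
    TensorProduct.ext' fun a x => by simp [tot, D.c_par]
  have h1 := LinearMap.congr_fun h u
  have h2 : (tot R D.gU).par u = sg k e • u := hu
  rw [LinearMap.comp_apply, LinearMap.comp_apply, h2, map_smul] at h1
  exact h1

theorem aug_vec {z : R.carrier ⊗[k] (S × U)} (hz : R.aug.toLinearMap.rTensor (S × U) z = 0) :
    R.aug.toLinearMap.rTensor U (D.vec R z) = 0 := by
  have h : R.aug.toLinearMap.rTensor U ∘ₗ D.vec R =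
      (LinearMap.snd k S U).lTensor k ∘ₗ R.aug.toLinearMap.rTensor (S × U) :=
    TensorProduct.ext' fun a x => rfl
  have h1 := LinearMap.congr_fun h z
  rwa [LinearMap.comp_apply, LinearMap.comp_apply, hz, map_zero] at h1

theorem isHom_ΔR : (tot R D.g).IsHom 1 (D.ΔR R) := by
  have := isHom_tmul (R := R) (α := 0) (a := 1) (by
    rw [SuperStructure.IsHom, sg_zero, one_smul]; exact map_one R.par) D.Δ_odd
  rwa [zero_add] at this

theorem PR_cR (u : R.carrier ⊗[k] U) : D.PR R (D.cR R u) = u := by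
  rw [← LinearMap.comp_apply, ← LinearMap.lTensor_comp,
    show D.P ∘ₗ D.c = LinearMap.id from LinearMap.ext D.P_c, LinearMap.lTensor_id, LinearMap.id_apply]

theorem PR_F (z : R.carrier ⊗[k] (S × U)) : D.PR R (D.F R z) = 0 := by
  have : D.PR R ∘ₗ D.F R = 0 := TensorProduct.ext' fun a x => by
    rw [LinearMap.comp_apply, F_tmul, LinearMap.lTensor_tmul, D.P_i]; simp
  exact LinearMap.congr_fun this z

theorem PR_ΔR : D.PR R (D.ΔR R) = 0 := by
  rw [ΔR, LinearMap.lTensor_tmul, D.P_Δ, TensorProduct.tmul_zero]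

theorem decompR (x : R.carrier ⊗[k] 𝔤) : D.πR R x + D.cR R (D.PR R x) = x := by
  rw [← LinearMap.comp_apply (D.cR R), ← LinearMap.lTensor_comp, ← LinearMap.add_apply,
    ← LinearMap.lTensor_add,
    show D.i ∘ₗ D.r + D.c ∘ₗ D.P = LinearMap.id from LinearMap.ext D.decomp, LinearMap.lTensor_id,
    LinearMap.id_apply]

theorem πR_cR (u : R.carrier ⊗[k] U) : D.πR R (D.cR R u) = 0 := by
  rw [← LinearMap.comp_apply, ← LinearMap.lTensor_comp,
    show (D.i ∘ₗ D.r) ∘ₗ D.c = 0 from LinearMap.ext fun u => by simp [D.r_c],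
    LinearMap.lTensor_zero, LinearMap.zero_apply]

theorem πR_eq {x : R.carrier ⊗[k] 𝔤} (h : D.PR R x = 0) : D.πR R x = x := by
  have := D.decompR x
  rwa [h, map_zero, add_zero] at this

theorem brR_cR_cR (u u' : R.carrier ⊗[k] U) : D.brR R (D.cR R u) (D.cR R u') = 0 := by
  have : (D.brR R).compl₁₂ (D.cR R) (D.cR R) = 0 :=
    bilin_tensor_ext (G := D.gU) (H := D.gU) fun α p a x β q b y ha hx hb hy => by
      rw [LinearMap.compl₁₂_apply, LinearMap.lTensor_tmul, LinearMap.lTensor_tmul,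
        extBilin_tmul _ _ (D.isHom_c hx) hb, D.br_c_c]
      simp
  exact LinearMap.congr_fun₂ this u u'

theorem PR_brR_πR (x y : R.carrier ⊗[k] 𝔤) : D.PR R (D.brR R (D.πR R x) (D.πR R y)) = 0 := by
  have : ((D.brR R).compl₁₂ (D.πR R) (D.πR R)).compr₂ (D.PR R) = 0 :=
    bilin_tensor_ext (G := D.g) (H := D.g) fun α p a x β q b y ha hx hb hy => by
      rw [LinearMap.compr₂_apply, LinearMap.compl₁₂_apply, LinearMap.lTensor_tmul,
        LinearMap.lTensor_tmul, extBilin_tmul (p := p) _ _ (by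
          rw [SuperStructure.IsHom] at *
          rw [LinearMap.comp_apply, ← D.i_par, ← D.r_par, hx, map_smul, map_smul]) hb, map_smul,
        LinearMap.lTensor_tmul, LinearMap.comp_apply, LinearMap.comp_apply, D.P_br]
      simp
  exact LinearMap.congr_fun₂ this x y

/-- The odd element `Δ` has to pass the coefficient, which accounts for the involution on the factor
`A`. -/
theorem brR_ΔR_cR (u : R.carrier ⊗[k] U) : D.brR R (D.ΔR R) (D.cR R u) =
    D.cR R (TensorProduct.map R.par.toLinearMap D.d u) := by
  have : D.brR R (D.ΔR R) ∘ₗ D.cR R = D.cR R ∘ₗ TensorProduct.map R.par.toLinearMap D.d :=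
    tensor_ext_isHom (G := D.gU) fun α p a x ha hx => by
      have ha' : R.par a = sg k α • a := ha
      rw [LinearMap.comp_apply, LinearMap.lTensor_tmul, ΔR, extBilin_tmul _ _ D.Δ_odd ha,
        D.br_Δ_c, one_mul, one_mul, LinearMap.comp_apply, TensorProduct.map_tmul,
        LinearMap.lTensor_tmul, AlgHom.toLinearMap_apply, ha', TensorProduct.smul_tmul']
  exact LinearMap.congr_fun this u

theorem brR_ΔR_ΔR : D.brR R (D.ΔR R) (D.ΔR R) = 0 := by
  rw [ΔR, extBilin_tmul (α := 0) _ _ D.Δ_odd (by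
    rw [SuperStructure.IsHom, sg_zero, one_smul]; exact map_one R.par), D.br_Δ_Δ]
  simp

/-- The bracket with an even element is a derivation. -/
theorem brR_derivation {ξ : R.carrier ⊗[k] 𝔤} (hξ : (tot R D.g).IsHom 0 ξ)
    (x y : R.carrier ⊗[k] 𝔤) :
    D.brR R (D.brR R x y) ξ = D.brR R (D.brR R x ξ) y + D.brR R x (D.brR R y ξ) := by
  have key : ∀ x, D.brR R x ξ = -D.brR R ξ x := by
    intro x
    have h := LinearMap.congr_fun (f := (D.brR R).flip ξ) (g := (-1 : k) • D.brR R ξ)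
      (linear_ext_isHom (tot R D.g) fun p x hx => by
        rw [LinearMap.flip_apply, LinearMap.smul_apply, neg_one_smul, D.brR_antisymm hx hξ,
          mul_zero, sg_zero, one_smul]) x
    rwa [LinearMap.flip_apply, LinearMap.smul_apply, neg_one_smul] at h
  have h : ∀ p x, (tot R D.g).IsHom p x →
      D.brR R (D.brR R x y) ξ = D.brR R (D.brR R x ξ) y + D.brR R x (D.brR R y ξ) := by
    intro p x hx
    rw [key, D.brR_jacobi hξ hx, key x, key y, zero_mul, sg_zero, one_smul, map_neg, map_neg,
      LinearMap.neg_apply, neg_add]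
  refine LinearMap.congr_fun (f := (D.brR R).flip ξ ∘ₗ (D.brR R).flip y)
    (g := (D.brR R).flip y ∘ₗ (D.brR R).flip ξ + (D.brR R).flip (D.brR R y ξ))
    (linear_ext_isHom (tot R D.g) fun p x hx => ?_) x
  exact h p x hx

/-- Nilpotency of the bracket with elements of `A_+ ⊗ U`. -/
theorem isNilpotent_brR {u : R.carrier ⊗[k] U} (hu : (tot R D.gU).IsHom 0 u)
    (h : R.aug.toLinearMap.rTensor U u = 0) : IsNilpotent ((D.brR R).flip (D.cR R u)) := by
  obtain ⟨N, hN⟩ := R.exists_nilp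
  refine ⟨N, tensor_ext_isHom (G := D.g) fun β φ b f hb hf => ?_⟩
  rw [← iter_const, LinearMap.zero_apply]
  refine multilinear_eq_zero_of_span (iter (D.brR R) (D.cR R) N (b ⊗ₜ f))
    (fun _ => augPureSet R D.gU 0) (fun x hx => ?_) _ fun _ => mem_span_augPureSet hu h
  choose α p a y ha ha' hy _ hz using hx
  rw [show x = fun i => a i ⊗ₜ y i from funext hz, iter_tmul
    (fun _ _ _ _ => D.isHom_br) (fun _ _ => D.isHom_c) hf ha hy, hN N le_rfl a ha']
  simp

end TwistData

/-! ### Iterated brackets with one exceptional entry; extension of linear maps -/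

section

variable {k : Type u} [Field k] {A : Type*} [AddCommGroup A] [Module k A]
variable {U : Type*} [AddCommGroup U] [Module k U]

/-- By `h` the brackets with `u` and with `u'` commute, so the exceptional entry can be moved to the
end from any slot. -/
theorem iter_update {b : A →ₗ[k] A →ₗ[k] A} {c : U →ₗ[k] A} {u u' : U}
    (h : ∀ y, b (b y (c u')) (c u) = b (b y (c u)) (c u')) (m : ℕ) (f : A) (j : Fin (m + 1)) :
    iter b c (m + 1) f (Function.update (fun _ => u) j u') =
      b (((b.flip (c u)) ^ m) f) (c u') := by
  induction m generalizing f with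
  | zero =>
    obtain rfl : j = 0 := by omega
    rw [iter_succ, iter_zero, Function.update_self]
    rfl
  | succ m ih =>
    rw [iter_succ]
    induction j using Fin.cases with
    | zero =>
      have h1 : Fin.tail (Function.update (fun _ : Fin (m + 2) => u) 0 u') = fun _ => u := by
        funext i
        simp [Fin.tail]
      rw [h1, iter_const, Function.update_self]
      generalize m + 1 = l
      induction l generalizing f with
      | zero => rfl
      | succ l ihl =>
        rw [pow_succ, Module.End.mul_apply, LinearMap.flip_apply, h, ihl]
        rfl
    | succ j =>
      have h1 : Fin.tail (Function.update (fun _ : Fin (m + 2) => u) j.succ u') =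
          Function.update (fun _ => u) j u' := by
        funext i
        simp [Fin.tail, Function.update_apply]
      rw [h1, ih, Function.update_of_ne (Fin.succ_ne_zero _).symm, pow_succ]
      rfl

variable [CharZero k] {R : ArtinCdga k} {Y : Type*} [AddCommGroup Y] [Module k Y]

theorem extendScalars_ofSubsingleton_zero (G : SuperStructure k A) (T : A →ₗ[k] Y)
    (ζ : Fin 1 → R.carrier ⊗[k] A) :
    extendScalars R G 0 (MultilinearMap.ofSubsingleton k A Y (0 : Fin 1) T) ζ =
      T.lTensor R.carrier (ζ 0) := by
  have : extendScalars R G 0 (MultilinearMap.ofSubsingleton k A Y (0 : Fin 1) T) =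
      MultilinearMap.ofSubsingleton k _ _ (0 : Fin 1) (T.lTensor R.carrier) :=
    multilinear_tensor_ext G fun α p a x ha hx => by
      rw [extendScalars_tmul G _ _ ha hx]
      simp [sg_zero]
  rw [this]
  rfl

theorem extendScalars_ofSubsingleton_one (G : SuperStructure k A) (T : A →ₗ[k] Y)
    (ζ : Fin 1 → R.carrier ⊗[k] A) :
    extendScalars R G 1 (MultilinearMap.ofSubsingleton k A Y (0 : Fin 1) T) ζ =
      TensorProduct.map R.par.toLinearMap T (ζ 0) := by
  rw [show (1 : ZMod 2) = 0 + 1 from rfl, ← par_extendScalars, extendScalars_ofSubsingleton_zero,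
    ← LinearMap.comp_apply, LinearMap.rTensor_comp_lTensor]

end

namespace TwistData

variable {k : Type u} [Field k] [CharZero k] {𝔤 S U : Type*} [AddCommGroup 𝔤] [Module k 𝔤]
variable [AddCommGroup S] [Module k S] [AddCommGroup U] [Module k U] (D : TwistData k 𝔤 S U)
variable {R : ArtinCdga k} {Y : Type*} [AddCommGroup Y] [Module k Y]

/-! ### The structure maps after extension of scalars -/

/-- The extension has parity 1 because the bracket takes `f` as input where the argument is `Πf`.
The involution built into `F` supplies the sign of moving the first coefficient past this parity
shift. -/
theorem extendScalars_nested (n : ℕ) (ζ : Fin (n + 1) → R.carrier ⊗[k] (S × U)) :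
    extendScalars R D.gr 1 (D.nested n) ζ =
      iter (D.brR R) (D.cR R) n (D.F R (ζ 0)) (fun j => D.vec R (ζ j.succ)) := by
  have : extendScalars R D.gr 1 (D.nested n) = LinearMap.uncurryLeft
      (MultilinearMap.compLinearMapₗ (fun _ : Fin n => D.vec R) ∘ₗ
        iter (D.brR R) (D.cR R) n ∘ₗ D.F R) := by
    refine multilinear_tensor_ext D.gr fun α p a x ha hx => ?_
    rw [extendScalars_tmul D.gr _ _ ha hx]
    change _ = iter (D.brR R) (D.cR R) n (D.F R (a 0 ⊗ₜ x 0)) (fun j => D.vec R (a j.succ ⊗ₜ x j.succ))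
    have ha0 : R.par (a 0) = sg k (α 0) • a 0 := ha 0
    simp only [F_tmul, vec_tmul]
    rw [ha0, ← TensorProduct.smul_tmul', map_smul, _root_.smul_apply,
      iter_tmul (fun _ _ _ _ => D.isHom_br) (fun _ _ => D.isHom_c) (D.isHom_i (isHom_fst (hx 0)))
        (fun j => ha j.succ) (fun j => isHom_snd (hx j.succ)), smul_smul, ← sg_add,
      List.ofFn_succ, List.prod_cons, nested_apply]
    congr 2
    simp only [Fin.sum_univ_succ, Fin.succ_pos, if_true, Fin.not_lt_zero, if_false, zero_add,
      Fin.succ_lt_succ_iff, add_mul, one_mul, Finset.sum_add_distrib]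
    ring
  rw [this]
  rfl

/-- The bracket with the second component of an element of `A ⊗ (ΠS ⊕ U)`. -/
def X (ζ : R.carrier ⊗[k] (S × U)) : R.carrier ⊗[k] 𝔤 →ₗ[k] R.carrier ⊗[k] 𝔤 :=
  (D.brR R).flip (D.cR R (D.vec R ζ))

theorem factorial_ne_zero (n : ℕ) : (n.factorial : k) ≠ 0 := by exact_mod_cast n.factorial_ne_zero

variable {ζ v : R.carrier ⊗[k] (S × U)}

theorem X_bilin (hζ : (tot R D.gr).IsHom 0 ζ) (x y : R.carrier ⊗[k] 𝔤) :
    D.X ζ (D.brR R x y) = D.brR R (D.X ζ x) y + D.brR R x (D.X ζ y) :=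
  D.brR_derivation (D.isHom_cR (D.isHom_vec hζ)) x y

theorem X_cR (u : R.carrier ⊗[k] U) : D.X ζ (D.cR R u) = 0 := by
  rw [X, LinearMap.flip_apply, brR_cR_cR]

theorem X_brR_cR (hζ : (tot R D.gr).IsHom 0 ζ) (x : R.carrier ⊗[k] 𝔤) (u : R.carrier ⊗[k] U) :
    D.X ζ (D.brR R x (D.cR R u)) = D.brR R (D.X ζ x) (D.cR R u) := by
  rw [D.X_bilin hζ, X_cR, map_zero, add_zero]

theorem isNilpotent_X (hζ : AugHom D.gr R 0 ζ) : IsNilpotent (D.X ζ) :=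
  D.isNilpotent_brR (D.isHom_vec hζ.hom) (D.aug_vec hζ.aug)

theorem extendScalars_symNested_const (T : 𝔤 →ₗ[k] Y) (hζ : (tot R D.gr).IsHom 0 ζ) (n : ℕ) :
    extendScalars R D.gr 1 (D.symNested T (n + 1)) (fun _ => ζ) =
      ((n + 1 : ℕ) : k) • T.lTensor R.carrier ((D.X ζ ^ n) (D.F R ζ)) := by
  rw [symNested, extendScalars_smul, _root_.smul_apply, extendScalars_koszulSymm_const _ hζ,
    extendScalars_comp, extendScalars_nested, iter_const, smul_smul, Nat.factorial_succ,
    Nat.cast_mul, mul_comm ((n + 1 : ℕ) : k), inv_mul_cancel_left₀ (factorial_ne_zero n)]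
  rfl

/-- Either `v` occupies the slot of the field, or one of the `n` slots of vectors; by `iter_update`
the latter all give the same term. For `n = 0` the second term has coefficient zero, so the value of
`n - 1` is immaterial there. -/
theorem extendScalars_symNested_cons (T : 𝔤 →ₗ[k] Y) (hζ : (tot R D.gr).IsHom 0 ζ) {e : ZMod 2}
    (hv : (tot R D.gr).IsHom e v) (n : ℕ) :
    extendScalars R D.gr 1 (D.symNested T (n + 1)) (Fin.cons v fun _ => ζ) =
      T.lTensor R.carrier ((D.X ζ ^ n) (D.F R v)) +
        (n : k) • T.lTensor R.carrier
          (D.brR R ((D.X ζ ^ (n - 1)) (D.F R ζ)) (D.cR R (D.vec R v))) := by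
  rw [symNested, extendScalars_smul, _root_.smul_apply, extendScalars_koszulSymm_cons _ hv hζ,
    inv_smul_smul₀ (factorial_ne_zero n), Fin.sum_univ_succ]
  simp only [extendScalars_comp, extendScalars_nested]
  congr 1
  · simp only [Function.update_self, Function.update_of_ne (Fin.succ_ne_zero _), iter_const]
    rfl
  · cases n with
    | zero => simp
    | succ n =>
      have h : ∀ j : Fin (n + 1), iter (D.brR R) (D.cR R) (n + 1)
          (D.F R (Function.update (fun _ : Fin (n + 2) => ζ) j.succ v 0))
          (fun i => D.vec R (Function.update (fun _ : Fin (n + 2) => ζ) j.succ v i.succ)) =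
          D.brR R ((D.X ζ ^ n) (D.F R ζ)) (D.cR R (D.vec R v)) := by
        intro j
        rw [Function.update_of_ne (Fin.succ_ne_zero _).symm]
        have h1 : (fun i => D.vec R (Function.update (fun _ : Fin (n + 2) => ζ) j.succ v i.succ)) =
            Function.update (fun _ => D.vec R ζ) j (D.vec R v) := by
          funext i
          by_cases hi : i = j
          · subst hi; simp
          · rw [Function.update_of_ne hi, Function.update_of_ne (by simpa using hi)]
        rw [h1, iter_update (fun y => D.X_brR_cR hζ y _)]
        rfl
      simp only [h, Finset.sum_const, Finset.card_univ, Fintype.card_fin, Nat.cast_smul_eq_nsmul,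
        Nat.add_sub_cancel]

/-- In degree `n + 1` symmetrization contributes the factor `n + 1`, and `(n + 1) / (n + 1)! = 1 /
n!` turns the series into an exponential. -/
theorem ser_symNested (T : 𝔤 →ₗ[k] Y) (hζ : AugHom D.gr R 0 ζ) :
    ser D.gr R 1 (D.symNested T) ζ = T.lTensor R.carrier (expEnd (D.X ζ) (D.F R ζ)) := by
  obtain ⟨N, hN⟩ := R.exists_nilp
  obtain ⟨N', hN'⟩ := D.isNilpotent_X hζ
  rw [ser_eq_sum (NilBound.mono (N' := N + N' + 1) hN (by omega)) hζ,
    expEnd_eq_sum (N := N + N') (pow_eq_zero_of_le (by omega) hN'), Finset.sum_range_succ', map_sum]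
  simp only [symNested.eq_1, extendScalars_zero, _root_.zero_apply, smul_zero, add_zero]
  refine Finset.sum_congr rfl fun n _ => ?_
  rw [D.extendScalars_symNested_const T hζ.hom, smul_smul, map_smul]
  congr 1
  rw [Nat.factorial_succ, Nat.cast_mul]
  have h1 : ((n + 1 : ℕ) : k) ≠ 0 := by exact_mod_cast n.succ_ne_zero
  have h2 := factorial_ne_zero (k := k) n
  field_simp

/-- This is the derivative of `ζ ↦ T (e^X F ζ)`. As brackets with constants commute, differentiating
the exponent just brackets the exponential with the constant `vec v`. -/
theorem dser_symNested (T : 𝔤 →ₗ[k] Y) (hζ : AugHom D.gr R 0 ζ) {e : ZMod 2}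
    (hv : AugHom D.gr R e v) :
    dser D.gr R 1 (D.symNested T) ζ v = T.lTensor R.carrier (expEnd (D.X ζ) (D.F R v) +
      D.brR R (expEnd (D.X ζ) (D.F R ζ)) (D.cR R (D.vec R v))) := by
  obtain ⟨N, hN⟩ := R.exists_nilp
  obtain ⟨N', hN'⟩ := D.isNilpotent_X hζ
  rw [dser_eq_sum (NilBound.mono (N' := N + N' + 1) hN (by omega)) hζ hv,
    expEnd_eq_sum (N := N + N' + 1) (pow_eq_zero_of_le (by omega) hN'),
    expEnd_eq_sum (N := N + N') (pow_eq_zero_of_le (by omega) hN')]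
  simp only [D.extendScalars_symNested_cons T hζ.hom hv.hom, smul_add, Finset.sum_add_distrib,
    map_add, map_sum, map_smul]
  congr 1
  rw [sum_range_succ_factorial (k := k) (fun n => T.lTensor R.carrier
          (D.brR R ((D.X ζ ^ (n - 1)) (D.F R ζ)) (D.cR R (D.vec R v))))]
  rw [LinearMap.coe_sum, Finset.sum_apply, map_sum]
  refine Finset.sum_congr rfl fun n _ => ?_
  rw [LinearMap.smul_apply, map_smul]
  rfl

theorem diff_of_ne {n : ℕ} (h : n ≠ 1) : D.diff n = 0 := by
  match n, h with
  | 0, _ => rfl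
  | n + 2, _ => rfl

theorem lie_of_ne {n : ℕ} (h : n ≠ 2) : D.lie n = 0 := by
  match n, h with
  | 0, _ => rfl
  | 1, _ => rfl
  | n + 3, _ => rfl

theorem negVec_of_ne {n : ℕ} (h : n ≠ 1) :
    (negVec n : MultilinearMap k (fun _ : Fin n => S × U) (S × U)) = 0 := by
  match n, h with
  | 0, _ => rfl
  | n + 2, _ => rfl

theorem F_map_diff (z : R.carrier ⊗[k] (S × U)) :
    D.F R (TensorProduct.map R.par.toLinearMap ((-(D.r ∘ₗ D.br D.Δ ∘ₗ D.i)).prodMap D.d) z) =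
      -D.brR R (D.ΔR R) (D.F R z) := by
  -- The field `[Δ, s]` has no constant part, since `Δ` lies in the subalgebra `S`; so projecting to
  -- `S` loses nothing.
  have h1 : ∀ s, D.i (D.r (D.br D.Δ (D.i s))) = D.br D.Δ (D.i s) := fun s => by
    have h2 := D.decomp D.Δ
    rw [D.P_Δ, map_zero, add_zero] at h2
    have h3 := D.decomp (D.br D.Δ (D.i s))
    rw [← h2, D.P_br, map_zero, add_zero, h2] at h3
    exact h3
  have : D.F R ∘ₗ TensorProduct.map R.par.toLinearMap
      ((-(D.r ∘ₗ D.br D.Δ ∘ₗ D.i)).prodMap D.d) = (-1 : k) • D.brR R (D.ΔR R) ∘ₗ D.F R :=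
    tensor_ext_isHom (G := D.gr) fun α p a z ha hz => by
      have ha' : R.par a = sg k α • a := ha
      rw [LinearMap.comp_apply, LinearMap.smul_apply, LinearMap.comp_apply, TensorProduct.map_tmul,
        F_tmul, F_tmul, AlgHom.toLinearMap_apply, R.par_par, ha', ← TensorProduct.smul_tmul',
        map_smul, ΔR, extBilin_tmul _ _ D.Δ_odd ha, one_mul, one_mul, smul_smul (sg k α), sg_mul_self,
        one_smul, neg_one_smul,
        ← TensorProduct.tmul_neg, ← h1 z.1]
      simp
  have h2 := LinearMap.congr_fun this z
  rwa [LinearMap.smul_apply, neg_one_smul] at h2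

theorem vec_map_diff (z : R.carrier ⊗[k] (S × U)) :
    D.vec R (TensorProduct.map R.par.toLinearMap ((-(D.r ∘ₗ D.br D.Δ ∘ₗ D.i)).prodMap D.d) z) =
      TensorProduct.map R.par.toLinearMap D.d (D.vec R z) := by
  have : D.vec R ∘ₗ TensorProduct.map R.par.toLinearMap ((-(D.r ∘ₗ D.br D.Δ ∘ₗ D.i)).prodMap D.d) =
      TensorProduct.map R.par.toLinearMap D.d ∘ₗ D.vec R := TensorProduct.ext' fun a z => rfl
  exact LinearMap.congr_fun this z

theorem F_extendScalars_lie (ζ : Fin 2 → R.carrier ⊗[k] (S × U)) :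
    D.F R (extendScalars R D.gr 1 (D.lie 2) ζ) =
      D.brR R ((tot R D.g).par (D.F R (ζ 0))) (D.F R (ζ 1)) := by
  have : (D.F R).compMultilinearMap (extendScalars R D.gr 1 (D.lie 2)) =
      LinearMap.uncurryLeft ((MultilinearMap.ofSubsingletonₗ k k _ _ (0 : Fin 1)).toLinearMap ∘ₗ
        (D.brR R).compl₁₂ ((tot R D.g).par ∘ₗ D.F R) (D.F R)) := by
    refine multilinear_tensor_ext D.gr fun α p a x ha hx => ?_
    rw [LinearMap.compMultilinearMap_apply, extendScalars_tmul D.gr _ _ ha hx]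
    change _ = D.brR R ((tot R D.g).par (D.F R (a 0 ⊗ₜ x 0))) (D.F R (a 1 ⊗ₜ x 1))
    have h0 : R.par (a 0) = sg k (α 0) • a 0 := ha 0
    have h1 : R.par (a 1) = sg k (α 1) • a 1 := ha 1
    have hf := D.isHom_i (isHom_fst (hx 0))
    have hf' : D.g.par (D.i (x 0).1) = sg k (p 0 + 1) • D.i (x 0).1 := hf
    have h3 := D.decomp (D.br (D.i (x 0).1) (D.i (x 1).1))
    rw [D.P_br, map_zero, add_zero] at h3
    rw [map_smul, F_tmul, F_tmul, F_tmul, lie_two, tot, TensorProduct.map_tmul,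
      AlgHom.toLinearMap_apply, R.par_par, hf', TensorProduct.tmul_smul, map_smul, map_smul,
      LinearMap.smul_apply, map_smul, map_smul, h1, ← TensorProduct.smul_tmul', map_smul,
      LinearMap.smul_apply, extBilin_tmul _ _ hf (ha 1), h3]
    simp only [List.ofFn_succ, List.ofFn_zero, List.prod_cons, List.prod_nil, mul_one, map_mul,
      Fin.succ_zero_eq_one, h0, h1, TensorProduct.tmul_smul, ← TensorProduct.smul_tmul',
      smul_mul_smul_comm, smul_smul, ← sg_add]
    congr 2
    simp [Fin.sum_univ_two]
    grind
  exact congrArg (fun F => F ζ) this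

theorem vec_extendScalars_lie (ζ : Fin 2 → R.carrier ⊗[k] (S × U)) :
    D.vec R (extendScalars R D.gr 1 (D.lie 2) ζ) = 0 := by
  have h : (LinearMap.snd k S U).compMultilinearMap (D.lie 2) = 0 := by
    ext z
    rfl
  rw [vec, ← extendScalars_comp, h, extendScalars_zero]
  rfl

end TwistData

/-! ## Parity of symmetrizations -/

section

variable {k : Type u} [Field k] [CharZero k] {V : Type*} [AddCommGroup V] [Module k V]
variable {X : Type*} [AddCommGroup X] [Module k X]

theorem koszulSymm_apply (G : SuperStructure k V) {n : ℕ}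
    (f : MultilinearMap k (fun _ : Fin n => V) X) (x : Fin n → V) :
    koszulSymm G f x = ∑ σ, act G σ f x := by
  rw [koszulSymm, LinearMap.coe_sum, Finset.sum_apply, _root_.sum_apply]

theorem par_koszulSymm {G : SuperStructure k V} {H : SuperStructure k X} {c : k} {n : ℕ}
    {f : MultilinearMap k (fun _ : Fin n => V) X}
    (hf : ∀ x, H.par (f x) = c • f (fun i => G.par (x i))) (x : Fin n → V) :
    H.par (koszulSymm G f x) = c • koszulSymm G f (fun i => G.par (x i)) := by
  simp only [koszulSymm_apply, map_sum, Finset.smul_sum, act_apply, map_smul, hf, proj_par]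
  exact Finset.sum_congr rfl fun σ _ => Finset.sum_congr rfl fun p _ => smul_comm _ _ _

end

/-! ### Elements and brackets of definite parity -/

section

variable {k : Type u} [Field k] {V : Type*} [AddCommGroup V] [Module k V]

theorem SuperStructure.IsHom.par_zero {G : SuperStructure k V} {x : V} (h : G.IsHom 0 x) :
    G.par x = x := by
  rw [show G.par x = sg k 0 • x from h, sg_zero, one_smul]

theorem SuperStructure.IsHom.par_one {G : SuperStructure k V} {x : V} (h : G.IsHom 1 x) :
    G.par x = -x := by
  rw [show G.par x = sg k 1 • x from h, sg_one, neg_one_smul]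

theorem eq_of_eq_neg_sg_one_smul {x y : V} (h : x = -(sg k 1 • y)) : x = y := by
  rw [h, sg_one, neg_one_smul, neg_neg]

theorem eq_neg_of_eq_neg_sg_zero_smul {x y : V} (h : x = -(sg k 0 • y)) : x = -y := by
  rw [h, sg_zero, one_smul]

end

/-! ## Involutive endomorphisms of Maurer–Cartan functors -/

section Functor

variable {k : Type u} [Field k] [CharZero k] {W : Type v} [AddCommGroup W] [Module k W]
variable {L : LInftyData k W} {φ : (n : ℕ) → MultilinearMap k (fun _ : Fin n => W) W}

theorem pushMC_map {R R' : ArtinCdga k} (F : ArtinCdga.Hom R R')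
    {ξ : R.carrier ⊗[k] W} (h : IsMC L R ξ) :
    F.f.toLinearMap.rTensor W (pushMC L φ R ξ) = pushMC L φ R' (F.f.toLinearMap.rTensor W ξ) :=
  (ser_map F.f F.par F.aug h.augHom).1

theorem pushMC_mem_MC (hφ : ∀ R ξ, IsMC L R ξ → IsMC L R (pushMC L φ R ξ))
    {A : FormalCdga.{u, w} k} {ζ : (i : A.ι) → (A.obj i).carrier ⊗[k] W} (hζ : ζ ∈ MC L A) :
    (fun i => pushMC L φ (A.obj i) (ζ i)) ∈ MC L A := by
  refine ⟨fun i => hφ _ _ (hζ.1 i), fun i j h => ?_⟩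
  rw [pushMC_map _ (hζ.1 j), hζ.2 i j h]

theorem bijOn_pushMC (hφ : ∀ R ξ, IsMC L R ξ → IsMC L R (pushMC L φ R ξ))
    (hφ' : ∀ R ξ, IsMC L R ξ → pushMC L φ R (pushMC L φ R ξ) = ξ) (A : FormalCdga.{u, w} k) :
    Set.BijOn (fun (ζ : (i : A.ι) → (A.obj i).carrier ⊗[k] W) i => pushMC L φ (A.obj i) (ζ i))
      (MC L A) (MC L A) := by
  have h : ∀ ζ ∈ MC L A, (fun i => pushMC L φ (A.obj i) (pushMC L φ (A.obj i) (ζ i))) = ζ :=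
    fun ζ hζ => funext fun i => hφ' _ _ (hζ.1 i)
  refine ⟨fun ζ hζ => pushMC_mem_MC hφ hζ, fun ζ hζ ζ' hζ' e => ?_,
    fun ζ hζ => ⟨_, pushMC_mem_MC hφ hζ, h ζ hζ⟩⟩
  rw [← h ζ hζ, ← h ζ' hζ']
  funext i
  exact congrArg (pushMC L φ (A.obj i)) (congrFun e i)

/-- Compatibility over `j ≤ j'` is checked after replacing both components of `ζ` by images of one
component at a common index, where the maps of `F` agree. -/
theorem push_mem_MC {A B : FormalCdga.{u, w} k} (F : FormalCdga.Hom A B)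
    {ζ : (i : A.ι) → (A.obj i).carrier ⊗[k] W} (hζ : ζ ∈ MC L A) : F.push ζ ∈ MC L B := by
  refine ⟨fun j => isMC_map (F.f j) (hζ.1 _), fun j j' h => ?_⟩
  obtain ⟨i, h₁, h₂, hc⟩ := F.compat h
  have e := hζ.2 _ _ h₁
  have e' := hζ.2 _ _ h₂
  change (B.map h).f.toLinearMap.rTensor W ((F.f j').f.toLinearMap.rTensor W (ζ (F.idx j'))) =
    (F.f j).f.toLinearMap.rTensor W (ζ (F.idx j))
  rw [← e, ← e']
  generalize ζ i = y
  simp only [← LinearMap.comp_apply, ← LinearMap.rTensor_comp]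
  congr 2
  exact LinearMap.ext hc

theorem pushMC_push {A B : FormalCdga.{u, w} k} (F : FormalCdga.Hom A B)
    {ζ : (i : A.ι) → (A.obj i).carrier ⊗[k] W} (hζ : ζ ∈ MC L A) :
    (fun j => pushMC L φ (B.obj j) (F.push ζ j)) = F.push fun i => pushMC L φ (A.obj i) (ζ i) :=
  funext fun j => (pushMC_map (F.f j) (hζ.1 _)).symm

/-- Families of symmetric maps are determined by their action on Maurer–Cartan elements. -/
theorem eq_of_pushMC_eq
    (hm : ∀ n x, L.gr.par (L.m n x) = -L.m n (fun i => L.gr.par (x i))) (h0 : L.m 0 = 0)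
    (hs : ∀ n (σ : Equiv.Perm (Fin n)), act L.gr σ (L.m n) = L.m n)
    (H : ∀ (R : ArtinCdga k) (ζ : R.carrier ⊗[k] W), AugHom L.gr R 0 ζ →
      dser L.gr R 1 L.m ζ (ser L.gr R 1 L.m ζ) = 0)
    {ψ : (n : ℕ) → MultilinearMap k (fun _ : Fin n => W) W}
    (hφ : ∀ n (σ : Equiv.Perm (Fin n)), act L.gr σ (φ n) = φ n)
    (hψ : ∀ n (σ : Equiv.Perm (Fin n)), act L.gr σ (ψ n) = ψ n)
    (h : ∀ R ξ, IsMC L R ξ → pushMC L φ R ξ = pushMC L ψ R ξ) : φ = ψ := by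
  refine eq_of_ser_eq 0 hφ hψ fun n p x hx => ?_
  -- The generic element is not itself a Maurer–Cartan element; it is lifted to the cone, the
  -- actions are compared there, and the result is projected back.
  obtain ⟨z, hz, e⟩ := exists_isMC_cone hm h0 hs H (augHom_generic hx)
  have hn : ∀ a, coneProj (Grass.cdga k p) ((cone (Grass.cdga k p)).par a) =
    (Grass.cdga k p).par (coneProj (Grass.cdga k p) a) := conePar_one_one _
  have h1 := (ser_map (q := 0) (φ := φ) (coneProj (Grass.cdga k p)) hn (fun _ => rfl) hz.augHom).1
  have h2 := (ser_map (q := 0) (φ := ψ) (coneProj (Grass.cdga k p)) hn (fun _ => rfl) hz.augHom).1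
  rw [e] at h1 h2
  rw [← h1, ← h2]
  exact congrArg _ (h _ z hz)

end Functor

namespace TwistData

variable {k : Type u} [Field k] [CharZero k] {𝔤 : Type*} {S U : Type*} [AddCommGroup 𝔤] [Module k 𝔤]
variable [AddCommGroup S] [Module k S] [AddCommGroup U] [Module k U] (D : TwistData k 𝔤 S U)
variable {R : ArtinCdga k} {ζ v : R.carrier ⊗[k] (S × U)}

/-! ### The series -/

theorem isHom_F_even (hζ : (tot R D.gr).IsHom 0 ζ) : (tot R D.g).IsHom 1 (D.F R ζ) := by
  have h := D.isHom_F hζ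
  rwa [zero_add] at h

theorem isHom_F_odd (hζ : (tot R D.gr).IsHom 1 ζ) : (tot R D.g).IsHom 0 (D.F R ζ) := by
  have h := D.isHom_F hζ
  rwa [zmod_two_add_self] at h

theorem par_F (hζ : (tot R D.gr).IsHom 0 ζ) : (tot R D.g).par (D.F R ζ) = -D.F R ζ :=
  (D.isHom_F_even hζ).par_one

theorem brR_odd {x y : R.carrier ⊗[k] 𝔤} (hx : (tot R D.g).IsHom 1 x)
    (hy : (tot R D.g).IsHom 1 y) : D.brR R x y = D.brR R y x :=
  eq_of_eq_neg_sg_one_smul (D.brR_antisymm hx hy)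

theorem brR_even_odd {x y : R.carrier ⊗[k] 𝔤} (hx : (tot R D.g).IsHom 0 x)
    (hy : (tot R D.g).IsHom 1 y) : D.brR R x y = -D.brR R y x :=
  eq_neg_of_eq_neg_sg_zero_smul (D.brR_antisymm hx hy)

theorem F_lTensor (T : 𝔤 →ₗ[k] S × U) (y : R.carrier ⊗[k] 𝔤) :
    D.F R (R.par.toLinearMap.rTensor _ (T.lTensor R.carrier y)) =
      (D.i ∘ₗ LinearMap.fst k S U ∘ₗ T).lTensor R.carrier y := by
  have : D.F R ∘ₗ R.par.toLinearMap.rTensor _ ∘ₗ T.lTensor R.carrier =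
      (D.i ∘ₗ LinearMap.fst k S U ∘ₗ T).lTensor R.carrier := TensorProduct.ext' fun a x => by
    simp only [LinearMap.comp_apply, LinearMap.lTensor_tmul, LinearMap.rTensor_tmul, F_tmul,
      AlgHom.toLinearMap_apply, R.par_par]
    rfl
  exact LinearMap.congr_fun this y

theorem F_lTensor_inr (y : R.carrier ⊗[k] 𝔤) :
    D.F R ((LinearMap.inr k S U ∘ₗ D.P).lTensor R.carrier y) = 0 := by
  have : D.F R ∘ₗ (LinearMap.inr k S U ∘ₗ D.P).lTensor R.carrier = 0 :=
    TensorProduct.ext' fun a x => by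
      simp [LinearMap.comp_apply, LinearMap.lTensor_tmul, F_tmul]
  exact LinearMap.congr_fun this y

theorem vec_lTensor_inr (y : R.carrier ⊗[k] 𝔤) :
    D.vec R ((LinearMap.inr k S U ∘ₗ D.P).lTensor R.carrier y) = D.PR R y := by
  rw [vec, ← LinearMap.comp_apply, ← LinearMap.lTensor_comp]
  rfl

theorem vec_rTensor_par (T : 𝔤 →ₗ[k] S) (y : R.carrier ⊗[k] 𝔤) :
    D.vec R (R.par.toLinearMap.rTensor _ ((LinearMap.inl k S U ∘ₗ T).lTensor R.carrier y)) = 0 := by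
  have : D.vec R ∘ₗ R.par.toLinearMap.rTensor _ ∘ₗ (LinearMap.inl k S U ∘ₗ T).lTensor R.carrier =
      0 := TensorProduct.ext' fun a x => by
    simp [LinearMap.comp_apply, vec_tmul]
  exact LinearMap.congr_fun this y

/-- The bracket of `Δ` with a constant is constant and constants commute, so the exponential stops
after the linear term. -/
theorem expEnd_ΔR (ζ : R.carrier ⊗[k] (S × U)) : expEnd (D.X ζ) (D.ΔR R) =
    D.ΔR R + D.cR R (TensorProduct.map R.par.toLinearMap D.d (D.vec R ζ)) := by
  have h : D.X ζ (D.ΔR R) = D.cR R (TensorProduct.map R.par.toLinearMap D.d (D.vec R ζ)) := by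
    rw [X, LinearMap.flip_apply, brR_ΔR_cR]
  rw [expEnd_of_sq (by rw [h, X_cR]), h]

theorem expEnd_brR (hζ : AugHom D.gr R 0 ζ) (x y : R.carrier ⊗[k] 𝔤) :
    expEnd (D.X ζ) (D.brR R x y) = D.brR R (expEnd (D.X ζ) x) (expEnd (D.X ζ) y) :=
  expEnd_bilin (D.isNilpotent_X hζ) _ (D.X_bilin hζ.hom) x y

theorem expEnd_cR (u : R.carrier ⊗[k] U) : expEnd (D.X ζ) (D.cR R u) = D.cR R u :=
  expEnd_of_eq_zero (D.X_cR u)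

/-- Completing the square: the differential gives `-[Δ, F]`, the binary product gives `-½[F, F]`,
and `[Δ, Δ] = 0`. -/
theorem F_ser (hζ : AugHom D.gr R 0 ζ) : D.F R (ser D.gr R 1 D.tilde.m ζ) =
    -((2 : k)⁻¹ • D.brR R (D.F R ζ + D.ΔR R) (D.F R ζ + D.ΔR R)) := by
  have h1 : D.brR R (D.F R ζ) (D.ΔR R) = D.brR R (D.ΔR R) (D.F R ζ) :=
    D.brR_odd (D.isHom_F_even hζ.hom) D.isHom_ΔR
  have h2 := D.brR_ΔR_ΔR (R := R)
  change D.F R (ser D.gr R 1 (fun n => D.diff n + D.lie n + D.symNested _ n) ζ) = _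
  rw [ser_add hζ, ser_add hζ, ser_symNested _ _ hζ, map_add, map_add, F_lTensor_inr,
    ser_single (fun n => D.diff_of_ne), ser_single (fun n => D.lie_of_ne), map_smul, map_smul,
    F_extendScalars_lie, D.par_F hζ.hom, diff, extendScalars_ofSubsingleton_one, F_map_diff]
  simp only [map_add, LinearMap.add_apply, h1, h2, map_neg, LinearMap.neg_apply,
    Nat.factorial, smul_add]
  push_cast
  module

/-- The differential on `U` is the constant part of `e^X Δ`, so it merges with the products of all
arities into one projection. -/
theorem vec_ser (hζ : AugHom D.gr R 0 ζ) : D.vec R (ser D.gr R 1 D.tilde.m ζ) =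
    D.PR R (expEnd (D.X ζ) (D.F R ζ + D.ΔR R)) := by
  change D.vec R (ser D.gr R 1 (fun n => D.diff n + D.lie n + D.symNested _ n) ζ) = _
  rw [ser_add hζ, ser_add hζ, ser_symNested _ _ hζ, map_add, map_add, vec_lTensor_inr,
    ser_single (fun n => D.diff_of_ne), ser_single (fun n => D.lie_of_ne), map_smul, map_smul,
    vec_extendScalars_lie, diff, extendScalars_ofSubsingleton_one, vec_map_diff,
    expEnd_add _ (D.isNilpotent_X hζ), expEnd_ΔR, map_add, map_add, PR_ΔR, PR_cR]
  simp [add_comm]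

theorem F_dser (hζ : AugHom D.gr R 0 ζ) (hv : AugHom D.gr R 1 v) :
    D.F R (dser D.gr R 1 D.tilde.m ζ v) = D.brR R (D.F R v) (D.F R ζ + D.ΔR R) := by
  have hF := D.isHom_F_odd hv.hom
  have h1 : D.brR R (D.F R v) (D.ΔR R) = -D.brR R (D.ΔR R) (D.F R v) :=
    D.brR_even_odd hF D.isHom_ΔR
  have h2 : (tot R D.g).par (D.F R v) = D.F R v := hF.par_zero
  change D.F R (dser D.gr R 1 (fun n => D.diff n + D.lie n + D.symNested _ n) ζ v) = _
  rw [dser_add hζ hv, dser_add hζ hv, dser_symNested _ _ hζ hv, map_add, map_add, F_lTensor_inr,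
    dser_single (m := 0) (fun n => D.diff_of_ne), dser_single (m := 1) (fun n => D.lie_of_ne),
    map_smul, map_smul, F_extendScalars_lie, diff, extendScalars_ofSubsingleton_one, F_map_diff,
    map_add, h1]
  simp [h2, add_comm]

/-- The derivative of `P e^X M`. Since `e^X` preserves the bracket and fixes constants, the bracket
with the constant `vec v` can be written inside the exponential. -/
theorem vec_dser (hζ : AugHom D.gr R 0 ζ) (hv : AugHom D.gr R 1 v) :
    D.vec R (dser D.gr R 1 D.tilde.m ζ v) =
      D.PR R (expEnd (D.X ζ) (D.F R v + D.brR R (D.F R ζ + D.ΔR R) (D.cR R (D.vec R v)))) := by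
  change D.vec R (dser D.gr R 1 (fun n => D.diff n + D.lie n + D.symNested _ n) ζ v) = _
  have hX := D.isNilpotent_X hζ
  rw [dser_add hζ hv, dser_add hζ hv, dser_symNested _ _ hζ hv, map_add, map_add, vec_lTensor_inr,
    dser_single (m := 0) (fun n => D.diff_of_ne), dser_single (m := 1) (fun n => D.lie_of_ne),
    map_smul, map_smul, vec_extendScalars_lie, diff, extendScalars_ofSubsingleton_one,
    vec_map_diff, expEnd_add _ hX, D.expEnd_brR hζ, expEnd_cR, expEnd_add _ hX, expEnd_ΔR,
    map_add (D.brR R), map_add (D.brR R), LinearMap.add_apply, LinearMap.add_apply, brR_cR_cR,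
    brR_ΔR_cR]
  simp only [map_add, PR_cR]
  simp
  abel

/-- The iterated brackets were extended as odd maps and `tw` is even. By `par_ser` the difference is
an involution on coefficients, which cancels the one in `F`. -/
theorem F_ser_tw (hζ : AugHom D.gr R 0 ζ) : D.F R (ser D.gr R 0 D.tw ζ) =
    D.πR R (expEnd (D.X ζ) (D.F R ζ)) := by
  change D.F R (ser D.gr R 0 (fun n => D.symNested _ n + negVec n) ζ) = _
  rw [ser_add hζ, show (0 : ZMod 2) = 1 + 1 from rfl, ← par_ser hζ, ser_symNested _ _ hζ, map_add,
    F_lTensor, show (1 + 1 : ZMod 2) = 0 from rfl, ser_single (fun n => negVec_of_ne), map_smul,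
    negVec, extendScalars_ofSubsingleton_zero]
  have : D.F R ∘ₗ (-(LinearMap.inr k S U ∘ₗ LinearMap.snd k S U)).lTensor R.carrier = 0 :=
    TensorProduct.ext' fun a x => by simp [LinearMap.lTensor_tmul, F_tmul]
  rw [← LinearMap.comp_apply (D.F R), this, LinearMap.zero_apply, smul_zero, add_zero]
  rfl

theorem vec_negVec (y : R.carrier ⊗[k] (S × U)) :
    D.vec R ((-(LinearMap.inr k S U ∘ₗ LinearMap.snd k S U)).lTensor R.carrier y) =
      -D.vec R y := by
  rw [vec, LinearMap.lTensor_neg, LinearMap.neg_apply, map_neg, ← LinearMap.comp_apply,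
    ← LinearMap.lTensor_comp]
  rfl

theorem vec_ser_tw (hζ : AugHom D.gr R 0 ζ) : D.vec R (ser D.gr R 0 D.tw ζ) = -D.vec R ζ := by
  change D.vec R (ser D.gr R 0 (fun n => D.symNested _ n + negVec n) ζ) = _
  rw [ser_add hζ, show (0 : ZMod 2) = 1 + 1 from rfl, ← par_ser hζ, ser_symNested _ _ hζ, map_add,
    vec_rTensor_par, show (1 + 1 : ZMod 2) = 0 from rfl, ser_single (fun n => negVec_of_ne),
    map_smul, negVec, extendScalars_ofSubsingleton_zero, vec_negVec]
  simp

theorem F_dser_tw (hζ : AugHom D.gr R 0 ζ) (hv : AugHom D.gr R 1 v) :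
    D.F R (dser D.gr R 0 D.tw ζ v) = D.πR R (expEnd (D.X ζ) (D.F R v) +
      D.brR R (expEnd (D.X ζ) (D.F R ζ)) (D.cR R (D.vec R v))) := by
  change D.F R (dser D.gr R 0 (fun n => D.symNested _ n + negVec n) ζ v) = _
  rw [dser_add hζ hv, show (0 : ZMod 2) = 1 + 1 from rfl, ← par_dser hζ hv,
    dser_symNested _ _ hζ hv, map_add (D.F R),
    F_lTensor, show (1 + 1 : ZMod 2) = 0 from rfl, dser_single (m := 0) (fun n => negVec_of_ne),
    map_smul, negVec, extendScalars_ofSubsingleton_zero]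
  have : D.F R ∘ₗ (-(LinearMap.inr k S U ∘ₗ LinearMap.snd k S U)).lTensor R.carrier = 0 :=
    TensorProduct.ext' fun a x => by simp [LinearMap.lTensor_tmul, F_tmul]
  rw [← LinearMap.comp_apply (D.F R), this, LinearMap.zero_apply, smul_zero, add_zero]
  rfl

theorem vec_dser_tw (hζ : AugHom D.gr R 0 ζ) (hv : AugHom D.gr R 1 v) :
    D.vec R (dser D.gr R 0 D.tw ζ v) = -D.vec R v := by
  change D.vec R (dser D.gr R 0 (fun n => D.symNested _ n + negVec n) ζ v) = _
  rw [dser_add hζ hv, show (0 : ZMod 2) = 1 + 1 from rfl, ← par_dser hζ hv,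
    dser_symNested _ _ hζ hv, map_add (D.vec R),
    vec_rTensor_par, show (1 + 1 : ZMod 2) = 0 from rfl,
    dser_single (m := 0) (fun n => negVec_of_ne),
    map_smul, negVec, extendScalars_ofSubsingleton_zero, vec_negVec]
  simp

end TwistData

theorem expEnd_neg_smul {k : Type u} [Field k] [CharZero k] {M : Type*} [AddCommGroup M]
    [Module k M] {X : M →ₗ[k] M} (hX : IsNilpotent X) (c : k) (m : M) :
    expEnd X (-(c • m)) = -(c • expEnd X m) := by
  rw [← neg_smul, expEnd_smul _ hX, neg_smul]

namespace TwistData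

variable {k : Type u} [Field k] [CharZero k] {𝔤 : Type*} {S U : Type*} [AddCommGroup 𝔤] [Module k 𝔤]
variable [AddCommGroup S] [Module k S] [AddCommGroup U] [Module k U] (D : TwistData k 𝔤 S U)

/-! ### The L∞ relations, the morphism relation and involutivity -/

section Identities

variable {R : ArtinCdga k} {ζ v : R.carrier ⊗[k] (S × U)}

theorem isHom_lTensor {A B : Type*} [AddCommGroup A] [Module k A] [AddCommGroup B] [Module k B]
    {G : SuperStructure k A} {H : SuperStructure k B} {T : A →ₗ[k] B}
    (hT : ∀ x, T (G.par x) = H.par (T x)) {e : ZMod 2} {y : R.carrier ⊗[k] A}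
    (hy : (tot R G).IsHom e y) : (tot R H).IsHom e (T.lTensor R.carrier y) := by
  have h : (tot R H).par ∘ₗ T.lTensor R.carrier = T.lTensor R.carrier ∘ₗ (tot R G).par :=
    TensorProduct.ext' fun a x => by simp [tot, hT]
  have h1 := LinearMap.congr_fun h y
  have h2 : (tot R G).par y = sg k e • y := hy
  rw [LinearMap.comp_apply, LinearMap.comp_apply, h2, map_smul] at h1
  exact h1

theorem isHom_πR {e : ZMod 2} {x : R.carrier ⊗[k] 𝔤} (hx : (tot R D.g).IsHom e x) :
    (tot R D.g).IsHom e (D.πR R x) :=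
  isHom_lTensor (fun x => by rw [LinearMap.comp_apply, LinearMap.comp_apply, D.r_par, D.i_par]) hx

theorem isHom_PR {e : ZMod 2} {x : R.carrier ⊗[k] 𝔤} (hx : (tot R D.g).IsHom e x) :
    (tot R D.gU).IsHom e (D.PR R x) :=
  isHom_lTensor D.P_par hx

theorem isHom_brR {p q : ZMod 2} {x y : R.carrier ⊗[k] 𝔤} (hx : (tot R D.g).IsHom p x)
    (hy : (tot R D.g).IsHom q y) : (tot R D.g).IsHom (p + q) (D.brR R x y) := by
  have h := bilin_eq_of_isHom (B := (D.brR R).compr₂ (tot R D.g).par)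
    (B' := sg k (p + q) • D.brR R) (fun α φ a f β ψ b f' ha hf hb hf' h h' => by
      rw [LinearMap.compr₂_apply, LinearMap.smul_apply, LinearMap.smul_apply,
        extBilin_tmul _ _ hf hb, map_smul, smul_comm]
      congr 1
      have h1 : (tot R D.g).IsHom _ _ := isHom_tmul (isHom_mul ha hb) (D.isHom_br hf hf')
      rw [show (tot R D.g).par _ = _ from h1]
      congr 2
      subst h h'
      ring) hx hy
  exact h

/-- The structure maps evaluated at the sum of an element of `A ⊗ S` and a constant. -/
theorem brR_self_decomp {x : R.carrier ⊗[k] 𝔤} (hx : (tot R D.g).IsHom 1 x) :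
    -((2 : k)⁻¹ • D.brR R x x) + D.brR R x (D.cR R (D.PR R x)) =
      -((2 : k)⁻¹ • D.brR R (D.πR R x) (D.πR R x)) := by
  -- Write `x = s + t` with `t` constant. Then `[t, t] = 0`, so `[x, x] = [s, s] + 2[s, t]`, while
  -- `[x, t] = [s, t]`.
  obtain ⟨s, hs⟩ : ∃ s, s = D.πR R x := ⟨_, rfl⟩
  obtain ⟨t, ht⟩ : ∃ t, t = D.cR R (D.PR R x) := ⟨_, rfl⟩
  have h1 : D.brR R t s = D.brR R s t := by
    rw [hs, ht]
    exact D.brR_odd (D.isHom_cR (D.isHom_PR hx)) (D.isHom_πR hx)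
  have h2 : D.brR R t t = 0 := by rw [ht]; exact D.brR_cR_cR _ _
  have h3 : x = s + t := by rw [hs, ht]; exact (D.decompR x).symm
  rw [← hs, ← ht, h3]
  simp only [map_add, LinearMap.add_apply, h1, h2]
  module

theorem expEnd_isHom (hζ : AugHom D.gr R 0 ζ) {e : ZMod 2} {x : R.carrier ⊗[k] 𝔤}
    (hx : (tot R D.g).IsHom e x) : (tot R D.g).IsHom e (expEnd (D.X ζ) x) := by
  obtain ⟨N, hN⟩ := D.isNilpotent_X hζ
  rw [expEnd_eq_sum hN]
  refine Finset.sum_induction _ ((tot R D.g).IsHom e) (fun _ _ => SuperStructure.IsHom.add)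
    (isHom_zero _ _) fun n hn => SuperStructure.IsHom.smul ?_ _
  clear hn
  induction n with
  | zero => exact hx
  | succ n ih =>
    rw [pow_succ']
    have := D.isHom_brR ih (D.isHom_cR (D.isHom_vec hζ.hom))
    rwa [add_zero] at this

theorem isHom_field (hζ : AugHom D.gr R 0 ζ) : (tot R D.g).IsHom 1 (D.F R ζ + D.ΔR R) :=
  (D.isHom_F_even hζ.hom).add D.isHom_ΔR

/-- The triple bracket of an odd element vanishes. -/
theorem brR_brR_self {x : R.carrier ⊗[k] 𝔤} (hx : (tot R D.g).IsHom 1 x) :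
    D.brR R (D.brR R x x) x = 0 := by
  have h1 := D.brR_jacobi hx hx x
  have h0 : (tot R D.g).IsHom 0 (D.brR R x x) := by
    have := D.isHom_brR hx hx
    rwa [zmod_two_add_self] at this
  have h2 := D.brR_even_odd h0 hx
  rw [mul_one, sg_one] at h1
  have h3 : D.brR R x (D.brR R x x) = -D.brR R (D.brR R x x) x := by rw [h2, neg_neg]
  rw [h3] at h1
  generalize D.brR R (D.brR R x x) x = y at *
  -- With antisymmetry, the Jacobi identity for three copies of `x` reads `-y = 2 y`.
  have h4 : (3 : k) • y = 0 := by
    have h5 : -y = y + (-1 : k) • -y := h1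
    have h6 : (3 : k) • y = (y + (-1 : k) • -y) - -y := by module
    rw [h6, ← h5, sub_self]
  exact (smul_eq_zero.1 h4).resolve_left (by norm_num)

theorem par_iter (n : ℕ) (f : 𝔤) (u : Fin n → U) :
    D.g.par (iter D.br D.c n f u) = iter D.br D.c n (D.g.par f) (fun i => D.gU.par (u i)) := by
  induction n generalizing f with
  | zero => rfl
  | succ n ih =>
    rw [iter_succ, iter_succ, ih, D.c_par, D.br_par]
    rfl

theorem par_nested (n : ℕ) (z : Fin (n + 1) → S × U) :
    D.g.par (D.nested n z) = (-1 : k) • D.nested n (fun i => D.gr.par (z i)) := by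
  rw [nested_apply, nested_apply, par_iter]
  change _ = (-1 : k) • iter D.br D.c n (D.i (-D.gS.par (z 0).1)) (fun j => D.gU.par (z j.succ).2)
  rw [map_neg, map_neg, D.i_par, neg_one_smul, _root_.neg_apply, neg_neg]

theorem par_symNested {Y : Type*} [AddCommGroup Y] [Module k Y] {H : SuperStructure k Y}
    {T : 𝔤 →ₗ[k] Y} {c : k} (hT : ∀ x, H.par (T x) = -(c • T (D.g.par x))) (n : ℕ)
    (z : Fin n → S × U) :
    H.par (D.symNested T n z) = c • D.symNested T n (fun i => D.gr.par (z i)) := by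
  cases n with
  | zero => simp [symNested]
  | succ n =>
    rw [symNested, _root_.smul_apply, map_smul, par_koszulSymm (c := c), _root_.smul_apply,
      smul_comm]
    intro x
    rw [LinearMap.compMultilinearMap_apply, hT, par_nested, LinearMap.compMultilinearMap_apply]
    rw [neg_one_smul, map_neg, smul_neg, neg_neg]

theorem br_Δ_par (x : 𝔤) : D.br D.Δ (D.g.par x) = -D.g.par (D.br D.Δ x) := by
  have h := D.br_par D.Δ x
  rw [D.Δ_odd.par_one, map_neg, LinearMap.neg_apply] at h
  rw [← h, neg_neg]

theorem par_diff (n : ℕ) (z : Fin n → S × U) :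
    D.gr.par (D.diff n z) = -D.diff n (fun i => D.gr.par (z i)) := by
  by_cases hn : n = 1
  · subst hn
    change ((-D.gS.par (-D.r (D.br D.Δ (D.i (z 0).1))), D.gU.par (D.d (z 0).2)) : S × U) =
      -(-D.r (D.br D.Δ (D.i (-D.gS.par (z 0).1))), D.d (D.gU.par (z 0).2))
    rw [D.d_par, map_neg D.i, D.i_par, map_neg (D.br D.Δ), br_Δ_par, neg_neg, D.r_par]
    simp
  · rw [D.diff_of_ne hn]; simp

theorem par_lie (n : ℕ) (z : Fin n → S × U) :
    D.gr.par (D.lie n z) = -D.lie n (fun i => D.gr.par (z i)) := by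
  by_cases hn : n = 2
  · subst hn
    rw [lie_two, lie_two]
    change ((-D.gS.par (D.r (D.br (D.g.par (D.i (z 0).1)) (D.i (z 1).1))), D.gU.par 0) : S × U) =
      -(D.r (D.br (D.g.par (D.i (-D.gS.par (z 0).1))) (D.i (-D.gS.par (z 1).1))), 0)
    simp only [map_neg, LinearMap.neg_apply, neg_neg, D.i_par]
    rw [D.br_par, D.r_par]
    simp
  · rw [D.lie_of_ne hn]; simp

theorem par_m (n : ℕ) (z : Fin n → S × U) :
    D.tilde.gr.par (D.tilde.m n z) = -D.tilde.m n (fun i => D.tilde.gr.par (z i)) := by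
  change D.gr.par ((D.diff n + D.lie n + D.symNested (LinearMap.inr k S U ∘ₗ D.P) n :
      MultilinearMap k (fun _ : Fin n => S × U) (S × U)) z) =
    -((D.diff n + D.lie n + D.symNested (LinearMap.inr k S U ∘ₗ D.P) n :
      MultilinearMap k (fun _ : Fin n => S × U) (S × U)) fun i => D.gr.par (z i))
  simp only [_root_.add_apply, map_add]
  rw [par_diff, par_lie, D.par_symNested (c := -1), neg_one_smul]
  · abel
  · intro x
    rw [neg_one_smul, neg_neg, LinearMap.comp_apply, LinearMap.comp_apply, D.P_par]
    change ((-D.gS.par 0, D.gU.par (D.P x)) : S × U) = _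
    simp

theorem par_tw (n : ℕ) (z : Fin n → S × U) :
    D.gr.par (D.tw n z) = D.tw n (fun i => D.gr.par (z i)) := by
  simp only [tw, _root_.add_apply, map_add]
  rw [D.par_symNested (c := 1), one_smul]
  · congr 1
    by_cases hn : n = 1
    · subst hn
      change D.gr.par (-((0, (z 0).2) : S × U)) = -(0, D.gU.par (z 0).2)
      rw [map_neg]
      change -((-D.gS.par 0, D.gU.par (z 0).2) : S × U) = _
      simp
    · rw [negVec_of_ne hn]; simp
  · intro x
    rw [one_smul, LinearMap.comp_apply, LinearMap.comp_apply, D.r_par]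
    change ((-D.gS.par (D.r x), D.gU.par 0) : S × U) = _
    simp

theorem symm_symNested {Y : Type*} [AddCommGroup Y] [Module k Y] (T : 𝔤 →ₗ[k] Y) (n : ℕ)
    (σ : Equiv.Perm (Fin n)) : act D.gr σ (D.symNested T n) = D.symNested T n := by
  cases n with
  | zero => rw [symNested, map_zero]
  | succ n => rw [symNested, map_smul, act_koszulSymm]

theorem act_subsingleton {V X : Type*} [AddCommGroup V] [Module k V] [AddCommGroup X] [Module k X]
    (G : SuperStructure k V) (σ : Equiv.Perm (Fin 1)) (f : MultilinearMap k (fun _ : Fin 1 => V) X) :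
    act G σ f = f := by
  rw [Subsingleton.elim σ 1, act_one]

/-- The sign carried by the first field, together with the shift of parity, turns graded
antisymmetry of the bracket into graded symmetry on `ΠS`. -/
theorem symm_lie (n : ℕ) (σ : Equiv.Perm (Fin n)) : act D.gr σ (D.lie n) = D.lie n := by
  by_cases hn : n = 2
  · subst hn
    refine multilinear_ext_isHom D.gr _ _ fun p x hx => ?_
    rw [act_isHom _ _ _ hx]
    have hσ : σ = 1 ∨ σ = Equiv.swap (Fin.castSucc 0) (Fin.succ 0) := by
      revert σ; decide
    rcases hσ with rfl | rfl
    · have : koszul k (1 : Equiv.Perm (Fin 2)).symm p = 1 := by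
        refine Finset.prod_eq_one fun i _ => Finset.prod_eq_one fun j _ => if_neg ?_
        rintro ⟨h1, h2⟩
        exact absurd h1 h2.not_gt
      rw [this, one_smul]
      rfl
    · rw [koszul_swap, lie_two, lie_two]
      have h0 := D.isHom_i (isHom_fst (hx 0))
      have h1 := D.isHom_i (isHom_fst (hx 1))
      have e0 : D.g.par (D.i (x 0).1) = _ := h0
      have e1 : D.g.par (D.i (x 1).1) = _ := h1
      change sg k (p 0 * p 1) • ((D.r (D.br (D.g.par (D.i (x 1).1)) (D.i (x 0).1)), 0) : S × U) = _
      rw [e0, e1, map_smul, map_smul, LinearMap.smul_apply, LinearMap.smul_apply,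
        D.antisymm _ _ _ _ h1 h0, Prod.smul_mk, smul_zero]
      simp only [map_smul, map_neg, smul_neg, smul_smul, ← sg_add]
      rw [← neg_one_smul k (sg k _ • _), ← sg_one (k := k), smul_smul, ← sg_add]
      congr 3
      grind
  · rw [D.lie_of_ne hn, map_zero]

theorem symm_m (n : ℕ) (σ : Equiv.Perm (Fin n)) : act D.tilde.gr σ (D.tilde.m n) = D.tilde.m n := by
  change act D.gr σ (D.diff n + D.lie n + D.symNested _ n) = D.diff n + D.lie n + D.symNested _ n
  rw [map_add, map_add, symm_lie, symm_symNested]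
  congr 2
  by_cases hn : n = 1
  · subst hn; exact act_subsingleton _ _ _
  · rw [D.diff_of_ne hn, map_zero]

theorem symm_tw (n : ℕ) (σ : Equiv.Perm (Fin n)) : act D.gr σ (D.tw n) = D.tw n := by
  rw [tw, map_add, symm_symNested]
  congr 1
  by_cases hn : n = 1
  · subst hn; exact act_subsingleton _ _ _
  · rw [negVec_of_ne hn, map_zero]

theorem m_zero : D.tilde.m 0 = 0 := by
  change (0 : MultilinearMap k (fun _ : Fin 0 => S × U) (S × U)) + 0 + 0 = 0
  simp

theorem tw_zero : D.tw 0 = 0 := by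
  change (0 : MultilinearMap k (fun _ : Fin 0 => S × U) (S × U)) + 0 = 0
  simp

theorem augHom_ser_m (hζ : AugHom D.gr R 0 ζ) : AugHom D.gr R 1 (ser D.gr R 1 D.tilde.m ζ) :=
  augHom_ser (fun n x => by
    rw [sg_one, neg_one_smul]; exact D.par_m n x) D.m_zero hζ

theorem augHom_ser_tw (hζ : AugHom D.gr R 0 ζ) : AugHom D.gr R 0 (ser D.gr R 0 D.tw ζ) :=
  augHom_ser (fun n x => by
    rw [sg_zero, one_smul]; exact D.par_tw n x) D.tw_zero hζ

/-- The field component is a multiple of `[[M, M], M]`, which vanishes. For the other, put `N = e^X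
M`: the derivative is `P(-½[N, N] + [N, c P N])`, which equals `P(-½[π N, π N])` by
`brR_self_decomp`, and this is zero because `S` is a subalgebra. -/
theorem dser_ser (hζ : AugHom D.gr R 0 ζ) :
    dser D.gr R 1 D.tilde.m ζ (ser D.gr R 1 D.tilde.m ζ) = 0 := by
  have hQ := D.augHom_ser_m hζ
  have hM := D.isHom_field hζ
  refine D.ext_F_vec ?_ ?_
  · rw [D.F_dser hζ hQ, D.F_ser hζ, map_neg, LinearMap.neg_apply, map_smul, LinearMap.smul_apply,
      D.brR_brR_self hM]
    simp
  · have hE := D.brR_self_decomp (D.expEnd_isHom hζ hM)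
    rw [D.vec_dser hζ hQ, D.F_ser hζ, D.vec_ser hζ, expEnd_add _ (D.isNilpotent_X hζ),
      D.expEnd_brR hζ, expEnd_cR, expEnd_neg_smul (D.isNilpotent_X hζ), D.expEnd_brR hζ, hE, map_neg, map_smul, PR_brR_πR]
    simp

theorem X_ser_tw (hζ : AugHom D.gr R 0 ζ) : D.X (ser D.gr R 0 D.tw ζ) = -D.X ζ := by
  refine LinearMap.ext fun x => ?_
  rw [X, X, D.vec_ser_tw hζ, map_neg, LinearMap.flip_apply, map_neg, LinearMap.neg_apply,
    LinearMap.flip_apply]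

theorem F_ser_tw_add (hζ : AugHom D.gr R 0 ζ) : D.F R (ser D.gr R 0 D.tw ζ) + D.ΔR R =
    D.πR R (expEnd (D.X ζ) (D.F R ζ + D.ΔR R)) := by
  rw [D.F_ser_tw hζ, expEnd_add _ (D.isNilpotent_X hζ), expEnd_ΔR, map_add, map_add, πR_cR,
    D.πR_eq D.PR_ΔR, add_zero]

/-- Put `N = e^X M`. Both field components equal `-½[π N, π N]`: replacing `e^X m` by `N` on the
left changes the expression by a constant field, which `π` kills. In the `U`-component, `e^{-X}`
undoes `e^X` and fixes constants, so `P e^{-X} π N = P(M - c P N) = -P N`. -/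
theorem dser_tw (hζ : AugHom D.gr R 0 ζ) :
    dser D.gr R 0 D.tw ζ (ser D.gr R 1 D.tilde.m ζ) =
      ser D.gr R 1 D.tilde.m (ser D.gr R 0 D.tw ζ) := by
  have hQ := D.augHom_ser_m hζ
  have hM := D.isHom_field hζ
  have hT := D.augHom_ser_tw hζ
  have hX := D.isNilpotent_X hζ
  refine D.ext_F_vec ?_ ?_
  · have hE := D.brR_self_decomp (D.expEnd_isHom hζ hM)
    rw [D.F_dser_tw hζ hQ, D.F_ser hT, D.F_ser_tw_add hζ, D.F_ser hζ, expEnd_neg_smul hX,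
      D.expEnd_brR hζ, D.vec_ser hζ]
    -- The difference between the two exponentials is `e^X Δ = Δ + [Δ, ξ]`, whose bracket with a
    -- constant is the constant given by the differential of `U`.
    have h1 : D.brR R (expEnd (D.X ζ) (D.F R ζ))
        (D.cR R (D.PR R (expEnd (D.X ζ) (D.F R ζ + D.ΔR R)))) =
        D.brR R (expEnd (D.X ζ) (D.F R ζ + D.ΔR R))
          (D.cR R (D.PR R (expEnd (D.X ζ) (D.F R ζ + D.ΔR R)))) -
        D.cR R (TensorProduct.map R.par.toLinearMap D.d
          (D.PR R (expEnd (D.X ζ) (D.F R ζ + D.ΔR R)))) := by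
      generalize D.PR R (expEnd (D.X ζ) (D.F R ζ + D.ΔR R)) = u
      rw [expEnd_add _ hX, expEnd_ΔR, map_add, map_add, LinearMap.add_apply, LinearMap.add_apply,
        brR_cR_cR, brR_ΔR_cR]
      abel
    rw [h1, ← add_sub_assoc, hE, map_sub, πR_cR, sub_zero, D.πR_eq]
    rw [map_neg, map_smul, PR_brR_πR]
    simp
  · rw [D.vec_dser_tw hζ hQ, D.vec_ser hT, D.F_ser_tw_add hζ, D.X_ser_tw hζ, D.vec_ser hζ]
    generalize hN : expEnd (D.X ζ) (D.F R ζ + D.ΔR R) = N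
    have h1 : D.πR R N = N + -D.cR R (D.PR R N) := by
      conv_rhs => enter [1]; rw [← D.decompR N]
      abel
    have h2 : (-D.X ζ) (-D.cR R (D.PR R N)) = 0 := by
      rw [map_neg, LinearMap.neg_apply, X_cR, neg_zero, neg_zero]
    have h3 : expEnd (-D.X ζ) N = D.F R ζ + D.ΔR R := by rw [← hN, expEnd_neg_expEnd hX]
    rw [h1, expEnd_add _ hX.neg, h3, expEnd_of_eq_zero h2, map_add, map_add, PR_F, PR_ΔR, map_neg,
      PR_cR]
    simp

/-- The second twisting uses `e^{-X}`, since the vector has changed sign. The constant removed by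
the first `π` is fixed by `e^{-X}` and is killed by the second `π`. -/
theorem tw_tw (hζ : AugHom D.gr R 0 ζ) : ser D.gr R 0 D.tw (ser D.gr R 0 D.tw ζ) = ζ := by
  have hT := D.augHom_ser_tw hζ
  have hX := D.isNilpotent_X hζ
  refine D.ext_F_vec ?_ ?_
  · rw [D.F_ser_tw hT, D.X_ser_tw hζ, D.F_ser_tw hζ]
    generalize hN : expEnd (D.X ζ) (D.F R ζ) = N
    have h1 : D.πR R N = N + -D.cR R (D.PR R N) := by
      conv_rhs => enter [1]; rw [← D.decompR N]
      abel
    have h2 : (-D.X ζ) (-D.cR R (D.PR R N)) = 0 := by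
      rw [map_neg, LinearMap.neg_apply, X_cR, neg_zero, neg_zero]
    have h3 : expEnd (-D.X ζ) N = D.F R ζ := by rw [← hN, expEnd_neg_expEnd hX]
    rw [h1, expEnd_add _ hX.neg, h3, expEnd_of_eq_zero h2, map_add, map_neg, πR_cR,
      D.πR_eq (D.PR_F ζ), neg_zero, add_zero]
  · rw [D.vec_ser_tw hT, D.vec_ser_tw hζ, neg_neg]

/-- The `U`-component of the Maurer–Cartan equation evaluates the constant part of `e^X F`, which is
the only difference between `π e^X F` and `e^X F`. -/
theorem F_ser_tw_of_isMC (h : IsMC D.tilde R ζ) : D.F R (ser D.gr R 0 D.tw ζ) =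
    expEnd (D.X ζ) (D.F R ζ) + D.cR R (R.d.rTensor U (D.vec R ζ) +
      TensorProduct.map R.par.toLinearMap D.d (D.vec R ζ)) := by
  obtain ⟨hζ, h1⟩ := isMC_iff.1 h
  have h2 : D.vec R (R.d.rTensor (S × U) ζ) = R.d.rTensor U (D.vec R ζ) := by
    have : D.vec R ∘ₗ R.d.rTensor (S × U) = R.d.rTensor U ∘ₗ D.vec R :=
      TensorProduct.ext' fun a x => rfl
    exact LinearMap.congr_fun this ζ
  have h3 := congrArg (D.vec R) h1
  change D.vec R (_ + ser D.gr R 1 D.tilde.m ζ) = _ at h3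
  rw [map_add, map_zero, h2, D.vec_ser hζ, expEnd_add _ (D.isNilpotent_X hζ), expEnd_ΔR, map_add,
    map_add, PR_ΔR, PR_cR, zero_add] at h3
  rw [D.F_ser_tw hζ]
  have h4 := D.decompR (expEnd (D.X ζ) (D.F R ζ))
  have h5 : D.PR R (expEnd (D.X ζ) (D.F R ζ)) = -(R.d.rTensor U (D.vec R ζ) +
      TensorProduct.map R.par.toLinearMap D.d (D.vec R ζ)) := by
    rw [eq_neg_iff_add_eq_zero, ← h3]
    abel
  rw [h5, map_neg] at h4
  conv_rhs => rw [← h4]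
  abel

end Identities

/-! ### The twisting automorphism -/

theorem isLInfty : IsLInfty D.tilde where
  zero := D.m_zero
  odd := D.par_m
  symm := D.symm_m
  jacobi _ _ _ hx := linfty_jacobi_of_ser D.par_m D.m_zero D.symm_m (fun _ _ hζ => D.dser_ser hζ) hx

theorem isLInftyHom_tw : IsLInftyHom D.tilde D.tilde D.tw where
  zero := D.tw_zero
  even := D.par_tw
  symm := D.symm_tw
  comm _ _ _ hx := linfty_comm_of_ser D.par_m D.m_zero D.symm_m D.par_tw D.tw_zero D.symm_tw
    (fun _ _ hζ => D.dser_tw hζ) hx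

theorem isLInftyAut_tw : IsLInftyAut D.tilde D.tw where
  hom := D.isLInftyHom_tw
  inv := ⟨D.tw, D.isLInftyHom_tw, fun _ _ _ hx =>
    have h := compVal_of_ser D.par_tw D.tw_zero D.symm_tw (fun _ _ hζ => D.tw_tw hζ) hx
    ⟨h, h⟩⟩

end TwistData

/-! ### Adjacent transpositions and symmetrizations with a distinguished first argument -/

section

variable {k : Type u} [Field k] [CharZero k] {V : Type*} [AddCommGroup V] [Module k V]
variable {X : Type*} [AddCommGroup X] [Module k X] {G : SuperStructure k V}

theorem act_eq_of_adjacent {n : ℕ} {f : MultilinearMap k (fun _ : Fin (n + 1) => V) X}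
    (h : ∀ i : Fin n, act G (Equiv.swap i.castSucc i.succ) f = f) (σ : Equiv.Perm (Fin (n + 1))) :
    act G σ f = f := by
  have hσ : σ ∈ Submonoid.closure (Set.range fun i : Fin n => Equiv.swap i.castSucc i.succ) := by
    rw [Equiv.Perm.mclosure_swap_castSucc_succ]; trivial
  induction hσ using Submonoid.closure_induction with
  | mem σ h' =>
    obtain ⟨i, rfl⟩ := h'
    exact h i
  | one => exact act_one G f
  | mul σ τ _ _ h1 h2 => rw [← act_act, h2, h1]

theorem swap_succ_eq_liftPerm {n : ℕ} (i : Fin n) :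
    Equiv.swap i.succ.castSucc i.succ.succ = liftPerm (Equiv.swap i.castSucc i.succ) := by
  ext j
  induction j using Fin.cases with
  | zero =>
    rw [liftPerm_zero, Equiv.swap_apply_of_ne_of_ne (by simp [Fin.ext_iff]) (Fin.succ_ne_zero _).symm]
  | succ j =>
    rw [liftPerm_succ]
    simp only [Equiv.swap_apply_def, Fin.ext_iff, Fin.val_succ, Fin.val_castSucc]
    split_ifs <;> simp_all

/-- By `h` only permutations fixing the first slot contribute, and by `h'` each of these `n!`
permutations contributes `f x`. -/
theorem koszulSymm_cons (f : MultilinearMap k (fun _ : Fin (n + 1) => V) X)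
    {p : Fin (n + 1) → ZMod 2} {x : Fin (n + 1) → V} (hx : ∀ i, G.IsHom (p i) (x i))
    (h : ∀ σ : Equiv.Perm (Fin (n + 1)), σ 0 ≠ 0 → f (x ∘ σ) = 0)
    (h' : ∀ σ, act G σ (f.curryLeft (x 0)) = f.curryLeft (x 0)) :
    koszulSymm G f x = (n.factorial : k) • f x := by
  rw [koszulSymm_apply, ← Equiv.sum_comp (Equiv.Perm.decomposeFin (n := n)).symm,
    Fintype.sum_prod_type, Finset.sum_eq_single 0]
  · have : ∀ τ : Equiv.Perm (Fin n), act G (Equiv.Perm.decomposeFin.symm (0, τ)) f x = f x := by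
      intro τ
      have h1 := congrArg (fun F => F (Fin.tail x)) ((act_curryLeft G τ f (x 0)).symm.trans (h' τ))
      simp only [MultilinearMap.curryLeft_apply, Fin.cons_self_tail] at h1
      exact h1
    simp [this, Fintype.card_perm, Nat.cast_smul_eq_nsmul]
  · intro j _ hj
    refine Finset.sum_eq_zero fun τ _ => ?_
    rw [act_isHom G _ _ hx, h _ (by rwa [Equiv.Perm.decomposeFin_symm_apply_zero]), smul_zero]
  · simp

end

namespace TwistData

variable {k : Type u} [Field k] [CharZero k] {𝔤 : Type*} {S U : Type*} [AddCommGroup 𝔤] [Module k 𝔤]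
variable [AddCommGroup S] [Module k S] [AddCommGroup U] [Module k U] (D : TwistData k 𝔤 S U)

/-! ### The components of the twisting -/

/-- The Jacobi identity for `f` and two constants, whose own bracket is zero. -/
theorem br_br_c {p p' : ZMod 2} {u u' : U} (hu : D.gU.IsHom p u) (hu' : D.gU.IsHom p' u') (f : 𝔤) :
    sg k (p * p') • D.br (D.br f (D.c u')) (D.c u) = D.br (D.br f (D.c u)) (D.c u') := by
  have key : sg k (p * p') • D.br.flip (D.c u) ∘ₗ D.br.flip (D.c u') =
      D.br.flip (D.c u') ∘ₗ D.br.flip (D.c u) := by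
    refine linear_ext_isHom D.g fun φ f hf => ?_
    change sg k (p * p') • D.br (D.br f (D.c u')) (D.c u) = D.br (D.br f (D.c u)) (D.c u')
    have h1 := D.jacobi _ _ _ _ _ _ hf (D.isHom_c hu) (D.isHom_c hu')
    rw [D.br_c_c, map_zero, D.antisymm _ _ _ _ (D.isHom_c hu) (D.isHom_br hf (D.isHom_c hu')),
      smul_neg, smul_smul, ← sg_add, ← sub_eq_add_neg, eq_comm, sub_eq_zero] at h1
    rw [h1]
    congr 2
    grind
  exact LinearMap.congr_fun key f

/-- Adjacent transpositions suffice. The one of the first two arguments is `br_br_c`, and the others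
act on an iterated bracket of smaller length. -/
theorem act_iter (n : ℕ) (f : 𝔤) (σ : Equiv.Perm (Fin n)) :
    act D.gU σ (iter D.br D.c n f) = iter D.br D.c n f := by
  cases n with
  | zero => rw [Subsingleton.elim σ 1, act_one]
  | succ n =>
    refine act_eq_of_adjacent (fun i => ?_) σ
    clear σ
    induction n generalizing f with
    | zero => exact i.elim0
    | succ n ih =>
      induction i using Fin.cases with
      | zero =>
        refine multilinear_ext_isHom D.gU _ _ fun p x hx => ?_
        rw [act_isHom _ _ _ hx, koszul_swap, iter_succ, iter_succ, iter_succ, iter_succ]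
        have h1 : ∀ j : Fin n, (x ∘ Equiv.swap (Fin.castSucc 0) (Fin.succ 0)) j.succ.succ =
            x j.succ.succ := fun j => by
          rw [Function.comp, Equiv.swap_apply_of_ne_of_ne (by simp [Fin.ext_iff])
            (by simp [Fin.ext_iff])]
        have h2 : Fin.tail (Fin.tail (x ∘ Equiv.swap (Fin.castSucc 0) (Fin.succ 0))) =
            Fin.tail (Fin.tail x) := funext h1
        have h3 := D.br_br_c (hx 0) (hx 1) f
        rw [h2, ← _root_.smul_apply, ← map_smul]
        congr 2
      | succ i =>
        rw [swap_succ_eq_liftPerm]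
        have h1 : ∀ u, (iter D.br D.c (n + 2) f).curryLeft u =
            iter D.br D.c (n + 1) (D.br f (D.c u)) := fun u => rfl
        ext x
        have h2 := act_curryLeft D.gU (Equiv.swap i.castSucc i.succ) (iter D.br D.c (n + 2) f) (x 0)
        rw [h1, ih] at h2
        have h3 := congrArg (fun F => F (Fin.tail x)) h2
        simp only [MultilinearMap.curryLeft_apply, Fin.cons_self_tail] at h3
        exact h3.symm

/-- Permutations that put a pure vector into the field slot give zero; the others give equal terms
because iterated brackets are symmetric, and the factorials cancel. Linearity reduces to homogeneous
entries of the same shape, described by `s`. -/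
theorem symNested_field {Y : Type*} [AddCommGroup Y] [Module k Y] (T : 𝔤 →ₗ[k] Y) (n : ℕ) (f : S)
    (w : Fin n → U) :
    D.symNested T (n + 1) (Fin.cons (f, 0) fun j => (0, w j)) = T (iter D.br D.c n (D.i f) w) := by
  set s : Fin (n + 1) → Set (S × U) := Fin.cons ((LinearMap.inl k S U) '' {f | ∃ p, D.gS.IsHom p f})
    (fun _ => (LinearMap.inr k S U) '' {w | ∃ p, D.gU.IsHom p w}) with hs
  have h := multilinear_eq_of_span (koszulSymm D.gr (T.compMultilinearMap (D.nested n)))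
    ((n.factorial : k) • T.compMultilinearMap (D.nested n)) s (fun x hx => ?_)
    (Fin.cons (f, 0) fun j => (0, w j)) (fun i => ?_)
  · rw [symNested, _root_.smul_apply, h, _root_.smul_apply, inv_smul_smul₀ (factorial_ne_zero n)]
    rfl
  · obtain ⟨f, ⟨q, hf⟩, h0⟩ := hx 0
    have h1 : ∀ j : Fin n, ∃ w, (∃ p, D.gU.IsHom p w) ∧ LinearMap.inr k S U w = x j.succ :=
      fun j => hx j.succ
    choose w h1 h2 using h1
    choose p hw using h1
    have hx' : ∀ i, D.gr.IsHom ((Fin.cons (q + 1) p : Fin (n + 1) → ZMod 2) i) (x i) := by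
      intro i
      induction i using Fin.cases with
      | zero =>
        rw [← h0, Fin.cons_zero, SuperStructure.IsHom, sg_add, sg_one, mul_neg_one, neg_smul]
        change ((-D.gS.par f, D.gU.par 0) : S × U) = -(sg k q • (f, 0))
        rw [show D.gS.par f = _ from hf]
        simp
      | succ j =>
        rw [← h2, Fin.cons_succ, SuperStructure.IsHom]
        change ((-D.gS.par 0, D.gU.par (w j)) : S × U) = sg k (p j) • (0, w j)
        rw [show D.gU.par (w j) = _ from hw j]
        simp
    rw [_root_.smul_apply]
    refine koszulSymm_cons _ hx' (fun σ hσ => ?_) fun σ => ?_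
    · obtain ⟨j, hj⟩ := Fin.exists_succ_eq.2 hσ
      rw [LinearMap.compMultilinearMap_apply, nested_apply, Function.comp, ← hj, ← h2]
      simp
    · refine multilinear_ext_isHom D.gr _ _ fun p' x' hx' => ?_
      rw [act_isHom _ _ _ hx']
      change koszul k σ.symm p' • T (iter D.br D.c n (D.i (x 0).1) fun j => (x' (σ j)).2) =
        T (iter D.br D.c n (D.i (x 0).1) fun j => (x' j).2)
      have h3 := congrArg (fun F => F fun j => (x' j).2) (D.act_iter n (D.i (x 0).1) σ)
      change act D.gU σ (iter D.br D.c n (D.i (x 0).1)) (fun j => (x' j).2) = _ at h3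
      rw [act_isHom _ _ _ (fun j => isHom_snd (hx' j))] at h3
      rw [← h3, map_smul]
      rfl
  · induction i using Fin.cases with
    | zero =>
      rw [hs, Fin.cons_zero, Fin.cons_zero, ← Submodule.map_span]
      exact ⟨f, mem_span_isHom _ _, rfl⟩
    | succ j =>
      rw [hs, Fin.cons_succ, Fin.cons_succ, ← Submodule.map_span]
      exact ⟨w j, mem_span_isHom _ _, rfl⟩

theorem tw_field (n : ℕ) (f : S) (w : Fin n → U) :
    D.tw (n + 1) (Fin.cons (f, 0) fun j => (0, w j)) = (D.r (iter D.br D.c n (D.i f) w), 0) := by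
  rw [tw, _root_.add_apply, symNested_field]
  have : negVec (k := k) (n + 1) (Fin.cons ((f, 0) : S × U) fun j => (0, w j)) = 0 := by
    cases n with
    | zero =>
      change -((0, 0) : S × U) = 0
      simp
    | succ n => rfl
  rw [this, add_zero]
  rfl

theorem snd_proj (p : ZMod 2) (z : S × U) : (D.gr.proj p z).2 = D.gU.proj p z.2 := rfl

/-- A nested bracket needs a field in its first slot and vectors in all others. Of two entries
without vector part, at least one lands in a vector slot. -/
theorem symNested_eq_zero {Y : Type*} [AddCommGroup Y] [Module k Y] (T : 𝔤 →ₗ[k] Y) {n : ℕ}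
    {z : Fin n → S × U}
    (h : (∀ i, (z i).1 = 0) ∨ ∃ i j, i ≠ j ∧ (z i).2 = 0 ∧ (z j).2 = 0) :
    D.symNested T n z = 0 := by
  cases n with
  | zero => rfl
  | succ n =>
    rw [symNested, _root_.smul_apply, koszulSymm_apply]
    refine (congrArg _ (Finset.sum_eq_zero fun σ _ => ?_)).trans (smul_zero _)
    rw [act_apply]
    refine Finset.sum_eq_zero fun p _ => ?_
    rw [LinearMap.compMultilinearMap_apply, nested_apply]
    refine (congrArg (fun y => _ • T y) ?_).trans (by rw [map_zero, smul_zero])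
    rcases h with h | ⟨i, j, hij, hi, hj⟩
    · have : (D.gr.proj (p (σ 0)) (z (σ 0))).1 = 0 := by
        change (D.gS.shift.proj (p (σ 0)) (z (σ 0)).1) = 0
        rw [h, map_zero]
      rw [this, map_zero, map_zero]
      rfl
    · have key : ∀ l, (z (σ l)).2 = 0 → l ≠ 0 → iter D.br D.c n (D.i (D.gr.proj (p (σ 0)) (z (σ 0))).1)
          (fun j => (D.gr.proj (p (σ j.succ)) (z (σ j.succ))).2) = 0 := by
        intro l hl hl0
        obtain ⟨m, rfl⟩ := Fin.exists_succ_eq.2 hl0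
        refine MultilinearMap.map_coord_zero _ m ?_
        rw [snd_proj, hl, map_zero]
      by_cases h0 : σ.symm i = 0
      · refine key (σ.symm j) (by rwa [Equiv.apply_symm_apply]) fun h => hij ?_
        rw [← h] at h0
        exact σ.symm.injective h0
      · exact key (σ.symm i) (by rwa [Equiv.apply_symm_apply]) h0

theorem tw_vec (w : U) : D.tw 1 (fun _ => ((0, w) : S × U)) = (0, -w) := by
  rw [tw, _root_.add_apply, D.symNested_eq_zero _ (Or.inl fun _ => rfl), zero_add]
  change -((0, w) : S × U) = (0, -w)
  simp

theorem tw_vec_of_ne {n : ℕ} (h : n ≠ 1) (w : Fin n → U) :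
    D.tw n (fun j => ((0, w j) : S × U)) = 0 := by
  rw [tw, _root_.add_apply, D.symNested_eq_zero _ (Or.inl fun _ => rfl), negVec_of_ne h]
  simp

theorem tw_two_fields {n : ℕ} {z : Fin n → S × U} {i j : Fin n} (h : i ≠ j) (hi : (z i).2 = 0)
    (hj : (z j).2 = 0) : D.tw n z = 0 := by
  have h1 : n ≠ 1 := by
    rintro rfl
    exact h (Subsingleton.elim _ _)
  rw [tw, _root_.add_apply, D.symNested_eq_zero _ (Or.inr ⟨i, j, h, hi, hj⟩), negVec_of_ne h1]
  simp

/-! ### Functoriality -/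

variable {𝔤' S' : Type*} [AddCommGroup 𝔤'] [Module k 𝔤'] [AddCommGroup S'] [Module k S']

/-- The maps `tw` are built from the bracket, the constants, the projection and the parity alone.
This is applied to inclusions of algebras of fields, to see that twistings restrict. -/
theorem tw_map {D : TwistData k 𝔤 S U} {D' : TwistData k 𝔤' S' U} {a : 𝔤 →ₗ[k] 𝔤'} {s : S →ₗ[k] S'}
    (hbr : ∀ x y, a (D.br x y) = D'.br (a x) (a y)) (hc : ∀ u, a (D.c u) = D'.c u)
    (hi : ∀ f, a (D.i f) = D'.i (s f)) (hr : ∀ x, s (D.r x) = D'.r (a x))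
    (hs : ∀ f, s (D.gS.par f) = D'.gS.par (s f)) (hU : D.gU = D'.gU) (n : ℕ) (z : Fin n → S × U) :
    D'.tw n (fun i => (s (z i).1, (z i).2)) = (s (D.tw n z).1, (D.tw n z).2) := by
  have hiter : ∀ (n : ℕ) (f : 𝔤) (w : Fin n → U),
      a (iter D.br D.c n f w) = iter D'.br D'.c n (a f) w := by
    intro n
    induction n with
    | zero => exact fun _ _ => rfl
    | succ n ih =>
      intro f w
      rw [iter_succ, iter_succ, ih, hbr, hc]
  have hproj : ∀ p z, D'.gr.proj p (s.prodMap LinearMap.id z) =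
      s.prodMap LinearMap.id (D.gr.proj p z) := by
    intro p z
    refine Prod.ext ?_ ?_
    · change D'.gS.shift.proj p (s z.1) = s (D.gS.shift.proj p z.1)
      simp [SuperStructure.proj, SuperStructure.shift, hs]
    · change D'.gU.proj p z.2 = D.gU.proj p z.2
      rw [hU]
  change D'.tw n (fun i => s.prodMap LinearMap.id (z i)) = s.prodMap LinearMap.id (D.tw n z)
  rw [tw, tw, _root_.add_apply, _root_.add_apply, map_add]
  congr 1
  · cases n with
    | zero => exact (map_zero (s.prodMap LinearMap.id)).symm
    | succ n =>
      rw [symNested, symNested, _root_.smul_apply, _root_.smul_apply, map_smul, koszulSymm_apply,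
        koszulSymm_apply, map_sum]
      congr 1
      refine Finset.sum_congr rfl fun σ _ => ?_
      rw [act_apply, act_apply, map_sum]
      refine Finset.sum_congr rfl fun p _ => ?_
      rw [map_smul]
      congr 1
      simp only [hproj]
      rw [LinearMap.compMultilinearMap_apply, LinearMap.compMultilinearMap_apply, nested_apply,
        nested_apply]
      change ((D'.r (iter D'.br D'.c n (D'.i (s _)) _), 0) : S' × U) = (s (D.r _), 0)
      rw [← hi, ← hiter, hr]
      rfl
  · by_cases hn : n = 1
    · subst hn
      change -((0, (z 0).2) : S' × U) = s.prodMap LinearMap.id (-(0, (z 0).2))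
      simp
    · rw [negVec_of_ne hn, negVec_of_ne hn]
      exact (map_zero (s.prodMap LinearMap.id)).symm

end TwistData

/-! ### From algebras of formal vector fields to the abstract setting -/

section

variable {k : Type u} [Field k] [CharZero k] {V : Type v} [AddCommGroup V] [Module k V]

/-- The exponential in `twist` is formed on all families, whereas nilpotency is known on an algebra
`M` of fields; the lemma compares the two sums along the inclusion. -/
theorem finsum_pow_map {M M₁ : Type*} [AddCommGroup M] [Module k M] [AddCommGroup M₁] [Module k M₁]
    {X : M →ₗ[k] M} {Y : M₁ →ₗ[k] M₁} (hX : IsNilpotent X)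
    (g : M →ₗ[k] M₁) (h : ∀ m, Y (g m) = g (X m)) (m : M) :
    ∑ᶠ i : ℕ, ((i.factorial : k)⁻¹) • (Y ^ i) (g m) = g (expEnd X m) := by
  obtain ⟨N, hN⟩ := hX
  have hpow : ∀ n m, (Y ^ n) (g m) = g ((X ^ n) m) := by
    intro n
    induction n with
    | zero => exact fun m => rfl
    | succ n ih => intro m; rw [pow_succ, pow_succ, Module.End.mul_apply, h, ih, Module.End.mul_apply]
  rw [expEnd_eq_sum hN, map_sum, finsum_eq_sum_range _ N]
  · exact Finset.sum_congr rfl fun n _ => by rw [hpow, map_smul]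
  · intro n hn
    rw [hpow, pow_eq_zero_of_le hn hN]
    simp

/-- The space `M` of formal vector fields on a dg vector space contains the constant vector fields
and `d`, and is a graded Lie algebra with the bracket `br`; the space `S` consists of the elements
of `M` vanishing at zero. -/
structure IsFieldAlgebra (D : DGStructure k V) (br : Fam k V →ₗ[k] Fam k V →ₗ[k] Fam k V)
    (M S : Submodule k (Fam k V)) : Prop where
  mem_iff : ∀ f, f ∈ S ↔ f ∈ M ∧ f 0 = 0
  par_mem : ∀ f ∈ M, D.fam.par f ∈ M
  br_mem : ∀ f ∈ M, ∀ g ∈ M, br f g ∈ M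
  const_mem : ∀ w, constField w ∈ M
  d_mem : linField D.d ∈ M
  br_par : ∀ f ∈ M, ∀ g ∈ M, br (D.fam.par f) (D.fam.par g) = D.fam.par (br f g)
  antisymm : ∀ p q, ∀ f ∈ M, ∀ g ∈ M, D.fam.IsHom p f → D.fam.IsHom q g →
    br f g = -(sg k (p * q) • br g f)
  jacobi : ∀ p q l, ∀ f ∈ M, ∀ g ∈ M, ∀ h ∈ M,
    D.fam.IsHom p f → D.fam.IsHom q g → D.fam.IsHom l h →
    br f (br g h) = br (br f g) h + sg k (p * q) • br g (br f h)
  br_const : ∀ u u', br (constField u) (constField u') = 0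
  br_zero : ∀ f ∈ S, ∀ g ∈ S, br f g 0 = 0
  br_d : br (linField D.d) (linField D.d) = 0
  br_d_const : ∀ u, br (linField D.d) (constField u) = constField (D.d u)

theorem linField_isHom (D : DGStructure k V) : D.fam.IsHom 1 (linField D.d) := by
  funext n
  match n with
  | 0 => ext x; simp [SuperStructure.fam, linField]
  | 1 =>
    ext x
    change D.par (D.d (D.par (x 0))) = sg k 1 • D.d (x 0)
    rw [D.d_par, map_neg, D.par_par, sg_one, neg_one_smul]
  | n + 2 => ext x; simp [SuperStructure.fam, linField]

theorem constField_zero (w : V) (x : Fin 0 → V) : constField (k := k) w 0 x = w := rfl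

theorem constField_par (G : SuperStructure k V) (w : V) :
    constField (G.par w) = G.fam.par (constField w) := by
  funext n
  match n with
  | 0 => rfl
  | n + 1 => ext x; simp [SuperStructure.fam, constField]

theorem TwistData.isMC_pushMC_tw {𝔤 S U : Type*} [AddCommGroup 𝔤] [Module k 𝔤] [AddCommGroup S]
    [Module k S] [AddCommGroup U] [Module k U] (D : TwistData k 𝔤 S U) {R : ArtinCdga k}
    {ζ : R.carrier ⊗[k] (S × U)} (h : IsMC D.tilde R ζ) :
    IsMC D.tilde R (pushMC D.tilde D.tw R ζ) := by
  refine isMC_pushMC (L := D.tilde) (L' := D.tilde) (φ := D.tw) ?_ ?_ ?_ ?_ h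
  · exact D.par_tw
  · exact D.tw_zero
  · exact D.symm_tw
  · intro R ζ hζ
    exact D.dser_tw hζ

namespace IsFieldAlgebra

variable {D : DGStructure k V} {br : Fam k V →ₗ[k] Fam k V →ₗ[k] Fam k V}
variable {M S : Submodule k (Fam k V)} (H : IsFieldAlgebra D br M S)

include H

theorem le : S ≤ M := fun f hf => ((H.mem_iff f).1 hf).1

theorem S_par_mem : ∀ f ∈ S, D.fam.par f ∈ S := fun f hf => by
  obtain ⟨h1, h2⟩ := (H.mem_iff f).1 hf
  refine (H.mem_iff _).2 ⟨H.par_mem f h1, ?_⟩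
  ext x
  simp [SuperStructure.fam, h2]

theorem d_mem_S : linField D.d ∈ S := (H.mem_iff _).2 ⟨H.d_mem, rfl⟩

theorem isDGLieSubalgebra : IsDGLieSubalgebra D br S where
  par_mem := H.S_par_mem
  d_mem f hf := (H.mem_iff _).2 ⟨H.br_mem _ H.d_mem _ (H.le hf), H.br_zero _ H.d_mem_S _ hf⟩
  br_mem f hf g hg := (H.mem_iff _).2 ⟨H.br_mem _ (H.le hf) _ (H.le hg), H.br_zero _ hf _ hg⟩

omit H in
theorem constField_self {f : Fam k V} : (f - (constField (f 0 ![]) : Fam k V)) 0 = 0 := by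
  ext x
  rw [Pi.sub_apply, _root_.sub_apply, constField_zero, Subsingleton.elim x ![], sub_self]
  rfl

theorem sub_const_mem {f : Fam k V} (hf : f ∈ M) : f - (constField (f 0 ![]) : Fam k V) ∈ S :=
  (H.mem_iff _).2 ⟨M.sub_mem hf (H.const_mem _), constField_self⟩

/-- The abstract twisting data of an algebra of formal vector fields. -/
def data : TwistData k M S V where
  g := ⟨D.fam.par.restrict H.par_mem, fun f => Subtype.ext (D.fam.par_par f)⟩
  gS := ⟨D.fam.par.restrict H.S_par_mem, fun f => Subtype.ext (D.fam.par_par f)⟩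
  gU := D.toSuperStructure
  br := LinearMap.mk₂ k (fun f g => ⟨br f g, H.br_mem _ f.2 _ g.2⟩)
    (fun _ _ _ => Subtype.ext (by simp)) (fun _ _ _ => Subtype.ext (by simp))
    (fun _ _ _ => Subtype.ext (by simp)) (fun _ _ _ => Subtype.ext (by simp))
  i := Submodule.inclusion H.le
  r := 
    { toFun := fun f => ⟨f.1 - constField (f.1 0 ![]), H.sub_const_mem f.2⟩
      map_add' := fun f g => Subtype.ext (by simp; abel)
      map_smul' := fun c f => Subtype.ext (by simp [smul_sub]) }
  c := constField.codRestrict M H.const_mem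
  P := 
    { toFun := fun f => f.1 0 ![]
      map_add' := fun f g => by simp
      map_smul' := fun c f => by simp }
  d := D.d
  Δ := ⟨linField D.d, H.d_mem⟩
  i_par _ := rfl
  c_par u := Subtype.ext (constField_par _ u)
  br_par f g := Subtype.ext (H.br_par _ f.2 _ g.2)
  antisymm p q f g hf hg := Subtype.ext
    (H.antisymm p q _ f.2 _ g.2 (congrArg Subtype.val hf) (congrArg Subtype.val hg))
  jacobi p q l f g h hf hg hh := Subtype.ext
    (H.jacobi p q l _ f.2 _ g.2 _ h.2 (congrArg Subtype.val hf) (congrArg Subtype.val hg)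
      (congrArg Subtype.val hh))
  P_c u := rfl
  P_i f := by
    change f.1 0 ![] = 0
    rw [((H.mem_iff _).1 f.2).2]
    rfl
  r_i f := Subtype.ext (by
    change f.1 - constField (f.1 0 ![]) = f.1
    rw [((H.mem_iff _).1 f.2).2, _root_.zero_apply, map_zero, sub_zero])
  decomp f := Subtype.ext (sub_add_cancel _ _)
  br_c_c u u' := Subtype.ext (H.br_const u u')
  P_br f g := by
    change br f.1 g.1 0 ![] = 0
    rw [H.br_zero _ f.2 _ g.2]
    rfl
  Δ_odd := Subtype.ext (linField_isHom D)
  P_Δ := rfl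
  br_Δ_Δ := Subtype.ext H.br_d
  br_Δ_c u := Subtype.ext (H.br_d_const u)

theorem coe_iter (n : ℕ) (f : M) (w : Fin n → V) :
    ((iter H.data.br H.data.c n f w : M) : Fam k V) = iter br constField n f.1 w := by
  induction n generalizing f with
  | zero => rfl
  | succ n ih => rw [iter_succ, iter_succ, ih]; rfl

/-- By `hρ` the products with vectors are the constant terms of iterated brackets. The differential
and the bracket agree with the abstract ones because the projection to `S` only subtracts a constant
term, which is zero here. -/
theorem tilde_eq {ρ : Fam k V →ₗ[k] Fam k V} (h : IsDGLieSubalgebra D br S)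
    (hρ : ∀ f ∈ S, ∀ n w, ρ f n w = iter br constField n f w 0 ![]) :
    tilde D br ρ S h = H.data.tilde := by
  have hm : (tilde D br ρ S h).m = H.data.tilde.m := by
    funext n
    refine congrArg₂ (· + ·) (congrArg₂ (· + ·) ?_ ?_) ?_
    · match n with
      | 0 => rfl
      | 1 =>
        ext1 z
        refine Prod.ext (Subtype.ext ?_) rfl
        have h0 : br (linField D.d) (z 0).1.1 0 = 0 := H.br_zero _ H.d_mem_S _ (z 0).1.2
        change -(br (linField D.d) (z 0).1.1) = -(br (linField D.d) (z 0).1.1 -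
          constField (br (linField D.d) (z 0).1.1 0 ![]))
        rw [h0, _root_.zero_apply, map_zero, sub_zero]
      | n + 2 => rfl
    · match n with
      | 0 => rfl
      | 1 => rfl
      | 2 =>
        ext1 z
        refine Prod.ext (Subtype.ext ?_) rfl
        have h0 : br (D.fam.par (z 0).1.1) (z 1).1.1 0 = 0 :=
          H.br_zero _ (H.S_par_mem _ (z 0).1.2) _ (z 1).1.2
        change br (D.fam.par (z 0).1.1) (z 1).1.1 = br (D.fam.par (z 0).1.1) (z 1).1.1 -
          constField (br (D.fam.par (z 0).1.1) (z 1).1.1 0 ![])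
        rw [h0, _root_.zero_apply, map_zero, sub_zero]
      | n + 3 => rfl
    · match n with
      | 0 => rfl
      | n + 1 =>
        refine congrArg (fun f => ((n.factorial : k)⁻¹) • koszulSymm H.data.gr f) ?_
        ext1 z
        refine Prod.ext rfl ?_
        change ρ (z 0).1.1 n (fun j => (z j.succ).2) =
          (iter H.data.br H.data.c n (H.data.i (z 0).1) fun j => (z j.succ).2 : M).1 0 ![]
        rw [H.coe_iter]
        exact hρ _ (z 0).1.2 _ _
  exact congrArg (LInftyData.mk H.data.gr) hm

theorem subtype_brR (R : ArtinCdga k) (x y : R.carrier ⊗[k] M) :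
    extBilin R D.fam br (M.subtype.lTensor R.carrier x) (M.subtype.lTensor R.carrier y) =
      M.subtype.lTensor R.carrier (H.data.brR R x y) := by
  have key : (extBilin R D.fam br).compl₁₂ (M.subtype.lTensor R.carrier)
      (M.subtype.lTensor R.carrier) = (H.data.brR R).compr₂ (M.subtype.lTensor R.carrier) := by
    refine bilin_tensor_ext (G := H.data.g) (H := H.data.g) fun α p a f β q b g ha hf hb hg => ?_
    have hf' : D.fam.IsHom p (f : Fam k V) := congrArg Subtype.val hf
    simp only [LinearMap.compl₁₂_apply, LinearMap.compr₂_apply, LinearMap.lTensor_tmul]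
    have h1 := extBilin_tmul (R := R) D.fam br (a := a) hf' hb (g : Fam k V)
    have h2 := extBilin_tmul (R := R) H.data.g H.data.br (a := a) hf hb g
    refine h1.trans ((congrArg _ h2).trans ?_).symm
    rw [map_smul]
    rfl
  exact LinearMap.congr_fun₂ key x y

theorem fieldPart_eq (R : ArtinCdga k) (z : R.carrier ⊗[k] (S × V)) :
    fieldPart R S z = M.subtype.lTensor R.carrier (H.data.F R z) := by
  have key : fieldPart R S = M.subtype.lTensor R.carrier ∘ₗ H.data.F R :=
    TensorProduct.ext' fun a z => rfl
  exact LinearMap.congr_fun key z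

theorem constField_eq (R : ArtinCdga k) (u : R.carrier ⊗[k] V) :
    constField.lTensor R.carrier u = M.subtype.lTensor R.carrier (H.data.cR R u) := by
  have key : constField.lTensor R.carrier = M.subtype.lTensor R.carrier ∘ₗ H.data.cR R :=
    TensorProduct.ext' fun a z => rfl
  exact LinearMap.congr_fun key u

/-- On Maurer–Cartan elements the abstract formula `F_ser_tw_of_isMC` is, after inclusion of `M`
into all families, the definition of `twist`. -/
theorem isTwistOf {R : ArtinCdga k} {ζ : R.carrier ⊗[k] (S × V)} (h : IsMC H.data.tilde R ζ) :
    IsTwistOf D br R ζ (pushMC H.data.tilde H.data.tw R ζ) := by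
  constructor
  · rw [H.fieldPart_eq, H.fieldPart_eq]
    refine (congrArg _ (H.data.F_ser_tw_of_isMC h)).trans ?_
    rw [map_add, twist, ← H.constField_eq]
    refine congrArg₂ (· + ·) (Eq.symm ?_) rfl
    refine finsum_pow_map (H.data.isNilpotent_X h.augHom) _ (fun m => ?_) _
    rw [LinearMap.flip_apply, H.constField_eq, H.subtype_brR]
    rfl
  · exact H.data.vec_ser_tw h.augHom

theorem twistingIsFunctorAut : TwistingIsFunctorAut.{u, v, w} D br H.data.tilde := by
  refine ⟨fun A ζ i => pushMC H.data.tilde H.data.tw (A.obj i) (ζ i),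
    fun A ζ hζ i => H.isTwistOf (hζ.1 i), fun A => bijOn_pushMC (fun _ _ => H.data.isMC_pushMC_tw)
      (fun R ξ h => H.data.tw_tw h.augHom) A, fun A B F ζ hζ => ⟨push_mem_MC F hζ, pushMC_push F hζ⟩⟩

/-- Over a field, tensoring with `A` preserves injectivity of the inclusion of `M`, so the field
part determines the component in `A ⊗ S`. -/
theorem isTwistOf_unique {R : ArtinCdga k} {ζ z z' : R.carrier ⊗[k] (S × V)}
    (h : IsTwistOf D br R ζ z) (h' : IsTwistOf D br R ζ z') : z = z' := by
  refine H.data.ext_F_vec ?_ (h.2.trans h'.2.symm)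
  have h1 := h.1.trans h'.1.symm
  rw [H.fieldPart_eq, H.fieldPart_eq] at h1
  exact Module.Flat.lTensor_preserves_injective_linearMap _ M.subtype_injective h1

theorem isInducedByTwisting : IsInducedByTwisting.{u, v, w} D br H.data.tilde H.data.tw where
  aut := H.data.isLInftyAut_tw
  induces A ζ hζ i := H.isTwistOf (hζ.1 i)
  unique ψ hψ h := by
    refine eq_of_pushMC_eq H.data.par_m H.data.m_zero H.data.symm_m
      (fun _ _ hζ => H.data.dser_ser hζ) hψ.symm H.data.symm_tw fun R ξ hξ => ?_
    -- An Artinian algebra is tested as a constant inverse system.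
    exact H.isTwistOf_unique (h (constFormal R) _ (mem_MC_constFormal hξ) ⟨⟩) (H.isTwistOf hξ)

theorem hasTwistingComponents
    {ins : ∀ {m l : ℕ}, MultilinearMap k (fun _ : Fin (m + l) => V) V →
      (Fin m → V) → (Fin l → V) → V}
    (hins : ∀ (m : ℕ), ∀ f ∈ S, ∀ (w : Fin m → V) (l : ℕ) (x : Fin l → V),
      iter br constField m f w l x = ins (f (m + l)) w x) :
    HasTwistingComponents ins H.data.tw where
  field_fst m f w l x hl := by
    rw [H.data.tw_field, ← hins m f f.2]
    obtain ⟨l, rfl⟩ := Nat.exists_eq_succ_of_ne_zero (Nat.one_le_iff_ne_zero.1 hl)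
    have h1 := H.coe_iter m (H.data.i f) w
    have h2 : H.data.i f = (f : Fam k V) := rfl
    rw [h2] at h1
    rw [← h1]
    -- The constant field subtracted by the projection sits in arity zero and does not affect arity
    -- `l + 1`.
    exact sub_zero (((iter H.data.br H.data.c m (H.data.i f) w : M) : Fam k V) (l + 1) x)
  field_snd m f w := by rw [H.data.tw_field]
  vec_one := H.data.tw_vec
  vec_other n hn := H.data.tw_vec_of_ne hn
  two_fields n z i j := H.data.tw_two_fields

theorem isRestriction {M' S' : Submodule k (Fam k V)} (H' : IsFieldAlgebra D br M' S')
    (hM : M ≤ M') (hS : S ≤ S') : IsRestriction hS H.data.tw H'.data.tw := fun n z =>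
  TwistData.tw_map (D := H.data) (D' := H'.data) (a := Submodule.inclusion hM)
    (s := Submodule.inclusion hS) (fun _ _ => rfl) (fun _ => rfl) (fun _ => rfl) (fun _ => rfl)
    (fun _ => rfl) rfl n z

end IsFieldAlgebra

end

/-! ### Sums over decompositions of lists -/

section Lists

variable {V X Y : Type*}

/-- The sum of `Ψ a b` over all decompositions `l = a ++ b`. -/
def splitSum [AddCommMonoid X] : (List V → List V → X) → List V → X
  | Ψ, [] => Ψ [] []
  | Ψ, v :: l => Ψ [] (v :: l) + splitSum (fun a b => Ψ (v :: a) b) l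

section

variable [AddCommMonoid X] [AddCommMonoid Y]

theorem splitSum_cons (Ψ : List V → List V → X) (v : V) (l : List V) :
    splitSum Ψ (v :: l) = Ψ [] (v :: l) + splitSum (fun a b => Ψ (v :: a) b) l := rfl

theorem splitSum_eq_sum (Ψ : List V → List V → X) (l : List V) :
    splitSum Ψ l = ∑ i ∈ Finset.range (l.length + 1), Ψ (l.take i) (l.drop i) := by
  induction l generalizing Ψ with
  | nil => simp [splitSum]
  | cons v l ih =>
    rw [splitSum, ih, List.length_cons, Finset.sum_range_succ' _ (l.length + 1), add_comm]
    rfl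

theorem splitSum_add (Ψ Φ : List V → List V → X) (l : List V) :
    splitSum (fun a b => Ψ a b + Φ a b) l = splitSum Ψ l + splitSum Φ l := by
  simp only [splitSum_eq_sum, Finset.sum_add_distrib]

theorem map_splitSum {F : Type*} [FunLike F X Y] [AddMonoidHomClass F X Y] (T : F)
    (Ψ : List V → List V → X) (l : List V) :
    T (splitSum Ψ l) = splitSum (fun a b => T (Ψ a b)) l := by
  simp only [splitSum_eq_sum, map_sum]

theorem splitSum_congr {Ψ Φ : List V → List V → X} {l : List V}
    (h : ∀ a b, a ++ b = l → Ψ a b = Φ a b) : splitSum Ψ l = splitSum Φ l := by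
  simp only [splitSum_eq_sum]
  exact Finset.sum_congr rfl fun i _ => h _ _ (List.take_append_drop i l)

theorem splitSum_map {W : Type*} (s : W → V) (Ψ : List V → List V → X) (l : List W) :
    splitSum Ψ (l.map s) = splitSum (fun a b => Ψ (a.map s) (b.map s)) l := by
  simp only [splitSum_eq_sum, List.length_map, List.map_take, List.map_drop]

theorem splitSum_concat (Ψ : List V → List V → X) (l : List V) (y : V) :
    splitSum Ψ (l ++ [y]) = splitSum (fun a b => Ψ a (b ++ [y])) l + Ψ (l ++ [y]) [] := by
  induction l generalizing Ψ with
  | nil => rfl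
  | cons v l ih => rw [List.cons_append, splitSum_cons, ih, splitSum_cons, add_assoc]; rfl

theorem splitSum_zero (l : List V) : splitSum (fun _ _ => (0 : X)) l = 0 := by
  simp [splitSum_eq_sum]

/-- The sum of `φ (g a :: b)` over all decompositions `l = a ++ b`. -/
def prefixSum (g : List V → V) (φ : List V → X) (l : List V) : X :=
  splitSum (fun a b => φ (g a :: b)) l

/-- The sum of `φ (s a ++ g b :: c)` over all decompositions `l = a ++ b ++ c`. -/
def insertSum (s : V → V) (g : List V → V) (φ : List V → X) (l : List V) : X :=
  splitSum (fun a r => prefixSum g (fun m => φ (a.map s ++ m)) r) l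

theorem prefixSum_cons (g : List V → V) (φ : List V → X) (v : V) (l : List V) :
    prefixSum g φ (v :: l) = φ (g [] :: v :: l) + prefixSum (fun a => g (v :: a)) φ l := rfl

theorem insertSum_cons (s : V → V) (g : List V → V) (φ : List V → X) (v : V) (l : List V) :
    insertSum s g φ (v :: l) =
      prefixSum g φ (v :: l) + insertSum s g (fun m => φ (s v :: m)) l := rfl

theorem map_prefixSum {F : Type*} [FunLike F X Y] [AddMonoidHomClass F X Y] (T : F)
    (g : List V → V) (φ : List V → X) (l : List V) :
    T (prefixSum g φ l) = prefixSum g (fun m => T (φ m)) l := map_splitSum T _ l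

theorem map_insertSum {F : Type*} [FunLike F X Y] [AddMonoidHomClass F X Y] (T : F) (s : V → V)
    (g : List V → V) (φ : List V → X) (l : List V) :
    T (insertSum s g φ l) = insertSum s g (fun m => T (φ m)) l := by
  simp only [insertSum, map_splitSum, map_prefixSum]

theorem prefixSum_add (g : List V → V) (φ ψ : List V → X) (l : List V) :
    prefixSum g (fun m => φ m + ψ m) l = prefixSum g φ l + prefixSum g ψ l := splitSum_add _ _ l

theorem insertSum_add (s : V → V) (g : List V → V) (φ ψ : List V → X) (l : List V) :
    insertSum s g (fun m => φ m + ψ m) l = insertSum s g φ l + insertSum s g ψ l := by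
  simp only [insertSum, prefixSum_add, splitSum_add]

/-- The sum of `φ (s a ++ [g (b ++ [y])])` over all decompositions `l = a ++ b`. -/
def suffixSum (s : V → V) (g : List V → V) (φ : List V → X) (l : List V) (y : V) : X :=
  splitSum (fun a b => φ (a.map s ++ [g (b ++ [y])])) l

/-- The block fed to `g` ends before `y`, or contains `y`, or is the empty block after `y`. -/
theorem insertSum_concat (s : V → V) (g : List V → V) (φ : List V → X) (l : List V) (y : V) :
    insertSum s g φ (l ++ [y]) = insertSum s g (fun m => φ (m ++ [y])) l + suffixSum s g φ l y +
      φ ((l ++ [y]).map s ++ [g []]) := by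
  simp only [insertSum, suffixSum, prefixSum, splitSum_concat, ← splitSum_add]
  congr 2
  funext a b
  simp

end

section Linear

variable {k : Type*} [Field k] [AddCommGroup V] [Module k V] [AddCommGroup X] [Module k X]
variable [AddCommGroup Y] [Module k Y]

variable (k) in
/-- Functions of lists which are linear in every entry. -/
def IsMultilin (φ : List V → X) : Prop :=
  ∀ a b, IsLinearMap k fun v => φ (a ++ v :: b)

theorem IsMultilin.cons {φ : List V → X} (h : IsMultilin k φ) (u : V) :
    IsMultilin k fun m => φ (u :: m) := fun a b => h (u :: a) b

theorem IsMultilin.append {φ : List V → X} (h : IsMultilin k φ) (r : List V) :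
    IsMultilin k fun m => φ (m ++ r) := fun a b => by
  simpa using h a (b ++ r)

theorem IsMultilin.comp_map {φ : List V → X} (h : IsMultilin k φ) (s : V →ₗ[k] V) :
    IsMultilin k fun m => φ (m.map s) := fun a b =>
  ⟨fun x y => by simpa using (h (a.map s) (b.map s)).map_add (s x) (s y),
    fun c x => by simpa using (h (a.map s) (b.map s)).map_smul c (s x)⟩

theorem IsMultilin.map {φ : List V → X} (h : IsMultilin k φ) (T : X →ₗ[k] Y) :
    IsMultilin k fun m => T (φ m) := fun a b =>
  ⟨fun x y => (congrArg T ((h a b).map_add x y)).trans (map_add T _ _),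
    fun c x => (congrArg T ((h a b).map_smul c x)).trans (map_smul T _ _)⟩

theorem prefixSum_smul (c : k) (g : List V → V) (φ : List V → X) (l : List V) :
    prefixSum g (fun m => c • φ m) l = c • prefixSum g φ l :=
  (map_prefixSum (LinearMap.lsmul k X c) g φ l).symm

theorem insertSum_smul (c : k) (s : V → V) (g : List V → V) (φ : List V → X) (l : List V) :
    insertSum s g (fun m => c • φ m) l = c • insertSum s g φ l :=
  (map_insertSum (LinearMap.lsmul k X c) s g φ l).symm

theorem prefixSum_add_left {φ : List V → X} (h : IsMultilin k φ) (g g' : List V → V) (l : List V) :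
    prefixSum (fun a => g a + g' a) φ l = prefixSum g φ l + prefixSum g' φ l := by
  simp only [prefixSum, ← splitSum_add]
  congr 1
  funext a b
  exact (h [] b).map_add _ _

theorem prefixSum_comp_map {s : V → V} {c : k} {g : List V → V} (hg : ∀ l, g (l.map s) = c • s (g l))
    {φ : List V → X} (h : IsMultilin k φ) (l : List V) :
    prefixSum g φ (l.map s) = c • prefixSum g (fun m => φ (m.map s)) l := by
  rw [← prefixSum_smul, prefixSum, splitSum_map, prefixSum]
  congr 1
  funext a b
  rw [hg]
  exact (h [] _).map_smul _ _

theorem insertSum_comp_map {s t : V → V} {c : k} {g : List V → V}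
    (hg : ∀ l, g (l.map s) = c • s (g l)) (hst : ∀ v, t (s v) = s (t v))
    {φ : List V → X} (h : IsMultilin k φ) (l : List V) :
    insertSum t g φ (l.map s) = c • insertSum t g (fun m => φ (m.map s)) l := by
  rw [← insertSum_smul, insertSum, splitSum_map, insertSum]
  congr 1
  funext a b
  rw [prefixSum_comp_map hg (by
    intro a' b'
    have := h ((a.map s).map t ++ a') b'
    simpa using this), prefixSum_smul]
  congr 2
  funext m
  simp [hst, Function.comp_def]

/-- The sum of `φ (g b :: s c ++ h d :: e)` over all decompositions `l = b ++ c ++ d ++ e`. -/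
def prefixInsertSum (s : V → V) (h g : List V → V) (φ : List V → X) (l : List V) : X :=
  splitSum (fun b r => insertSum s h (fun m => φ (g b :: m)) r) l

theorem prefixInsertSum_cons (s : V → V) (h g : List V → V) (φ : List V → X) (v : V) (l : List V) :
    prefixInsertSum s h g φ (v :: l) = insertSum s h (fun m => φ (g [] :: m)) (v :: l) +
      prefixInsertSum s h (fun a => g (v :: a)) φ l := rfl

/-- The second prefix is either empty, and then stands before the value of `h`, or it swallows that
value and yields the composite of `g` with `h`. -/
theorem prefixSum_prefixSum {φ : List V → X} (hφ : IsMultilin k φ) (h g : List V → V)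
    (l : List V) : prefixSum h (prefixSum g φ) l =
      prefixSum h (fun m => φ (g [] :: m)) l + prefixSum (prefixSum h g) φ l := by
  induction l generalizing h with
  | nil => rfl
  | cons v l ih =>
    have h1 : ∀ a, prefixSum h g (v :: a) =
        g (h [] :: v :: a) + prefixSum (fun a => h (v :: a)) g a := fun a => rfl
    rw [prefixSum_cons, ih, prefixSum_cons, prefixSum_cons, prefixSum_cons, prefixSum_cons]
    simp only [h1]
    rw [prefixSum_add_left hφ]
    change _ = _ + (φ (g [h []] :: v :: l) + _)
    abel

/-- The value of `h` lies inside the prefix fed to `g`, or after it. In the second case `h` has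
moved past that whole prefix, hence the `s` applied to it. -/
theorem insertSum_prefixSum {φ : List V → X} (hφ : IsMultilin k φ) (s : V → V) (h g : List V → V)
    (l : List V) : insertSum s h (prefixSum g φ) l =
      prefixSum (insertSum s h g) φ l + prefixInsertSum s h (fun a => g (a.map s)) φ l := by
  induction l generalizing g with
  | nil => exact add_comm _ _
  | cons v l ih =>
    have h1 : ∀ a, insertSum s h g (v :: a) =
        prefixSum h g (v :: a) + insertSum s h (fun m => g (s v :: m)) a := fun a => rfl
    have h2 : (fun m => prefixSum g φ (s v :: m)) =
        fun m => φ (g [] :: s v :: m) + prefixSum (fun a => g (s v :: a)) φ m := rfl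
    rw [insertSum_cons, h2, insertSum_add, ih, prefixSum_prefixSum hφ, prefixInsertSum_cons,
      insertSum_cons, prefixSum_cons (g := insertSum s h g)]
    simp only [h1]
    rw [prefixSum_add_left hφ, prefixSum_cons (g := prefixSum h g)]
    simp only [List.map_nil, List.map_cons]
    have h3 : insertSum s h g [] = prefixSum h g [] := rfl
    rw [h3]
    abel

theorem prefixSum_insertSum (t : V → V) (h g : List V → V) (φ : List V → X) (l : List V) :
    prefixSum h (insertSum t g φ) l =
      prefixSum h (prefixSum g φ) l + prefixInsertSum t g (fun a => t (h a)) φ l := by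
  rw [prefixSum, prefixSum, prefixInsertSum, ← splitSum_add]
  rfl

/-- The sum of `φ (s t a ++ g (s b) :: s c ++ h d :: e)` over all decompositions
`l = a ++ b ++ c ++ d ++ e`. -/
def insertInsertSum (s t : V → V) (h g : List V → V) (φ : List V → X) (l : List V) : X :=
  splitSum (fun a r => prefixInsertSum s h (fun b => g (b.map s))
    (fun m => φ (a.map (fun v => t (s v)) ++ m)) r) l

theorem insertInsertSum_cons (s t : V → V) (h g : List V → V) (φ : List V → X) (v : V)
    (l : List V) : insertInsertSum s t h g φ (v :: l) =
      prefixInsertSum s h (fun b => g (b.map s)) φ (v :: l) +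
        insertInsertSum s t h g (fun m => φ (t (s v) :: m)) l := rfl

theorem prefixInsertSum_smul {φ : List V → X} (hφ : IsMultilin k φ) (c : k) (s : V → V)
    (h g : List V → V) (l : List V) :
    prefixInsertSum s h (fun a => c • g a) φ l = c • prefixInsertSum s h g φ l := by
  rw [prefixInsertSum, prefixInsertSum, ← LinearMap.lsmul_apply (R := k) c, map_splitSum]
  congr 1
  funext a b
  rw [LinearMap.lsmul_apply, ← insertSum_smul]
  congr 1
  funext m
  exact (hφ [] m).map_smul _ _

/-- The value of `h` lies inside the block fed to `g`, to its right, or to its left. The first case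
is the composite; the other two are exchanged when `g` and `h` are, up to the scalar `c`. This is
the combinatorial content of the pre-Lie identity. -/
theorem insertSum_insertSum {φ : List V → X} (hφ : IsMultilin k φ) {s t : V → V}
    (hst : ∀ v, s (t v) = t (s v)) {h g : List V → V} {c : k}
    (hc : ∀ l, t (h l) = c • h (l.map t)) (l : List V) :
    insertSum s h (insertSum t g φ) l = insertSum (fun v => t (s v)) (insertSum s h g) φ l +
      insertInsertSum s t h g φ l + c • insertInsertSum t s g h φ l := by
  induction l generalizing φ with
  | nil =>
    change prefixSum h (insertSum t g φ) [] = prefixSum (insertSum s h g) φ [] +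
      prefixInsertSum s h (fun b => g (b.map s)) φ [] +
      c • prefixInsertSum t g (fun b => h (b.map t)) φ []
    rw [prefixSum_insertSum, ← insertSum_prefixSum hφ, ← prefixInsertSum_smul hφ]
    simp only [hc]
    rfl
  | cons v l ih =>
    have h2 : (fun m => insertSum t g φ (s v :: m)) =
        fun m => prefixSum g φ (s v :: m) + insertSum t g (fun m => φ (t (s v) :: m)) m := rfl
    rw [insertSum_cons, h2, insertSum_add, ih (hφ.cons _), prefixSum_insertSum, insertSum_cons,
      insertInsertSum_cons, insertInsertSum_cons, hst, smul_add, ← prefixInsertSum_smul hφ]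
    simp only [hc]
    have h3 := insertSum_prefixSum hφ s h g (v :: l)
    rw [insertSum_cons] at h3
    have h4 : prefixSum h (prefixSum g φ) (v :: l) + insertSum s h (fun m => prefixSum g φ (s v :: m)) l =
      _ := h3
    linear_combination (norm := module) h4

end Linear

end Lists

section

variable {k : Type u} [Field k] {V : Type v} [AddCommGroup V] [Module k V]

/-! ### Noncommutative vector fields as functions of lists -/

/-- The value of a vector field on a list of arguments. -/
def ev (f : Fam k V) (l : List V) : V := f l.length l.get

theorem ev_eq (f : Fam k V) {n : ℕ} {x : Fin n → V} {l : List V} (h : l.length = n)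
    (hx : ∀ (i : ℕ) (hi : i < n), l[i]'(h ▸ hi) = x ⟨i, hi⟩) : ev f l = f n x := by
  subst h
  exact congrArg (f l.length) (funext fun i : Fin l.length => hx i.1 i.2)

theorem ev_ofFn (f : Fam k V) {n : ℕ} (x : Fin n → V) : ev f (List.ofFn x) = f n x :=
  ev_eq f (List.length_ofFn) fun i hi => by simp

theorem fam_ext {f g : Fam k V} (h : ∀ l, ev f l = ev g l) : f = g := by
  funext n
  ext x
  rw [← ev_ofFn, h, ev_ofFn]

theorem isMultilin_ev (f : Fam k V) : IsMultilin k (ev f) := by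
  intro a b
  have h : ∀ v, ev f (a ++ v :: b) =
      f (a ++ 0 :: b).length (Function.update (a ++ 0 :: b).get ⟨a.length, by simp⟩ v) := by
    intro v
    refine ev_eq f (by simp) fun i hi => ?_
    by_cases hia : i = a.length
    · subst hia
      simp
    · rw [Function.update_of_ne (by simpa [Fin.ext_iff] using hia)]
      simp only [List.get_eq_getElem]
      rcases lt_or_gt_of_ne hia with h | h
      · rw [List.getElem_append_left h, List.getElem_append_left h]
      · rw [List.getElem_append_right h.le, List.getElem_append_right h.le, List.getElem_cons,
          List.getElem_cons, dif_neg (by omega), dif_neg (by omega)]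
  constructor
  · intro x y
    simp only [h, MultilinearMap.map_update_add]
  · intro c x
    simp only [h, MultilinearMap.map_update_smul]

/-- The sign `v ↦ (-1)^{q|v|} v`. -/
def signMap (G : SuperStructure k V) (q : ZMod 2) : V →ₗ[k] V := G.par ^ q.val

variable {G : SuperStructure k V}

theorem signMap_zero (v : V) : signMap G 0 v = v := rfl

theorem signMap_one (v : V) : signMap G 1 v = G.par v := rfl

theorem SuperStructure.IsHom.signMap {p q : ZMod 2} {v : V} (h : G.IsHom p v) : signMap G q v = sg k (q * p) • v := by
  rcases zmod_two q with rfl | rfl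
  · rw [zero_mul, sg_zero, one_smul, signMap_zero]
  · rw [one_mul, signMap_one, h]

theorem signMap_add (p q : ZMod 2) (v : V) : signMap G (p + q) v = signMap G p (signMap G q v) := by
  rcases zmod_two p with rfl | rfl <;> rcases zmod_two q with rfl | rfl
  · rfl
  · rfl
  · rfl
  · exact (G.par_par v).symm

theorem signMap_comm (p q : ZMod 2) (v : V) :
    signMap G p (signMap G q v) = signMap G q (signMap G p v) := by
  rw [← signMap_add, add_comm, signMap_add]

theorem ev_map_par {β : ZMod 2} {g : Fam k V} (hg : G.fam.IsHom β g) (l : List V) :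
    ev g (l.map G.par) = sg k β • G.par (ev g l) := by
  have h := congrArg (fun f => ev f (l.map G.par)) hg
  have h1 : ev (G.fam.par g) (l.map G.par) = G.par (ev g l) := by
    refine congrArg G.par (ev_eq g (x := fun i => G.par ((l.map G.par).get i)) (by simp)
      fun i hi => ?_).symm
    simp [G.par_par]
  have h2 : G.par (ev g l) = sg k β • ev g (l.map G.par) := h1.symm.trans h
  rw [h2, smul_smul, sg_mul_self, one_smul]

theorem ev_map_signMap {β : ZMod 2} {g : Fam k V} (hg : G.fam.IsHom β g) (q : ZMod 2) (l : List V) :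
    ev g (l.map (signMap G q)) = sg k (q * β) • signMap G q (ev g l) := by
  rcases zmod_two q with rfl | rfl
  · have : ⇑(signMap G 0 : V →ₗ[k] V) = id := rfl
    simp [this, sg_zero]
  · rw [one_mul]
    exact ev_map_par hg l

/-- A choice of arity and slot in `circT` is a decomposition of the list of arguments into three
consecutive parts. Working with lists avoids dependent indices when compositions are iterated. -/
theorem ev_circT [CharZero k] (f : Fam k V) {g : Fam k V} {β : ZMod 2} (hg : G.fam.IsHom β g) (l : List V) :
    ev (circT G f g) l = insertSum (signMap G β) (ev g) (ev f) l := by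
  set F : ℕ → ℕ → V := fun i a => ev f ((l.take i).map (signMap G β) ++
    ev g ((l.drop i).take a) :: (l.drop i).drop a) with hF
  have h1 : ∀ (a : Fin (l.length + 1)) (i : Fin (l.length - a + 1)),
      ∑ q : ZMod 2, MultilinearMap.compLinearMapₗ
        (fun j : Fin l.length => if j.val < i.val then G.par ^ q.val else LinearMap.id)
        (insertAt (blockEquiv l.length a i) i (f (l.length - a + 1)) (G.fam.proj q g a)) l.get =
      F i a := by
    intro a i
    rw [Finset.sum_eq_single β]
    · rw [hg.proj_self]
      refine (ev_eq f (x := i.insertNth (g a fun j => _) fun j => _) ?_ fun m hm => ?_).symm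
      · simp
        omega
      · by_cases hmi : m = i
        · subst hmi
          rw [List.getElem_append_right (by simp), List.getElem_cons, dif_pos (by simp; omega)]
          have : (⟨i, hm⟩ : Fin (l.length - a + 1)) = i := rfl
          rw [this, Fin.insertNth_apply_same]
          refine ev_eq g (by simp; omega) fun j hj => ?_
          simp [blockEquiv]
        · obtain ⟨j, hj⟩ := Fin.exists_succAbove_eq (x := ⟨m, hm⟩) (y := i)
            (by simpa [Fin.ext_iff] using hmi)
          rw [← hj, Fin.insertNth_apply_succAbove]
          have hj' : (j.val < i.val ∧ j.val = m) ∨ (i.val ≤ j.val ∧ j.val + 1 = m) := by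
            have h := congrArg Fin.val hj
            unfold Fin.succAbove at h
            split_ifs at h with h'
            · exact Or.inl ⟨h', h⟩
            · exact Or.inr ⟨not_lt.1 h', h⟩
          rcases hj' with ⟨h, rfl⟩ | ⟨h, rfl⟩
          · rw [List.getElem_append_left (by simp; omega)]
            simp [blockEquiv, h, signMap]
          · rw [List.getElem_append_right (by simp; omega), List.getElem_cons,
              dif_neg (by simp; omega)]
            have h2 : ¬ j.val < i.val := by omega
            have h3 : ¬ a.val + j.val < i.val := by omega
            simp [blockEquiv, h2, h3]
            congr 1
            omega
    · intro q _ hq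
      have : G.fam.proj q g = 0 := by
        rw [hg.proj, if_neg hq]
      rw [this, Pi.zero_apply, map_zero, map_zero]
      rfl
    · simp
  have h2 : ev (circT G f g) l = ∑ a : Fin (l.length + 1), ∑ i : Fin (l.length - a + 1), F i a := by
    rw [ev, circT_apply]
    simp only [_root_.sum_apply]
    exact Finset.sum_congr rfl fun a _ => Finset.sum_congr rfl fun i _ => by
      rw [← h1]
  rw [h2, Fin.sum_univ_eq_sum_range (fun a => ∑ i : Fin (l.length - a + 1), F i a)]
  simp only [fun a => Fin.sum_univ_eq_sum_range (fun i => F i a)]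
  simp only [insertSum, prefixSum, splitSum_eq_sum]
  -- The pairs range over the triangle `a + i ≤ n`; the list sum runs over it in the other order.
  refine Finset.sum_comm' fun a i => ?_
  simp
  omega

end

section

variable {k : Type u} [Field k] [CharZero k] {V : Type v} [AddCommGroup V] [Module k V]
variable {G : SuperStructure k V}

/-! ### The Lie algebra of noncommutative vector fields -/

theorem isHom_of_ev {α : ZMod 2} {f : Fam k V}
    (h : ∀ l, ev f (l.map G.par) = sg k α • G.par (ev f l)) : G.fam.IsHom α f := by
  refine fam_ext fun l => ?_
  have h1 : ev (G.fam.par f) l = G.par (ev f (l.map G.par)) := by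
    refine congrArg G.par (ev_eq f (x := fun i => G.par (l.get i)) (by simp) fun i hi => ?_).symm
    simp
  rw [h1, h, map_smul, G.par_par]
  rfl

theorem isHom_circT {α β : ZMod 2} {f g : Fam k V} (hf : G.fam.IsHom α f) (hg : G.fam.IsHom β g) :
    G.fam.IsHom (α + β) (circT G f g) := by
  refine isHom_of_ev fun l => ?_
  rw [ev_circT f hg, ev_circT f hg,
    insertSum_comp_map (k := k) (ev_map_par hg) (fun v => signMap_comm (G := G) β 1 v)
      (isMultilin_ev f)]
  simp only [ev_map_par hf]
  rw [insertSum_smul, map_insertSum, smul_smul, sg_add, mul_comm]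

/-- By `insertSum_insertSum` the associator consists of the terms in which `g` and `h` enter
different slots of `f`. These are symmetric in `g` and `h` up to the Koszul sign, so `circT` is a
pre-Lie product. -/
theorem circT_assoc {β γ : ZMod 2} (f : Fam k V) {g h : Fam k V} (hg : G.fam.IsHom β g)
    (hh : G.fam.IsHom γ h) :
    circT G (circT G f g) h - circT G f (circT G g h) =
      sg k (β * γ) • (circT G (circT G f h) g - circT G f (circT G h g)) := by
  have key : ∀ {β γ : ZMod 2} {g h : Fam k V}, G.fam.IsHom β g → G.fam.IsHom γ h →
      ∀ l, ev (circT G (circT G f g) h) l = ev (circT G f (circT G g h)) l +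
        insertInsertSum (signMap G γ) (signMap G β) (ev h) (ev g) (ev f) l +
        sg k (β * γ) • insertInsertSum (signMap G β) (signMap G γ) (ev g) (ev h) (ev f) l := by
    intro β γ g h hg hh l
    have h1 : ev (circT G f g) = insertSum (signMap G β) (ev g) (ev f) :=
      funext fun l => ev_circT f hg l
    have h2 : ev (circT G g h) = insertSum (signMap G γ) (ev h) (ev g) :=
      funext fun l => ev_circT g hh l
    rw [ev_circT _ hh, h1, ev_circT _ (isHom_circT hg hh), h2]
    have h3 : ⇑(signMap G (β + γ)) = fun v => signMap G β (signMap G γ v) :=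
      funext fun v => signMap_add β γ v
    rw [h3]
    refine insertSum_insertSum (k := k) (isMultilin_ev f) (fun v => signMap_comm γ β v)
      (fun l => ?_) l
    rw [ev_map_signMap hh, smul_smul, sg_mul_self, one_smul]
  refine fam_ext fun l => ?_
  change ev (circT G (circT G f g) h) l - ev (circT G f (circT G g h)) l =
    sg k (β * γ) • (ev (circT G (circT G f h) g) l - ev (circT G f (circT G h g)) l)
  rw [key hg hh, key hh hg, mul_comm γ β]
  have := sg_mul_self (k := k) (β * γ)
  linear_combination (norm := skip) this • insertInsertSum (signMap G γ) (signMap G β) (ev h) (ev g) (ev f) l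
  simp only [smul_add, smul_sub, smul_smul, this]
  module

theorem commutator_isHom {circ : Fam k V →ₗ[k] Fam k V →ₗ[k] Fam k V} {p q : ZMod 2}
    {f g : Fam k V} (hf : G.fam.IsHom p f) (hg : G.fam.IsHom q g) :
    commutator G circ f g = circ f g - sg k (p * q) • circ g f := by
  simp only [commutator, LinearMap.sub_apply, LinearMap.coe_sum, Finset.sum_apply,
    LinearMap.smul_apply, LinearMap.flip_apply, LinearMap.compl₁₂_apply, hf.proj, hg.proj]
  rw [Finset.sum_eq_single p, Finset.sum_eq_single q]
  · simp
  · intro q' _ h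
    simp [h]
  · simp
  · intro p' _ h
    refine Finset.sum_eq_zero fun q' _ => ?_
    simp [h]
  · simp

theorem isHom_bracketT {α β : ZMod 2} {f g : Fam k V} (hf : G.fam.IsHom α f)
    (hg : G.fam.IsHom β g) : G.fam.IsHom (α + β) (bracketT G f g) := by
  rw [bracketT, commutator_isHom hf hg]
  refine (isHom_circT hf hg).sub (.smul ?_ _)
  rw [add_comm]
  exact isHom_circT hg hf

theorem bilin_eq_of_fam_isHom {X : Type*} [AddCommGroup X] [Module k X]
    {b b' : Fam k V →ₗ[k] Fam k V →ₗ[k] X}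
    (h : ∀ p q f g, G.fam.IsHom p f → G.fam.IsHom q g → b f g = b' f g) : b = b' :=
  linear_ext_isHom G.fam fun p f hf => linear_ext_isHom G.fam fun q g hg => h p q f g hf hg

theorem bracketT_par (f g : Fam k V) :
    bracketT G (G.fam.par f) (G.fam.par g) = G.fam.par (bracketT G f g) := by
  have : (bracketT G).compl₁₂ G.fam.par G.fam.par = (bracketT G).compr₂ G.fam.par :=
    bilin_eq_of_fam_isHom (G := G) fun p q f g hf hg => by
      have h := isHom_bracketT hf hg
      rw [LinearMap.compl₁₂_apply, LinearMap.compr₂_apply, hf, hg, h, map_smul, map_smul,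
        LinearMap.smul_apply, smul_smul, sg_add, mul_comm]
  exact LinearMap.congr_fun₂ this f g

theorem bracketT_antisymm {p q : ZMod 2} {f g : Fam k V} (hf : G.fam.IsHom p f)
    (hg : G.fam.IsHom q g) : bracketT G f g = -(sg k (p * q) • bracketT G g f) := by
  rw [bracketT, commutator_isHom hf hg, commutator_isHom hg hf, smul_sub, smul_smul, mul_comm q p,
    sg_mul_self, one_smul, neg_sub]

theorem sg_eq_one_or (p : ZMod 2) : sg k p = 1 ∨ sg k p = -1 := by
  rcases zmod_two p with rfl | rfl
  · exact Or.inl sg_zero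
  · exact Or.inr sg_one

/-- The commutator of a pre-Lie product is a Lie bracket: the identity is a combination of the
symmetries of the associator with `f`, `g` and `h` in turn as the outer field. -/
theorem bracketT_jacobi {α β γ : ZMod 2} {f g h : Fam k V} (hf : G.fam.IsHom α f)
    (hg : G.fam.IsHom β g) (hh : G.fam.IsHom γ h) :
    bracketT G f (bracketT G g h) =
      bracketT G (bracketT G f g) h + sg k (α * β) • bracketT G g (bracketT G f h) := by
  have h1 := circT_assoc f hg hh
  have h2 := circT_assoc g hf hh
  have h3 := circT_assoc h hf hg
  have e : ∀ {p q : ZMod 2} {f g : Fam k V}, G.fam.IsHom p f → G.fam.IsHom q g →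
    bracketT G f g = circT G f g - sg k (p * q) • circT G g f := commutator_isHom
  rw [e hf (isHom_bracketT hg hh), e (isHom_bracketT hf hg) hh, e hg (isHom_bracketT hf hh),
    e hg hh, e hf hg, e hf hh]
  clear e
  simp only [map_sub, map_smul, LinearMap.sub_apply, LinearMap.smul_apply, mul_add, add_mul, sg_add,
    mul_comm β α]
  -- Each of the three pairwise signs is 1 or -1; in every case the coefficients of the combination
  -- are explicit.
  rcases sg_eq_one_or (k := k) (α * β) with e | e <;> rcases sg_eq_one_or (k := k) (β * γ) with e' | e' <;>
    rcases sg_eq_one_or (k := k) (α * γ) with e'' | e'' <;>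
    simp only [e, e', e'', neg_smul, one_smul, mul_one, mul_neg, neg_neg] at h1 h2 h3 ⊢
  · linear_combination (norm := module) -h1 + h2 - h3
  · linear_combination (norm := module) -h1 + h2 + h3
  · linear_combination (norm := module) -h1 + h2 + h3
  · linear_combination (norm := module) -h1 + h2 - h3
  · linear_combination (norm := module) -h1 - h2 - h3
  · linear_combination (norm := module) -h1 - h2 + h3
  · linear_combination (norm := module) -h1 - h2 + h3
  · linear_combination (norm := module) -h1 - h2 - h3

theorem constField_isHom {p : ZMod 2} {w : V} (h : G.IsHom p w) : G.fam.IsHom p (constField w) := by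
  rw [SuperStructure.IsHom, ← constField_par, h, map_smul]

theorem ev_constField_cons (w v : V) (l : List V) : ev (constField (k := k) w) (v :: l) = 0 := rfl

theorem ev_linField_singleton (a : V →ₗ[k] V) (v : V) : ev (linField a) [v] = a v := rfl

theorem ev_linField_cons_cons (a : V →ₗ[k] V) (v v' : V) (l : List V) :
    ev (linField a) (v :: v' :: l) = 0 := rfl

theorem bracketT_const_const (u u' : V) :
    bracketT G (constField u) (constField u') = 0 := by
  have h : ∀ w (g : Fam k V), circT G (constField w) g = 0 := by
    intro w g
    funext n
    rw [circT_apply]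
    refine Finset.sum_eq_zero fun a _ => Finset.sum_eq_zero fun i _ =>
      Finset.sum_eq_zero fun q _ => ?_
    have : (constField w : Fam k V) (n - a + 1) = 0 := rfl
    rw [this, map_zero, LinearMap.zero_apply, map_zero]
  have : (bracketT G).compl₁₂ constField constField = 0 :=
    linear_ext_isHom G fun p u hu => linear_ext_isHom G fun q u' hu' => by
      rw [LinearMap.compl₁₂_apply, bracketT,
        commutator_isHom (constField_isHom hu) (constField_isHom hu'), h, h, smul_zero, sub_zero]
      rfl
  exact LinearMap.congr_fun₂ this u u'

/-- A constant field has a nonzero value only on the empty prefix. -/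
theorem prefixSum_constField {X : Type*} [AddCommGroup X] [Module k X] {φ : List V → X}
    (hφ : IsMultilin k φ) (w : V) (l : List V) :
    prefixSum (ev (constField (k := k) w)) φ l = φ (w :: l) := by
  cases l with
  | nil => rfl
  | cons v l =>
    rw [prefixSum_cons]
    have : (fun a => ev (constField (k := k) w) (v :: a)) = fun _ => 0 := rfl
    have h0 : ∀ b, φ (0 :: b) = 0 := fun b => (hφ [] b).map_zero
    rw [this, prefixSum]
    simp only [h0]
    rw [splitSum_zero, add_zero]
    rfl

theorem bracketT_lin_const (D : DGStructure k V) (w : V) :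
    bracketT D.toSuperStructure (linField D.d) (constField w) = constField (D.d w) := by
  have key : (bracketT D.toSuperStructure (linField D.d)) ∘ₗ constField = constField ∘ₗ D.d := by
    refine linear_ext_isHom D.toSuperStructure fun p w hw => ?_
    rw [LinearMap.comp_apply, LinearMap.comp_apply, bracketT,
      commutator_isHom (linField_isHom D) (constField_isHom hw)]
    have h : circT D.toSuperStructure (constField w) (linField D.d) = 0 := by
      funext n
      rw [circT_apply]
      refine Finset.sum_eq_zero fun a _ => Finset.sum_eq_zero fun i _ =>
        Finset.sum_eq_zero fun q _ => ?_
      have : (constField w : Fam k V) (n - a + 1) = 0 := rfl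
      rw [this, map_zero, LinearMap.zero_apply, map_zero]
    rw [h, smul_zero, sub_zero]
    refine fam_ext fun l => ?_
    rw [ev_circT _ (constField_isHom hw)]
    match l with
    | [] => rfl
    | v :: l =>
      rw [ev_constField_cons, insertSum_cons, prefixSum_constField (isMultilin_ev _),
        ev_linField_cons_cons, zero_add, insertSum]
      have : ∀ a r : List V, prefixSum (ev (constField (k := k) w))
          (fun m => ev (linField D.d) (signMap D.toSuperStructure p v ::
            (a.map (signMap D.toSuperStructure p) ++ m))) r = 0 := by
        intro a r
        rw [prefixSum_constField (φ := fun m => _) (by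
          intro a' b'
          have := isMultilin_ev (linField D.d) (signMap D.toSuperStructure p v ::
            (a.map (signMap D.toSuperStructure p) ++ a')) b'
          simpa using this)]
        cases a <;> rfl
      simp only [this, splitSum_zero]
  exact LinearMap.congr_fun key w

theorem bracketT_lin_lin (D : DGStructure k V) :
    bracketT D.toSuperStructure (linField D.d) (linField D.d) = 0 := by
  have h : circT D.toSuperStructure (linField D.d) (linField D.d) = 0 := by
    refine fam_ext fun l => ?_
    rw [ev_circT _ (linField_isHom D)]
    have h0 : ∀ r, ev (linField D.d) (0 :: r) = 0 := fun r => (isMultilin_ev _ [] r).map_zero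
    have h0' : ∀ v, ev (linField D.d) [v, 0] = 0 := fun r => rfl
    match l with
    | [] => exact h0 []
    | [v] =>
      change ev (linField D.d) [0, v] + ev (linField D.d) [D.d v] +
        ev (linField D.d) [signMap D.toSuperStructure 1 v, 0] = 0
      rw [h0, h0', ev_linField_singleton, D.d_d, add_zero, add_zero]
    | v :: v' :: l =>
      rw [insertSum, splitSum_eq_sum]
      refine Finset.sum_eq_zero fun i _ => ?_
      rw [prefixSum, splitSum_eq_sum]
      refine Finset.sum_eq_zero fun j _ => ?_
      match i, j with
      | 0, 0 => exact h0 _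
      | 0, 1 => rfl
      | 0, j + 2 =>
        have : ev (linField D.d) (((v :: v' :: l).drop 0).take (j + 2)) = 0 := rfl
        rw [this]
        exact h0 _
      | 1, j => rfl
      | i + 2, j => rfl
  rw [bracketT, commutator_isHom (linField_isHom D) (linField_isHom D), h, smul_zero, sub_zero]

theorem isFieldAlgebra_bracketT (D : DGStructure k V) :
    IsFieldAlgebra D (bracketT D.toSuperStructure) ⊤ (aFields k V) where
  mem_iff f := ⟨fun h => ⟨trivial, h⟩, fun h => h.2⟩
  par_mem _ _ := trivial
  br_mem _ _ _ _ := trivial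
  const_mem _ := trivial
  d_mem := trivial
  br_par f _ g _ := bracketT_par f g
  antisymm _ _ _ _ _ _ hf hg := bracketT_antisymm hf hg
  jacobi _ _ _ _ _ _ _ _ _ hf hg hh := bracketT_jacobi hf hg hh
  br_const := bracketT_const_const
  br_zero f hf g hg := (aFields_isDGLieSubalgebra D).br_mem f hf g hg
  br_d := bracketT_lin_lin D
  br_d_const := bracketT_lin_const D

/-- Subalgebras of algebras of formal vector fields. -/
theorem IsFieldAlgebra.of_le {D : DGStructure k V} {br : Fam k V →ₗ[k] Fam k V →ₗ[k] Fam k V}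
    {M S M' S' : Submodule k (Fam k V)} (H : IsFieldAlgebra D br M S) (hM : M' ≤ M)
    (hS : ∀ f, f ∈ S' ↔ f ∈ M' ∧ f 0 = 0) (par_mem : ∀ f ∈ M', D.fam.par f ∈ M')
    (br_mem : ∀ f ∈ M', ∀ g ∈ M', br f g ∈ M') (const_mem : ∀ w, constField w ∈ M')
    (d_mem : linField D.d ∈ M') : IsFieldAlgebra D br M' S' where
  mem_iff := hS
  par_mem := par_mem
  br_mem := br_mem
  const_mem := const_mem
  d_mem := d_mem
  br_par f hf g hg := H.br_par f (hM hf) g (hM hg)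
  antisymm p q f hf g hg := H.antisymm p q f (hM hf) g (hM hg)
  jacobi p q l f hf g hg h hh := H.jacobi p q l f (hM hf) g (hM hg) h (hM hh)
  br_const := H.br_const
  br_zero f hf g hg := by
    have hle : S' ≤ S := fun f hf => (H.mem_iff f).2 ⟨hM ((hS f).1 hf).1, ((hS f).1 hf).2⟩
    exact H.br_zero f (hle hf) g (hle hg)
  br_d := H.br_d
  br_d_const := H.br_d_const

end

section

variable {k : Type u} [Field k] [CharZero k] {V : Type v} [AddCommGroup V] [Module k V]
variable {G : SuperStructure k V}

/-! ### Symplectic vector fields -/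

theorem IsMultilin.ext_isHom {X : Type*} [AddCommGroup X] [Module k X] {φ ψ : List V → X}
    (hφ : IsMultilin k φ) (hψ : IsMultilin k ψ)
    (h : ∀ l : List V, (∀ v ∈ l, ∃ p, G.IsHom p v) → φ l = ψ l) (l : List V) : φ l = ψ l := by
  suffices H : ∀ l a : List V, (∀ v ∈ a, ∃ p, G.IsHom p v) → φ (a ++ l) = ψ (a ++ l) from
    H l [] (by simp)
  intro l
  induction l with
  | nil => intro a ha; rw [List.append_nil]; exact h a ha
  | cons v l ih =>
    intro a ha
    have key : (hφ a l).mk' = (hψ a l).mk' := linear_ext_isHom G fun p v hv => by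
      have := ih (a ++ [v]) (by
        intro w hw
        rcases List.mem_append.1 hw with hw | hw
        · exact ha w hw
        · rw [List.mem_singleton.1 hw]; exact ⟨p, hv⟩)
      simpa using this
    exact LinearMap.congr_fun key v

theorem ev_smul_cons (f : Fam k V) (c : k) (v : V) (l : List V) :
    ev f (c • v :: l) = c • ev f (v :: l) := (isMultilin_ev f [] l).map_smul c v

theorem ev_append_smul (f : Fam k V) (c : k) (v : V) (l : List V) :
    ev f (l ++ [c • v]) = c • ev f (l ++ [v]) := (isMultilin_ev f l []).map_smul c v

/-- The rotation moves the first argument past all the others. -/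
theorem koszul_finRotate {n : ℕ} (p : Fin (n + 1) → ZMod 2) :
    koszul k (finRotate (n + 1)).symm p = ∏ j : Fin n, sg k (p 0 * p j.succ) := by
  have h0 : (finRotate (n + 1)).symm 0 = Fin.last n := by
    rw [Equiv.symm_apply_eq, finRotate_last]
  have hs : ∀ j : Fin n, (finRotate (n + 1)).symm j.succ = j.castSucc := by
    intro j
    rw [Equiv.symm_apply_eq, finRotate_apply, Fin.coeSucc_eq_succ]
  unfold koszul
  rw [Fin.prod_univ_succ, Finset.prod_eq_one (s := Finset.univ) (f := fun i : Fin n => _), mul_one,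
    Fin.prod_univ_succ]
  · rw [if_neg (by simp), one_mul]
    refine Finset.prod_congr rfl fun j _ => if_pos ⟨Fin.succ_pos j, ?_⟩
    rw [h0, hs]
    exact Fin.castSucc_lt_last j
  · intro i _
    refine Finset.prod_eq_one fun j _ => if_neg ?_
    rintro ⟨h1, h2⟩
    obtain ⟨j, rfl⟩ := Fin.exists_succ_eq.2 (Fin.ne_zero_of_lt h1)
    rw [hs, hs] at h2
    exact absurd (Fin.castSucc_lt_castSucc_iff.1 h2) (Fin.succ_lt_succ_iff.1 h1).not_gt

theorem mem_cyclicFields_iff_fin {ω : V →ₗ[k] V →ₗ[k] k} {f : Fam k V} :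
    f ∈ cyclicFields G ω ↔ ∀ (n : ℕ) (p : Fin (n + 1) → ZMod 2) (x : Fin (n + 1) → V),
      (∀ i, G.IsHom (p i) (x i)) → ω (f n (Fin.init x)) (x (Fin.last n)) =
        ω (f n fun i => signMap G (p 0) (x i.succ)) (x 0) := by
  refine forall_congr' fun n => forall_congr' fun p => forall_congr' fun x =>
    forall_congr' fun hx => ?_
  have h1 : (fun i : Fin n => signMap G (p 0) (x i.succ)) =
      fun i => sg k (p 0 * p i.succ) • x i.succ := funext fun i => (hx i.succ).signMap
  have h2 : Fin.init (x ∘ finRotate (n + 1)) = fun i : Fin n => x i.succ := by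
    funext i
    simp [Fin.init]
  rw [h1, MultilinearMap.map_smul_univ, koszul_finRotate, h2, Function.comp, finRotate_last, map_smul,
    LinearMap.smul_apply, smul_eq_mul]

/-- The rotation sign depends on the moved argument only through its parity `q`, so it can be
distributed over the others as `signMap G q`. Linearity then frees all arguments but `v` from
homogeneity. -/
theorem mem_cyclicFields_iff {ω : V →ₗ[k] V →ₗ[k] k} {f : Fam k V} :
    f ∈ cyclicFields G ω ↔ ∀ (q : ZMod 2) (v : V), G.IsHom q v → ∀ (m : List V) (y : V),
      ω (ev f (v :: m)) y = ω (ev f ((m ++ [y]).map (signMap G q))) v := by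
  rw [mem_cyclicFields_iff_fin]
  constructor
  · intro h q v hv m y
    suffices H : ∀ m : List V, (∀ v ∈ m, ∃ p, G.IsHom p v) → ∀ y p, G.IsHom p y →
        ω (ev f (v :: m)) y = ω (ev f ((m ++ [y]).map (signMap G q))) v by
      have hl : ∀ m : List V, (∀ v ∈ m, ∃ p, G.IsHom p v) → ∀ y,
          ω (ev f (v :: m)) y = ω (ev f ((m ++ [y]).map (signMap G q))) v := by
        intro m hm y
        have e := (((isMultilin_ev f).comp_map (signMap G q)).map (ω.flip v)) m []
        have key : ω (ev f (v :: m)) = e.mk' := linear_ext_isHom G fun p y hy => H m hm y p hy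
        exact LinearMap.congr_fun key y
      exact IsMultilin.ext_isHom (G := G) (((isMultilin_ev f).cons v).map (ω.flip y))
        ((((isMultilin_ev f).comp_map (signMap G q)).append [y]).map (ω.flip v))
        (fun m hm => hl m hm y) m
    intro m hm y p hy
    have hx : ∀ i : Fin (m.length + 1 + 1), ∃ p, G.IsHom p
        ((v :: (m ++ [y]))[i.val]'(by simp; omega)) := by
      intro i
      have h1 := List.getElem_mem (l := v :: (m ++ [y])) (n := i.val) (by simp; omega)
      generalize (v :: (m ++ [y]))[i.val]'(by simp; omega) = z at h1 ⊢
      rcases List.mem_cons.1 h1 with h1 | h1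
      · exact ⟨q, h1 ▸ hv⟩
      · rcases List.mem_append.1 h1 with h1 | h1
        · exact hm _ h1
        · exact ⟨p, List.mem_singleton.1 h1 ▸ hy⟩
    choose P hP using hx
    set P' : Fin (m.length + 1 + 1) → ZMod 2 := Fin.cons q fun i => P i.succ with hP'
    have h1 := h (m.length + 1) P' (fun i => (v :: (m ++ [y]))[i.val]'(by simp; omega)) (fun i => by
      induction i using Fin.cases with
      | zero => exact hv
      | succ i => exact hP i.succ)
    have h2 : ev f (v :: m) = f (m.length + 1)
        (Fin.init fun i : Fin (m.length + 1 + 1) => (v :: (m ++ [y]))[i.val]'(by simp; omega)) :=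
      ev_eq f (by simp) fun i hi => by
        simp only [Fin.init, Fin.val_castSucc]
        rcases i with _ | i
        · rfl
        · simp only [List.getElem_cons_succ]
          rw [List.getElem_append_left]
    have h3 : ev f ((m ++ [y]).map (signMap G q)) = f (m.length + 1)
        (fun i => signMap G (P' 0) ((v :: (m ++ [y]))[i.succ.val]'(by simp; omega))) :=
      ev_eq f (by simp) fun i hi => by
        rw [List.getElem_map]
        simp [hP']
    have h4 : (v :: (m ++ [y]))[(Fin.last (m.length + 1)).val]'(by simp) = y := by simp
    rw [h2, h3]
    exact (congrArg _ h4.symm).trans h1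
  · intro h n p x hx
    cases n with
    | zero =>
      have : (Fin.last 0) = 0 := rfl
      rw [this]
      congr 3
      exact Subsingleton.elim _ _
    | succ n =>
      have h1 := h (p 0) (x 0) (hx 0) (List.ofFn fun i : Fin n => x i.castSucc.succ)
        (x (Fin.last (n + 1)))
      have h2 : ev f (x 0 :: List.ofFn fun i : Fin n => x i.castSucc.succ) =
          f (n + 1) (Fin.init x) := ev_eq f (by simp) fun i hi => by
        rcases i with _ | i
        · rfl
        · simp [Fin.init]
      have h3 : ev f (((List.ofFn fun i : Fin n => x i.castSucc.succ) ++
          [x (Fin.last (n + 1))]).map (signMap G (p 0))) =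
          f (n + 1) fun i => signMap G (p 0) (x i.succ) := ev_eq f (by simp) fun i hi => by
        rw [List.getElem_map]
        congr 1
        by_cases hin : i < n
        · rw [List.getElem_append_left (by simpa using hin)]
          simp
        · rw [List.getElem_append_right (by simpa using hin)]
          have : i = n := by omega
          subst this
          simp
          rfl
      rw [h2, h3] at h1
      exact h1

theorem suffixSum_map_left {X Y F : Type*} [AddCommGroup X] [AddCommGroup Y] [FunLike F X Y]
    [AddMonoidHomClass F X Y] (T : F) (s : V → V) (g : List V → V) (φ : List V → X)
    (l : List V) (y : V) : T (suffixSum s g φ l y) = suffixSum s g (fun m => T (φ m)) l y :=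
  map_splitSum T _ l

variable {ω : V →ₗ[k] V →ₗ[k] k}

/-- Cyclic invariance brings `u` to the second argument of `ω`, and antisymmetry of `ω` exchanges it
with the value of `f`. -/
theorem form_flip (hω : ∀ p q x y, G.IsHom p x → G.IsHom q y → ω x y = -(sg k (p * q) * ω y x))
    {α : ZMod 2} {f : Fam k V} (hf : G.fam.IsHom α f) (hK : f ∈ cyclicFields G ω) (u : V)
    (l : List V) (y : V) :
    ω (ev f (u :: l)) y = -ω (signMap G α u) (ev f (l ++ [y])) := by
  have hflip : ∀ q u, G.IsHom q u → ∀ x, ω x u = -ω u (signMap G q x) := by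
    intro q u hu x
    have key : ω.flip u = -(ω u ∘ₗ signMap G q) := linear_ext_isHom G fun p x hx => by
      rw [LinearMap.flip_apply, hω p q x u hx hu, LinearMap.neg_apply, LinearMap.comp_apply, hx.signMap,
        map_smul, smul_eq_mul, mul_comm q p]
    exact LinearMap.congr_fun key x
  have key : (ω ∘ₗ ((isMultilin_ev f) [] l).mk').flip y =
      -(ω ∘ₗ signMap G α).flip (ev f (l ++ [y])) := linear_ext_isHom G fun q u hu => by
    change ω (ev f (u :: l)) y = -ω (signMap G α u) (ev f (l ++ [y]))
    rw [mem_cyclicFields_iff.1 hK q u hu, hflip q u hu, ev_map_signMap hf, map_smul, ← signMap_add,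
      CharTwo.add_self_eq_zero, signMap_zero, hu.signMap, map_smul, map_smul, LinearMap.smul_apply,
      mul_comm]
  exact LinearMap.congr_fun key u

/-- In `f(g(v, a), b)` paired with `y`, `form_flip` pairs the value of `g` with `f(b, y)`. Cyclic
invariance of `g` then makes `f(b, y)` its last argument and pairs the result with `v`: the roles of
the inner and the outer field are exchanged. -/
theorem prefixSum_eq_suffixSum
    (hω : ∀ p q x y, G.IsHom p x → G.IsHom q y → ω x y = -(sg k (p * q) * ω y x))
    {α β q : ZMod 2} {f g : Fam k V} (hf : G.fam.IsHom α f) (hKf : f ∈ cyclicFields G ω)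
    (hg : G.fam.IsHom β g) (hKg : g ∈ cyclicFields G ω) {v : V} (hv : G.IsHom q v) (m : List V)
    (y : V) : ω (prefixSum (fun a => ev g (v :: a)) (ev f) m) y = -(sg k (α * β) *
      ω (suffixSum (signMap G α) (ev f) (ev g) (m.map (signMap G q)) (signMap G q y)) v) := by
  have e : ∀ x z, ω x z = ω.flip z x := fun _ _ => rfl
  rw [e _ y, map_prefixSum, e _ v, suffixSum_map_left,
    ← neg_mul, ← smul_eq_mul, suffixSum, splitSum_map, ← LinearMap.lsmul_apply, map_splitSum, prefixSum]
  congr 1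
  funext a b
  rw [LinearMap.flip_apply, form_flip hω hf hKf, LinearMap.lsmul_apply, LinearMap.flip_apply]
  have h1 : signMap G α (ev g (v :: a)) = sg k (α * β) • ev g ((v :: a).map (signMap G α)) := by
    rw [ev_map_signMap hg, smul_smul, sg_mul_self, one_smul]
  have h2 : ev f (b.map (signMap G q) ++ [signMap G q y]) =
      sg k (q * α) • signMap G q (ev f (b ++ [y])) := by
    rw [← ev_map_signMap hf]
    simp
  rw [h1, h2, map_smul, LinearMap.smul_apply, List.map_cons, hv.signMap,
    ev_smul_cons, map_smul, LinearMap.smul_apply,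
    mem_cyclicFields_iff.1 hKg q v hv, ev_append_smul, map_smul,
    LinearMap.smul_apply, List.map_append, List.map_map, List.map_map]
  have h3 : signMap G q ∘ signMap G α = signMap G α ∘ (signMap G q : V → V) :=
    funext fun v => signMap_comm q α v
  rw [h3, mul_comm q α, neg_smul]
  rfl

/-- The defect of cyclic invariance of `f ∘ g`. Terms with `v` outside the block of `g` match after
rotation (`h1`), and so do an empty block at the front and one at the end (`h2`). What remains is
the block containing `v` before rotation, and the block containing `y` after it. -/
theorem form_circT {β q : ZMod 2} {f g : Fam k V} (hKf : f ∈ cyclicFields G ω)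
    (hg : G.fam.IsHom β g) {v : V} (hv : G.IsHom q v) (m : List V) (y : V) :
    ω (ev (circT G f g) (v :: m)) y - ω (ev (circT G f g) ((m ++ [y]).map (signMap G q))) v =
      ω (prefixSum (fun a => ev g (v :: a)) (ev f) m) y -
      ω (suffixSum (signMap G β) (ev g) (ev f) (m.map (signMap G q)) (signMap G q y)) v := by
  have hK := mem_cyclicFields_iff.1 hKf
  have e : ∀ x z, ω x z = ω.flip z x := fun _ _ => rfl
  have hβ : signMap G β v = sg k (β * q) • v := hv.signMap
  have h1 : ω (insertSum (signMap G β) (ev g) (fun l => ev f (signMap G β v :: l)) m) y =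
      ω (insertSum (signMap G β) (ev g) (fun l => ev f (l ++ [signMap G q y]))
        (m.map (signMap G q))) v := by
    rw [insertSum_comp_map (k := k) (ev_map_signMap hg q) (fun v => signMap_comm β q v)
      ((isMultilin_ev f).append _), e _ v, e _ y, map_smul, map_insertSum, map_insertSum,
      ← insertSum_smul]
    congr 1
    funext l
    rw [LinearMap.flip_apply, hβ, ev_smul_cons, map_smul, LinearMap.smul_apply,
      hK q v hv, mul_comm q β]
    simp
  have h2 : ω (ev f (ev g [] :: v :: m)) y = ω (ev f ((m.map (signMap G q) ++ [signMap G q y]).map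
      (signMap G β) ++ [ev g []])) v := by
    have h0 : signMap G q (ev g []) = sg k (q * β) • ev g [] := by
      have := ev_map_signMap hg q []
      rw [List.map_nil] at this
      rw [this, smul_smul, sg_mul_self, one_smul, ← this]
    have h0' : G.IsHom β (ev g []) := by
      have := ev_map_par hg []
      rw [List.map_nil] at this
      rw [SuperStructure.IsHom, this, smul_smul, sg_mul_self, one_smul, ← this]
    rw [hK β _ h0', List.cons_append, List.map_cons, hβ, ev_smul_cons, map_smul,
      LinearMap.smul_apply, hK q v hv, List.map_append, List.map_singleton, h0,
      ev_append_smul, map_smul, LinearMap.smul_apply, smul_smul, mul_comm q β,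
      sg_mul_self, one_smul]
    simp only [List.map_append, List.map_map, List.map_singleton]
    have h3 : signMap G q ∘ signMap G β = signMap G β ∘ (signMap G q : V → V) :=
      funext fun v => signMap_comm q β v
    rw [h3, signMap_comm]
  rw [ev_circT f hg, ev_circT f hg, List.map_append, List.map_singleton, insertSum_concat,
    insertSum_cons, prefixSum_cons]
  simp only [map_add, LinearMap.add_apply]
  rw [h1, h2]
  ring

/-- By `form_circT` and `prefixSum_eq_suffixSum` the defect of `f ∘ g` is the Koszul sign times the
defect of `g ∘ f`, so it cancels in the graded commutator. -/
theorem bracketT_mem_cyclicFields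
    (hω : ∀ p q x y, G.IsHom p x → G.IsHom q y → ω x y = -(sg k (p * q) * ω y x))
    (hp : ∀ f ∈ cyclicFields G ω, G.fam.par f ∈ cyclicFields G ω) {f g : Fam k V}
    (hf : f ∈ cyclicFields G ω) (hg : g ∈ cyclicFields G ω) :
    bracketT G f g ∈ cyclicFields G ω := by
  have key : ∀ {α β : ZMod 2} {f g : Fam k V}, G.fam.IsHom α f → f ∈ cyclicFields G ω →
      G.fam.IsHom β g → g ∈ cyclicFields G ω → bracketT G f g ∈ cyclicFields G ω := by
    intro α β f g hf hKf hg hKg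
    rw [bracketT, commutator_isHom hf hg, mem_cyclicFields_iff]
    intro q v hv m y
    have h1 := form_circT hKf hg hv m y
    have h2 := form_circT hKg hf hv m y
    rw [prefixSum_eq_suffixSum hω hf hKf hg hKg hv] at h1
    rw [prefixSum_eq_suffixSum hω hg hKg hf hKf hv, mul_comm β α] at h2
    have h3 := sg_mul_self (k := k) (α * β)
    change ω (ev (circT G f g) (v :: m) - sg k (α * β) • ev (circT G g f) (v :: m)) y =
      ω (ev (circT G f g) _ - sg k (α * β) • ev (circT G g f) _) v
    simp only [map_sub, map_smul, LinearMap.sub_apply, LinearMap.smul_apply, smul_eq_mul]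
    linear_combination h1 - sg k (α * β) * h2 + ω (suffixSum (signMap G β) (ev g) (ev f)
      (m.map (signMap G q)) (signMap G q y)) v * h3
  rw [← sum_proj G.fam f, ← sum_proj G.fam g, map_sum]
  refine Submodule.sum_mem _ fun p _ => ?_
  rw [map_sum, LinearMap.sum_apply]
  exact Submodule.sum_mem _ fun q _ => key (isHom_proj _ q f) (proj_mem hp q hf)
    (isHom_proj _ p g) (proj_mem hp p hg)

theorem constField_mem_cyclicFields (w : V) : constField w ∈ cyclicFields G ω := by
  rw [mem_cyclicFields_iff]
  intro q v hv m y
  have h : ev (constField (k := k) w) ((m ++ [y]).map (signMap G q)) = 0 := by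
    cases m <;> rfl
  rw [h, ev_constField_cons, map_zero, LinearMap.zero_apply, LinearMap.zero_apply]

theorem par_mem_cyclicFields {c : k} (hc : ∀ x y, ω (G.par x) (G.par y) = c * ω x y) {f : Fam k V}
    (hf : f ∈ cyclicFields G ω) : G.fam.par f ∈ cyclicFields G ω := by
  rw [mem_cyclicFields_iff] at hf ⊢
  have h0 : ∀ l, ev (G.fam.par f) l = G.par (ev f (l.map G.par)) := by
    intro l
    refine congrArg G.par (ev_eq f (x := fun i => G.par (l.get i)) (by simp) fun i hi => ?_).symm
    simp
  have hc' : ∀ x y, ω (G.par x) y = c * ω x (G.par y) := by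
    intro x y
    rw [← hc, G.par_par]
  intro q v hv m y
  rw [h0, h0, hc', hc', List.map_cons, hf q (G.par v) (by
    rw [SuperStructure.IsHom, hv, map_smul, hv])]
  congr 4
  simp only [List.map_append, List.map_map, List.map_singleton]
  have h3 : signMap G q ∘ G.par = G.par ∘ (signMap G q : V → V) :=
    funext fun v => signMap_comm q 1 v
  rw [h3]
  congr 2
  exact signMap_comm q 1 y

theorem linField_mem_cyclicFields {a : V →ₗ[k] V}
    (h : ∀ p q x y, G.IsHom p x → G.IsHom q y → ω (a x) y = sg k (p * q) * ω (a y) x) :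
    linField a ∈ cyclicFields G ω := by
  rw [mem_cyclicFields_iff]
  intro q v hv m y
  match m with
  | [] =>
    have key : ω (a v) = (ω.flip v) ∘ₗ a ∘ₗ signMap G q := linear_ext_isHom G fun p y hy => by
      rw [LinearMap.comp_apply, LinearMap.comp_apply, LinearMap.flip_apply, hy.signMap, map_smul,
        map_smul, LinearMap.smul_apply, h q p v y hv hy]
      rfl
    exact LinearMap.congr_fun key y
  | [u] =>
    change ω 0 y = ω 0 v
    simp
  | u :: u' :: m =>
    change ω 0 y = ω 0 v
    simp

/-! ### The symplectic form of a scalar product -/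

section

variable {E : DGStructure k V} {ε : ZMod 2} {s : V →ₗ[k] V →ₗ[k] k}

theorem isHom_of_shift {p : ZMod 2} {x : V} (h : E.shift.toSuperStructure.IsHom p x) :
    E.IsHom (p + 1) x := by
  have h' : -E.par x = sg k p • x := h
  rw [SuperStructure.IsHom, sg_add, sg_one, mul_neg_one, neg_smul, ← h', neg_neg]

theorem symplecticForm_apply {p : ZMod 2} {x : V} (h : E.shift.toSuperStructure.IsHom p x) (y : V) :
    symplecticForm E s x y = sg k (p + 1) * s x y := by
  rw [symplecticForm, LinearMap.comp_apply, isHom_of_shift h, map_smul]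
  rfl

/-- Shifting both parities by one, together with the sign in the definition of `ω`, turns graded
symmetry into graded antisymmetry. -/
theorem symplecticForm_antisymm (hs : IsInnerProduct E ε s) (p q : ZMod 2) (x y : V)
    (hx : E.shift.toSuperStructure.IsHom p x) (hy : E.shift.toSuperStructure.IsHom q y) :
    symplecticForm E s x y = -(sg k (p * q) * symplecticForm E s y x) := by
  rw [symplecticForm_apply hx, symplecticForm_apply hy,
    hs.symm _ _ x y (isHom_of_shift hx) (isHom_of_shift hy), ← mul_assoc, ← mul_assoc, ← neg_mul,
    ← neg_one_mul, ← sg_one (k := k), ← sg_add, ← sg_add, ← sg_add]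
  congr 2
  grind

theorem symplecticForm_par (hs : IsInnerProduct E ε s) (x y : V) :
    symplecticForm E s (E.shift.par x) (E.shift.par y) = sg k ε * symplecticForm E s x y := by
  change s (E.par (-E.par x)) (-E.par y) = _
  rw [map_neg, map_neg, map_neg, LinearMap.neg_apply, neg_neg, hs.parity]
  rfl

/-- After the shift of parity, compatibility of the scalar product with `d` is exactly the condition
that the linear field `d` be symplectic. -/
theorem symplecticForm_d (hs : IsInnerProduct E ε s) (p q : ZMod 2) (x y : V)
    (hx : E.shift.toSuperStructure.IsHom p x) (hy : E.shift.toSuperStructure.IsHom q y) :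
    symplecticForm E s (E.d x) y = sg k (p * q) * symplecticForm E s (E.d y) x := by
  have hd : ∀ {p x}, E.shift.toSuperStructure.IsHom p x →
      E.shift.toSuperStructure.IsHom (p + 1) (E.d x) := by
    intro p x hx
    have h : E.shift.par (E.d x) = -E.d (E.shift.par x) :=
      neg_eq_iff_eq_neg.1 (E.shift.d_par x).symm
    rw [SuperStructure.IsHom, h, hx, map_smul, sg_add, sg_one, mul_neg_one, neg_smul]
  have h1 := hs.d_compat x y
  rw [isHom_of_shift hx, map_smul, LinearMap.smul_apply, smul_eq_mul,
    hs.symm _ _ x (E.d y) (isHom_of_shift hx) (isHom_of_shift (hd hy)), ← mul_assoc, ← sg_add] at h1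
  rw [symplecticForm_apply (hd hx), symplecticForm_apply (hd hy), eq_neg_of_add_eq_zero_left h1,
    ← neg_one_mul, ← sg_one (k := k), ← mul_assoc, ← mul_assoc, ← mul_assoc, ← sg_add, ← sg_add, ← sg_add]
  congr 2
  grind

theorem isFieldAlgebra_asFields (hs : IsInnerProduct E ε s) :
    IsFieldAlgebra E.shift (bracketT E.shift.toSuperStructure)
      (cyclicFields E.shift.toSuperStructure (symplecticForm E s))
      (asFields E.shift.toSuperStructure (symplecticForm E s)) :=
  (isFieldAlgebra_bracketT E.shift).of_le le_top
    (fun f => ⟨fun h => ⟨h.2, h.1⟩, fun h => ⟨h.2, h.1⟩⟩)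
    (fun f hf => par_mem_cyclicFields (symplecticForm_par hs) hf)
    (fun f hf g hg => bracketT_mem_cyclicFields (symplecticForm_antisymm hs)
      (fun f hf => par_mem_cyclicFields (symplecticForm_par hs) hf) hf hg)
    (fun w => constField_mem_cyclicFields w) (linField_mem_cyclicFields (symplecticForm_d hs))

end

end

section

variable {k : Type u} [Field k] [CharZero k] {V : Type v} [AddCommGroup V] [Module k V]
variable {G : SuperStructure k V}

/-! ### Iterated brackets with constant vector fields -/

/-- The rearrangement moves the first argument into slot `i`, past the arguments that precede this
slot. -/
theorem koszul_cycleRange {n : ℕ} (i : Fin (n + 1)) (a : ZMod 2) (p : Fin n → ZMod 2) :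
    koszul k i.cycleRange.symm (Fin.cons a p : Fin (n + 1) → ZMod 2) =
      ∏ j : Fin n, if j.castSucc < i then sg k (a * p j) else 1 := by
  unfold koszul
  rw [Fin.prod_univ_succ, Finset.prod_eq_one (s := Finset.univ) (f := fun i : Fin n => _), mul_one,
    Fin.prod_univ_succ, if_neg (by simp), one_mul]
  · refine Finset.prod_congr rfl fun j _ => ?_
    rw [Fin.cycleRange_symm_zero, Fin.cycleRange_symm_succ, Fin.cons_zero, Fin.cons_succ]
    simp [Fin.succAbove_lt_iff_castSucc_lt]
  · intro j _
    refine Finset.prod_eq_one fun j' _ => if_neg ?_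
    rintro ⟨h1, h2⟩
    obtain ⟨j', rfl⟩ := Fin.exists_succ_eq.2 (Fin.ne_zero_of_lt h1)
    rw [Fin.cycleRange_symm_succ, Fin.cycleRange_symm_succ] at h2
    exact absurd ((Fin.strictMono_succAbove i).lt_iff_lt.1 h2) (Fin.succ_lt_succ_iff.1 h1).not_gt

theorem ev_circT_constField (f : Fam k V) {p : ZMod 2} {w : V} (hw : G.IsHom p w) (l : List V) :
    ev (circT G f (constField w)) l = ∑ i ∈ Finset.range (l.length + 1),
      ev f ((l.take i).map (signMap G p) ++ w :: l.drop i) := by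
  rw [ev_circT _ (constField_isHom hw), insertSum, splitSum_eq_sum]
  refine Finset.sum_congr rfl fun i _ => ?_
  exact prefixSum_constField (φ := fun m => _) (fun a b => by
    have := isMultilin_ev f ((l.take i).map (signMap G p) ++ a) b
    simpa using this) _ _

/-- Nothing can be inserted into a constant field, so the bracket is the composition `f ∘ w`: the
sum over the slots of `f` into which `w` is inserted, each insertion being a signed cyclic
permutation. -/
theorem bracketT_constField (f : Fam k V) (w : V) (n : ℕ) :
    bracketT G f (constField w) n =
      ∑ i : Fin (n + 1), (act G i.cycleRange (f (n + 1))).curryLeft w := by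
  have key : LinearMap.proj n ∘ₗ bracketT G f ∘ₗ constField =
      ∑ i : Fin (n + 1), (act G i.cycleRange (f (n + 1))).curryLeft :=
    linear_ext_isHom G fun p w hw => by
    have h0 : ∀ g : Fam k V, circT G (constField w) g = 0 := by
      intro g
      funext n
      rw [circT_apply]
      refine Finset.sum_eq_zero fun a _ => Finset.sum_eq_zero fun i _ =>
        Finset.sum_eq_zero fun q _ => ?_
      have : (constField w : Fam k V) (n - a + 1) = 0 := rfl
      rw [this, map_zero, LinearMap.zero_apply, map_zero]
    have h1 : bracketT G f (constField w) = circT G f (constField w) := by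
      have : (bracketT G).flip (constField w) = (circT G).flip (constField w) :=
        linear_ext_isHom G.fam fun q f hf => by
          rw [LinearMap.flip_apply, LinearMap.flip_apply, bracketT,
            commutator_isHom hf (constField_isHom hw), h0, smul_zero, sub_zero]
      exact LinearMap.congr_fun this f
    rw [LinearMap.comp_apply, LinearMap.comp_apply, h1, LinearMap.sum_apply]
    refine multilinear_ext_isHom G _ _ fun q x hx => ?_
    rw [LinearMap.proj_apply, ← ev_ofFn, ev_circT_constField f hw, List.length_ofFn,
      Finset.sum_range, _root_.sum_apply]
    refine Finset.sum_congr rfl fun i _ => ?_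
    have hx' : ∀ j, G.IsHom ((Fin.cons p q : Fin (n + 1) → ZMod 2) j)
        ((Fin.cons w x : Fin (n + 1) → V) j) := fun j => by
      induction j using Fin.cases with
      | zero => exact hw
      | succ j => exact hx j
    rw [MultilinearMap.curryLeft_apply, act_isHom _ _ _ hx', koszul_cycleRange,
      Fin.cons_comp_cycleRange]
    -- The sign is written as a product over all slots, with factor 1 in slot `i`, so that
    -- multilinearity distributes it over the arguments.
    have h2 : (∏ j : Fin n, if j.castSucc < i then sg k (p * q j) else 1) =
        ∏ j : Fin (n + 1), (i.insertNth 1 (fun j => if j.castSucc < i then sg k (p * q j) else 1) :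
          Fin (n + 1) → k) j := by
      rw [Fin.prod_univ_succAbove _ i]
      simp
    rw [h2, ← MultilinearMap.map_smul_univ]
    refine ev_eq f (by simp; omega) fun m hm => ?_
    by_cases hmi : m = i
    · subst hmi
      rw [List.getElem_append_right (by simp), List.getElem_cons, dif_pos (by simp; omega)]
      have : (⟨i, hm⟩ : Fin (n + 1)) = i := rfl
      rw [this, Fin.insertNth_apply_same, Fin.insertNth_apply_same, one_smul]
    · obtain ⟨j, hj⟩ := Fin.exists_succAbove_eq (x := ⟨m, hm⟩) (y := i)
        (by simpa [Fin.ext_iff] using hmi)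
      rw [← hj, Fin.insertNth_apply_succAbove, Fin.insertNth_apply_succAbove]
      have hj' : (j.val < i.val ∧ j.val = m) ∨ (i.val ≤ j.val ∧ j.val + 1 = m) := by
        have h := congrArg Fin.val hj
        unfold Fin.succAbove at h
        split_ifs at h with h'
        · exact Or.inl ⟨h', h⟩
        · exact Or.inr ⟨not_lt.1 h', h⟩
      rcases hj' with ⟨h, rfl⟩ | ⟨h, rfl⟩
      · rw [List.getElem_append_left (by simp; omega), if_pos (show j.castSucc < i from h), ← (hx j).signMap]
        simp
      · rw [List.getElem_append_right (by simp; omega), List.getElem_cons,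
          dif_neg (by simp; omega), if_neg (by rw [Fin.lt_def]; simpa using h), one_smul]
        simp
        congr 1
        ext
        simp
        omega
  exact (LinearMap.congr_fun key w).trans (LinearMap.sum_apply _ _ _)

/-- A permutation is determined by the place `i` of the letter 0 and by the order of the remaining
letters. -/
theorem bijective_liftPerm_mul_cycleRange (n : ℕ) : Function.Bijective
    fun a : Equiv.Perm (Fin n) × Fin (n + 1) => liftPerm a.1 * a.2.cycleRange := by
  refine (Fintype.bijective_iff_injective_and_card _).2 ⟨?_, ?_⟩
  · rintro ⟨τ, i⟩ ⟨τ', i'⟩ h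
    have h1 : ∀ (τ : Equiv.Perm (Fin n)) (i : Fin (n + 1)),
        (liftPerm τ * i.cycleRange).symm 0 = i := fun τ i => by
      rw [Equiv.symm_apply_eq, Equiv.Perm.mul_apply, Fin.cycleRange_self, liftPerm_zero]
    have h2 : i = i' := by rw [← h1 τ i, ← h1 τ' i']; exact congrArg (fun σ => σ.symm 0) h
    subst h2
    have h3 := mul_right_cancel h
    refine Prod.ext (Equiv.ext fun j => Fin.succ_injective _ ?_) rfl
    rw [← liftPerm_succ, h3, liftPerm_succ]
  · rw [Fintype.card_prod, Fintype.card_perm, Fintype.card_perm, Fintype.card_fin, Fintype.card_fin,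
      Nat.factorial_succ, mul_comm]

open Classical in
-- Each bracket inserts one more constant into an arbitrary slot, so every `w_i` may end up anywhere
-- while the `x_j` keep their order. In the induction a permutation splits into a place for `w_0`
-- and a permutation of the rest, and the order condition concerns only the rest. A general `N` and
-- `z` avoid casts between sums of arities.
theorem iter_bracketT (m l : ℕ) (f : Fam k V) (w : Fin m → V) (x : Fin l → V) {N : ℕ}
    (hN : N = m + l) (z : Fin N → V) (hw : ∀ i : Fin m, z ⟨i, by omega⟩ = w i)
    (hx : ∀ j : Fin l, z ⟨m + j, by omega⟩ = x j) :
    iter (bracketT G) constField m f w l x =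
      ∑ τ : Equiv.Perm (Fin N) with ∀ i j : Fin N, m ≤ i.val → i < j → τ.symm i < τ.symm j,
        act G τ (f N) z := by
  induction m generalizing f N with
  | zero =>
    rw [zero_add] at hN
    subst hN
    rw [iter_zero, Finset.sum_eq_single 1, act_one]
    · congr 1
      funext j
      rw [← hx]
      congr 1
      ext
      simp
    · intro τ hτ h1
      refine absurd ?_ h1
      have hm : StrictMono τ.symm := fun i j hij => (Finset.mem_filter.1 hτ).2 i j (Nat.zero_le _) hij
      have h2 : τ.symm = 1 := Equiv.ext fun i => by
        have := Subsingleton.elim ((hm.orderIsoOfSurjective τ.symm τ.symm.surjective)) (OrderIso.refl _)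
        exact congrArg (fun e : Fin N ≃o Fin N => e i) this
      rw [← Equiv.symm_symm τ, h2]
      rfl
    · intro h
      exact absurd (Finset.mem_filter.2 ⟨Finset.mem_univ _, fun i j _ hij => hij⟩) h
  | succ m ih =>
    obtain ⟨N, rfl⟩ : ∃ N', N = N' + 1 := ⟨m + l, by omega⟩
    have hz : z = Fin.cons (w 0) (Fin.tail z) := by
      rw [← hw 0]
      exact (Fin.cons_self_tail z).symm
    rw [iter_succ, ih _ (Fin.tail w) (N := N) (by omega) (Fin.tail z)
      (fun i => hw i.succ) (fun j => by rw [← hx]; exact congrArg z (Fin.ext (by simp; omega))),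
      bracketT_constField]
    simp only [map_sum, act_curryLeft, act_act, _root_.sum_apply, MultilinearMap.curryLeft_apply]
    rw [← hz, Finset.sum_filter, Finset.sum_filter,
      ← (bijective_liftPerm_mul_cycleRange N).sum_comp, Fintype.sum_prod_type]
    refine Finset.sum_congr rfl fun τ _ => ?_
    have hs : ∀ (i : Fin (N + 1)) (j : Fin N), (liftPerm τ * i.cycleRange).symm j.succ =
        i.succAbove (τ.symm j) := fun i j => by
      rw [Equiv.symm_apply_eq, Equiv.Perm.mul_apply, Fin.cycleRange_succAbove, liftPerm_succ,
        Equiv.apply_symm_apply]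
    have hiff : ∀ i : Fin (N + 1), (∀ a b : Fin (N + 1), m + 1 ≤ a.val → a < b →
        (liftPerm τ * i.cycleRange).symm a < (liftPerm τ * i.cycleRange).symm b) ↔
        ∀ a b : Fin N, m ≤ a.val → a < b → τ.symm a < τ.symm b := by
      intro i
      constructor
      · intro h a b ha hab
        have := h a.succ b.succ (by simpa using ha) (Fin.succ_lt_succ_iff.2 hab)
        rwa [hs, hs, (Fin.strictMono_succAbove i).lt_iff_lt] at this
      · intro h a b ha hab
        obtain ⟨a, rfl⟩ := Fin.exists_succ_eq.2 (show a ≠ 0 by rintro rfl; simp at ha)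
        obtain ⟨b, rfl⟩ := Fin.exists_succ_eq.2 (Fin.ne_zero_of_lt hab)
        rw [hs, hs, (Fin.strictMono_succAbove i).lt_iff_lt]
        exact h a b (by simpa using ha) (Fin.succ_lt_succ_iff.1 hab)
    simp only [hiff]
    split_ifs
    · rfl
    · simp

theorem iter_bracketT_eq_insA (m : ℕ) (f : Fam k V) (w : Fin m → V) (l : ℕ) (x : Fin l → V) :
    iter (bracketT G) constField m f w l x = insA G (f (m + l)) w x := by
  classical
  rw [iter_bracketT m l f w x rfl (Fin.append w x)
    (fun i => Fin.append_left w x i) (fun j => Fin.append_right w x j), insA]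
  refine Finset.sum_congr (Finset.filter_congr fun τ _ => ?_) fun _ _ => rfl
  constructor
  · intro h i j hij
    exact h _ _ (Nat.le_add_right m i) (Nat.add_lt_add_left hij m)
  · intro h i j hi hij
    have hj : m ≤ j.val := hi.trans hij.le
    have := @h ⟨i - m, by omega⟩ ⟨j - m, by omega⟩ (by rw [Fin.lt_def] at hij ⊢; simp; omega)
    have e : ∀ (i : Fin (m + l)) (h : m ≤ i.val), Fin.natAdd m ⟨i - m, by omega⟩ = i :=
      fun i h => Fin.ext (Nat.add_sub_cancel' h)
    beta_reduce at this
    rw [e i hi, e j hj] at this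
    exact this

/-- With no arguments `x` the order condition of `iter_bracketT` is empty, and the sum runs over all
permutations. -/
theorem symmetrize_eq_iter (f : Fam k V) (n : ℕ) (w : Fin n → V) :
    symmetrize G f n w = iter (bracketT G) constField n f w 0 ![] := by
  classical
  rw [iter_bracketT n 0 f w ![] (N := n) rfl w (fun i => rfl) (fun j => j.elim0)]
  rw [Finset.filter_true_of_mem]
  · exact koszulSymm_apply _ _ _
  · intro τ _ i j hi
    exact absurd i.2 (not_lt.2 hi)

end

section

variable {k : Type u} [Field k] [CharZero k] {V : Type v} [AddCommGroup V] [Module k V]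
variable {G : SuperStructure k V} {R : ArtinCdga k}

/-! ### Extension of scalars for vector fields -/

/-- A pure tensor of homogeneous elements. -/
structure PureTensor (R : ArtinCdga k) (G : SuperStructure k V) where
  α : ZMod 2
  p : ZMod 2
  a : R.carrier
  x : V
  ha : R.gr.IsHom α a
  hx : G.IsHom p x

namespace PureTensor

/-- The underlying tensor. -/
def val (t : PureTensor R G) : R.carrier ⊗[k] V := t.a ⊗ₜ t.x

/-- The exponent of the sign which arises when the coefficients of a list of pure tensors are
moved to the front past a map of parity `q`. -/
def exponent : ZMod 2 → List (PureTensor R G) → ZMod 2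
  | _, [] => 0
  | q, t :: L => q * t.α + exponent (q + t.p) L

theorem exponent_add (q r : ZMod 2) (L : List (PureTensor R G)) :
    exponent (q + r) L = exponent q L + r * (L.map α).sum := by
  induction L generalizing q with
  | nil => simp [exponent]
  | cons t L ih =>
    rw [exponent, exponent, add_right_comm, ih, List.map_cons, List.sum_cons]
    ring

theorem exponent_append (q : ZMod 2) (L L' : List (PureTensor R G)) :
    exponent q (L ++ L') = exponent q L + exponent (q + (L.map p).sum) L' := by
  induction L generalizing q with
  | nil => simp [exponent]
  | cons t L ih =>
    rw [List.cons_append, exponent, exponent, ih, List.map_cons, List.sum_cons, add_assoc, add_assoc]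

theorem exponent_eq_sum (q : ZMod 2) (L : List (PureTensor R G)) :
    exponent q L = ∑ i : Fin L.length, q * L[i].α +
      ∑ i : Fin L.length, ∑ j : Fin L.length, if i < j then L[i].p * L[j].α else 0 := by
  induction L generalizing q with
  | nil => simp [exponent]
  | cons t L ih =>
    rw [exponent, ih]
    simp only [List.length_cons, Fin.sum_univ_succ]
    simp [Finset.sum_add_distrib, add_mul]
    ring

theorem isHom_prod (L : List (PureTensor R G)) :
    R.gr.IsHom (L.map α).sum (L.map a).prod := by
  induction L with
  | nil =>
    change R.par 1 = sg k 0 • 1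
    rw [map_one, sg_zero, one_smul]
  | cons t L ih =>
    rw [List.map_cons, List.map_cons, List.sum_cons, List.prod_cons]
    exact isHom_mul t.ha ih

end PureTensor

open PureTensor

/-- The scalar extension of a vector field. -/
def extendField (R : ArtinCdga k) (G : SuperStructure k V) (q : ZMod 2) (f : Fam k V) :
    Fam k (R.carrier ⊗[k] V) := fun n => extendScalars R G q (f n)

theorem ev_extendField (q : ZMod 2) (f : Fam k V) (L : List (PureTensor R G)) :
    ev (extendField R G q f) (L.map val) =
      sg k (exponent q L) • ((L.map a).prod ⊗ₜ[k] ev f (L.map x)) := by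
  have h1 : ev (extendField R G q f) (L.map val) =
      extendScalars R G q (f L.length) (fun i => L[i].a ⊗ₜ L[i].x) :=
    ev_eq _ (by simp) fun i hi => by simp [val]
  have h2 : ev f (L.map x) = f L.length (fun i => L[i].x) := ev_eq _ (by simp) fun i hi => by simp
  have h3 : List.ofFn (fun i : Fin L.length => L[i].a) = L.map a := by
    refine List.ext_getElem (by simp) fun i h h' => by simp
  rw [h1, h2, extendScalars_tmul (α := fun i => L[i].α) (p := fun i => L[i].p) _ _ _
    (fun i => L[i].ha) (fun i => L[i].hx), exponent_eq_sum, h3]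

theorem IsMultilin.ext_pure {X : Type*} [AddCommGroup X] [Module k X]
    {φ ψ : List (R.carrier ⊗[k] V) → X} (hφ : IsMultilin k φ) (hψ : IsMultilin k ψ)
    (h : ∀ L : List (PureTensor R G), φ (L.map val) = ψ (L.map val)) (l) : φ l = ψ l := by
  suffices H : ∀ (l) (L : List (PureTensor R G)), φ (L.map val ++ l) = ψ (L.map val ++ l) from
    H l []
  intro l
  induction l with
  | nil => intro L; rw [List.append_nil]; exact h L
  | cons v l ih =>
    intro L
    have key : (hφ (L.map val) l).mk' = (hψ (L.map val) l).mk' :=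
      tensor_ext_isHom (G := G) fun α p a x ha hx => by
        have := ih (L ++ [⟨α, p, a, x, ha, hx⟩])
        simpa [val] using this
    exact LinearMap.congr_fun key v

theorem isHom_ev {β : ZMod 2} {g : Fam k V} (hg : G.fam.IsHom β g) (L : List (PureTensor R G)) :
    G.IsHom (β + (L.map p).sum) (ev g (L.map x)) := by
  have h : ∀ (L : List (PureTensor R G)) (l : List V),
      ev g (l ++ (L.map x).map G.par) = sg k (L.map p).sum • ev g (l ++ L.map x) := by
    intro L
    induction L with
    | nil => intro l; simp [sg_zero]
    | cons t L ih =>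
      intro l
      have h1 := ih (l ++ [G.par t.x])
      simp only [List.append_assoc, List.singleton_append] at h1
      rw [List.map_cons, List.map_cons, List.map_cons, List.sum_cons, h1, t.hx,
        ((isMultilin_ev g) l _).map_smul, smul_smul, sg_add, mul_comm]
  have h1 := h L []
  rw [List.nil_append, List.nil_append, ev_map_par hg] at h1
  have h2 : G.par (ev g (L.map x)) = sg k β • sg k (L.map p).sum • ev g (L.map x) := by
    rw [← h1, smul_smul, sg_mul_self, one_smul]
  rw [SuperStructure.IsHom, h2, smul_smul, sg_add]

/-- The value on the block `B` is a scalar multiple of the pure tensor `T`, so the outer extension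
is again evaluated on pure tensors. The signs then agree by additivity of `exponent` (`h6`). -/
theorem ev_extendField_insert (α : ZMod 2) (f : Fam k V) {β : ZMod 2} {g : Fam k V}
    (hg : G.fam.IsHom β g) (A B C : List (PureTensor R G)) :
    ev (extendField R G α f) ((A.map val).map (signMap (tot R G) β) ++
        ev (extendField R G β g) (B.map val) :: C.map val) =
      sg k (exponent (α + β) (A ++ (B ++ C))) • (((A ++ (B ++ C)).map a).prod ⊗ₜ[k]
        ev f ((A.map x).map (signMap G β) ++ ev g (B.map x) :: C.map x)) := by
  set s : PureTensor R G → PureTensor R G := fun t =>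
    ⟨t.α, t.p, t.a, sg k (β * (t.α + t.p)) • t.x, t.ha, t.hx.smul _⟩ with hs
  set T : PureTensor R G := ⟨(B.map PureTensor.α).sum, β + (B.map p).sum, (B.map a).prod,
    ev g (B.map x), isHom_prod B, isHom_ev hg B⟩ with hT
  have h1 : (A.map val).map (signMap (tot R G) β) = (A.map s).map val := by
    simp only [List.map_map]
    refine List.map_congr_left fun t _ => ?_
    rw [Function.comp_apply, val, (isHom_tmul t.ha t.hx).signMap]
    exact (TensorProduct.tmul_smul _ _ _).symm
  have h2 : ev (extendField R G β g) (B.map val) = sg k (exponent β B) • T.val :=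
    ev_extendField β g B
  have h3 : (A.map s).map val ++ T.val :: C.map val = (A.map s ++ T :: C).map val := by simp
  have h4 : ∀ (A : List (PureTensor R G)) (r : List V),
      IsMultilin k (fun l => ev f (l ++ r)) := fun A r => (isMultilin_ev f).append r
  have h5 : ∀ (A : List (PureTensor R G)) (l r : List V), ev f (l ++ ((A.map s).map x ++ r)) =
      sg k (β * (A.map PureTensor.α).sum) • ev f (l ++ ((A.map x).map (signMap G β) ++ r)) := by
    intro A
    induction A with
    | nil => intro l r; simp [sg_zero]
    | cons t A ih =>
      intro l r
      have h1 := ih (l ++ [(s t).x]) r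
      simp only [List.append_assoc, List.singleton_append] at h1
      have h6 : (s t).x = sg k (β * t.α) • signMap G β t.x := by
        rw [t.hx.signMap, smul_smul, ← sg_add, ← mul_add]
      simp only [List.map_cons, List.cons_append, List.sum_cons]
      rw [h1, h6, ((isMultilin_ev f) l _).map_smul, smul_smul, mul_add, sg_add, mul_comm]
  have h6 : exponent α (A.map s ++ T :: C) + β * (A.map PureTensor.α).sum + exponent β B =
      exponent (α + β) (A ++ (B ++ C)) := by
    have hq : ∀ q, exponent q (A.map s) = exponent q A := by
      intro q
      clear * -
      induction A generalizing q with
      | nil => rfl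
      | cons t A ih => rw [List.map_cons, exponent, ih, exponent]
    have hp : (A.map s).map p = A.map p := by simp [hs]
    rw [exponent_append, exponent_append, exponent_append, exponent, hq, hp, exponent_add α β A,
      show α + β + (A.map p).sum = β + (α + (A.map p).sum) by ring, exponent_add β _ B,
      show β + (α + (A.map p).sum) + (B.map p).sum = α + (A.map p).sum + T.p by rw [hT]; ring]
    change _ + ((α + (A.map p).sum) * (B.map PureTensor.α).sum + _) + _ + _ = _
    ring
  have h7 : ((A.map s ++ T :: C).map a).prod = ((A ++ (B ++ C)).map a).prod := by
    simp [hs, hT, Function.comp_def]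
  have h8 := h5 A [] (ev g (B.map x) :: C.map x)
  rw [List.nil_append, List.nil_append] at h8
  have h9 : (A.map s ++ T :: C).map x = (A.map s).map x ++ ev g (B.map x) :: C.map x := by
    rw [List.map_append, List.map_cons]
  rw [h1, h2, ((isMultilin_ev _) _ _).map_smul, h3, ev_extendField, h7, h9,
    h8, ← h6, TensorProduct.tmul_smul, smul_smul, smul_smul, sg_add, sg_add]
  congr 1
  ring

theorem SuperStructure.IsHom.par_apply {β : ZMod 2} {g : Fam k V} (hg : G.fam.IsHom β g) (n : ℕ)
    (x : Fin n → V) : G.par (g n x) = sg k β • g n (fun i => G.par (x i)) := by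
  have := congrArg (fun f : Fam k V => f n fun i => G.par (x i)) hg
  refine Eq.trans ?_ this
  change G.par (g n x) = G.par (g n fun i => G.par (G.par (x i)))
  simp only [G.par_par]

theorem isHom_extendField {β : ZMod 2} {g : Fam k V} (hg : G.fam.IsHom β g) :
    (tot R G).fam.IsHom β (extendField R G β g) := by
  funext n
  refine multilinear_ext_isHom (tot R G) _ _ fun e ζ hζ => ?_
  have h1 := extendScalars_isHom G G β (hg.par_apply n) hζ
  change (tot R G).par (extendScalars R G β (g n) fun i => (tot R G).par (ζ i)) =
    sg k β • extendScalars R G β (g n) ζ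
  have h2 : (fun i => (tot R G).par (ζ i)) = fun i => sg k (e i) • ζ i := funext hζ
  rw [h2, MultilinearMap.map_smul_univ, map_smul, h1, smul_smul, sg_add, sg_sum]
  congr 1
  rw [mul_left_comm, ← sg_sum, sg_mul_self, mul_one]

/-- Termwise this is `ev_extendField_insert`. The parameter `α` is a free choice of extension sign
for `f`; only the parity of the inserted field `g` matters. -/
theorem extendField_circT (α : ZMod 2) (f : Fam k V) {β : ZMod 2} {g : Fam k V}
    (hg : G.fam.IsHom β g) : extendField R G (α + β) (circT G f g) =
      circT (tot R G) (extendField R G α f) (extendField R G β g) := by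
  refine fam_ext (IsMultilin.ext_pure (G := G) (isMultilin_ev _) (isMultilin_ev _) fun L => ?_)
  rw [ev_circT _ (isHom_extendField hg), ev_extendField, ev_circT f hg]
  set ψ : V →ₗ[k] R.carrier ⊗[k] V :=
    sg k (exponent (α + β) L) • TensorProduct.mk k R.carrier V (L.map a).prod with hψ
  change ψ _ = _
  simp only [insertSum, prefixSum, map_splitSum, splitSum_map]
  refine splitSum_congr fun A r hA => splitSum_congr fun B C hB => ?_
  rw [ev_extendField_insert _ _ hg, hB, hA]
  rfl

theorem insertAt_zero_apply {X : Type*} [AddCommGroup X] [Module k X] (f g : Fam k X) {a b : ℕ}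
    (x : Fin (a + b) → X) :
    insertAt (finSumFinEquiv.trans (finCongr rfl)) 0 (f (b + 1)) (g a) x =
      ev f (ev g ((List.ofFn x).take a) :: (List.ofFn x).drop a) := by
  change f (b + 1) (Fin.insertNth 0 (g a fun i => x (Fin.castAdd b i)) fun i => x (Fin.natAdd a i)) = _
  have h : ev g ((List.ofFn x).take a) = g a fun i => x (Fin.castAdd b i) :=
    ev_eq g (by simp) fun i hi => by simp [Fin.castAdd, Fin.castLE]
  rw [Fin.insertNth_zero', h]
  refine (ev_eq f (by simp) fun i hi => ?_).symm
  rcases i with _ | i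
  · rfl
  · simp
    rfl

theorem extendScalars_insertAt {a b n : ℕ} (h : a + b = n) (α : ZMod 2) (f : Fam k V) {β : ZMod 2}
    {g : Fam k V} (hg : G.fam.IsHom β g) (ζ : R.carrier ⊗[k] V) :
    extendScalars R G (α + β) (insertAt (finSumFinEquiv.trans (finCongr h)) 0 (f (b + 1)) (g a))
        (fun _ => ζ) =
      extendScalars R G α (f (b + 1)) (Fin.cons (extendScalars R G β (g a) fun _ => ζ) fun _ => ζ) := by
  subst h
  have key : extendScalars R G (α + β) (insertAt (finSumFinEquiv.trans (finCongr rfl)) 0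
      (f (b + 1)) (g a)) = insertAt (finSumFinEquiv.trans (finCongr rfl)) 0
      (extendField R G α f (b + 1)) (extendField R G β g a) := by
    refine multilinear_tensor_ext G fun γ p r x hr hx => ?_
    set t : Fin (a + b) → PureTensor R G := fun i => ⟨γ i, p i, r i, x i, hr i, hx i⟩ with ht
    have h1 : List.ofFn (fun i => r i ⊗ₜ[k] x i) = (List.ofFn t).map val := by
      rw [List.map_ofFn]
      rfl
    have h2 := ev_extendField_insert α f hg [] ((List.ofFn t).take a) ((List.ofFn t).drop a)
    rw [insertAt_zero_apply, h1, ← List.map_take, ← List.map_drop]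
    refine Eq.trans ?_ h2.symm
    have h3 : List.ofFn x = (List.ofFn t).map PureTensor.x := by
      rw [List.map_ofFn]
      rfl
    -- A family with a single nonzero component, so that evaluation on lists applies to one
    -- multilinear map.
    set H : Fam k V := Function.update 0 (a + b)
      (insertAt (finSumFinEquiv.trans (finCongr rfl)) 0 (f (b + 1)) (g a)) with hH
    have h5 : H (a + b) = insertAt (finSumFinEquiv.trans (finCongr rfl)) 0 (f (b + 1)) (g a) :=
      Function.update_self ..
    have h6 := ev_extendField (α + β) H (List.ofFn t)
    rw [← h1, ev_ofFn, ← h3, ev_ofFn, extendField, h5, insertAt_zero_apply] at h6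
    rw [h6, List.nil_append, List.take_append_drop, List.map_nil, List.map_nil, List.nil_append, h3,
      List.map_take, List.map_drop]
  have h1 := congrArg (fun F => F fun _ => ζ) key
  refine h1.trans ?_
  change extendScalars R G α (f (b + 1)) (Fin.insertNth 0 _ _) = _
  rw [Fin.insertNth_zero']
  rfl

/-! ### Symmetrization -/

/-- Polarization for a single symmetric map, viewed as the only nonzero component of a family: its
values on one repeated even argument determine it. -/
theorem eq_of_extendScalars_eq {n : ℕ} {X : Type*} [AddCommGroup X] [Module k X]
    {f g : MultilinearMap k (fun _ : Fin n => V) X}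
    (hf : ∀ σ, act G σ f = f) (hg : ∀ σ, act G σ g = g) (q : ZMod 2)
    (H : ∀ (R : ArtinCdga k) (ζ : R.carrier ⊗[k] V), (tot R G).IsHom 0 ζ →
      extendScalars R G q f (fun _ => ζ) = extendScalars R G q g fun _ => ζ) : f = g := by
  have h1 : ∀ (f : MultilinearMap k (fun _ : Fin n => V) X), (∀ σ, act G σ f = f) →
      ∀ m (σ : Equiv.Perm (Fin m)), act G σ
        ((Pi.single n f : (n : ℕ) → MultilinearMap k (fun _ : Fin n => V) X) m) =
          (Pi.single n f : (n : ℕ) → MultilinearMap k (fun _ : Fin n => V) X) m := by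
    intro f hf m σ
    obtain rfl | h := eq_or_ne m n
    · rw [Pi.single_eq_same, hf]
    · rw [Pi.single_eq_of_ne h, map_zero]
  have h2 := eq_of_ser_eq q (h1 f hf) (h1 g hg) fun m p x hx => by
    rw [ser_single (m := n) fun m h => Pi.single_eq_of_ne h _,
      ser_single (m := n) fun m h => Pi.single_eq_of_ne h _, Pi.single_eq_same, Pi.single_eq_same,
      H _ _ (augHom_generic hx).hom]
  exact Pi.single_injective n h2

theorem act_symmetrize (f : Fam k V) (n : ℕ) (σ : Equiv.Perm (Fin n)) :
    act G σ (symmetrize G f n) = symmetrize G f n := act_koszulSymm G σ (f n)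

theorem act_circS (f g : Fam k V) (n : ℕ) (σ : Equiv.Perm (Fin n)) :
    act G σ (circS G f g n) = circS G f g n := by
  simp only [circS_apply, map_sum, map_smul, act_koszulSymm]

theorem symmetrize_par (f : Fam k V) : symmetrize G (G.fam.par f) = G.fam.par (symmetrize G f) := by
  funext n
  ext x
  change koszulSymm G (G.fam.par f n) x = G.par (koszulSymm G (f n) fun i => G.par (x i))
  simp only [koszulSymm_apply, act_apply, map_sum, map_smul, proj_par]
  rfl

theorem isHom_symmetrize {p : ZMod 2} {f : Fam k V} (hf : G.fam.IsHom p f) :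
    G.fam.IsHom p (symmetrize G f) := by
  rw [SuperStructure.IsHom, ← symmetrize_par, hf, map_smul]

theorem ev_replicate (f : Fam k V) (n : ℕ) (v : V) : ev f (List.replicate n v) = f n fun _ => v :=
  ev_eq f (by simp) fun i hi => by simp

theorem insertSum_replicate {s : V → V} {v : V} (hv : s v = v) (g : List V → V) {X : Type*}
    [AddCommMonoid X] (φ : List V → X) (n : ℕ) :
    insertSum s g φ (List.replicate n v) = ∑ a : Fin (n + 1), ∑ j : Fin (n - a + 1),
      φ (List.replicate j v ++ g (List.replicate a v) :: List.replicate (n - a - j) v) := by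
  have h : insertSum s g φ (List.replicate n v) = ∑ j ∈ Finset.range (n + 1),
      ∑ a ∈ Finset.range (n - j + 1),
        φ (List.replicate j v ++ g (List.replicate a v) :: List.replicate (n - a - j) v) := by
    simp only [insertSum, prefixSum, splitSum_eq_sum, List.length_replicate,
      List.take_replicate, List.drop_replicate, List.map_replicate, hv]
    refine Finset.sum_congr rfl fun j hj => Finset.sum_congr rfl fun a ha => ?_
    rw [Finset.mem_range] at hj ha
    rw [min_eq_left (by omega), min_eq_left (by omega), Nat.sub_right_comm]
  rw [h, Finset.sum_comm' (t' := Finset.range (n + 1)) (s' := fun a => Finset.range (n - a + 1))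
    (fun j a => by simp only [Finset.mem_range]; omega), Finset.sum_range]
  exact Finset.sum_congr rfl fun a _ => Finset.sum_range _

/-- Both sides are symmetric, so they may be compared at a repeated even argument `ζ`, where no
signs occur. Each side is then a sum of insertions of `g(ζ, …, ζ)` into `f`: the factor `n!` on the
left matches `n! / (a! (n - a)!)` times the factors `a!` and `(n - a)!` of the two symmetrizations
on the right. -/
theorem symmetrize_circT (f : Fam k V) {β : ZMod 2} {g : Fam k V} (hg : G.fam.IsHom β g) :
    symmetrize G (circT G f g) = circS G (symmetrize G f) (symmetrize G g) := by
  funext n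
  refine eq_of_extendScalars_eq (act_symmetrize _ n) (act_circS _ _ n) (0 + β) fun R ζ hζ => ?_
  have h1 : extendScalars R G (0 + β) (symmetrize G (circT G f g) n) (fun _ => ζ) =
      (n.factorial : k) • ∑ a : Fin (n + 1), ∑ j : Fin (n - a + 1),
        ev (extendField R G 0 f) (List.replicate j ζ ++
          extendScalars R G β (g a) (fun _ => ζ) :: List.replicate (n - a - j) ζ) := by
    have h := extendScalars_koszulSymm_const (q := 0 + β) (circT G f g n) hζ
    refine h.trans (congrArg _ ?_)
    have h2 := congrFun (extendField_circT (R := R) 0 f hg) n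
    refine (congrArg (fun F => F fun _ => ζ) h2).trans ?_
    beta_reduce
    rw [← ev_replicate, ev_circT _ (isHom_extendField hg), insertSum_replicate]
    · simp only [ev_replicate]
      rfl
    · rw [hζ.signMap, mul_zero, sg_zero, one_smul]
  rw [h1, circS_apply, extendScalars_sum, _root_.sum_apply, Finset.smul_sum]
  refine Finset.sum_congr rfl fun a _ => ?_
  rw [extendScalars_smul, _root_.smul_apply, extendScalars_koszulSymm_const _ hζ,
    extendScalars_insertAt _ _ _ (isHom_symmetrize hg)]
  have h3 : extendScalars R G β (symmetrize G g a) (fun _ => ζ) =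
      ((a : ℕ).factorial : k) • extendScalars R G β (g a) fun _ => ζ :=
    extendScalars_koszulSymm_const _ hζ
  set Y := extendScalars R G β (g a) fun _ => ζ with hY
  have hYh : (tot R G).IsHom β Y := by
    have := extendScalars_isHom G G β (hg.par_apply a) (e := fun _ => 0) fun _ => hζ
    rwa [Finset.sum_const_zero, add_zero] at this
  have h4 : extendScalars R G 0 (symmetrize G f (n - a + 1))
      (Fin.cons (((a : ℕ).factorial : k) • Y) fun _ => ζ) = ((a : ℕ).factorial : k) •
        ((n - a).factorial : k) • ∑ j : Fin (n - a + 1), ev (extendField R G 0 f)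
          (List.replicate j ζ ++ Y :: List.replicate (n - a - j) ζ) := by
    refine (MultilinearMap.cons_smul _ _ _ _).trans (congrArg _ ?_)
    refine (extendScalars_koszulSymm_cons _ hYh hζ).trans (congrArg _ ?_)
    refine Finset.sum_congr rfl fun j _ => Eq.symm ?_
    have hl : (List.replicate j ζ ++ Y :: List.replicate (n - a - j) ζ).length = n - a + 1 := by
      simp
      omega
    refine ev_eq _ hl fun i hi => ?_
    rcases lt_trichotomy i j with h | h | h
    · rw [Function.update_of_ne (by simp [Fin.ext_iff]; omega),
        List.getElem_append_left (by simpa using h)]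
      simp
    · subst h
      rw [List.getElem_append_right (by simp), List.getElem_cons, dif_pos (by simp)]
      exact (Function.update_self j Y fun _ => ζ).symm
    · rw [Function.update_of_ne (by simp [Fin.ext_iff]; omega),
        List.getElem_append_right (by simp; omega), List.getElem_cons, dif_neg (by simp; omega)]
      simp
  rw [h3, h4, smul_smul, smul_smul, smul_smul]
  congr 1
  have := Nat.factorial_ne_zero a
  have := Nat.factorial_ne_zero (n - a)
  push_cast
  field_simp

end

section

variable {k : Type u} [Field k] [CharZero k] {V : Type v} [AddCommGroup V] [Module k V]
variable {G : SuperStructure k V}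

/-! ### The Lie algebra of commutative vector fields -/

theorem symmetrize_bracketT (f g : Fam k V) :
    symmetrize G (bracketT G f g) = bracketS G (symmetrize G f) (symmetrize G g) := by
  have : (bracketT G).compr₂ (symmetrize G) =
      (bracketS G).compl₁₂ (symmetrize G) (symmetrize G) :=
    bilin_eq_of_fam_isHom (G := G) fun p q f g hf hg => by
      rw [LinearMap.compr₂_apply, LinearMap.compl₁₂_apply, bracketT, bracketS,
        commutator_isHom hf hg, commutator_isHom (isHom_symmetrize hf) (isHom_symmetrize hg),
        map_sub, map_smul, symmetrize_circT f hg, symmetrize_circT g hf]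
  exact LinearMap.congr_fun₂ this f g

/-- Commutative formal vector fields. -/
def symFields (G : SuperStructure k V) : Submodule k (Fam k V) where
  carrier := {f | ∀ n (σ : Equiv.Perm (Fin n)), act G σ (f n) = f n}
  add_mem' {f g} hf hg := fun n σ => by rw [Pi.add_apply, map_add, hf, hg]
  zero_mem' := fun n σ => by simp
  smul_mem' c f hf := fun n σ => by rw [Pi.smul_apply, map_smul, hf]

theorem symmetrize_mem (f : Fam k V) : symmetrize G f ∈ symFields G := act_symmetrize f

/-- The section `f_n ↦ f_n / n!` of the symmetrization. -/
def desymmetrize : Fam k V →ₗ[k] Fam k V :=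
  LinearMap.pi fun n => ((n.factorial : k)⁻¹) • LinearMap.proj n

theorem symmetrize_desymmetrize {f : Fam k V} (hf : f ∈ symFields G) :
    symmetrize G (desymmetrize f) = f := by
  funext n
  change koszulSymm G (((n.factorial : k)⁻¹) • f n) = f n
  rw [map_smul, koszulSymm, LinearMap.coe_sum, Finset.sum_apply, Finset.sum_congr rfl fun σ _ => hf n σ,
    Finset.sum_const, Finset.card_univ, Fintype.card_perm, Fintype.card_fin,
    ← Nat.cast_smul_eq_nsmul k, smul_smul,
    inv_mul_cancel₀ (Nat.cast_ne_zero.2 n.factorial_ne_zero), one_smul]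

theorem isHom_desymmetrize {p : ZMod 2} {f : Fam k V} (hf : G.fam.IsHom p f) :
    G.fam.IsHom p (desymmetrize f) := by
  have h : G.fam.par (desymmetrize f) = desymmetrize (G.fam.par f) := by
    funext n
    ext x
    change G.par (((n.factorial : k)⁻¹) • f n fun i => G.par (x i)) = _
    rw [map_smul]
    rfl
  rw [SuperStructure.IsHom, h, hf, map_smul]

/-- Symmetrization is onto the commutative fields and homogeneous preimages exist, so identities of
brackets can be pulled back to noncommutative fields. -/
theorem exists_symmetrize {f : Fam k V} (hf : f ∈ symFields G) :
    ∃ f', symmetrize G f' = f ∧ ∀ p, G.fam.IsHom p f → G.fam.IsHom p f' :=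
  ⟨_, symmetrize_desymmetrize hf, fun _ => isHom_desymmetrize⟩

theorem koszulSymm_of_subsingleton {n : ℕ} [Subsingleton (Fin n)] {X : Type*} [AddCommGroup X]
    [Module k X] (f : MultilinearMap k (fun _ : Fin n => V) X) : koszulSymm G f = f := by
  rw [koszulSymm, Fintype.sum_unique, Subsingleton.elim default (1 : Equiv.Perm (Fin n)), act_one]

theorem symmetrize_constField (w : V) : symmetrize G (constField w) = constField w := by
  funext n
  match n with
  | 0 => exact koszulSymm_of_subsingleton _
  | n + 1 => exact map_zero (koszulSymm G)

theorem symmetrize_linField (a : V →ₗ[k] V) : symmetrize G (linField a) = linField a := by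
  funext n
  match n with
  | 0 => exact map_zero (koszulSymm G)
  | 1 => exact koszulSymm_of_subsingleton _
  | n + 2 => exact map_zero (koszulSymm G)

/-- Every axiom is the image of the noncommutative one under the surjective Lie homomorphism
`symmetrize`, which fixes constants and linear fields. -/
theorem isFieldAlgebra_bracketS (D : DGStructure k V) :
    IsFieldAlgebra D (bracketS D.toSuperStructure) (symFields D.toSuperStructure)
      (cFields D.toSuperStructure) where
  mem_iff f := ⟨fun h => ⟨h.2, h.1⟩, fun h => ⟨h.2, h.1⟩⟩
  par_mem f hf := by
    obtain ⟨f, rfl, -⟩ := exists_symmetrize hf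
    rw [← symmetrize_par]
    exact symmetrize_mem _
  br_mem f hf g hg := by
    obtain ⟨f, rfl, -⟩ := exists_symmetrize hf
    obtain ⟨g, rfl, -⟩ := exists_symmetrize hg
    rw [← symmetrize_bracketT]
    exact symmetrize_mem _
  const_mem w := by
    rw [← symmetrize_constField (G := D.toSuperStructure)]
    exact symmetrize_mem _
  d_mem := by
    rw [← symmetrize_linField (G := D.toSuperStructure)]
    exact symmetrize_mem _
  br_par f hf g hg := by
    obtain ⟨f, rfl, -⟩ := exists_symmetrize hf
    obtain ⟨g, rfl, -⟩ := exists_symmetrize hg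
    rw [← symmetrize_par, ← symmetrize_par, ← symmetrize_bracketT, ← symmetrize_bracketT,
      bracketT_par, symmetrize_par]
  antisymm p q f hf g hg hp hq := by
    obtain ⟨f, rfl, h⟩ := exists_symmetrize hf
    obtain ⟨g, rfl, h'⟩ := exists_symmetrize hg
    rw [← symmetrize_bracketT, ← symmetrize_bracketT, bracketT_antisymm (h p hp) (h' q hq), map_neg,
      map_smul]
  jacobi p q l f hf g hg h hh hp hq hl := by
    obtain ⟨f, rfl, h1⟩ := exists_symmetrize hf
    obtain ⟨g, rfl, h2⟩ := exists_symmetrize hg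
    obtain ⟨h, rfl, h3⟩ := exists_symmetrize hh
    simp only [← symmetrize_bracketT]
    rw [bracketT_jacobi (h1 p hp) (h2 q hq) (h3 l hl), map_add, map_smul]
  br_const u u' := by
    have h := symmetrize_bracketT (G := D.toSuperStructure) (constField u) (constField u')
    rwa [bracketT_const_const, map_zero, symmetrize_constField, symmetrize_constField, eq_comm] at h
  br_zero f hf g hg := ((cFields_isDGLieSubalgebra D).br_mem f hf g hg).1
  br_d := by
    have h := symmetrize_bracketT (G := D.toSuperStructure) (linField D.d) (linField D.d)
    rwa [bracketT_lin_lin, map_zero, symmetrize_linField, eq_comm] at h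
  br_d_const u := by
    have h := symmetrize_bracketT (G := D.toSuperStructure) (linField D.d) (constField u)
    rwa [bracketT_lin_const, symmetrize_constField, symmetrize_constField, symmetrize_linField,
      eq_comm] at h

/-- For a lift of `f`, the sum over slots for `w` and over permutations of the other arguments is
the sum over all permutations, that is, the symmetrization itself. -/
theorem bracketS_constField {f : Fam k V} (hf : f ∈ symFields G) (w : V) (n : ℕ) :
    bracketS G f (constField w) n = (f (n + 1)).curryLeft w := by
  obtain ⟨f, rfl, -⟩ := exists_symmetrize hf
  have h := symmetrize_bracketT (G := G) f (constField w)
  rw [symmetrize_constField] at h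
  rw [← h]
  change koszulSymm G (bracketT G f (constField w) n) = _
  ext x
  rw [koszulSymm_apply, bracketT_constField]
  simp only [map_sum, act_curryLeft, act_act, _root_.sum_apply, MultilinearMap.curryLeft_apply]
  rw [← Fintype.sum_prod_type', (bijective_liftPerm_mul_cycleRange n).sum_comp fun σ =>
    act G σ (f (n + 1)) (Fin.cons w x)]
  exact (koszulSymm_apply _ _ _).symm

theorem iter_bracketS (m l : ℕ) {f : Fam k V} (hf : f ∈ symFields G) (w : Fin m → V) (x : Fin l → V)
    {N : ℕ} (hN : N = m + l) (z : Fin N → V) (hw : ∀ i : Fin m, z ⟨i, by omega⟩ = w i)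
    (hx : ∀ j : Fin l, z ⟨m + j, by omega⟩ = x j) :
    iter (bracketS G) constField m f w l x = f N z := by
  induction m generalizing f N with
  | zero =>
    rw [zero_add] at hN
    subst hN
    rw [iter_zero]
    congr 1
    funext j
    rw [← hx]
    congr 1
    ext
    simp
  | succ m ih =>
    obtain ⟨N, rfl⟩ : ∃ N', N = N' + 1 := ⟨m + l, by omega⟩
    have hc : bracketS G f (constField (w 0)) ∈ symFields G := fun n σ => by
      rw [bracketS_constField hf, act_curryLeft_eq (hf _)]
    rw [iter_succ, ih hc (Fin.tail w) (N := N) (by omega) (Fin.tail z)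
      (fun i => hw i.succ) (fun j => by rw [← hx]; exact congrArg z (Fin.ext (by simp; omega))),
      bracketS_constField hf, MultilinearMap.curryLeft_apply, ← hw 0]
    exact congrArg _ (Fin.cons_self_tail z)

theorem iter_bracketS_eq_insC (m : ℕ) {f : Fam k V} (hf : f ∈ symFields G) (w : Fin m → V) (l : ℕ)
    (x : Fin l → V) : iter (bracketS G) constField m f w l x = insC (f (m + l)) w x :=
  iter_bracketS m l hf w x rfl (Fin.append w x)
    (fun i => Fin.append_left w x i) (fun j => Fin.append_right w x j)

/-! ### Symmetrization of symplectic vector fields -/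

/-- The extension of a permutation which fixes the last element. -/
def liftPermLast {n : ℕ} (σ : Equiv.Perm (Fin n)) : Equiv.Perm (Fin (n + 1)) :=
  finSumFinEquiv.permCongr (Equiv.sumCongr σ 1)

theorem liftPermLast_last {n : ℕ} (σ : Equiv.Perm (Fin n)) :
    liftPermLast σ (Fin.last n) = Fin.last n := by
  have h : finSumFinEquiv.symm (Fin.last n) = Sum.inr (0 : Fin 1) := by
    rw [Equiv.symm_apply_eq]
    rfl
  rw [liftPermLast, Equiv.permCongr_apply, h]
  rfl

theorem liftPermLast_castSucc {n : ℕ} (σ : Equiv.Perm (Fin n)) (i : Fin n) :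
    liftPermLast σ i.castSucc = (σ i).castSucc := by
  have h : finSumFinEquiv.symm i.castSucc = (Sum.inl i : Fin n ⊕ Fin 1) := by
    rw [Equiv.symm_apply_eq]
    rfl
  rw [liftPermLast, Equiv.permCongr_apply, h]
  rfl

theorem koszul_liftPermLast {n : ℕ} (σ : Equiv.Perm (Fin n)) (p : Fin (n + 1) → ZMod 2) :
    koszul k (liftPermLast σ).symm p = koszul k σ.symm (Fin.init p) := by
  have h1 : (liftPermLast σ).symm (Fin.last n) = Fin.last n := by
    rw [Equiv.symm_apply_eq, liftPermLast_last]
  have h2 : ∀ i : Fin n, (liftPermLast σ).symm i.castSucc = (σ.symm i).castSucc := fun i => by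
    rw [Equiv.symm_apply_eq, liftPermLast_castSucc, Equiv.apply_symm_apply]
  unfold koszul
  rw [Fin.prod_univ_castSucc, Finset.prod_eq_one (s := Finset.univ) (f := fun j => ite (_ ∧ _) _ _),
    mul_one]
  · refine Finset.prod_congr rfl fun i _ => ?_
    rw [Fin.prod_univ_castSucc]
    simp [h1, h2, Fin.init, (Fin.le_last _).not_gt]
  · intro j _
    exact if_neg fun h => (Fin.le_last j).not_gt h.1

/-- The form `ω (f (x_1, …, x_n), x_{n+1})`. -/
def formMap (ω : V →ₗ[k] V →ₗ[k] k) (n : ℕ) : MultilinearMap k (fun _ : Fin n => V) V →ₗ[k]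
    MultilinearMap k (fun _ : Fin (n + 1) => V) k where
  toFun f := MultilinearMap.uncurryRight (ω.compMultilinearMap f)
  map_add' f g := by ext; simp
  map_smul' c f := by ext; simp

variable {ω : V →ₗ[k] V →ₗ[k] k}

theorem formMap_apply {n : ℕ} (f : MultilinearMap k (fun _ : Fin n => V) V) (x : Fin (n + 1) → V) :
    formMap ω n f x = ω (f (Fin.init x)) (x (Fin.last n)) := rfl

theorem mem_cyclicFields_iff_act {f : Fam k V} :
    f ∈ cyclicFields G ω ↔ ∀ n, act G (finRotate (n + 1)) (formMap ω n (f n)) = formMap ω n (f n) := by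
  refine forall_congr' fun n => ⟨fun h => multilinear_ext_isHom G _ _ fun p x hx => ?_,
    fun h p x hx => ?_⟩
  · rw [act_isHom _ _ _ hx, formMap_apply, formMap_apply, h p x hx]
    rfl
  · rw [← formMap_apply, ← h, act_isHom _ _ _ hx]
    rfl

theorem formMap_act {n : ℕ} (σ : Equiv.Perm (Fin n)) (f : MultilinearMap k (fun _ : Fin n => V) V) :
    formMap ω n (act G σ f) = act G (liftPermLast σ) (formMap ω n f) := by
  refine multilinear_ext_isHom G _ _ fun p x hx => ?_
  rw [act_isHom _ _ _ hx, formMap_apply, formMap_apply,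
    act_isHom G σ f (p := Fin.init p) (x := Fin.init x) fun i => hx i.castSucc,
    koszul_liftPermLast, map_smul, LinearMap.smul_apply]
  have h : Fin.init (x ∘ liftPermLast σ) = Fin.init x ∘ σ := funext fun i =>
    congrArg x (liftPermLast_castSucc σ i)
  rw [h, Function.comp_apply, liftPermLast_last]

theorem finRotate_pow_apply {n : ℕ} (m : ℕ) (i : Fin (n + 1)) :
    (finRotate (n + 1) ^ m) i = i + Fin.ofNat (n + 1) m := by
  induction m with
  | zero => exact (add_zero i).symm
  | succ m ih =>
    rw [pow_succ', Equiv.Perm.mul_apply, ih, finRotate_apply, add_assoc]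
    congr 1
    ext
    simp [Fin.val_add]

/-- The letter sent to the last place fixes the power of the rotation; what is left is a permutation
of the other letters. -/
theorem bijective_liftPermLast_mul_pow (n : ℕ) : Function.Bijective
    fun a : Equiv.Perm (Fin n) × Fin (n + 1) => liftPermLast a.1 * finRotate (n + 1) ^ (a.2 : ℕ) := by
  refine (Fintype.bijective_iff_injective_and_card _).2 ⟨?_, ?_⟩
  · rintro ⟨τ, i⟩ ⟨τ', i'⟩ h
    have h1 : ∀ (τ : Equiv.Perm (Fin n)) (i : Fin (n + 1)),
        (liftPermLast τ * finRotate (n + 1) ^ (i : ℕ)) (Fin.last n - i) = Fin.last n := fun τ i => by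
      rw [Equiv.Perm.mul_apply, finRotate_pow_apply, Fin.ofNat_val_eq_self, sub_add_cancel,
        liftPermLast_last]
    have h2 : i = i' := sub_right_injective (b := Fin.last n)
      ((liftPermLast τ * finRotate (n + 1) ^ (i : ℕ)).injective
        ((h1 τ i).trans ((h1 τ' i').symm.trans (congrArg (fun σ => σ (Fin.last n - i')) h).symm)))
    subst h2
    have h3 := mul_right_cancel h
    refine Prod.ext (Equiv.ext fun j => Fin.castSucc_injective _ ?_) rfl
    rw [← liftPermLast_castSucc, h3, liftPermLast_castSucc]
  · rw [Fintype.card_prod, Fintype.card_perm, Fintype.card_perm, Fintype.card_fin, Fintype.card_fin,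
      Nat.factorial_succ, mul_comm]

/-- Permutations of `n + 1` letters factor into rotations and permutations fixing the last letter.
For a cyclic form the full symmetrization is therefore `n + 1` times the form of the symmetrized
field, which is then invariant under all permutations. -/
theorem symmetrize_mem_cyclicFields {f : Fam k V} (hf : f ∈ cyclicFields G ω) :
    symmetrize G f ∈ cyclicFields G ω := by
  rw [mem_cyclicFields_iff_act] at hf ⊢
  intro n
  have h0 : ∀ m : ℕ, act G (finRotate (n + 1) ^ m) (formMap ω n (f n)) = formMap ω n (f n) := by
    intro m
    induction m with
    | zero => exact act_one _ _
    | succ m ih => rw [pow_succ, ← act_act, hf, ih]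
  have h1 : koszulSymm G (formMap ω n (f n)) =
      ((n + 1 : ℕ) : k) • formMap ω n (symmetrize G f n) := by
    rw [koszulSymm, LinearMap.coe_sum, Finset.sum_apply, ← (bijective_liftPermLast_mul_pow n).sum_comp,
      Fintype.sum_prod_type]
    simp only [← act_act, h0, ← formMap_act, Finset.sum_const, Finset.card_univ, Fintype.card_fin]
    rw [← Finset.smul_sum, ← map_sum, Nat.cast_smul_eq_nsmul]
    congr 2
    exact (Finset.sum_apply ..).symm.trans (congrFun (LinearMap.coe_sum ..).symm _)
  have h2 : formMap ω n (symmetrize G f n) =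
      ((n + 1 : ℕ) : k)⁻¹ • koszulSymm G (formMap ω n (f n)) := by
    rw [h1, smul_smul, inv_mul_cancel₀ (Nat.cast_ne_zero.2 n.succ_ne_zero), one_smul]
  rw [h2, map_smul, act_koszulSymm]

theorem desymmetrize_mem_cyclicFields {f : Fam k V} (hf : f ∈ cyclicFields G ω) :
    desymmetrize f ∈ cyclicFields G ω := by
  rw [mem_cyclicFields_iff_act] at hf ⊢
  intro n
  change act G _ (formMap ω n (((n.factorial : k)⁻¹) • f n)) =
    formMap ω n (((n.factorial : k)⁻¹) • f n)
  rw [map_smul, map_smul, hf]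

theorem isFieldAlgebra_csFields {E : DGStructure k V} {ε : ZMod 2} {s : V →ₗ[k] V →ₗ[k] k}
    (hs : IsInnerProduct E ε s) :
    IsFieldAlgebra E.shift (bracketS E.shift.toSuperStructure)
      (symFields E.shift.toSuperStructure ⊓
        cyclicFields E.shift.toSuperStructure (symplecticForm E s))
      (csFields E.shift.toSuperStructure (symplecticForm E s)) := by
  have H := isFieldAlgebra_bracketS E.shift
  have Hs := isFieldAlgebra_asFields hs
  refine H.of_le inf_le_left
    (fun f => ⟨fun h => ⟨⟨h.1.2, h.2⟩, h.1.1⟩, fun h => ⟨⟨h.2, h.1.1⟩, h.1.2⟩⟩)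
    (fun f hf => ⟨H.par_mem f hf.1, Hs.par_mem f hf.2⟩) (fun f hf g hg =>
      ⟨H.br_mem f hf.1 g hg.1, ?_⟩) (fun w => ⟨H.const_mem w, Hs.const_mem w⟩) ⟨H.d_mem, Hs.d_mem⟩
  -- The bracket is computed on noncommutative lifts: dividing by factorials preserves cyclicity,
  -- the noncommutative bracket preserves it, and so does symmetrization.
  rw [← symmetrize_desymmetrize hf.1, ← symmetrize_desymmetrize hg.1, ← symmetrize_bracketT]
  exact symmetrize_mem_cyclicFields (Hs.br_mem _ (desymmetrize_mem_cyclicFields hf.2) _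
    (desymmetrize_mem_cyclicFields hg.2))

end

end Twisting

end

theorem theorem4p4 {k : Type u} [Field k] [CharZero k] {V : Type v} [AddCommGroup V]
    [Module k V] (E : DGStructure k V) :
    (IsLInfty (cTilde E) ∧
      TwistingIsFunctorAut.{u, v, w} E.shift (bracketS E.shift.toSuperStructure) (cTilde E) ∧
      ∃ tw : (n : ℕ) → MultilinearMap k
          (fun _ : Fin n => cFields E.shift.toSuperStructure × V)
          (cFields E.shift.toSuperStructure × V),
        IsInducedByTwisting.{u, v, w} E.shift (bracketS E.shift.toSuperStructure)
          (cTilde E) tw ∧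
        HasTwistingComponents insC tw ∧
        ∀ (ε : ZMod 2) (s : V →ₗ[k] V →ₗ[k] k), IsInnerProduct E ε s →
          ∃ h : IsDGLieSubalgebra E.shift (bracketS E.shift.toSuperStructure)
              (csFields E.shift.toSuperStructure (symplecticForm E s)),
            IsLInfty (csTilde E s h) ∧
            TwistingIsFunctorAut.{u, v, w} E.shift (bracketS E.shift.toSuperStructure)
              (csTilde E s h) ∧
            ∃ tws : (n : ℕ) → MultilinearMap k
                (fun _ : Fin n => csFields E.shift.toSuperStructure (symplecticForm E s) × V)
                (csFields E.shift.toSuperStructure (symplecticForm E s) × V),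
              IsInducedByTwisting.{u, v, w} E.shift (bracketS E.shift.toSuperStructure)
                (csTilde E s h) tws ∧
              IsRestriction inf_le_left tws tw) ∧
    (IsLInfty (aTilde E) ∧
      TwistingIsFunctorAut.{u, v, w} E.shift (bracketT E.shift.toSuperStructure) (aTilde E) ∧
      ∃ tw : (n : ℕ) → MultilinearMap k
          (fun _ : Fin n => aFields k V × V)
          (aFields k V × V),
        IsInducedByTwisting.{u, v, w} E.shift (bracketT E.shift.toSuperStructure)
          (aTilde E) tw ∧
        HasTwistingComponents (insA E.shift.toSuperStructure) tw ∧
        ∀ (ε : ZMod 2) (s : V →ₗ[k] V →ₗ[k] k), IsInnerProduct E ε s →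
          ∃ h : IsDGLieSubalgebra E.shift (bracketT E.shift.toSuperStructure)
              (asFields E.shift.toSuperStructure (symplecticForm E s)),
            IsLInfty (asTilde E s h) ∧
            TwistingIsFunctorAut.{u, v, w} E.shift (bracketT E.shift.toSuperStructure)
              (asTilde E s h) ∧
            ∃ tws : (n : ℕ) → MultilinearMap k
                (fun _ : Fin n => asFields E.shift.toSuperStructure (symplecticForm E s) × V)
                (asFields E.shift.toSuperStructure (symplecticForm E s) × V),
              IsInducedByTwisting.{u, v, w} E.shift (bracketT E.shift.toSuperStructure)
                (asTilde E s h) tws ∧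
              IsRestriction inf_le_left tws tw) := by
  have hC := isFieldAlgebra_bracketS E.shift
  have hA := isFieldAlgebra_bracketT E.shift
  -- The products on commutative fields are plain evaluations, the case of `iter_bracketS` in which
  -- all arguments are inserted.
  have hc : ∀ {S : Submodule k (Fam k V)}, S ≤ symFields E.shift.toSuperStructure → ∀ f ∈ S, ∀ n w,
      (LinearMap.id : Fam k V →ₗ[k] Fam k V) f n w =
        iter (bracketS E.shift.toSuperStructure) constField n f w 0 ![] := fun hS f hf n w =>
    (iter_bracketS n 0 (hS hf) w ![] rfl w (fun _ => rfl) fun j => j.elim0).symm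
  have ha : ∀ {S : Submodule k (Fam k V)}, ∀ f ∈ S, ∀ n w,
      symmetrize E.shift.toSuperStructure f n w =
        iter (bracketT E.shift.toSuperStructure) constField n f w 0 ![] :=
    fun f _ n w => symmetrize_eq_iter f n w
  -- From here on the four explicit structures are instances of the abstract one, and every claim is
  -- a general fact about `TwistData` or `IsFieldAlgebra`.
  have ec : cTilde E = hC.data.tilde := hC.tilde_eq _ (hc hC.le)
  have ea : aTilde E = hA.data.tilde := hA.tilde_eq _ ha
  rw [ec, ea]
  refine ⟨⟨hC.data.isLInfty, hC.twistingIsFunctorAut, hC.data.tw, hC.isInducedByTwisting,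
    hC.hasTwistingComponents fun m f hf w l x => iter_bracketS_eq_insC m (hC.le hf) w l x,
    fun ε s hs => ?_⟩, ⟨hA.data.isLInfty, hA.twistingIsFunctorAut, hA.data.tw,
    hA.isInducedByTwisting, hA.hasTwistingComponents fun m f _ w l x =>
      iter_bracketT_eq_insA m f w l x, fun ε s hs => ?_⟩⟩
  · have hCs := isFieldAlgebra_csFields hs
    have e : csTilde E s hCs.isDGLieSubalgebra = hCs.data.tilde :=
      hCs.tilde_eq _ (hc (hCs.le.trans inf_le_left))
    refine ⟨hCs.isDGLieSubalgebra, ?_⟩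
    rw [e]
    exact ⟨hCs.data.isLInfty, hCs.twistingIsFunctorAut, hCs.data.tw, hCs.isInducedByTwisting,
      hCs.isRestriction hC inf_le_left inf_le_left⟩
  · have hAs := isFieldAlgebra_asFields hs
    have e : asTilde E s hAs.isDGLieSubalgebra = hAs.data.tilde := hAs.tilde_eq _ ha
    refine ⟨hAs.isDGLieSubalgebra, ?_⟩
    rw [e]
    exact ⟨hAs.data.isLInfty, hAs.twistingIsFunctorAut, hAs.data.tw, hAs.isInducedByTwisting,
      hAs.isRestriction hA le_top inf_le_left⟩
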